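/- **Setting.** Let $(E,\omega)$ be a real symplectic plane with a compatible linear complex structure $j$, and let $R\subset E$ be a lattice with positive basis $(\mu,\lambda)$, $\omega(\mu,\lambda)=4\pi$. Put $M=E/R$, and let $p,q$ be the coordinates of $E$ dual to $(\mu,\lambda)$. The group $E\times U(1)$ acts on $L_E=E\times\mathbb C$ by $(x,u)\cdot(y,v)=(x+y,uve^{i\omega(x,y)/2})$. Let $L_M=L_E/(R\times\{1\})$, with the connection induced by $d+\frac1i\alpha$, $\alpha_x(y)=\frac12\omega(x,y)$, and the corresponding holomorphic structure. Let $K_j=\{\alpha\in E^*\otimes\mathbb C:\alpha(j\cdot)=i\alpha\}$ with scalar product $(\alpha,\beta)=i\alpha\wedge\bar\beta/\omega$, let $\delta$ be a Hermitian complex line with a unitary isomorphism $\delta^{\otimes2}\simeq K_j$, and let $\delta_M=M\times\delta$. For $u\in\delta$ we view $u^2$ as an element of $K_j$. Let $\mathcal H_k=H^0(M,L_M^k\otimes\delta_M)$, $k\ge1$, with the norm $\|\xi\|^2=\int_M|\xi|^2\omega$. For $x\in\frac1{2k}R$ let $T_x^*$ be the pull-back of sections of $L_M^k$ by the action of $(x,1)$.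 Fix $\Omega_\mu\in\delta$ with $\Omega_\mu^2(\mu)=1$, and let $(\Psi_\ell)_{\ell\in\mathbb Z/2k\mathbb Z}$ be the orthonormal basis of $\mathcal H_k$ with $T^*_{\mu/2k}\Psi_\ell=e^{i\pi\ell/k}\Psi_\ell$, $T^*_{\lambda/2k}\Psi_\ell=\Psi_{\ell+1}$ and $\Psi_0(0)\in\mathbb R_{>0}\,\Omega_\mu$ (where $L_{M,[0]}\simeq\mathbb C$). For $\xi_k\in\mathcal H_k$ denote by $\xi_k(\ell)$ the coefficient of $\Psi_{-\ell}$ in $\xi_k$. **Lagrangian states.** A family $\xi=(\xi_k\in\mathcal H_k)_{k\ge1}$ is admissible if $\|\xi_k\|\le Ck^{N'}$ for some $C>0$ and $N'$. Its microsupport $\mathrm{MS}(\xi)$ is the complement of the set of points of $M$ with a neighbourhood on which $|\xi_k|=O(k^{-\infty})$ uniformly. Let $U\subset M$ be open, $\Gamma\subset U$ a one-dimensional submanifold, $\Theta$ a flat section of $L_M\to\Gamma$ of pointwise norm $1$, $\sigma$ a section of $\delta_M\to\Gamma$ and $N\in\mathbb R$. The restriction of $\xi$ to $U$ is a Lagrangian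 state with associated data $(\Gamma,\Theta,\sigma,N)$ if $\mathrm{MS}(\xi)\cap U\subset\Gamma$ and every $x_0\in\Gamma$ has an open neighbourhood $V\subset U$ such that, uniformly on $V$, $$\xi_k(x)=\Bigl(\frac k{2\pi}\Bigr)^{1/4+N}\mathcal E^k(x)f(x,k)+O(k^{-\infty}),$$ where $\mathcal E$ is a smooth section of $L_M\to V$ with $\mathcal E=\Theta$ on $\Gamma\cap V$, $|\mathcal E|<1$ on $V\setminus\Gamma$ and $\bar\partial\mathcal E$ vanishing to infinite order along $\Gamma$, and where $f(\cdot,k)\in C^\infty(V,\delta_M)$ has an asymptotic expansion $\sum_{\ell\ge0}k^{-\ell}a_\ell$ in the $C^\infty$ topology with $a_\ell\in C^\infty(V,\delta_M)$ and $a_0=\sigma$ on $\Gamma\cap V$. **Theorem.** Let $q_0<q_1<q_0+1$, let $\phi\in C^\infty(]q_0,q_1[,\mathbb R)$, and put $$U=\{[p\mu+q\lambda]:p\in\mathbb R,\ q\in]q_0,q_1[\},\qquad\Gamma=\{[\phi'(q)\mu+q\lambda]:q\in]q_0,q_1[\}.$$ Let $\Theta$ be the section of $L_M\to\Gamma$ with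 $\Theta([p\mu+q\lambda])=e^{4i\pi\phi(q)}e^{-2i\pi pq}$ for $q\in]q_0,q_1[$, $p=\phi'(q)$ (in the trivialization of $L_E$ at $p\mu+q\lambda$). Then there is a smooth map $\tau:]q_0,q_1[\to\delta$, independent of $\xi$, $\sigma$ and $N$, with $\tau(q)^2=\omega(\cdot,\mu)/i$ on the tangent line $\mathbb R(\phi''(q)\mu+\lambda)$ of $\Gamma$ for all $q$, such that for every admissible family $\xi$, every section $\sigma$ of $\delta_M\to\Gamma$ and every $N\in\mathbb R$, the following are equivalent: 1. the restriction of $\xi$ to $U$ is a Lagrangian state with associated data $(\Gamma,\Theta,\sigma,N)$; 2. there are smooth functions $f_\ell:]q_0,q_1[\to\mathbb C$, $\ell\ge0$, such that for $q\in]q_0,q_1[\cap\frac1{2k}\mathbb Z$ $$\xi_k(2kq)=\Bigl(\frac k{2\pi}\Bigr)^{-1/2+N}e^{4i\pi k\phi(q)}\sum_{\ell=0}^\infty k^{-\ell}f_\ell(q)+O(k^{-\infty}),$$ uniformly on every compact subset of $]q_0,q_1[$, and such that for all $q\in]q_0,q_1[$ $$\sigma([\phi'(q)\mu+q\lambda])^2=f_0(q)^2\,\frac{\omega(\cdot,\mu)}i\quad\text{on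 }T_{[\phi'(q)\mu+q\lambda]}\Gamma,$$ the square root being given by $\sigma([\phi'(q)\mu+q\lambda])=f_0(q)\,\tau(q)$. -/

import Mathlib

open Set Filter Topology
open scoped ContDiff TensorProduct

/-- A real symplectic plane `(E, ω)` with a compatible linear complex structure `j` and a lattice
of volume `4π`, given through a positive basis `(μ, lam)`. -/
structure QuantumTorus (E : Type*) [NormedAddCommGroup E] [NormedSpace ℝ E] where
  finrank_eq : Module.finrank ℝ E = 2
  om : E →ₗ[ℝ] E →ₗ[ℝ] ℝ
  alt : ∀ x, om x x = 0
  j : E →ₗ[ℝ] E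
  j_j : ∀ x, j (j x) = -x
  om_j : ∀ x y, om (j x) (j y) = om x y
  om_pos : ∀ x, x ≠ 0 → 0 < om x (j x)
  μ : E
  lam : E
  om_basis : om μ lam = 4 * Real.pi

namespace QuantumTorus

variable {E : Type*} [NormedAddCommGroup E] [NormedSpace ℝ E] (D : QuantumTorus E)

/-- The lattice `R = ℤ μ + ℤ lam`. -/
def R : AddSubgroup E := AddSubgroup.closure {D.μ, D.lam}

/-- The torus `M = E / R`. -/
abbrev M : Type _ := E ⧸ D.R

/-- The projection `x ↦ [x]` from `E` to `M`. -/
def proj (x : E) : D.M := (x : E ⧸ D.R)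

/-- The linear coordinate `p` of `x = p μ + q lam`. -/
noncomputable def pCoord (x : E) : ℝ := D.om x D.lam / (4 * Real.pi)

/-- The linear coordinate `q` of `x = p μ + q lam`. -/
noncomputable def qCoord (x : E) : ℝ := D.om D.μ x / (4 * Real.pi)

/-- The integral over `M` of an `R`-periodic function against the symplectic form
`ω = 4π dp ∧ dq`. -/
noncomputable def torusIntegral {F : Type*} [NormedAddCommGroup F] [NormedSpace ℝ F]
    (g : E → F) : F :=
  (4 * Real.pi) • ∫ p in (0 : ℝ)..1, ∫ q in (0 : ℝ)..1, g (p • D.μ + q • D.lam)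

section Sections

variable {F : Type*} [NormedAddCommGroup F] [NormedSpace ℂ F]

/-- The group `E × U(1)` acts on `L_E = E × ℂ` by `(r, 1) • (x, v) = (r + x, e^{iω(r, x)/2} v)`,
and `L_M` is the quotient of `L_E` by `R × {1}`. So a section of `L_M ^ k ⊗ F` over a subset of `M`
with preimage `S` in `E` is a function on `S` satisfying this condition. -/
def EquivariantOn (k : ℕ) (u : E → F) (S : Set E) : Prop :=
  ∀ r ∈ D.R, ∀ x ∈ S, u (r + x) = Complex.exp (Complex.I * k * D.om r x / 2) • u x

/-- The covariant derivative of `L_E ^ k`: `∇ = d + (k / i) α` with `α_x(X) = ω(x, X) / 2`. -/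
noncomputable def covDeriv (k : ℕ) (u : E → F) (x X : E) : F :=
  fderiv ℝ u x X - (Complex.I * k * (D.om x X / 2)) • u x

/-- The `(0, 1)`-part of the covariant derivative, evaluated at the vector `X`. -/
noncomputable def dbar (k : ℕ) (u : E → F) (x X : E) : F :=
  (1 / 2 : ℂ) • (D.covDeriv k u x X + Complex.I • D.covDeriv k u x (D.j X))

/-- The pull-back of sections of `L_E ^ k ⊗ F` by the action of `(x, 1)`. -/
noncomputable def translate (k : ℕ) (x : E) (u : E → F) : E → F := fun y =>
  Complex.exp (-(Complex.I * k * D.om x y / 2)) • u (x + y)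

lemma covDeriv_add {k : ℕ} {u v : E → F} (hu : ContDiff ℝ ∞ u) (hv : ContDiff ℝ ∞ v) (x X : E) :
    D.covDeriv k (u + v) x X = D.covDeriv k u x X + D.covDeriv k v x X := by
  have h := fderiv_add (hu.differentiable (by simp) x) (hv.differentiable (by simp) x)
  simp only [covDeriv, h, Pi.add_apply, smul_add, _root_.add_apply]
  abel

lemma covDeriv_smul {k : ℕ} {u : E → F} (hu : ContDiff ℝ ∞ u) (c : ℂ) (x X : E) :
    D.covDeriv k (c • u) x X = c • D.covDeriv k u x X := by
  have h := fderiv_const_smul (hu.differentiable (by simp) x) c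
  simp only [covDeriv, h, Pi.smul_apply, smul_sub, _root_.smul_apply]
  rw [smul_comm]

/-- The holomorphic sections of `L_M ^ k ⊗ F`. For `F = δ` this is `𝓗_k = H⁰(M, L_M ^ k ⊗ δ_M)`. -/
def holSections (F : Type*) [NormedAddCommGroup F] [NormedSpace ℂ F] (k : ℕ) :
    Submodule ℂ (E → F) where
  carrier := {u | ContDiff ℝ ∞ u ∧ D.EquivariantOn k u univ ∧ ∀ x X, D.dbar k u x X = 0}
  zero_mem' := by
    refine ⟨contDiff_const, fun r _ x _ => by simp, fun x X => ?_⟩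
    have : fderiv ℝ (0 : E → F) x = 0 := fderiv_const_apply 0
    simp [dbar, covDeriv, this]
  add_mem' := by
    rintro u v ⟨hu, hu1, hu2⟩ ⟨hv, hv1, hv2⟩
    refine ⟨hu.add hv, fun r hr x hx => ?_, fun x X => ?_⟩
    · simp [hu1 r hr x hx, hv1 r hr x hx]
    · have h := congrArg₂ (· + ·) (hu2 x X) (hv2 x X)
      simp only [dbar, add_zero] at h
      rw [dbar, covDeriv_add D hu hv, covDeriv_add D hu hv, ← h, ← smul_add, smul_add Complex.I]
      congr 1
      abel
  smul_mem' := by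
    rintro c u ⟨hu, hu1, hu2⟩
    refine ⟨contDiff_const.smul hu, fun r hr x hx => ?_, fun x X => ?_⟩
    · simp only [Pi.smul_apply, hu1 r hr x hx]
      rw [smul_comm]
    · have h := congrArg (c • ·) (hu2 x X)
      simp only [dbar, smul_zero] at h
      rw [dbar, covDeriv_smul D hu, covDeriv_smul D hu, ← h, smul_comm Complex.I c, ← smul_add,
        smul_comm c]

end Sections

/-- The canonical line `K_j = {α ∈ E* ⊗ ℂ | α(j ·) = i α}`. -/
def canonicalLine : Submodule ℂ (E →ₗ[ℝ] ℂ) where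
  carrier := {α | ∀ x, α (D.j x) = Complex.I * α x}
  zero_mem' := by simp
  add_mem' := by
    intro a b ha hb x
    simp [ha x, hb x, mul_add]
  smul_mem' := by
    intro c a ha x
    simp only [LinearMap.smul_apply, ha x, smul_eq_mul]
    ring

/-- The scalar product `(α, β) = i α ∧ β̄ / ω` of `K_j`, computed on the basis `(μ, lam)`. -/
noncomputable def canonicalInner (α β : E →ₗ[ℝ] ℂ) : ℂ :=
  Complex.I * (α D.μ * star (β D.lam) - α D.lam * star (β D.μ)) / D.om D.μ D.lam

end QuantumTorus

/-- A half-form line: a complex line `δ` with an isomorphism from `δ ⊗ δ` to `K_j`, which is unitary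
for the scalar product of `δ`. (The isomorphism forces `δ` to have dimension one.) -/
structure HalfFormLine {E : Type*} [NormedAddCommGroup E] [NormedSpace ℝ E] (D : QuantumTorus E)
    (δ : Type*) [NormedAddCommGroup δ] [InnerProductSpace ℂ δ] where
  iso : (δ ⊗[ℂ] δ) ≃ₗ[ℂ] D.canonicalLine
  unitary : ∀ u v : δ,
    (((‖u‖ * ‖v‖) ^ 2 : ℝ) : ℂ) = D.canonicalInner (iso (u ⊗ₜ v)).1 (iso (u ⊗ₜ v)).1

/-- The square of `u ∈ δ`, seen as a complex valued linear form of `E`. -/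
noncomputable def HalfFormLine.sq {E : Type*} [NormedAddCommGroup E] [NormedSpace ℝ E] {D : QuantumTorus E}
    {δ : Type*} [NormedAddCommGroup δ] [InnerProductSpace ℂ δ] (h : HalfFormLine D δ) (u : δ) :
    E →ₗ[ℝ] ℂ :=
  (h.iso (u ⊗ₜ u)).1

namespace QuantumTorus

variable {E : Type*} [NormedAddCommGroup E] [NormedSpace ℝ E] (D : QuantumTorus E)
  {δ : Type*} [NormedAddCommGroup δ] [InnerProductSpace ℂ δ]

/-- `Ψ` is the orthonormal basis of `𝓗_k` associated with `(μ, lam)`, normalized by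
`Ψ_0(0) = c Ω` with `c > 0`. -/
structure IsThetaBasis (Ω : δ) (k : ℕ)
    (Ψ : Module.Basis (ZMod (2 * k)) ℂ (D.holSections δ k)) : Prop where
  orthonormal : ∀ l m : ZMod (2 * k),
    D.torusIntegral (fun x => inner ℂ ((Ψ l).1 x) ((Ψ m).1 x)) = if l = m then (1 : ℂ) else 0
  translate_μ : ∀ l : ℤ, D.translate k ((1 / (2 * k) : ℝ) • D.μ) (Ψ (l : ZMod (2 * k))).1
    = Complex.exp (Complex.I * Real.pi * l / k) • (Ψ (l : ZMod (2 * k))).1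
  translate_lam : ∀ l : ZMod (2 * k),
    D.translate k ((1 / (2 * k) : ℝ) • D.lam) (Ψ l).1 = (Ψ (l + 1)).1
  normalized : ∃ c : ℝ, 0 < c ∧ (Ψ 0).1 0 = (c : ℂ) • Ω

/-- The coefficient `ξ_k(l)` of `Ψ_{-l}` in `ξ_k`. -/
noncomputable def coeff (Ψ : (k : ℕ+) → Module.Basis (ZMod (2 * (k : ℕ))) ℂ (D.holSections δ k))
    (ξ : (k : ℕ+) → D.holSections δ k) (k : ℕ+) (l : ℤ) : ℂ :=
  (Ψ k).repr (ξ k) (-(l : ZMod (2 * (k : ℕ))))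

/-- `‖ξ_k‖ = O(k ^ N)` for some `N`, where `‖ξ_k‖² = ∫_M |ξ_k|² ω`. -/
def Admissible (ξ : (k : ℕ+) → D.holSections δ k) : Prop :=
  ∃ N C : ℝ, 0 < C ∧ ∀ k : ℕ+,
    Real.sqrt (D.torusIntegral (fun x => ‖(ξ k).1 x‖ ^ 2)) ≤ C * (k : ℝ) ^ N

/-- The microsupport of the family `ξ`. The pointwise norm of a section of `L_M ^ k ⊗ δ_M` at `[y]`
is the norm of the value at `y` of the corresponding equivariant function. -/
def microsupport (ξ : (k : ℕ+) → D.holSections δ k) : Set D.M :=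
  {x | ¬ ∃ W ∈ 𝓝 x, ∃ C : ℕ → ℝ, ∀ (n : ℕ) (k : ℕ+) (y : E), D.proj y ∈ W →
    ‖(ξ k).1 y‖ ≤ C n * (k : ℝ) ^ (-(n : ℝ))}

/-- The sequence `f(·, k)` of `C^∞(V, δ_M)` has the asymptotic expansion `∑ k^{-l} a_l` with
coefficients in `C^∞(V, δ_M)`, for the `C^∞` topology. Smoothness is read on `E`. -/
def HasSmoothExpansion (V : Set D.M) (f : ℕ+ → D.M → δ) (a : ℕ → D.M → δ) : Prop :=
  (∀ k, ContDiffOn ℝ ∞ (fun y => f k (D.proj y)) (D.proj ⁻¹' V)) ∧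
  (∀ l, ContDiffOn ℝ ∞ (fun y => a l (D.proj y)) (D.proj ⁻¹' V)) ∧
  ∀ K ⊆ V, IsCompact K → ∀ n L : ℕ, ∃ C : ℝ, ∀ (k : ℕ+) (y : E), D.proj y ∈ K →
    ‖iteratedFDeriv ℝ n (fun z => f k (D.proj z)
        - ∑ l ∈ Finset.range L, (((k : ℂ) ^ l)⁻¹) • a l (D.proj z)) y‖
      ≤ C * (k : ℝ) ^ (-(L : ℝ))

/-- The restriction of `ξ` to the open set `U` is a Lagrangian state with associated data
`(Γ, Θ, σ, N)`. Here `Γ` is a one-dimensional submanifold of `U`, `Θ` is a flat section with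
pointwise norm `1` of `L_M` over `Γ` (an equivariant function on the preimage of `Γ`), and `σ` is a
section of `δ_M` over `Γ`; the values of `Θ` and `σ` elsewhere are irrelevant. -/
def IsLagrangianState (ξ : (k : ℕ+) → D.holSections δ k) (U Γ : Set D.M) (Θ : E → ℂ) (σ : D.M → δ)
    (N : ℝ) : Prop :=
  D.microsupport ξ ∩ U ⊆ Γ ∧
  ∀ x₀ ∈ Γ, ∃ V : Set D.M, IsOpen V ∧ x₀ ∈ V ∧ V ⊆ U ∧
    ∃ (e : E → ℂ) (f : ℕ+ → D.M → δ) (a : ℕ → D.M → δ),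
      ContDiffOn ℝ ∞ e (D.proj ⁻¹' V) ∧ D.EquivariantOn 1 e (D.proj ⁻¹' V) ∧
      (∀ y, D.proj y ∈ Γ ∩ V → e y = Θ y) ∧
      (∀ y, D.proj y ∈ V \ Γ → ‖e y‖ < 1) ∧
      (∀ y, D.proj y ∈ Γ ∩ V → ∀ (X : E) (n : ℕ),
        iteratedFDeriv ℝ n (fun z => D.dbar 1 e z X) y = 0) ∧
      D.HasSmoothExpansion V f a ∧
      (∀ x ∈ Γ ∩ V, a 0 x = σ x) ∧
      ∀ n : ℕ, ∃ C : ℝ, ∀ (k : ℕ+) (y : E), D.proj y ∈ V →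
        ‖(ξ k).1 y
            - ((((k : ℝ) / (2 * Real.pi)) ^ (1 / 4 + N) : ℝ) * e y ^ (k : ℕ)) • f k (D.proj y)‖
          ≤ C * (k : ℝ) ^ (-(n : ℝ))

/-- The section `s = e^{-2iπpq}` of `L_E`. -/
noncomputable def flatSection (x : E) : ℂ :=
  Complex.exp (-(2 * Complex.I * Real.pi * D.pCoord x * D.qCoord x))

/-- The open set `{[p μ + q lam] | q ∈ ]q₀, q₁[}` of `M`. -/
def strip (q₀ q₁ : ℝ) : Set D.M :=
  {x | ∃ p : ℝ, ∃ q ∈ Ioo q₀ q₁, x = D.proj (p • D.μ + q • D.lam)}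

/-- The point `φ'(q) μ + q lam` of `E`. -/
noncomputable def graphPoint (φ : ℝ → ℝ) (q : ℝ) : E := deriv φ q • D.μ + q • D.lam

/-- The submanifold `Γ = {[φ'(q) μ + q lam] | q ∈ ]q₀, q₁[}` of `M`. -/
def graph (φ : ℝ → ℝ) (q₀ q₁ : ℝ) : Set D.M :=
  {x | ∃ q ∈ Ioo q₀ q₁, x = D.proj (D.graphPoint φ q)}

/-- The tangent line of `Γ` at `[φ'(q) μ + q lam]`, a subspace of `E`. -/
noncomputable def graphTangent (φ : ℝ → ℝ) (q : ℝ) : Submodule ℝ E :=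
  Submodule.span ℝ {deriv (deriv φ) q • D.μ + D.lam}

/-- The section `Θ` of `L_M` over `Γ` with `Θ([p μ + q lam]) = e^{4iπφ(q)} s(p μ + q lam)` for
`q ∈ ]q₀, q₁[` and `p = φ'(q)`. A point `y` over `Γ` is `r + x` with `r ∈ R` and
`x = φ'(q) μ + q lam`, where `q` is the representative in `]q₀, q₁[ ⊆ [q₀, q₀ + 1[` of the
coordinate of `y`, and `Θ(r + x) = e^{iω(r, x)/2} Θ(x)`. -/
noncomputable def graphSection (φ : ℝ → ℝ) (q₀ : ℝ) (y : E) : ℂ :=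
  let q := D.qCoord y - ⌊D.qCoord y - q₀⌋
  let x := D.graphPoint φ q
  Complex.exp (Complex.I * D.om (y - x) x / 2) *
    (Complex.exp (4 * Complex.I * Real.pi * φ q) * D.flatSection x)

end QuantumTorus

/-- `c k (2kq) = (k/2π)^{-1/2+N} e^{4iπkφ(q)} ∑ k^{-l} f_l(q) + O(k^{-∞})` for
`q ∈ ]q₀, q₁[ ∩ (1/2k)ℤ`, uniformly on the compact subsets of `]q₀, q₁[`. -/
def HasWKBExpansion (c : ℕ+ → ℤ → ℂ) (φ : ℝ → ℝ) (q₀ q₁ N : ℝ) (f : ℕ → ℝ → ℂ) : Prop :=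
  ∀ K ⊆ Ioo q₀ q₁, IsCompact K → ∀ L : ℕ, ∃ C : ℝ, ∀ (k : ℕ+) (m : ℤ) (q : ℝ),
    q ∈ K → 2 * (k : ℝ) * q = m →
    ‖c k m - (((k : ℝ) / (2 * Real.pi)) ^ (-(1 / 2) + N) : ℝ)
          * Complex.exp (4 * Complex.I * Real.pi * k * φ q)
          * ∑ l ∈ Finset.range L, ((k : ℂ) ^ l)⁻¹ * f l q‖
      ≤ C * (k : ℝ) ^ (-(1 / 2) + N - L)

/-!
In the coordinates `x = p μ + q lam` and the trivialization `e^{-2iπkpq}` of `L_E ^ k`, a section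
`u` of `𝓗_k` is a function of `(q, p)` which is periodic up to explicit factors, and `∂̄u = 0` is the
equation `∂_q u - T ∂_p u = 4πikp u`, where `Ω ^ 2 = dp + T dq` and `0 < im T`
(`HalfFormLine.dbar_eq_dbarOp`). Its Fourier coefficient on the circle `q = m / 2k` (`thetaCoeff`) is
the coefficient of `Ψ_{-m}` up to a constant `β_k`, because both behave in the same way under the
translations by `μ / 2k` and `lam / 2k` (`thetaCoeff_eq_repr`). The normalization of the basis gives
`β_k = (k / 2π) ^ (1 / 4)` up to an exponentially small error (`norm_thetaCoeff_basis_sub_le`): the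
modulus comes from `‖Ψ_0‖ = 1` and the phase from the sign of `Ψ_0(0)`. The theorem thus becomes a
statement on the integrals of `ξ_k` on the circles `q = m / 2k`, which is proved in the coordinates
`(q, v)` with `v = p - φ'(q)`, where `Γ` is `v = 0`.

From Lagrangian states to expansions (`exists_local_expansion`): the section is negligible on the part
of the circle away from `Γ`. Near `Γ`, the conditions `𝓔 = Θ` and `∂̄𝓔 = O(v²)` force
`𝓔 = e^{4πiφ(q)} e^{-v² W(q, v)}` with `W(q, 0) = 2πi / (φ''(q) + T)`, of positive real part
(`exists_phase_of_dbar`), and Laplace's method applies (`exists_laplace_expansion`). The factor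
`(π / W(q, 0)) ^ (1 / 2)` of the leading term is the relation between `f_0` and the symbol `σ`; it
defines `τ` (`graphRoot`), whose square is `ω(·, μ) / i` on the tangent lines of `Γ`.

From expansions to Lagrangian states (`isLagrangianState_of_expansion`): Borel's lemma
(`exists_borel_sum`) produces a phase and amplitudes which are holomorphic to infinite order along `Γ`,
with amplitudes chosen inductively such that the integrals of the resulting quasimode on the circles
`q = m / 2k` have the prescribed expansion (`exists_quasimode`). It remains to see that a section and
a quasimode with the same integrals on these circles agree up to `O(k^{-∞})`. By the equation
`∂̄u = 0`, the Fourier coefficient with index `m` on the circle of parameter `q` (`fiberCoeff`) satisfies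
a linear differential equation in `q` (`hasDerivAt_fiberCoeff`), whose solutions are the multiples of
`e^{2πikT(q - m/2k)²}`; for the quasimode the equation holds up to `O(k^{-∞})`. Since `|e^{2πikTt²}|`
decreases with `|t|`, errors are not amplified when one moves away from `q = m / 2k`, and when this point
lies outside of the interval under consideration both coefficients are `O(k^{-∞})` inside
(`exists_norm_fiberCoeff_sub_le`). Summing the Fourier series gives the comparison
(`exists_norm_chart_sub_wave_le`), with the quadratic decay of the coefficients for the convergence.
-/

/-! ### Smooth division -/

section Tools

variable {F : Type} [NormedAddCommGroup F] [NormedSpace ℝ F] [FiniteDimensional ℝ F]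

theorem contDiff_nat_parametric_integral (n : ℕ) :
    ∀ {G : Type} [NormedAddCommGroup G] [NormedSpace ℝ G] {K : F × ℝ → G},
      ContDiff ℝ ∞ K → ContDiff ℝ n (fun x => ∫ s in (0 : ℝ)..1, K (x, s)) := by
  induction n with
  | zero =>
    intro G _ _ K hK
    refine contDiff_zero.2 ?_
    exact intervalIntegral.continuous_parametric_intervalIntegral_of_continuous'
      (f := fun x s => K (x, s)) (by simpa [Function.uncurry_def] using hK.continuous) 0 1
  | succ n ih =>
    intro G _ _ K hK
    have : ProperSpace F := FiniteDimensional.proper_real F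
    have hK' : ContDiff ℝ ∞ (fun y : F × ℝ => (fderiv ℝ K y).comp (ContinuousLinearMap.inl ℝ F ℝ)) :=
      (hK.fderiv_right (m := ∞) (by simp)).clm_comp contDiff_const
    push_cast
    refine contDiff_succ_iff_hasFDerivAt.2
      ⟨fun x => ∫ s in (0 : ℝ)..1, (fderiv ℝ K (x, s)).comp (ContinuousLinearMap.inl ℝ F ℝ),
        ih hK', fun x => ?_⟩
    obtain ⟨C, hC⟩ := ((isCompact_closedBall x 1).prod isCompact_Icc).exists_bound_of_continuousOn
      (s := Metric.closedBall x 1 ×ˢ Icc (0 : ℝ) 1) hK'.continuous.continuousOn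
    have hcont : ∀ y : F, Continuous fun s : ℝ => K (y, s) := fun y =>
      hK.continuous.comp (by fun_prop)
    have hcont' : Continuous fun s : ℝ =>
        (fderiv ℝ K (x, s)).comp (ContinuousLinearMap.inl ℝ F ℝ) :=
      hK'.continuous.comp (g := fun y : F × ℝ => _) (by fun_prop : Continuous fun s : ℝ => (x, s))
    refine intervalIntegral.hasFDerivAt_integral_of_dominated_of_fderiv_le
      (F := fun y s => K (y, s))
      (F' := fun y s => (fderiv ℝ K (y, s)).comp (ContinuousLinearMap.inl ℝ F ℝ))
      (bound := fun _ => C) (Metric.closedBall_mem_nhds x one_pos)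
      (Eventually.of_forall fun y => (hcont y).aestronglyMeasurable)
      ((hcont x).intervalIntegrable _ _) hcont'.aestronglyMeasurable
      (MeasureTheory.ae_of_all _ fun s hs y hy => hC (y, s) ⟨hy, ?_⟩) (by simp)
      (MeasureTheory.ae_of_all _ fun s _ y _ => ?_)
    · rw [uIoc_of_le zero_le_one] at hs
      exact Ioc_subset_Icc_self hs
    · have h1 := (hK.differentiable (by simp) (y, s)).hasFDerivAt
      exact h1.comp y (hasFDerivAt_prodMk_left y s)

theorem contDiff_parametric_integral {K : F × ℝ → ℂ} (hK : ContDiff ℝ ∞ K) :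
    ContDiff ℝ ∞ (fun x => ∫ s in (0 : ℝ)..1, K (x, s)) :=
  contDiff_infty.2 fun n => contDiff_nat_parametric_integral n hK

/-- Hadamard's lemma: a smooth function is its restriction to `v = 0` plus `v` times a smooth
function. -/
theorem exists_smooth_division {G : F × ℝ → ℂ} (hG : ContDiff ℝ ∞ G) :
    ∃ G₁ : F × ℝ → ℂ, ContDiff ℝ ∞ G₁ ∧ ∀ x v, G (x, v) = G (x, 0) + v * G₁ (x, v) := by
  have hd : ContDiff ℝ ∞ (fun z : (F × ℝ) × ℝ =>
      fderiv ℝ G (z.1.1, z.2 * z.1.2) ((0 : F), (1 : ℝ))) := by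
    refine ContDiff.clm_apply ?_ contDiff_const
    exact (hG.fderiv_right (m := ∞) (by simp)).comp (by fun_prop)
  refine ⟨_, contDiff_parametric_integral hd, fun x v => ?_⟩
  have hder : ∀ s ∈ uIcc (0 : ℝ) 1, HasDerivAt (fun s : ℝ => G (x, s * v))
      (v * fderiv ℝ G (x, s * v) ((0 : F), (1 : ℝ))) s := by
    intro s _
    have h1 := (hG.differentiable (by simp) (x, s * v)).hasFDerivAt
    have h2 : HasDerivAt (fun s : ℝ => (x, s * v)) ((0 : F), v) s :=
      (hasDerivAt_const s x).prodMk (by simpa using (hasDerivAt_id s).mul_const v)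
    have h3 := h1.comp_hasDerivAt s h2
    have : ((0 : F), v) = v • ((0 : F), (1 : ℝ)) := by simp
    rw [this, map_smul, Complex.real_smul] at h3
    exact h3
  have hc : Continuous fun s : ℝ => (v : ℂ) * fderiv ℝ G (x, s * v) ((0 : F), (1 : ℝ)) :=
    continuous_const.mul (hd.continuous.comp (by fun_prop : Continuous fun s : ℝ => ((x, v), s)))
  have := intervalIntegral.integral_eq_sub_of_hasDerivAt hder (hc.intervalIntegrable _ _)
  rw [intervalIntegral.integral_const_mul] at this
  simp only [one_mul, zero_mul] at this
  rw [this]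
  ring

/-- Hadamard's lemma for an even function, whose quotient by `v ^ 2` is even again. -/
theorem exists_smooth_division_of_even {G : F × ℝ → ℂ} (hG : ContDiff ℝ ∞ G)
    (he : ∀ x v, G (x, -v) = G (x, v)) :
    ∃ G₂ : F × ℝ → ℂ, ContDiff ℝ ∞ G₂ ∧ (∀ x v, G₂ (x, -v) = G₂ (x, v)) ∧
      ∀ x v, G (x, v) = G (x, 0) + (v : ℂ) ^ 2 * G₂ (x, v) := by
  obtain ⟨G₁, h1, h2⟩ := exists_smooth_division hG
  obtain ⟨G₂, h3, h4⟩ := exists_smooth_division h1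
  have hodd : ∀ x, G₁ (x, 0) = 0 := by
    intro x
    have hc : Continuous fun v : ℝ => G₁ (x, v) + G₁ (x, -v) :=
      (h1.continuous.comp (by fun_prop)).add (h1.continuous.comp (by fun_prop))
    have : (fun v : ℝ => G₁ (x, v) + G₁ (x, -v)) = fun _ => 0 := by
      refine hc.ext_on (dense_compl_singleton (0 : ℝ)) continuous_const fun v hv => ?_
      have hv' : (v : ℂ) ≠ 0 := by exact_mod_cast hv
      have e1 := h2 x v
      have e2 := h2 x (-v)
      rw [he, e1] at e2
      push_cast at e2
      apply mul_left_cancel₀ hv'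
      linear_combination e2
    have := congrFun this 0
    simp only [neg_zero] at this
    linear_combination this / 2
  have h5 : ∀ x v, G (x, v) = G (x, 0) + (v : ℂ) ^ 2 * G₂ (x, v) := by
    intro x v
    rw [h2, h4, hodd]
    ring
  refine ⟨G₂, h3, fun x v => ?_, h5⟩
  rcases eq_or_ne v 0 with rfl | hv
  · simp
  · have hv' : (v : ℂ) ^ 2 ≠ 0 := pow_ne_zero 2 (by exact_mod_cast hv)
    have e1 := h5 x v
    have e2 := h5 x (-v)
    rw [he, e1] at e2
    push_cast at e2
    apply mul_left_cancel₀ hv'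
    linear_combination -e2

/-- Taylor expansion with smooth remainder of a smooth even function, in powers of `v ^ 2`. -/
theorem exists_even_taylor {G : F × ℝ → ℂ} (hG : ContDiff ℝ ∞ G)
    (he : ∀ x v, G (x, -v) = G (x, v)) :
    ∃ S : ℕ → F × ℝ → ℂ, S 0 = G ∧ (∀ j, ContDiff ℝ ∞ (S j)) ∧
      ∀ L x v, G (x, v) = ∑ j ∈ Finset.range L, ((v : ℂ) ^ 2) ^ j * S j (x, 0)
        + ((v : ℂ) ^ 2) ^ L * S L (x, v) := by
  let X := {G : F × ℝ → ℂ // ContDiff ℝ ∞ G ∧ ∀ x v, G (x, -v) = G (x, v)}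
  let next : X → X := fun G =>
    ⟨(exists_smooth_division_of_even G.2.1 G.2.2).choose,
      (exists_smooth_division_of_even G.2.1 G.2.2).choose_spec.1,
      (exists_smooth_division_of_even G.2.1 G.2.2).choose_spec.2.1⟩
  have hnext : ∀ G : X, ∀ x v, G.1 (x, v) = G.1 (x, 0) + (v : ℂ) ^ 2 * (next G).1 (x, v) :=
    fun G => (exists_smooth_division_of_even G.2.1 G.2.2).choose_spec.2.2
  let S : ℕ → X := fun j => next^[j] ⟨G, hG, he⟩
  have hS : ∀ j, S (j + 1) = next (S j) := fun j => Function.iterate_succ_apply' _ _ _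
  refine ⟨fun j => (S j).1, rfl, fun j => (S j).2.1, fun L x v => ?_⟩
  induction L with
  | zero => simp [S]
  | succ L ih =>
    have h := hnext (S L) x v
    rw [← hS] at h
    simp only [Finset.sum_range_succ] at ih ⊢
    rw [ih, h]
    ring

/-! ### Cutting off smooth functions -/

theorem exists_smooth_cutoff {K O : Set F} (hK : IsCompact K) (hO : IsOpen O) (hKO : K ⊆ O) :
    ∃ χ : F → ℝ, ContDiff ℝ ∞ χ ∧ HasCompactSupport χ ∧ tsupport χ ⊆ O ∧
      (∀ x, χ x ∈ Icc (0 : ℝ) 1) ∧ ∃ O₁, IsOpen O₁ ∧ K ⊆ O₁ ∧ O₁ ⊆ O ∧ ∀ x ∈ O₁, χ x = 1 := by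
  have : ProperSpace F := FiniteDimensional.proper_real F
  obtain ⟨V, hV, hKV, hVO, hVc⟩ := exists_open_between_and_isCompact_closure hK hO hKO
  obtain ⟨f, hf1, hf0, hf⟩ := exists_contMDiffMap_one_nhds_of_subset_interior
    (n := ⊤) (modelWithCornersSelf ℝ F) hK.isClosed (t := V) (by rwa [hV.interior_eq])
  have hts : tsupport f ⊆ closure V := by
    refine closure_mono fun x hx => ?_
    by_contra h
    exact hx (hf0 x h)
  obtain ⟨O₁, h1, h2, h3⟩ := mem_nhdsSet_iff_exists.1 hf1
  refine ⟨f, f.contMDiff.contDiff, hVc.of_isClosed_subset (isClosed_tsupport _) hts,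
    hts.trans hVO, hf, O₁ ∩ O, h1.inter hO, subset_inter h2 hKO, inter_subset_right, fun x hx => h3 hx.1⟩

omit [FiniteDimensional ℝ F] in
theorem contDiff_smul_of_tsupport_subset {G : Type*} [NormedAddCommGroup G] [NormedSpace ℝ G]
    {χ : F → ℝ} {f : F → G} {O : Set F} (hχ : ContDiff ℝ ∞ χ) (hO : IsOpen O)
    (hs : tsupport χ ⊆ O) (hf : ContDiffOn ℝ ∞ f O) : ContDiff ℝ ∞ (fun x => χ x • f x) := by
  rw [contDiff_iff_contDiffAt]
  intro x
  by_cases hx : x ∈ tsupport χ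
  · exact hχ.contDiffAt.smul (hf.contDiffAt (hO.mem_nhds (hs hx)))
  · refine contDiffAt_const (c := (0 : G)) |>.congr_of_eventuallyEq ?_
    filter_upwards [(isClosed_tsupport χ).isOpen_compl.mem_nhds hx] with y hy
    simp [image_eq_zero_of_notMem_tsupport hy]

/-- A smooth function near a compact set has a smooth compactly supported extension. -/
theorem exists_smooth_extension {G : Type*} [NormedAddCommGroup G] [NormedSpace ℝ G]
    {K O : Set F} (hK : IsCompact K) (hO : IsOpen O) (hKO : K ⊆ O) {f : F → G}
    (hf : ContDiffOn ℝ ∞ f O) :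
    ∃ g : F → G, ContDiff ℝ ∞ g ∧ HasCompactSupport g ∧
      ∃ O₁, IsOpen O₁ ∧ K ⊆ O₁ ∧ O₁ ⊆ O ∧ EqOn g f O₁ := by
  obtain ⟨χ, h1, h2, h3, -, O₁, h5, h6, h7, h8⟩ := exists_smooth_cutoff hK hO hKO
  exact ⟨_, contDiff_smul_of_tsupport_subset h1 hO h3 hf, h2.smul_right, O₁, h5, h6, h7,
    fun x hx => by simp [h8 x hx]⟩

end Tools

/-! ### Borel's lemma and functions vanishing to infinite order -/

section Borel

variable {F : Type} [NormedAddCommGroup F] [NormedSpace ℝ F]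

theorem exists_iteratedFDeriv_bound {G : Type*} [NormedAddCommGroup G] [NormedSpace ℝ G]
    {Φ : F → G} (h : ContDiff ℝ ∞ Φ) (hc : HasCompactSupport Φ) (M : ℕ) :
    ∃ C : ℝ, 0 ≤ C ∧ ∀ m ≤ M, ∀ z, ‖iteratedFDeriv ℝ m Φ z‖ ≤ C := by
  have : ∀ m : ℕ, ∃ C : ℝ, ∀ z, ‖iteratedFDeriv ℝ m Φ z‖ ≤ C := fun m =>
    (hc.iteratedFDeriv m).exists_bound_of_continuous
      (h.continuous_iteratedFDeriv (by exact_mod_cast le_top))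
  choose C hC using this
  refine ⟨∑ m ∈ Finset.range (M + 1), |C m|, Finset.sum_nonneg fun _ _ => abs_nonneg _,
    fun m hm z => ?_⟩
  exact (hC m z).trans ((le_abs_self _).trans (Finset.single_le_sum (f := fun m => |C m|)
    (fun _ _ => abs_nonneg _) (Finset.mem_range.2 (by omega))))

/-- Rescaling the last variable by `ε` costs `ε ^ (-m)` in the derivatives of order `m`. -/
theorem norm_iteratedFDeriv_rescale_le {Φ : F × ℝ → ℂ} (h : ContDiff ℝ ∞ Φ) {C ε : ℝ} {m : ℕ}
    (hC : ∀ z, ‖iteratedFDeriv ℝ m Φ z‖ ≤ C) (hε : 0 < ε) (hε1 : ε ≤ 1) (z : F × ℝ) :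
    ‖iteratedFDeriv ℝ m (fun z : F × ℝ => Φ (z.1, ε⁻¹ * z.2)) z‖ ≤ C * (ε⁻¹) ^ m := by
  have hC0 : 0 ≤ C := (norm_nonneg _).trans (hC z)
  let A : F × ℝ →L[ℝ] F × ℝ :=
    (ContinuousLinearMap.fst ℝ F ℝ).prod (ε⁻¹ • ContinuousLinearMap.snd ℝ F ℝ)
  have hA : ‖A‖ ≤ ε⁻¹ := by
    refine ContinuousLinearMap.opNorm_le_bound _ (by positivity) fun y => ?_
    have h1 : 1 ≤ ε⁻¹ := (one_le_inv₀ hε).2 hε1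
    simp only [A, ContinuousLinearMap.prod_apply, ContinuousLinearMap.coe_fst',
      smul_apply, ContinuousLinearMap.coe_snd', Prod.norm_def, smul_eq_mul,
      norm_mul, Real.norm_of_nonneg (inv_nonneg.2 hε.le)]
    refine max_le ?_ ?_
    · calc ‖y.1‖ ≤ max ‖y.1‖ ‖y.2‖ := le_max_left _ _
        _ ≤ ε⁻¹ * max ‖y.1‖ ‖y.2‖ := le_mul_of_one_le_left (by positivity) h1
    · gcongr
      exact le_max_right _ _
  have := A.iteratedFDeriv_comp_right h z (i := m) (by exact_mod_cast le_top)
  change ‖iteratedFDeriv ℝ m (Φ ∘ A) z‖ ≤ _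
  rw [this]
  refine (ContinuousMultilinearMap.norm_compContinuousLinearMap_le _ _).trans ?_
  rw [Finset.prod_const, Finset.card_univ, Fintype.card_fin]
  gcongr
  exact hC _

/-- Borel's lemma with parameters. The function `S 0` has the Taylor series `∑ a n v ^ n` at
`v = 0`, and `S j` is its `j`-th Taylor quotient. -/
theorem exists_borel_sum {a : ℕ → F → ℂ} (ha : ∀ n, ContDiff ℝ ∞ (a n))
    (hc : ∀ n, HasCompactSupport (a n)) :
    ∃ S : ℕ → F × ℝ → ℂ, (∀ j, ContDiff ℝ ∞ (S j)) ∧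
      ∀ j x v, S j (x, v) = a j x + v * S (j + 1) (x, v) := by
  obtain ⟨χ, hχ, hχc, -, -, O₁, hO₁, h0, -, hχ1⟩ :=
    exists_smooth_cutoff (F := ℝ) (isCompact_singleton (x := (0 : ℝ))) isOpen_univ (subset_univ _)
  obtain ⟨η, hη, hηO⟩ := Metric.isOpen_iff.1 hO₁ 0 (h0 rfl)
  have hχη : ∀ t, |t| < η → χ t = 1 := fun t ht => hχ1 t (hηO (by simpa using ht))
  let Φ : ℕ → ℕ → F × ℝ → ℂ := fun i n z => (χ z.2 : ℂ) * ((z.2 : ℂ) ^ i * a n z.1)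
  have hof : ContDiff ℝ ∞ (fun t : ℝ => (t : ℂ)) := Complex.ofRealCLM.contDiff
  have hΦ : ∀ i n, ContDiff ℝ ∞ (Φ i n) := fun i n =>
    (hof.comp (hχ.comp contDiff_snd)).mul (((hof.comp contDiff_snd).pow i).mul
      ((ha n).comp contDiff_fst))
  have hΦc : ∀ i n, HasCompactSupport (Φ i n) := fun i n => by
    refine HasCompactSupport.intro ((hc n).isCompact.prod hχc.isCompact) fun z hz => ?_
    by_cases h1 : z.1 ∈ tsupport (a n)
    · have h2 : z.2 ∉ tsupport χ := fun h2 => hz ⟨h1, h2⟩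
      simp [Φ, image_eq_zero_of_notMem_tsupport h2]
    · simp [Φ, image_eq_zero_of_notMem_tsupport h1]
  have hB : ∀ n, ∃ C : ℝ, 0 ≤ C ∧ ∀ i ≤ n, ∀ m ≤ n, ∀ z, ‖iteratedFDeriv ℝ m (Φ i n) z‖ ≤ C := by
    intro n
    choose C h0 hC using fun i => exists_iteratedFDeriv_bound (hΦ i n) (hΦc i n) n
    refine ⟨∑ i ∈ Finset.range (n + 1), C i, Finset.sum_nonneg fun i _ => h0 i,
      fun i hi m hm z => (hC i m hm z).trans ?_⟩
    exact Finset.single_le_sum (f := C) (fun i _ => h0 i) (Finset.mem_range.2 (by omega))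
  choose B hB0 hB using hB
  -- The `n`-th term is cut off at the scale `ε n`, so small that its derivatives are summable.
  let ε : ℕ → ℝ := fun n => (1 / 2) ^ n / (1 + B n)
  have hε : ∀ n, 0 < ε n := fun n => by have := hB0 n; positivity
  have hε1 : ∀ n, ε n ≤ 1 := fun n => by
    have := hB0 n
    have h2 : ((1 : ℝ) / 2) ^ n ≤ 1 := pow_le_one₀ (by norm_num) (by norm_num)
    exact div_le_one_of_le₀ (by linarith) (by linarith)
  let term : ℕ → ℕ → F × ℝ → ℂ := fun i n z => ((ε n : ℂ) ^ i) * Φ i n (z.1, (ε n)⁻¹ * z.2)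
  have hterm : ∀ i n, ContDiff ℝ ∞ (term i n) := fun i n =>
    contDiff_const.mul ((hΦ i n).comp (by fun_prop))
  have hterm_eq : ∀ i n x v, term i n (x, v) = (χ ((ε n)⁻¹ * v) : ℂ) * ((v : ℂ) ^ i * a n x) := by
    intro i n x v
    have : (ε n : ℂ) ^ i * (((ε n)⁻¹ * v : ℝ) : ℂ) ^ i = (v : ℂ) ^ i := by
      have h1 : (ε n : ℂ) ≠ 0 := by exact_mod_cast (hε n).ne'
      rw [← mul_pow]
      push_cast
      rw [mul_inv_cancel_left₀ h1]
    simp only [term, Φ]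
    rw [← this]
    ring
  have hbound : ∀ i n m, i ≤ n → m < i → ∀ z,
      ‖iteratedFDeriv ℝ m (term i n) z‖ ≤ (1 / 2) ^ n := by
    intro i n m hi hm z
    have h1 := norm_iteratedFDeriv_rescale_le (hΦ i n) (hB n i hi m (by omega)) (hε n) (hε1 n) z
    have h2 : iteratedFDeriv ℝ m (term i n) z = ((ε n : ℂ) ^ i) •
        iteratedFDeriv ℝ m (fun z : F × ℝ => Φ i n (z.1, (ε n)⁻¹ * z.2)) z := by
      have := iteratedFDeriv_const_smul_apply (𝕜 := ℝ) (i := m) (x := z) (a := (ε n : ℂ) ^ i)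
        (f := fun z : F × ℝ => Φ i n (z.1, (ε n)⁻¹ * z.2))
        (((hΦ i n).comp (by fun_prop)).contDiffAt.of_le (by exact_mod_cast le_top))
      rw [← this]
      rfl
    rw [h2, norm_smul, norm_pow, Complex.norm_real, Real.norm_of_nonneg (hε n).le]
    have hε0 : 0 ≤ ε n ^ i := (pow_pos (hε n) i).le
    calc ε n ^ i * _ ≤ ε n ^ i * (B n * (ε n)⁻¹ ^ m) := by
          gcongr
      _ = ε n ^ (i - m) * B n := by
          rw [inv_pow, ← Nat.sub_add_cancel hm.le, pow_add, Nat.add_sub_cancel]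
          have := (pow_pos (hε n) m).ne'
          field_simp
      _ ≤ ε n ^ 1 * B n := by
          gcongr ?_ * _
          · exact hB0 n
          · exact pow_le_pow_of_le_one (hε n).le (hε1 n) (by omega)
      _ ≤ (1 / 2) ^ n := by
          have := hB0 n
          rw [pow_one, div_mul_eq_mul_div]
          exact div_le_of_le_mul₀ (by positivity) (by positivity)
            (by gcongr; linarith)
  have hsum : ∀ j : ℕ, ∀ z, Summable fun i => term i (i + j) z := by
    intro j z
    rw [← summable_nat_add_iff 1]
    refine Summable.of_norm_bounded (g := fun i : ℕ => ((1 : ℝ) / 2) ^ i)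
      (summable_geometric_of_lt_one (by norm_num) (by norm_num)) fun i => ?_
    have := hbound (i + 1) (i + 1 + j) 0 (by omega) (by omega) z
    rw [norm_iteratedFDeriv_zero] at this
    exact this.trans (pow_le_pow_of_le_one (by norm_num) (by norm_num) (by omega))
  let T : ℕ → F × ℝ → ℂ := fun j z => ∑' i, term i (i + j) z
  have hT : ∀ j, ContDiff ℝ ∞ (T j) := by
    intro j
    refine contDiff_tsum_of_eventually (N := ⊤) (v := fun _ i => ((1 : ℝ) / 2) ^ i)
      (fun i => hterm i (i + j)) (fun m _ =>
        summable_geometric_of_lt_one (by norm_num) (by norm_num)) fun m _ => ?_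
    rw [Nat.cofinite_eq_atTop]
    filter_upwards [eventually_gt_atTop m] with i hi z
    exact (hbound i (i + j) m (by omega) hi z).trans
      (pow_le_pow_of_le_one (by norm_num) (by norm_num) (by omega))
  have hTrec : ∀ j x v, T j (x, v) = (χ ((ε j)⁻¹ * v) : ℂ) * a j x + v * T (j + 1) (x, v) := by
    intro j x v
    simp only [T]
    rw [(hsum j (x, v)).tsum_eq_zero_add, hterm_eq, ← tsum_mul_left]
    congr 1
    · simp
    · refine tsum_congr fun i => ?_
      rw [hterm_eq, hterm_eq, show i + 1 + j = i + (j + 1) by ring]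
      ring
  -- The cutoffs only contribute terms that vanish near `v = 0`, which can be divided by `v`.
  have hdiv : ∀ R : F × ℝ → ℂ, (ContDiff ℝ ∞ R ∧ ∃ r > 0, ∀ x v, |v| < r → R (x, v) = 0) →
      (ContDiff ℝ ∞ (fun z : F × ℝ => R z / (z.2 : ℂ)) ∧
        ∃ r > 0, ∀ x v, |v| < r → R (x, v) / (v : ℂ) = 0) := by
    rintro R ⟨hR, r, hr, h⟩
    refine ⟨contDiff_iff_contDiffAt.2 fun z => ?_, r, hr, fun x v hv => by simp [h x v hv]⟩
    by_cases hz : z.2 = 0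
    · refine contDiffAt_const (c := (0 : ℂ)) |>.congr_of_eventuallyEq ?_
      have : {z : F × ℝ | |z.2| < r} ∈ 𝓝 z :=
        (isOpen_lt (by fun_prop) continuous_const).mem_nhds (by simpa [hz] using hr)
      filter_upwards [this] with y hy
      rw [show y = (y.1, y.2) from rfl, h _ _ hy, zero_div]
    · simp only [div_eq_mul_inv]
      exact hR.contDiffAt.mul (ContDiffAt.inv (f := fun z : F × ℝ => (z.2 : ℂ))
        (hof.comp contDiff_snd).contDiffAt (by exact_mod_cast hz))
  let X := {R : F × ℝ → ℂ // ContDiff ℝ ∞ R ∧ ∃ r > 0, ∀ x v, |v| < r → R (x, v) = 0}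
  have hcut : ∀ (R : X) (j : ℕ), ContDiff ℝ ∞ (fun z : F × ℝ =>
      R.1 z + ((χ ((ε j)⁻¹ * z.2) : ℂ) - 1) * a j z.1) ∧
      ∃ r > 0, ∀ x v, |v| < r → R.1 (x, v) + ((χ ((ε j)⁻¹ * v) : ℂ) - 1) * a j x = 0 := by
    rintro ⟨R, hR, r, hr, h⟩ j
    refine ⟨hR.add (((hof.comp (hχ.comp (by fun_prop))).sub contDiff_const).mul
      ((ha j).comp contDiff_fst)), min r (ε j * η), lt_min hr (mul_pos (hε j) hη),
      fun x v hv => ?_⟩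
    have h1 : |(ε j)⁻¹ * v| < η := by
      rw [abs_mul, abs_of_pos (inv_pos.2 (hε j)), inv_mul_lt_iff₀ (hε j)]
      exact hv.trans_le (min_le_right _ _)
    simp [h x v (hv.trans_le (min_le_left _ _)), hχη _ h1]
  let nextR : ℕ → X → X := fun j R => ⟨_, hdiv _ (hcut R j)⟩
  let R : ℕ → X := fun j => Nat.rec ⟨0, contDiff_const, 1, one_pos, fun _ _ _ => rfl⟩ nextR j
  have hRrec : ∀ (j : ℕ) (x : F) (v : ℝ), (v : ℂ) * (R (j + 1)).1 (x, v) =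
      (R j).1 (x, v) + ((χ ((ε j)⁻¹ * v) : ℂ) - 1) * a j x := by
    intro j x v
    change (v : ℂ) * (((R j).1 (x, v) + ((χ ((ε j)⁻¹ * v) : ℂ) - 1) * a j x) / (v : ℂ)) = _
    rcases eq_or_ne v 0 with rfl | hv
    · obtain ⟨-, r, hr, h⟩ := hcut (R j) j
      rw [h x 0 (by simpa using hr)]
      simp
    · rw [mul_div_cancel₀]
      exact_mod_cast hv
  refine ⟨fun j z => T j z + (R j).1 z, fun j => (hT j).add (R j).2.1, fun j x v => ?_⟩
  simp only
  rw [mul_add, hRrec, hTrec]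
  ring

end Borel

/-- Multiplying by a function that vanishes at a point raises the order of vanishing there. -/
theorem iteratedFDeriv_mul_eq_zero {F : Type*} [NormedAddCommGroup F] [NormedSpace ℝ F]
    {g u : F → ℂ} {y : F} {n : ℕ} (hg : ContDiff ℝ ∞ g)
    (hu : ContDiff ℝ ∞ u) (h0 : g y = 0) (h : ∀ m < n, iteratedFDeriv ℝ m u y = 0) :
    ∀ m < n + 1, iteratedFDeriv ℝ m (fun x => g x * u x) y = 0 := by
  intro m hm
  rw [← norm_le_zero_iff]
  refine (norm_iteratedFDeriv_mul_le hg hu y (n := m) (by exact_mod_cast le_top)).trans ?_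
  refine (Finset.sum_eq_zero fun i hi => ?_).le
  rw [Finset.mem_range] at hi
  rcases Nat.eq_zero_or_pos i with rfl | hi'
  · simp [norm_iteratedFDeriv_zero, h0]
  · rw [h (m - i) (by omega)]
    simp

theorem iteratedFDeriv_pow_mul_eq_zero {F : Type*} [NormedAddCommGroup F] [NormedSpace ℝ F]
    {g u : F → ℂ} {y : F} (hg : ContDiff ℝ ∞ g)
    (hu : ContDiff ℝ ∞ u) (h0 : g y = 0) (n : ℕ) :
    ∀ m < n, iteratedFDeriv ℝ m (fun x => g x ^ n * u x) y = 0 := by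
  induction n with
  | zero => intro m hm; omega
  | succ n ih =>
    have := iteratedFDeriv_mul_eq_zero hg ((hg.pow n).mul hu) h0 ih
    simpa only [pow_succ', mul_assoc] using this

/-! ### Gaussian integrals depending on parameters -/

section Gaussian

/-- The integrand `t ^ m e^{-t² W(q, ht)} b(q, ht)`, where `z = (q, h)`. -/
noncomputable def gaussIntegrand (W : ℝ × ℝ → ℂ) (m : ℕ) (b : ℝ × ℝ → ℂ) (z : ℝ × ℝ) (t : ℝ) : ℂ :=
  (t : ℂ) ^ m * (Complex.exp (-((t : ℂ) ^ 2 * W (z.1, z.2 * t))) * b (z.1, z.2 * t))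

variable {W : ℝ × ℝ → ℂ} {c : ℝ}

theorem norm_exp_neg_le {w : ℂ} (hw : c ≤ w.re) (t : ℝ) :
    ‖Complex.exp (-((t : ℂ) ^ 2 * w))‖ ≤ Real.exp (-(c * t ^ 2)) := by
  rw [Complex.norm_exp]
  have : (-((t : ℂ) ^ 2 * w)).re = -(t ^ 2 * w.re) := by
    rw [Complex.neg_re, ← Complex.ofReal_pow, Complex.re_ofReal_mul]
  rw [this]
  exact Real.exp_le_exp.2 (by nlinarith [mul_le_mul_of_nonneg_left hw (sq_nonneg t)])

theorem integrable_pow_mul_exp (hc : 0 < c) (m : ℕ) :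
    MeasureTheory.Integrable (fun t : ℝ => |t| ^ m * Real.exp (-(c * t ^ 2))) := by
  have h := (integrable_rpow_mul_exp_neg_mul_sq hc (s := m)
    (by linarith [(Nat.cast_nonneg m : (0 : ℝ) ≤ m)])).norm
  refine h.congr (MeasureTheory.ae_of_all _ fun t => ?_)
  simp [abs_of_pos (Real.exp_pos _)]

theorem norm_gaussIntegrand_le (hW : ∀ z, c ≤ (W z).re) {b : ℝ × ℝ → ℂ} {B : ℝ}
    (hb : ∀ z, ‖b z‖ ≤ B) (m : ℕ) (z : ℝ × ℝ) (t : ℝ) :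
    ‖gaussIntegrand W m b z t‖ ≤ B * (|t| ^ m * Real.exp (-(c * t ^ 2))) := by
  rw [gaussIntegrand, norm_mul, norm_mul, norm_pow, Complex.norm_real, Real.norm_eq_abs]
  calc _ ≤ |t| ^ m * (Real.exp (-(c * t ^ 2)) * B) := by
        gcongr
        · exact norm_exp_neg_le (hW _) t
        · exact hb _
    _ = _ := by ring

theorem continuous_gaussIntegrand (hW : Continuous W) {b : ℝ × ℝ → ℂ} (hb : Continuous b) (m : ℕ)
    (z : ℝ × ℝ) : Continuous (gaussIntegrand W m b z) := by
  unfold gaussIntegrand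
  fun_prop

theorem integrable_gaussIntegrand (hc : 0 < c) (hWc : Continuous W) (hW : ∀ z, c ≤ (W z).re)
    {b : ℝ × ℝ → ℂ} (hb : Continuous b) (hbc : HasCompactSupport b) (m : ℕ) (z : ℝ × ℝ) :
    MeasureTheory.Integrable (gaussIntegrand W m b z) := by
  obtain ⟨B, hB⟩ := hbc.exists_bound_of_continuous hb
  exact ((integrable_pow_mul_exp hc m).const_mul B).mono'
    (continuous_gaussIntegrand hWc hb m z).aestronglyMeasurable
    (MeasureTheory.ae_of_all _ fun t => norm_gaussIntegrand_le hW hB m z t)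

/-- The partial derivative in the direction `e`. -/
noncomputable def pderiv (e : ℝ × ℝ) (f : ℝ × ℝ → ℂ) (z : ℝ × ℝ) : ℂ := fderiv ℝ f z e

theorem contDiff_pderiv {f : ℝ × ℝ → ℂ} (hf : ContDiff ℝ ∞ f) (e : ℝ × ℝ) :
    ContDiff ℝ ∞ (pderiv e f) :=
  (hf.fderiv_right (m := ∞) (by simp)).clm_apply contDiff_const

theorem hasCompactSupport_pderiv {f : ℝ × ℝ → ℂ} (hf : HasCompactSupport f) (e : ℝ × ℝ) :
    HasCompactSupport (pderiv e f) :=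
  hf.fderiv_apply ℝ e

theorem fderiv_eq_pderiv (f : ℝ × ℝ → ℂ) (z w : ℝ × ℝ) :
    fderiv ℝ f z w = w.1 * pderiv (1, 0) f z + w.2 * pderiv (0, 1) f z := by
  have : w = w.1 • ((1 : ℝ), (0 : ℝ)) + w.2 • ((0 : ℝ), (1 : ℝ)) := by ext <;> simp
  conv_lhs => rw [this, map_add, map_smul, map_smul]
  simp only [Complex.real_smul]
  rfl

theorem hasFDerivAt_gaussIntegrand (hW : ContDiff ℝ ∞ W) {b : ℝ × ℝ → ℂ} (hb : ContDiff ℝ ∞ b)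
    (m : ℕ) (z : ℝ × ℝ) (t : ℝ) :
    HasFDerivAt (fun z => gaussIntegrand W m b z t)
      ((gaussIntegrand W m (pderiv (1, 0) b) z t
          - gaussIntegrand W (m + 2) (fun z => pderiv (1, 0) W z * b z) z t) •
        (Complex.ofRealCLM.comp (ContinuousLinearMap.fst ℝ ℝ ℝ))
      + (gaussIntegrand W (m + 1) (pderiv (0, 1) b) z t
          - gaussIntegrand W (m + 3) (fun z => pderiv (0, 1) W z * b z) z t) •
        (Complex.ofRealCLM.comp (ContinuousLinearMap.snd ℝ ℝ ℝ))) z := by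
  let A : ℝ × ℝ →L[ℝ] ℝ × ℝ := (ContinuousLinearMap.fst ℝ ℝ ℝ).prod
    (t • ContinuousLinearMap.snd ℝ ℝ ℝ)
  have hA : ∀ z : ℝ × ℝ, A z = (z.1, z.2 * t) := fun z => by simp [A, mul_comm]
  have hW' : HasFDerivAt (fun z : ℝ × ℝ => W (z.1, z.2 * t))
      ((fderiv ℝ W (z.1, z.2 * t)).comp A) z := by
    have h := (hW.differentiable (by simp) (A z)).hasFDerivAt.comp z A.hasFDerivAt
    rw [hA] at h
    refine h.congr_of_eventuallyEq (Eventually.of_forall fun y => ?_)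
    simp [hA]
  have hb' : HasFDerivAt (fun z : ℝ × ℝ => b (z.1, z.2 * t))
      ((fderiv ℝ b (z.1, z.2 * t)).comp A) z := by
    have h := (hb.differentiable (by simp) (A z)).hasFDerivAt.comp z A.hasFDerivAt
    rw [hA] at h
    refine h.congr_of_eventuallyEq (Eventually.of_forall fun y => ?_)
    simp [hA]
  have h := (((hW'.const_mul ((t : ℂ) ^ 2)).neg.cexp).mul hb').const_mul ((t : ℂ) ^ m)
  refine h.congr_fderiv ?_
  refine ContinuousLinearMap.ext fun w => ?_
  simp only [gaussIntegrand, smul_apply, add_apply, neg_apply, Pi.neg_apply,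
    ContinuousLinearMap.comp_apply, hA, fderiv_eq_pderiv, smul_eq_mul, Complex.ofRealCLM_apply,
    ContinuousLinearMap.coe_fst', ContinuousLinearMap.coe_snd']
  push_cast
  ring

theorem contDiff_nat_integral_gaussIntegrand (hc : 0 < c) (hWs : ContDiff ℝ ∞ W)
    (hW : ∀ z, c ≤ (W z).re) (n : ℕ) : ∀ (m : ℕ) {b : ℝ × ℝ → ℂ}, ContDiff ℝ ∞ b →
      HasCompactSupport b → ContDiff ℝ n (fun z => ∫ t, gaussIntegrand W m b z t) := by
  induction n with
  | zero =>
    intro m b hb hbc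
    obtain ⟨B, hB⟩ := hbc.exists_bound_of_continuous hb.continuous
    refine contDiff_zero.2 (MeasureTheory.continuous_of_dominated
      (fun z => (continuous_gaussIntegrand hWs.continuous hb.continuous m z).aestronglyMeasurable)
      (fun z => MeasureTheory.ae_of_all _ fun t => norm_gaussIntegrand_le hW hB m z t)
      ((integrable_pow_mul_exp hc m).const_mul B)
      (MeasureTheory.ae_of_all _ fun t => ?_))
    have := hWs.continuous
    have := hb.continuous
    unfold gaussIntegrand
    fun_prop
  | succ n ih =>
    intro m b hb hbc
    -- the derivatives in `q` and `h` are integrals of the same form, so that induction applies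
    have h1 := contDiff_pderiv hb (1, 0)
    have h2 := contDiff_pderiv hb (0, 1)
    have h3 := (contDiff_pderiv hWs (1, 0)).mul hb
    have h4 := (contDiff_pderiv hWs (0, 1)).mul hb
    have c1 := hasCompactSupport_pderiv hbc (1, 0)
    have c2 := hasCompactSupport_pderiv hbc (0, 1)
    have c3 : HasCompactSupport (fun z => pderiv (1, 0) W z * b z) := hbc.mul_left
    have c4 : HasCompactSupport (fun z => pderiv (0, 1) W z * b z) := hbc.mul_left
    have hint := fun (m : ℕ) (b : ℝ × ℝ → ℂ) (hb : ContDiff ℝ ∞ b) (hbc : HasCompactSupport b) =>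
      integrable_gaussIntegrand hc hWs.continuous hW hb.continuous hbc m
    push_cast
    refine contDiff_succ_iff_hasFDerivAt.2 ⟨fun z =>
      ((∫ t, gaussIntegrand W m (pderiv (1, 0) b) z t)
          - ∫ t, gaussIntegrand W (m + 2) (fun z => pderiv (1, 0) W z * b z) z t) •
        (Complex.ofRealCLM.comp (ContinuousLinearMap.fst ℝ ℝ ℝ))
      + ((∫ t, gaussIntegrand W (m + 1) (pderiv (0, 1) b) z t)
          - ∫ t, gaussIntegrand W (m + 3) (fun z => pderiv (0, 1) W z * b z) z t) •
        (Complex.ofRealCLM.comp (ContinuousLinearMap.snd ℝ ℝ ℝ)),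
      (((ih _ h1 c1).sub (ih _ h3 c3)).smul contDiff_const).add
        (((ih _ h2 c2).sub (ih _ h4 c4)).smul contDiff_const), fun z => ?_⟩
    obtain ⟨B1, hB1⟩ := c1.exists_bound_of_continuous h1.continuous
    obtain ⟨B2, hB2⟩ := c2.exists_bound_of_continuous h2.continuous
    obtain ⟨B3, hB3⟩ := c3.exists_bound_of_continuous h3.continuous
    obtain ⟨B4, hB4⟩ := c4.exists_bound_of_continuous h4.continuous
    have key := hasFDerivAt_integral_of_dominated_of_fderiv_le (𝕜 := ℝ) (μ := MeasureTheory.volume)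
      (F := fun z t => gaussIntegrand W m b z t) (x₀ := z) (s := univ)
      (F' := fun z t => (gaussIntegrand W m (pderiv (1, 0) b) z t
          - gaussIntegrand W (m + 2) (fun z => pderiv (1, 0) W z * b z) z t) •
        (Complex.ofRealCLM.comp (ContinuousLinearMap.fst ℝ ℝ ℝ))
      + (gaussIntegrand W (m + 1) (pderiv (0, 1) b) z t
          - gaussIntegrand W (m + 3) (fun z => pderiv (0, 1) W z * b z) z t) •
        (Complex.ofRealCLM.comp (ContinuousLinearMap.snd ℝ ℝ ℝ)))
      (bound := fun t => (B1 * (|t| ^ m * Real.exp (-(c * t ^ 2)))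
          + B3 * (|t| ^ (m + 2) * Real.exp (-(c * t ^ 2)))) *
          ‖(Complex.ofRealCLM.comp (ContinuousLinearMap.fst ℝ ℝ ℝ))‖
        + (B2 * (|t| ^ (m + 1) * Real.exp (-(c * t ^ 2)))
          + B4 * (|t| ^ (m + 3) * Real.exp (-(c * t ^ 2)))) *
          ‖(Complex.ofRealCLM.comp (ContinuousLinearMap.snd ℝ ℝ ℝ))‖)
      univ_mem
      (Eventually.of_forall fun y =>
        (continuous_gaussIntegrand hWs.continuous hb.continuous m y).aestronglyMeasurable)
      (hint m b hb hbc z) ?_ ?_ ?_ ?_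
    · refine key.congr_fderiv ?_
      have i1 := (((hint m _ h1 c1 z).sub (hint (m + 2) _ h3 c3 z)).smul_const
        (Complex.ofRealCLM.comp (ContinuousLinearMap.fst ℝ ℝ ℝ)))
      have i2 := (((hint (m + 1) _ h2 c2 z).sub (hint (m + 3) _ h4 c4 z)).smul_const
        (Complex.ofRealCLM.comp (ContinuousLinearMap.snd ℝ ℝ ℝ)))
      beta_reduce
      rw [← MeasureTheory.integral_sub (hint m _ h1 c1 z) (hint (m + 2) _ h3 c3 z),
        ← MeasureTheory.integral_sub (hint (m + 1) _ h2 c2 z) (hint (m + 3) _ h4 c4 z)]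
      refine (MeasureTheory.integral_add i1 i2).trans ?_
      congr 1
      · exact integral_smul_const _ _
      · exact integral_smul_const _ _
    · have k := fun (m : ℕ) (b : ℝ × ℝ → ℂ) (hb : ContDiff ℝ ∞ b) =>
        continuous_gaussIntegrand hWs.continuous hb.continuous m z
      exact (((k m _ h1).sub (k (m + 2) _ h3)).smul continuous_const |>.add
        (((k (m + 1) _ h2).sub (k (m + 3) _ h4)).smul continuous_const)).aestronglyMeasurable
    · refine MeasureTheory.ae_of_all _ fun t y _ => ?_
      have e1 := norm_gaussIntegrand_le hW hB1 m y t
      have e2 := norm_gaussIntegrand_le hW hB2 (m + 1) y t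
      have e3 := norm_gaussIntegrand_le hW hB3 (m + 2) y t
      have e4 := norm_gaussIntegrand_le hW hB4 (m + 3) y t
      refine (norm_add_le _ _).trans (add_le_add ?_ ?_)
      · rw [norm_smul]
        gcongr
        exact (norm_sub_le _ _).trans (add_le_add e1 e3)
      · rw [norm_smul]
        gcongr
        exact (norm_sub_le _ _).trans (add_le_add e2 e4)
    · have i := fun m => integrable_pow_mul_exp hc m
      exact ((((i m).const_mul B1).add ((i (m + 2)).const_mul B3)).mul_const _).add
        ((((i (m + 1)).const_mul B2).add ((i (m + 3)).const_mul B4)).mul_const _)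
    · exact MeasureTheory.ae_of_all _ fun t y _ => hasFDerivAt_gaussIntegrand hWs hb m y t

theorem contDiff_integral_gaussIntegrand (hc : 0 < c) (hWs : ContDiff ℝ ∞ W)
    (hW : ∀ z, c ≤ (W z).re) {b : ℝ × ℝ → ℂ} (hb : ContDiff ℝ ∞ b) (hbc : HasCompactSupport b) :
    ContDiff ℝ ∞ (fun z => ∫ t, gaussIntegrand W 0 b z t) :=
  contDiff_infty.2 fun n => contDiff_nat_integral_gaussIntegrand hc hWs hW n 0 hb hbc

/-- The substitution `t ↦ -t` shows that the integral is even in `h`. -/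
theorem integral_gaussIntegrand_neg (b : ℝ × ℝ → ℂ) (q v : ℝ) :
    ∫ t, gaussIntegrand W 0 b (q, -v) t = ∫ t, gaussIntegrand W 0 b (q, v) t := by
  rw [← MeasureTheory.integral_neg_eq_self]
  refine MeasureTheory.integral_congr_ae (MeasureTheory.ae_of_all _ fun t => ?_)
  simp [gaussIntegrand]

theorem integral_gaussIntegrand_zero (hc : 0 < c) (hW : ∀ z, c ≤ (W z).re) (b : ℝ × ℝ → ℂ) (q : ℝ) :
    ∫ t, gaussIntegrand W 0 b (q, 0) t = (Real.pi / W (q, 0)) ^ (1 / 2 : ℂ) * b (q, 0) := by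
  rw [← integral_gaussian_complex (hc.trans_le (hW _)), ← MeasureTheory.integral_mul_const]
  refine MeasureTheory.integral_congr_ae (MeasureTheory.ae_of_all _ fun t => ?_)
  simp [gaussIntegrand, mul_comm]

theorem integral_gaussian_rescale (b : ℝ × ℝ → ℂ) (q : ℝ) {k h : ℝ} (hh : 0 < h) (hk : k * h ^ 2 = 1) :
    ∫ v : ℝ, Complex.exp (-((k : ℂ) * (v : ℂ) ^ 2 * W (q, v))) * b (q, v)
      = h * ∫ t, gaussIntegrand W 0 b (q, h) t := by
  have := MeasureTheory.Measure.integral_comp_mul_left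
    (fun v : ℝ => Complex.exp (-((k : ℂ) * (v : ℂ) ^ 2 * W (q, v))) * b (q, v)) h
  rw [abs_of_pos (inv_pos.2 hh), Complex.real_smul] at this
  have h0 : (h : ℂ) ≠ 0 := by exact_mod_cast hh.ne'
  push_cast at this
  rw [eq_inv_mul_iff_mul_eq₀ h0] at this
  rw [← this]
  congr 1
  refine MeasureTheory.integral_congr_ae (MeasureTheory.ae_of_all _ fun t => ?_)
  have hk' : (k : ℂ) * (h : ℂ) ^ 2 = 1 := by exact_mod_cast hk
  simp only [gaussIntegrand, pow_zero, one_mul]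
  congr 2
  linear_combination (-(t : ℂ) ^ 2 * W (q, h * t)) * hk'

end Gaussian

/-! ### Laplace's method with a complex phase -/

section Laplace

theorem exists_exp_neg_le_rpow {a : ℝ} (ha : 0 < a) (s : ℝ) :
    ∃ C : ℝ, 0 ≤ C ∧ ∀ k : ℝ, 1 ≤ k → Real.exp (-(a * k)) ≤ C * k ^ (-s) := by
  obtain ⟨n, hn⟩ := exists_nat_ge s
  refine ⟨n.factorial / a ^ n, by positivity, fun k hk => ?_⟩
  have hk0 : 0 < k := by linarith
  have h1 := Real.pow_div_factorial_le_exp (a * k) (by positivity) n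
  have h2 : k ^ (-(n : ℝ)) ≤ k ^ (-s) := Real.rpow_le_rpow_of_exponent_le hk (by linarith)
  refine le_trans ?_ (mul_le_mul_of_nonneg_left h2 (by positivity))
  rw [Real.exp_neg, Real.rpow_neg hk0.le, Real.rpow_natCast]
  rw [inv_le_comm₀ (Real.exp_pos _) (by positivity)]
  refine le_trans (le_of_eq ?_) h1
  rw [mul_pow]
  field_simp

/-- A function with positive real part has, near a compact set, an extension whose real part is
bounded below by a positive constant. -/
theorem exists_phase_extension {O K : Set (ℝ × ℝ)} (hO : IsOpen O) (hK : IsCompact K) (hKO : K ⊆ O)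
    {W : ℝ × ℝ → ℂ} (hW : ContDiffOn ℝ ∞ W O) (hpos : ∀ z ∈ O, 0 < (W z).re) :
    ∃ (W' : ℝ × ℝ → ℂ) (c : ℝ), ContDiff ℝ ∞ W' ∧ 0 < c ∧ (∀ z, c ≤ (W' z).re) ∧
      EqOn W' W K := by
  obtain ⟨χ, h1, h2, h3, h4, O₁, h5, h6, h7, h8⟩ := exists_smooth_cutoff hK hO hKO
  have hs : ContDiff ℝ ∞ (fun z => χ z • W z + ((1 - χ z : ℝ) : ℂ)) :=
    (contDiff_smul_of_tsupport_subset h1 hO h3 hW).add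
      (Complex.ofRealCLM.contDiff.comp (contDiff_const.sub h1))
  have hre : ∀ z, (χ z • W z + ((1 - χ z : ℝ) : ℂ)).re = χ z * (W z).re + (1 - χ z) := fun z => by
    simp
  have hpos' : ∀ z ∈ tsupport χ, 0 < (χ z • W z + ((1 - χ z : ℝ) : ℂ)).re := by
    intro z hz
    rw [hre]
    have h9 := hpos z (h3 hz)
    obtain ⟨h10, h11⟩ := h4 z
    rcases h10.eq_or_lt with h | h
    · rw [← h]; norm_num
    · have := mul_pos h h9
      linarith
  obtain ⟨c, hc, hmin⟩ := h2.isCompact.exists_forall_le'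
    (Complex.continuous_re.comp hs.continuous).continuousOn hpos'
  refine ⟨_, min c 1, hs, lt_min hc one_pos, fun z => ?_, fun z hz => by simp [h8 z (h6 hz)]⟩
  by_cases hz : z ∈ tsupport χ
  · exact (min_le_left _ _).trans (hmin z hz)
  · rw [hre, image_eq_zero_of_notMem_tsupport hz]
    simp

theorem norm_exp_phase_le {W : ℝ × ℝ → ℂ} {c : ℝ} {z : ℝ × ℝ} (hW : c ≤ (W z).re) {k : ℝ}
    (hk : 0 ≤ k) (v : ℝ) :
    ‖Complex.exp (-((k : ℂ) * (v : ℂ) ^ 2 * W z))‖ ≤ Real.exp (-(k * (c * v ^ 2))) := by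
  rw [Complex.norm_exp]
  have : (-((k : ℂ) * (v : ℂ) ^ 2 * W z)).re = -(k * v ^ 2 * (W z).re) := by
    rw [Complex.neg_re, ← Complex.ofReal_pow, ← Complex.ofReal_mul, Complex.re_ofReal_mul]
  rw [this]
  refine Real.exp_le_exp.2 (neg_le_neg ?_)
  nlinarith [mul_le_mul_of_nonneg_left hW (mul_nonneg hk (sq_nonneg v))]

/-- Laplace's method: asymptotic expansion of `∫ e^{-k v² W(q, v)} a(q, v) dv` over `[-δ, δ]`,
uniformly in the parameter `q`, with smooth coefficients. After rescaling, the integral is a smooth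
even function of `h = k ^ (-1 / 2)`, and the expansion is its Taylor series at `h = 0`. -/
theorem exists_laplace_expansion {O : Set (ℝ × ℝ)} (hO : IsOpen O) {x y δ : ℝ} (hδ : 0 < δ)
    (hbox : Icc x y ×ˢ Icc (-δ) δ ⊆ O) {W a : ℝ × ℝ → ℂ} (hW : ContDiffOn ℝ ∞ W O)
    (hpos : ∀ z ∈ O, 0 < (W z).re) (ha : ContDiffOn ℝ ∞ a O) :
    ∃ P : ℕ → ℝ → ℂ, (∀ j, ContDiff ℝ ∞ (P j)) ∧
      (∀ q ∈ Icc x y, P 0 q = (Real.pi / W (q, 0)) ^ (1 / 2 : ℂ) * a (q, 0)) ∧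
      ∀ L : ℕ, ∃ C : ℝ, ∀ k : ℝ, 1 ≤ k → ∀ q ∈ Icc x y,
        ‖(∫ v in (-δ)..δ, Complex.exp (-((k : ℂ) * (v : ℂ) ^ 2 * W (q, v))) * a (q, v))
          - ((k ^ (-(1 / 2) : ℝ) : ℝ) : ℂ) * ∑ j ∈ Finset.range L, ((k : ℂ) ^ j)⁻¹ * P j q‖
        ≤ C * k ^ (-(1 / 2) - (L : ℝ)) := by
  have hKc : IsCompact (Icc x y ×ˢ Icc (-δ) δ) := isCompact_Icc.prod isCompact_Icc
  obtain ⟨W', c, hWs, hc, hWc, hWW⟩ := exists_phase_extension hO hKc hbox hW hpos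
  obtain ⟨b, hb, hbc, O₁, -, hKO₁, -, hba⟩ := exists_smooth_extension hKc hO hbox ha
  obtain ⟨S, hS0, hS, hST⟩ := exists_even_taylor (contDiff_integral_gaussIntegrand hc hWs hWc hb hbc)
    (integral_gaussIntegrand_neg b)
  have h0 : ∀ q ∈ Icc x y, (q, (0 : ℝ)) ∈ Icc x y ×ˢ Icc (-δ) δ := fun q hq =>
    ⟨hq, by constructor <;> simp [hδ.le]⟩
  refine ⟨fun j q => S j (q, 0), fun j => (hS j).comp (by fun_prop), fun q hq => ?_, fun L => ?_⟩
  · simp only [hS0]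
    rw [integral_gaussIntegrand_zero hc hWc, hWW (h0 q hq), hba (hKO₁ (h0 q hq))]
  obtain ⟨B, hB⟩ := hbc.exists_bound_of_continuous hb.continuous
  have hB0 : 0 ≤ B := (norm_nonneg _).trans (hB 0)
  obtain ⟨B', hB'⟩ := (isCompact_Icc.prod isCompact_Icc).exists_bound_of_continuousOn
    (s := Icc x y ×ˢ Icc (0 : ℝ) 1) (hS L).continuous.continuousOn
  obtain ⟨C₁, hC₁0, hC₁⟩ := exists_exp_neg_le_rpow (a := c * δ ^ 2) (by positivity)
    (1 / 2 + (L : ℝ))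
  have hgi : MeasureTheory.Integrable (fun v : ℝ => Real.exp (-(c * v ^ 2))) := by
    simpa using integrable_pow_mul_exp hc 0
  let I : ℝ := ∫ v : ℝ, Real.exp (-(c * v ^ 2))
  refine ⟨B * (Real.exp (c * δ ^ 2) * C₁ * I) + B', fun k hk q hq => ?_⟩
  have hk0 : 0 < k := by linarith
  set f : ℝ → ℂ := fun v => Complex.exp (-((k : ℂ) * (v : ℂ) ^ 2 * W' (q, v))) * b (q, v) with hf
  set h : ℝ := k ^ (-(1 / 2) : ℝ) with hh
  have hhpos : 0 < h := Real.rpow_pos_of_pos hk0 _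
  have hh2 : h ^ 2 = k⁻¹ := by
    rw [hh, ← Real.rpow_natCast, ← Real.rpow_mul hk0.le]
    norm_num [Real.rpow_neg_one]
  have hh1 : h ≤ 1 := Real.rpow_le_one_of_one_le_of_nonpos hk (by norm_num)
  have hfb : ∀ v, ‖f v‖ ≤ B * Real.exp (-(k * (c * v ^ 2))) := fun v => by
    rw [hf]
    simp only [norm_mul]
    rw [mul_comm]
    gcongr
    · exact hB _
    · exact norm_exp_phase_le (hWc _) hk0.le v
  have hfc : Continuous f := by
    have := hWs.continuous
    have := hb.continuous
    fun_prop
  have hfi : MeasureTheory.Integrable f := by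
    refine (hgi.const_mul B).mono' hfc.aestronglyMeasurable (MeasureTheory.ae_of_all _ fun v => ?_)
    refine (hfb v).trans (mul_le_mul_of_nonneg_left (Real.exp_le_exp.2 ?_) hB0)
    nlinarith [mul_nonneg hc.le (sq_nonneg v)]
  have e1 : ∫ v in (-δ)..δ, Complex.exp (-((k : ℂ) * (v : ℂ) ^ 2 * W (q, v))) * a (q, v)
      = ∫ v in (-δ)..δ, f v := by
    refine intervalIntegral.integral_congr fun v hv => ?_
    rw [uIcc_of_le (by linarith)] at hv
    have hm : (q, v) ∈ Icc x y ×ˢ Icc (-δ) δ := ⟨hq, hv⟩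
    simp only [hf]
    rw [hWW hm, hba (hKO₁ hm)]
  -- the substitution `v = h t` with `h = k ^ (-1 / 2)`
  have e2 : ∫ v, f v = h * ∫ t, gaussIntegrand W' 0 b (q, h) t :=
    integral_gaussian_rescale b q hhpos (by rw [hh2, mul_inv_cancel₀ hk0.ne'])
  -- the integral outside of `[-δ, δ]` is exponentially small
  have e3 : ‖(∫ v in (-δ)..δ, f v) - ∫ v, f v‖ ≤
      B * (Real.exp (c * δ ^ 2) * C₁ * I) * k ^ (-(1 / 2) - (L : ℝ)) := by
    rw [intervalIntegral.integral_of_le (by linarith),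
      ← MeasureTheory.integral_add_compl (measurableSet_Ioc (a := -δ) (b := δ)) hfi, sub_add_cancel_left,
      norm_neg]
    have hle : ∀ v ∈ (Ioc (-δ) δ)ᶜ, ‖f v‖ ≤
        B * (Real.exp (c * δ ^ 2) * Real.exp (-(c * δ ^ 2 * k))) * Real.exp (-(c * v ^ 2)) := by
      intro v hv
      have hv2 : δ ^ 2 ≤ v ^ 2 := by
        rw [mem_compl_iff, mem_Ioc, not_and_or, not_lt, not_le] at hv
        rcases hv with hv | hv <;> nlinarith
      refine (hfb v).trans ?_
      rw [mul_assoc, ← Real.exp_add, ← Real.exp_add]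
      gcongr
      nlinarith [mul_nonneg (mul_nonneg hc.le (sub_nonneg.2 hk)) (sub_nonneg.2 hv2)]
    have hgi' := hgi.const_mul (B * (Real.exp (c * δ ^ 2) * Real.exp (-(c * δ ^ 2 * k))))
    refine (MeasureTheory.norm_integral_le_of_norm_le hgi'.integrableOn
      ((MeasureTheory.ae_restrict_iff' measurableSet_Ioc.compl).2
        (MeasureTheory.ae_of_all _ hle))).trans ?_
    refine (MeasureTheory.setIntegral_le_integral hgi'
      (MeasureTheory.ae_of_all _ fun v => by positivity)).trans ?_
    rw [MeasureTheory.integral_const_mul]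
    have hI : 0 ≤ I := MeasureTheory.integral_nonneg fun v => (Real.exp_pos _).le
    have := hC₁ k hk
    rw [neg_add] at this
    calc _ ≤ B * (Real.exp (c * δ ^ 2) * (C₁ * k ^ (-(1 / 2) - (L : ℝ)))) * I := by
          gcongr
          simpa [sub_eq_add_neg] using this
      _ = _ := by ring
  -- Taylor expansion in powers of `h ^ 2 = k⁻¹`
  have e4 : ‖(∫ v, f v) - (h : ℂ) * ∑ j ∈ Finset.range L, ((k : ℂ) ^ j)⁻¹ * S j (q, 0)‖
      ≤ B' * k ^ (-(1 / 2) - (L : ℝ)) := by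
    have hh2' : (h : ℂ) ^ 2 = (k : ℂ)⁻¹ := by exact_mod_cast hh2
    rw [e2, hST L q h, ← mul_sub, norm_mul, hh2']
    simp only [inv_pow, add_sub_cancel_left]
    rw [norm_mul, norm_inv, norm_pow, Complex.norm_real, Complex.norm_real,
      Real.norm_of_nonneg hhpos.le, Real.norm_of_nonneg hk0.le]
    have := hB' (q, h) ⟨hq, hhpos.le, hh1⟩
    rw [sub_eq_add_neg, Real.rpow_add hk0, Real.rpow_neg hk0.le (L : ℝ), Real.rpow_natCast]
    calc _ ≤ h * ((k ^ L)⁻¹ * B') := by gcongr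
      _ = _ := by ring
  rw [e1, add_mul]
  refine (norm_sub_le_norm_sub_add_norm_sub _ (∫ v, f v) _).trans (add_le_add e3 e4)

/-- Laplace's method for an amplitude which itself has an expansion in powers of `k⁻¹`. -/
theorem laplace_expansion_of_amplitude_expansion {x y δ c : ℝ} (hδ : 0 < δ) (hc : 0 ≤ c)
    {W : ℝ × ℝ → ℂ} (hW : ContinuousOn W (Icc x y ×ˢ Icc (-δ) δ))
    (hpos : ∀ z ∈ Icc x y ×ˢ Icc (-δ) δ, c ≤ (W z).re)
    {a : ℕ → ℝ × ℝ → ℂ} (ha : ∀ l, ContinuousOn (a l) (Icc x y ×ˢ Icc (-δ) δ))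
    {P : ℕ → ℕ → ℝ → ℂ}
    (hP : ∀ l L : ℕ, ∃ C : ℝ, ∀ k : ℝ, 1 ≤ k → ∀ q ∈ Icc x y,
        ‖(∫ v in (-δ)..δ, Complex.exp (-((k : ℂ) * (v : ℂ) ^ 2 * W (q, v))) * a l (q, v))
          - ((k ^ (-(1 / 2) : ℝ) : ℝ) : ℂ) * ∑ j ∈ Finset.range L, ((k : ℂ) ^ j)⁻¹ * P l j q‖
        ≤ C * k ^ (-(1 / 2) - (L : ℝ)))
    {f : ℕ+ → ℝ × ℝ → ℂ} (hfc : ∀ k, ContinuousOn (f k) (Icc x y ×ˢ Icc (-δ) δ))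
    (hf : ∀ L : ℕ, ∃ C : ℝ, ∀ k : ℕ+, ∀ z ∈ Icc x y ×ˢ Icc (-δ) δ,
      ‖f k z - ∑ l ∈ Finset.range L, ((k : ℂ) ^ l)⁻¹ * a l z‖ ≤ C * (k : ℝ) ^ (-(L : ℝ))) (L : ℕ) :
    ∃ C : ℝ, ∀ k : ℕ+, ∀ q ∈ Icc x y,
      ‖(∫ v in (-δ)..δ, Complex.exp (-((k : ℂ) * (v : ℂ) ^ 2 * W (q, v))) * f k (q, v))
        - (((k : ℝ) ^ (-(1 / 2) : ℝ) : ℝ) : ℂ) * ∑ n ∈ Finset.range L, ((k : ℂ) ^ n)⁻¹ *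
            ∑ i ∈ Finset.range (n + 1), P i (n - i) q‖
      ≤ C * (k : ℝ) ^ (-(1 / 2) - (L : ℝ)) := by
  obtain ⟨C₀, hC₀⟩ := hf (L + 1)
  choose C hC using fun l => hP l (L - l)
  refine ⟨|C₀| * (2 * δ) + ∑ l ∈ Finset.range (L + 1), C l, fun k q hq => ?_⟩
  have hk : (1 : ℝ) ≤ (k : ℝ) := Nat.one_le_cast.2 k.pos
  have hk0 : (0 : ℝ) < k := by linarith
  set E : ℝ → ℂ := fun v => Complex.exp (-((k : ℂ) * (v : ℂ) ^ 2 * W (q, v))) with hE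
  have hmem : ∀ v ∈ Icc (-δ) δ, (q, v) ∈ Icc x y ×ˢ Icc (-δ) δ := fun v hv => ⟨hq, hv⟩
  have hle : -δ ≤ δ := by linarith
  have slice : ∀ {g : ℝ × ℝ → ℂ}, ContinuousOn g (Icc x y ×ˢ Icc (-δ) δ) →
      ContinuousOn (fun v => g (q, v)) (Icc (-δ) δ) := fun hg =>
    hg.comp (by fun_prop) hmem
  have hEc : ContinuousOn E (Icc (-δ) δ) := by
    have := slice hW
    refine ContinuousOn.cexp (ContinuousOn.neg (ContinuousOn.mul ?_ this))
    fun_prop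
  have hint : ∀ {g : ℝ × ℝ → ℂ}, ContinuousOn g (Icc x y ×ˢ Icc (-δ) δ) →
      IntervalIntegrable (fun v => E v * g (q, v)) MeasureTheory.volume (-δ) δ := fun hg =>
    (hEc.mul (slice hg)).intervalIntegrable_of_Icc hle
  have hE1 : ∀ v ∈ Icc (-δ) δ, ‖E v‖ ≤ 1 := fun v hv => by
    have h1 := norm_exp_phase_le (c := c) (hpos _ (hmem v hv)) hk0.le v
    refine (h1.trans (Real.exp_le_one_iff.2 ?_))
    have := mul_nonneg hk0.le (mul_nonneg hc (sq_nonneg v))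
    linarith
  -- the amplitude is replaced by the partial sum of its expansion
  have e1 : ‖(∫ v in (-δ)..δ, E v * f k (q, v)) -
      ∑ l ∈ Finset.range (L + 1), ((k : ℂ) ^ l)⁻¹ * ∫ v in (-δ)..δ, E v * a l (q, v)‖
      ≤ |C₀| * (2 * δ) * (k : ℝ) ^ (-(1 / 2) - (L : ℝ)) := by
    have h1 : ∑ l ∈ Finset.range (L + 1), ((k : ℂ) ^ l)⁻¹ * ∫ v in (-δ)..δ, E v * a l (q, v)
        = ∫ v in (-δ)..δ, ∑ l ∈ Finset.range (L + 1), ((k : ℂ) ^ l)⁻¹ * (E v * a l (q, v)) := by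
      rw [intervalIntegral.integral_finsetSum fun l _ => (hint (ha l)).const_mul _]
      refine Finset.sum_congr rfl fun l _ => ?_
      rw [intervalIntegral.integral_const_mul]
    rw [h1, ← intervalIntegral.integral_sub (hint (hfc k))]
    · refine (intervalIntegral.norm_integral_le_of_norm_le_const
        (C := |C₀| * (k : ℝ) ^ (-(1 / 2) - (L : ℝ))) fun v hv => ?_).trans ?_
      · rw [uIoc_of_le hle] at hv
        have hv' := Ioc_subset_Icc_self hv
        have h2 : E v * f k (q, v) - ∑ l ∈ Finset.range (L + 1), ((k : ℂ) ^ l)⁻¹ * (E v * a l (q, v))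
            = E v * (f k (q, v) - ∑ l ∈ Finset.range (L + 1), ((k : ℂ) ^ l)⁻¹ * a l (q, v)) := by
          rw [mul_sub, Finset.mul_sum]
          congr 1
          refine Finset.sum_congr rfl fun l _ => by ring
        rw [h2, norm_mul]
        refine (mul_le_of_le_one_left (norm_nonneg _) (hE1 v hv')).trans ?_
        refine (hC₀ k (q, v) (hmem v hv')).trans ?_
        refine mul_le_mul (le_abs_self _) (Real.rpow_le_rpow_of_exponent_le hk ?_) (by positivity)
          (abs_nonneg _)
        push_cast
        linarith
      · rw [show δ - -δ = 2 * δ by ring, abs_of_pos (by linarith : 0 < 2 * δ)]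
        exact le_of_eq (by ring)
    · have h2 := IntervalIntegrable.sum (μ := MeasureTheory.volume) (a := -δ) (b := δ)
        (Finset.range (L + 1)) (f := fun l v => ((k : ℂ) ^ l)⁻¹ * (E v * a l (q, v)))
        fun l _ => (hint (ha l)).const_mul _
      simpa only [Finset.sum_fn] using h2
  -- the expansions of the terms are added and sorted by the powers of `k`
  have e2 : ‖(∑ l ∈ Finset.range (L + 1), ((k : ℂ) ^ l)⁻¹ * ∫ v in (-δ)..δ, E v * a l (q, v))
      - (((k : ℝ) ^ (-(1 / 2) : ℝ) : ℝ) : ℂ) * ∑ n ∈ Finset.range L, ((k : ℂ) ^ n)⁻¹ *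
            ∑ i ∈ Finset.range (n + 1), P i (n - i) q‖
      ≤ (∑ l ∈ Finset.range (L + 1), C l) * (k : ℝ) ^ (-(1 / 2) - (L : ℝ)) := by
    have h1 : ∑ n ∈ Finset.range L, ((k : ℂ) ^ n)⁻¹ * ∑ i ∈ Finset.range (n + 1), P i (n - i) q
        = ∑ l ∈ Finset.range (L + 1), ((k : ℂ) ^ l)⁻¹ *
          ∑ j ∈ Finset.range (L - l), ((k : ℂ) ^ j)⁻¹ * P l j q := by
      rw [Finset.sum_range_succ, Nat.sub_self, Finset.range_zero, Finset.sum_empty, mul_zero,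
        add_zero]
      have := Finset.sum_range_diag_flip L
        (fun i j => ((k : ℂ) ^ i)⁻¹ * (((k : ℂ) ^ j)⁻¹ * P i j q))
      simp only [Finset.mul_sum]
      rw [← this]
      refine Finset.sum_congr rfl fun n _ => Finset.sum_congr rfl fun i hi => ?_
      rw [Finset.mem_range] at hi
      rw [← mul_assoc, ← mul_inv, ← pow_add, Nat.add_sub_cancel' (by omega)]
    rw [h1, Finset.mul_sum, ← Finset.sum_sub_distrib, Finset.sum_mul]
    refine (norm_sum_le _ _).trans (Finset.sum_le_sum fun l hl => ?_)
    rw [Finset.mem_range] at hl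
    have h2 := hC l k hk q hq
    rw [mul_left_comm, ← mul_sub, norm_mul, norm_inv, norm_pow, Complex.norm_natCast]
    calc _ ≤ ((k : ℝ) ^ l)⁻¹ * (C l * (k : ℝ) ^ (-(1 / 2) - ((L - l : ℕ) : ℝ))) := by
          simp only [Complex.ofReal_natCast] at h2
          gcongr
      _ = _ := by
          rw [Nat.cast_sub (by omega), show (-(1 / 2) - ((L : ℝ) - l)) = (-(1 / 2) - L) + l by ring,
            Real.rpow_add hk0, Real.rpow_natCast]
          have := (pow_pos hk0 l).ne'
          field_simp
  rw [add_mul]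
  exact (norm_sub_le_norm_sub_add_norm_sub _ _ _).trans (add_le_add e1 e2)

end Laplace

/-! ### Fourier coefficients of approximately holomorphic functions -/

section Fourier

/-- Fourier inversion on `[a, a + 1]`, for coefficients taken against `e^{2πinx}`. -/
theorem hasSum_fourier_of_summable {f : ℝ → ℂ} {a : ℝ} (hf : ContinuousOn f (Icc a (a + 1)))
    (hper : f a = f (a + 1)) {c : ℤ → ℂ}
    (hc : ∀ n : ℤ, ∫ x in a..(a + 1), f x * Complex.exp (2 * Real.pi * Complex.I * n * x) = c n)
    (hs : Summable c) {x : ℝ} (hx : x ∈ Ico a (a + 1)) :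
    HasSum (fun n : ℤ => c n * Complex.exp (-(2 * Real.pi * Complex.I * n * x))) (f x) := by
  have : Fact (0 < (1 : ℝ)) := ⟨one_pos⟩
  let g : C(AddCircle (1 : ℝ), ℂ) := ⟨_, AddCircle.liftIco_continuous hper hf⟩
  have hg : ∀ n, fourierCoeff g n = c (-n) := by
    intro n
    rw [← hc]
    change fourierCoeff (AddCircle.liftIco 1 a f) n = _
    rw [fourierCoeff_liftIco_eq, fourierCoeffOn_eq_integral]
    simp only [add_sub_cancel_left, div_one, one_smul]
    refine intervalIntegral.integral_congr fun t _ => ?_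
    simp only [smul_eq_mul]
    rw [mul_comm]
    congr 1
    rw [fourier_coe_apply]
    congr 1
    push_cast
    ring
  have hs' : Summable (fourierCoeff g) := by
    simp only [funext hg]
    exact (Equiv.neg ℤ).summable_iff.2 hs
  have h := has_pointwise_sum_fourier_series_of_summable hs' (x : AddCircle (1 : ℝ))
  have hgx : g (x : AddCircle (1 : ℝ)) = f x := AddCircle.liftIco_coe_apply hx
  rw [hgx, ← (Equiv.neg ℤ).hasSum_iff] at h
  convert h using 2 with n
  simp only [Function.comp_apply, Equiv.neg_apply, hg, neg_neg, smul_eq_mul]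
  congr 1
  rw [fourier_coe_apply]
  congr 1
  push_cast
  ring

theorem hasSum_sq_fourier {f : ℝ → ℂ} {a : ℝ} (hf : ContinuousOn f (Icc a (a + 1))) {c : ℤ → ℂ}
    (hc : ∀ n : ℤ, ∫ x in a..(a + 1), f x * Complex.exp (2 * Real.pi * Complex.I * n * x) = c n) :
    HasSum (fun n : ℤ => ‖c n‖ ^ 2) (∫ x in a..(a + 1), ‖f x‖ ^ 2) := by
  have hab : a < a + 1 := by linarith
  have hL2 : MeasureTheory.MemLp f 2 (MeasureTheory.volume.restrict (Ioc a (a + 1))) := by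
    obtain ⟨C, hC⟩ := isCompact_Icc.exists_bound_of_continuousOn hf
    refine MeasureTheory.MemLp.of_bound
      ((hf.mono Ioc_subset_Icc_self).aestronglyMeasurable measurableSet_Ioc) C ?_
    exact (MeasureTheory.ae_restrict_iff' measurableSet_Ioc).2
      (MeasureTheory.ae_of_all _ fun x hx => hC x (Ioc_subset_Icc_self hx))
  have h := hasSum_sq_fourierCoeffOn hab hL2
  simp only [add_sub_cancel_left, inv_one, one_smul] at h
  rw [← (Equiv.neg ℤ).hasSum_iff] at h
  convert h using 2 with n
  simp only [Function.comp_apply, Equiv.neg_apply]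
  rw [← hc, fourierCoeffOn_eq_integral]
  simp only [add_sub_cancel_left, div_one, one_smul]
  congr 2
  refine intervalIntegral.integral_congr fun t _ => ?_
  simp only [smul_eq_mul]
  rw [mul_comm]
  congr 1
  rw [fourier_coe_apply]
  congr 1
  push_cast
  ring

/-- The total mass of the weights used to sum Fourier coefficients. -/
noncomputable def fourierWeight (n : ℤ) : ℝ := |(n : ℝ)| ^ (-(3 / 2) : ℝ) + if n = 0 then 1 else 0

theorem summable_fourierWeight : Summable fourierWeight :=
  (Real.summable_abs_int_rpow (by norm_num)).add
    (summable_of_hasFiniteSupport (Set.Finite.subset (Set.finite_singleton 0) fun n hn => by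
      by_contra h
      exact hn (if_neg h)))

/-- Interpolation between a uniform bound and a bound with quadratic decay. -/
theorem le_rpow_mul_fourierWeight {d a c : ℝ} {n : ℤ} (hd : 0 ≤ d) (hda : d ≤ a) (hc : 0 ≤ c)
    (hdc : (n : ℝ) ^ 2 * d ≤ c) :
    d ≤ a ^ (1 / 4 : ℝ) * (a + c) ^ (3 / 4 : ℝ) * fourierWeight n := by
  have ha : 0 ≤ a := hd.trans hda
  have hsplit : d = d ^ (1 / 4 : ℝ) * d ^ (3 / 4 : ℝ) := by
    rw [← Real.rpow_add_of_nonneg hd (by norm_num) (by norm_num)]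
    norm_num
  rcases eq_or_ne n 0 with rfl | hn
  · have h0 : fourierWeight 0 = 1 := by simp [fourierWeight, Real.zero_rpow]
    rw [h0, mul_one]
    calc d = d ^ (1 / 4 : ℝ) * d ^ (3 / 4 : ℝ) := hsplit
      _ ≤ a ^ (1 / 4 : ℝ) * (a + c) ^ (3 / 4 : ℝ) := by
        gcongr
        linarith
  · have hn' : 0 < |(n : ℝ)| := abs_pos.2 (by exact_mod_cast hn)
    have hw : fourierWeight n = |(n : ℝ)| ^ (-(3 / 2) : ℝ) := by simp [fourierWeight, hn]
    rw [hw]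
    have hdn : d ≤ (a + c) * |(n : ℝ)| ^ (-2 : ℝ) := by
      rw [Real.rpow_neg hn'.le, ← div_eq_mul_inv, le_div_iff₀ (by positivity)]
      have : |(n : ℝ)| ^ (2 : ℝ) = (n : ℝ) ^ 2 := by
        rw [← sq_abs, ← Real.rpow_natCast]
        norm_num
      rw [this]
      linarith
    calc d = d ^ (1 / 4 : ℝ) * d ^ (3 / 4 : ℝ) := hsplit
      _ ≤ a ^ (1 / 4 : ℝ) * ((a + c) * |(n : ℝ)| ^ (-2 : ℝ)) ^ (3 / 4 : ℝ) := by gcongr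
      _ = _ := by
        rw [Real.mul_rpow (by positivity) (by positivity), ← Real.rpow_mul hn'.le, ← mul_assoc]
        norm_num

/-- Decay of Fourier coefficients by two integrations by parts. -/
theorem sq_mul_norm_fourier_le {K K' K'' : ℝ → ℂ} (h1 : ∀ v, HasDerivAt K (K' v) v)
    (h2 : ∀ v, HasDerivAt K' (K'' v) v) (hc : Continuous K'') (b1 : K (1 / 2) = K (-(1 / 2)))
    (b2 : K' (1 / 2) = K' (-(1 / 2))) {M : ℝ} (hM : ∀ v ∈ Icc (-(1 / 2) : ℝ) (1 / 2), ‖K'' v‖ ≤ M)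
    (n : ℤ) :
    (n : ℝ) ^ 2 * ‖∫ v in (-(1 / 2) : ℝ)..(1 / 2),
      K v * Complex.exp (2 * Real.pi * Complex.I * n * v)‖ ≤ M := by
  set w : ℂ := 2 * Real.pi * Complex.I * n with hw
  set e : ℝ → ℂ := fun v => Complex.exp (w * v) with he
  have hed : ∀ v, HasDerivAt e (w * e v) v := fun v => by
    have := ((hasDerivAt_id (v : ℂ)).const_mul w).cexp.comp_ofReal
    simp only [id, mul_one] at this
    rw [mul_comm]
    exact this
  have hec : Continuous e := by fun_prop
  have hend : e (1 / 2) = e (-(1 / 2)) := by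
    simp only [he]
    rw [← sub_eq_zero, ← mul_left_inj' (Complex.exp_ne_zero (w * ((1 / 2 : ℝ) : ℂ))), sub_mul,
      ← Complex.exp_add, ← Complex.exp_add]
    have e1 : w * ((1 / 2 : ℝ) : ℂ) + w * ((1 / 2 : ℝ) : ℂ) = n * (2 * Real.pi * Complex.I) := by
      rw [hw]; push_cast; ring
    have e2 : w * ((-(1 / 2) : ℝ) : ℂ) + w * ((1 / 2 : ℝ) : ℂ) = 0 := by push_cast; ring
    rw [e1, e2, Complex.exp_int_mul_two_pi_mul_I, Complex.exp_zero]
    simp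
  have hK'c : Continuous K' := continuous_iff_continuousAt.2 fun v => (h2 v).continuousAt
  have step : ∀ {A A' : ℝ → ℂ}, (∀ v, HasDerivAt A (A' v) v) → Continuous A' →
      A (1 / 2) = A (-(1 / 2)) →
      w * ∫ v in (-(1 / 2) : ℝ)..(1 / 2), A v * e v
        = -∫ v in (-(1 / 2) : ℝ)..(1 / 2), A' v * e v := by
    intro A A' hA hA'c hA0
    have := intervalIntegral.integral_mul_deriv_eq_deriv_mul (a := -(1 / 2)) (b := 1 / 2)
      (fun v _ => hA v) (fun v _ => hed v) (hA'c.intervalIntegrable _ _)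
      ((continuous_const.mul hec).intervalIntegrable _ _)
    rw [hA0, hend, sub_self, zero_sub] at this
    rw [← this, ← intervalIntegral.integral_const_mul]
    refine intervalIntegral.integral_congr fun v _ => ?_
    ring
  have hint := (step h1 hK'c b1)
  have hint2 := (step h2 hc b2)
  have hkey : w ^ 2 * ∫ v in (-(1 / 2) : ℝ)..(1 / 2), K v * e v
      = ∫ v in (-(1 / 2) : ℝ)..(1 / 2), K'' v * e v := by
    rw [sq, mul_assoc, hint, mul_neg, hint2, neg_neg]
  have hb : ‖∫ v in (-(1 / 2) : ℝ)..(1 / 2), K'' v * e v‖ ≤ M := by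
    refine (intervalIntegral.norm_integral_le_of_norm_le_const (C := M) fun v hv => ?_).trans
      (by norm_num)
    rw [uIoc_of_le (by norm_num)] at hv
    rw [norm_mul]
    have : ‖e v‖ = 1 := by
      have h3 : w * v = ((2 * Real.pi * n * v : ℝ) : ℂ) * Complex.I := by
        rw [hw]; push_cast; ring
      simp only [he]
      rw [h3, Complex.norm_exp_ofReal_mul_I]
    rw [this, mul_one]
    exact hM v (Ioc_subset_Icc_self hv)
  rw [← hkey, norm_mul] at hb
  refine le_trans ?_ hb
  gcongr
  rw [norm_pow, hw]
  simp only [norm_mul, Complex.norm_I, Complex.norm_ofNat, Complex.norm_real, Complex.norm_intCast,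
    Real.norm_of_nonneg Real.pi_pos.le, mul_one]
  rw [mul_pow, sq_abs]
  have : (1 : ℝ) ≤ (2 * Real.pi) ^ 2 := by
    have := Real.pi_gt_three
    nlinarith
  nlinarith [sq_nonneg (n : ℝ)]

/-- The integral of `G(q, v) e^{-4πik(ψ(q) + v)(q - y)}` over a period in `v`. For `y = n / 2k`, this
is a Fourier coefficient of `G(q, ·)`, up to a factor. -/
noncomputable def fiberCoeff (ψ : ℝ → ℝ) (k : ℝ) (G : ℝ × ℝ → ℂ) (y q : ℝ) : ℂ :=
  ∫ v in (-(1 / 2) : ℝ)..(1 / 2),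
    G (q, v) * Complex.exp (-(4 * Real.pi * Complex.I * k * (ψ q + v) * (q - y)))

/-- The `∂̄`-operator in the coordinates `(q, v)` with `v = p - ψ(q)`. -/
noncomputable def dbarOp (ψ : ℝ → ℝ) (T : ℂ) (k : ℝ) (G : ℝ × ℝ → ℂ) (z : ℝ × ℝ) : ℂ :=
  pderiv (1, 0) G z - (deriv ψ z.1 + T) * pderiv (0, 1) G z
    - 4 * Real.pi * Complex.I * k * (ψ z.1 + z.2) * G z

/-- The fiber coefficients of an approximately holomorphic function solve a linear differential
equation up to a small error. -/
theorem hasDerivAt_fiberCoeff {ψ : ℝ → ℝ} (hψ : ContDiff ℝ ∞ ψ) {k : ℝ} (T : ℂ) {G : ℝ × ℝ → ℂ}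
    (hG : ContDiff ℝ ∞ G) {y : ℝ}
    (hend : ∀ q, G (q, 1 / 2) * Complex.exp (-(4 * Real.pi * Complex.I * k * (ψ q + (1 / 2 : ℝ)) * (q - y)))
      = G (q, -(1 / 2)) * Complex.exp (-(4 * Real.pi * Complex.I * k * (ψ q + (-(1 / 2) : ℝ)) * (q - y))))
    (q : ℝ) :
    HasDerivAt (fiberCoeff ψ k G y)
      (4 * Real.pi * Complex.I * k * T * (q - y) * fiberCoeff ψ k G y q
        + fiberCoeff ψ k (dbarOp ψ T k G) y q) q := by
  set e : ℝ → ℝ → ℂ := fun q v =>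
    Complex.exp (-(4 * Real.pi * Complex.I * k * (ψ q + v) * (q - y))) with he
  have hψd : ∀ q, HasDerivAt ψ (deriv ψ q) q := fun q => (hψ.differentiable (by simp) q).hasDerivAt
  have hψc := hψ.continuous
  have hψ'c : Continuous (deriv ψ) := hψ.continuous_deriv (by simp)
  have heq : ∀ q v, HasDerivAt (fun q => e q v)
      (-(4 * Real.pi * Complex.I * k) * (deriv ψ q * (q - y) + (ψ q + v)) * e q v) q := by
    intro q v
    have h1 : HasDerivAt (fun q : ℝ => ((ψ q : ℝ) : ℂ) + v) ((deriv ψ q : ℝ) : ℂ) q :=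
      (hψd q).ofReal_comp.add_const _
    have h2 : HasDerivAt (fun q : ℝ => (q : ℂ) - y) 1 q := by
      simpa using ((hasDerivAt_id q).ofReal_comp).sub_const (y : ℂ)
    have h3 := ((h1.const_mul (4 * Real.pi * Complex.I * k)).mul h2).neg.cexp
    refine h3.congr_deriv ?_
    simp only [he, Pi.neg_apply, Pi.mul_apply]
    ring
  have hev : ∀ q v, HasDerivAt (fun v => e q v)
      (-(4 * Real.pi * Complex.I * k * (q - y)) * e q v) v := by
    intro q v
    have h1 : HasDerivAt (fun v : ℝ => ((ψ q : ℝ) : ℂ) + v) 1 v := by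
      simpa using ((hasDerivAt_id v).ofReal_comp).const_add ((ψ q : ℝ) : ℂ)
    have h3 := ((h1.const_mul (4 * Real.pi * Complex.I * k)).mul_const ((q : ℂ) - y)).neg.cexp
    refine h3.congr_deriv ?_
    simp only [he, Pi.neg_apply]
    ring
  have hGq : ∀ q v, HasDerivAt (fun q => G (q, v)) (pderiv (1, 0) G (q, v)) q := fun q v =>
    (hG.differentiable (by simp) (q, v)).hasFDerivAt.comp_hasDerivAt q
      ((hasDerivAt_id q).prodMk (hasDerivAt_const q v))
  have hGv : ∀ q v, HasDerivAt (fun v => G (q, v)) (pderiv (0, 1) G (q, v)) v := fun q v =>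
    (hG.differentiable (by simp) (q, v)).hasFDerivAt.comp_hasDerivAt v
      ((hasDerivAt_const v q).prodMk (hasDerivAt_id v))
  have hGc := hG.continuous
  have hG1 := (contDiff_pderiv hG (1, 0)).continuous
  have hG2 := (contDiff_pderiv hG (0, 1)).continuous
  let D : ℝ → ℝ → ℂ := fun q v => pderiv (1, 0) G (q, v) * e q v +
    G (q, v) * (-(4 * Real.pi * Complex.I * k) * (deriv ψ q * (q - y) + (ψ q + v)) * e q v)
  have hDc : Continuous (Function.uncurry D) := by
    simp only [D, he, Function.uncurry_def]
    fun_prop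
  obtain ⟨C, hC⟩ := ((isCompact_closedBall q 1).prod isCompact_Icc).exists_bound_of_continuousOn
    (s := Metric.closedBall q 1 ×ˢ Icc (-(1 / 2) : ℝ) (1 / 2)) hDc.continuousOn
  have hcont : ∀ q, Continuous fun v => G (q, v) * e q v := fun q => by
    simp only [he]
    fun_prop
  have hD : HasDerivAt (fiberCoeff ψ k G y) (∫ v in (-(1 / 2) : ℝ)..(1 / 2), D q v) q := by
    refine (intervalIntegral.hasDerivAt_integral_of_dominated_loc_of_deriv_le
      (F := fun q v => G (q, v) * e q v) (F' := D) (bound := fun _ => C)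
      (Metric.closedBall_mem_nhds q one_pos)
      (Eventually.of_forall fun s => (hcont s).aestronglyMeasurable)
      ((hcont q).intervalIntegrable _ _)
      (hDc.comp (by fun_prop : Continuous fun v : ℝ => (q, v))).aestronglyMeasurable
      (MeasureTheory.ae_of_all _ fun v hv s hs => hC (s, v) ⟨hs, ?_⟩) (by simp)
      (MeasureTheory.ae_of_all _ fun v _ s _ => (hGq s v).mul (heq s v))).2
    rw [uIoc_of_le (by norm_num)] at hv
    exact Ioc_subset_Icc_self hv
  refine hD.congr_deriv ?_
  -- integration by parts in `v`
  have hparts := intervalIntegral.integral_mul_deriv_eq_deriv_mul (a := -(1 / 2)) (b := 1 / 2)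
    (fun v _ => hGv q v) (fun v _ => hev q v)
    ((hG2.comp (by fun_prop : Continuous fun v : ℝ => (q, v))).intervalIntegrable _ _)
    ((by simp only [he]; fun_prop : Continuous fun v =>
      -(4 * Real.pi * Complex.I * k * (q - y)) * e q v).intervalIntegrable _ _)
  have hend' : G (q, 1 / 2) * e q (1 / 2) = G (q, -(1 / 2)) * e q (-(1 / 2)) := by
    simp only [he]
    exact hend q
  rw [hend', sub_self, zero_sub] at hparts
  have hI1 : IntervalIntegrable (fun v => G (q, v) * e q v) MeasureTheory.volume
    (-(1 / 2) : ℝ) (1 / 2) := (hcont q).intervalIntegrable _ _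
  have hI2 : IntervalIntegrable (fun v => pderiv (0, 1) G (q, v) * e q v) MeasureTheory.volume
    (-(1 / 2) : ℝ) (1 / 2) :=
    (by simp only [he]; fun_prop : Continuous fun v => pderiv (0, 1) G (q, v) * e q v).intervalIntegrable _ _
  have hI3 : IntervalIntegrable (fun v => dbarOp ψ T k G (q, v) * e q v) MeasureTheory.volume
    (-(1 / 2) : ℝ) (1 / 2) :=
    (by simp only [he, dbarOp]; fun_prop :
      Continuous fun v => dbarOp ψ T k G (q, v) * e q v).intervalIntegrable _ _
  have hDeq : ∫ v in (-(1 / 2) : ℝ)..(1 / 2), D q v = (∫ v in (-(1 / 2) : ℝ)..(1 / 2),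
      dbarOp ψ T k G (q, v) * e q v) + (deriv ψ q + T) * (∫ v in (-(1 / 2) : ℝ)..(1 / 2),
        pderiv (0, 1) G (q, v) * e q v) - 4 * Real.pi * Complex.I * k * deriv ψ q * (q - y) *
        ∫ v in (-(1 / 2) : ℝ)..(1 / 2), G (q, v) * e q v := by
    rw [← intervalIntegral.integral_const_mul, ← intervalIntegral.integral_const_mul,
      ← intervalIntegral.integral_add hI3 (hI2.const_mul _),
      ← intervalIntegral.integral_sub (hI3.add (hI2.const_mul _)) (hI1.const_mul _)]
    refine intervalIntegral.integral_congr fun v _ => ?_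
    simp only [D, dbarOp]
    ring
  have hparts' : ∫ v in (-(1 / 2) : ℝ)..(1 / 2), pderiv (0, 1) G (q, v) * e q v
      = 4 * Real.pi * Complex.I * k * (q - y) * ∫ v in (-(1 / 2) : ℝ)..(1 / 2), G (q, v) * e q v := by
    rw [← neg_inj, ← hparts, ← intervalIntegral.integral_const_mul, ← intervalIntegral.integral_neg]
    refine intervalIntegral.integral_congr fun v _ => ?_
    ring
  rw [hDeq, hparts']
  change _ = 4 * Real.pi * Complex.I * k * T * (q - y) * (∫ v in (-(1 / 2) : ℝ)..(1 / 2),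
    G (q, v) * e q v) + ∫ v in (-(1 / 2) : ℝ)..(1 / 2), dbarOp ψ T k G (q, v) * e q v
  ring

/-- The solutions of `b' = 4πikT(q - y) b + r` propagate like `e^{2πikT(q - y)²}`; the error
is not amplified when moving away from `y`. -/
theorem norm_sub_propagator_mul_le {b r : ℝ → ℂ} {T : ℂ} {k y ε q q' : ℝ} (hk : 0 ≤ k) (hT : 0 ≤ T.im)
    (hb : ∀ s ∈ uIcc q q', HasDerivAt b (4 * Real.pi * Complex.I * k * T * (s - y) * b s + r s) s)
    (hr : ∀ s ∈ uIcc q q', ‖r s‖ ≤ ε) (hs : ∀ s ∈ uIcc q q', |s - y| ≤ |q - y|) :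
    ‖b q - Complex.exp (2 * Real.pi * Complex.I * k * T * (((q - y) ^ 2 - (q' - y) ^ 2 : ℝ) : ℂ)) * b q'‖
      ≤ ε * |q - q'| := by
  set E : ℝ → ℂ := fun s =>
    Complex.exp (2 * Real.pi * Complex.I * k * T * (((q - y) ^ 2 - (s - y) ^ 2 : ℝ) : ℂ)) with hE
  have hEd : ∀ s, HasDerivAt E (-(4 * Real.pi * Complex.I * k * T * (s - y)) * E s) s := by
    intro s
    have h1 : HasDerivAt (fun s : ℝ => (q - y) ^ 2 - (s - y) ^ 2) (-(2 * (s - y))) s := by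
      simpa using (((hasDerivAt_id s).sub_const y).pow 2).const_sub ((q - y) ^ 2)
    have h2 := (h1.ofReal_comp.const_mul (2 * Real.pi * Complex.I * k * T)).cexp
    refine h2.congr_deriv ?_
    simp only [hE]
    push_cast
    ring
  -- the propagator from `s` to `q` is bounded by `1`, as `s` is closer to `y` than `q`
  have hEn : ∀ s ∈ uIcc q q', ‖E s‖ ≤ 1 := by
    intro s hsm
    simp only [hE]
    rw [Complex.norm_exp, Complex.re_mul_ofReal]
    have h1 : (2 * Real.pi * Complex.I * k * T).re = -(2 * Real.pi * k * T.im) := by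
      have : (2 * Real.pi * Complex.I * k * T) = ((2 * Real.pi * k : ℝ) : ℂ) * (Complex.I * T) := by
        push_cast; ring
      rw [this, Complex.re_ofReal_mul, Complex.I_mul_re]
      ring
    rw [h1]
    refine Real.exp_le_one_iff.2 ?_
    have h2 : 0 ≤ (q - y) ^ 2 - (s - y) ^ 2 := by
      have := sq_le_sq' (by linarith [abs_nonneg (s - y), abs_nonneg (q - y), hs s hsm]) (hs s hsm)
      rw [sq_abs, sq_abs] at this
      linarith
    have h3 : 0 ≤ 2 * Real.pi * k * T.im := by have := Real.pi_pos; positivity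
    nlinarith [mul_nonneg h3 h2]
  have hF : ∀ s ∈ uIcc q q', HasDerivWithinAt (fun s => E s * b s) (E s * r s) (uIcc q q') s := by
    intro s hsm
    refine ((hEd s).mul (hb s hsm)).hasDerivWithinAt.congr_deriv ?_
    ring
  have hFb : ∀ s ∈ uIcc q q', ‖E s * r s‖ ≤ ε := fun s hsm => by
    rw [norm_mul]
    exact (mul_le_of_le_one_left (norm_nonneg _) (hEn s hsm)).trans (hr s hsm)
  have := (convex_uIcc q q').norm_image_sub_le_of_norm_hasDerivWithin_le hF hFb
    right_mem_uIcc left_mem_uIcc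
  have hEq : E q = 1 := by simp [hE]
  simp only [hEq, one_mul] at this
  rwa [Real.norm_eq_abs] at this

end Fourier

/-! ### Coordinates on the torus and on the half-form line -/

namespace QuantumTorus

variable {E : Type*} [NormedAddCommGroup E] [NormedSpace ℝ E] (D : QuantumTorus E)

/-- The point `p μ + q lam` of `E`. -/
def pt (p q : ℝ) : E := p • D.μ + q • D.lam

theorem finiteDimensional (D : QuantumTorus E) : FiniteDimensional ℝ E :=
  Module.finite_of_finrank_pos (by rw [D.finrank_eq]; norm_num)

theorem om_swap (x y : E) : D.om x y = -D.om y x := by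
  have h := D.alt (x + y)
  simp only [map_add, LinearMap.add_apply, D.alt, zero_add, add_zero] at h
  linarith

theorem om_pt_pt (p q p' q' : ℝ) : D.om (D.pt p q) (D.pt p' q') = 4 * Real.pi * (p * q' - q * p') := by
  have h1 := D.om_basis
  have h2 : D.om D.lam D.μ = -(4 * Real.pi) := by rw [om_swap, h1]
  simp only [pt, map_add, map_smul, LinearMap.add_apply, LinearMap.smul_apply, D.alt, h1, h2, smul_eq_mul]
  ring

theorem pt_one_zero : D.pt 1 0 = D.μ := by simp [pt]

theorem pt_zero_one : D.pt 0 1 = D.lam := by simp [pt]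

@[simp] theorem pCoord_pt (p q : ℝ) : D.pCoord (D.pt p q) = p := by
  rw [pCoord, ← pt_zero_one, om_pt_pt]
  have := Real.pi_pos
  field_simp
  ring

@[simp] theorem qCoord_pt (p q : ℝ) : D.qCoord (D.pt p q) = q := by
  rw [qCoord, ← pt_one_zero, om_pt_pt]
  have := Real.pi_pos
  field_simp
  ring

theorem pt_coords (x : E) : D.pt (D.pCoord x) (D.qCoord x) = x := by
  have := D.finiteDimensional
  have hli : LinearIndependent ℝ ![D.μ, D.lam] := by
    rw [LinearIndependent.pair_iff]
    intro s t hst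
    have h1 : D.pt s t = D.pt 0 0 := by simp only [pt, hst]; simp
    exact ⟨by simpa using congrArg D.pCoord h1, by simpa using congrArg D.qCoord h1⟩
  have hspan := hli.span_eq_top_of_card_eq_finrank (by simp [D.finrank_eq])
  have hx : x ∈ Submodule.span ℝ (range ![D.μ, D.lam]) := by rw [hspan]; trivial
  rw [Matrix.range_cons, Matrix.range_cons, Matrix.range_empty, union_empty, singleton_union,
    Submodule.mem_span_pair] at hx
  obtain ⟨a, b, rfl⟩ := hx
  change D.pt (D.pCoord (D.pt a b)) (D.qCoord (D.pt a b)) = D.pt a b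
  simp

theorem om_eq_coords (x y : E) :
    D.om x y = 4 * Real.pi * (D.pCoord x * D.qCoord y - D.qCoord x * D.pCoord y) := by
  conv_lhs => rw [← D.pt_coords x, ← D.pt_coords y, om_pt_pt]

theorem pt_add (p q p' q' : ℝ) : D.pt p q + D.pt p' q' = D.pt (p + p') (q + q') := by
  simp only [pt, add_smul]
  abel

/-- The coordinate `p` as a continuous linear form. -/
noncomputable def pL : E →L[ℝ] ℝ :=
  haveI := D.finiteDimensional
  LinearMap.toContinuousLinearMap
    { toFun := D.pCoord
      map_add' := fun x y => by simp [pCoord, add_div]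
      map_smul' := fun c x => by simp [pCoord, mul_div_assoc] }

/-- The coordinate `q` as a continuous linear form. -/
noncomputable def qL : E →L[ℝ] ℝ :=
  haveI := D.finiteDimensional
  LinearMap.toContinuousLinearMap
    { toFun := D.qCoord
      map_add' := fun x y => by simp [qCoord, add_div]
      map_smul' := fun c x => by simp [qCoord, mul_div_assoc] }

theorem pL_apply (x : E) : D.pL x = D.pCoord x := rfl

theorem qL_apply (x : E) : D.qL x = D.qCoord x := rfl

theorem contDiff_pCoord {n : WithTop ℕ∞} : ContDiff ℝ n D.pCoord := D.pL.contDiff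

theorem contDiff_qCoord {n : WithTop ℕ∞} : ContDiff ℝ n D.qCoord := D.qL.contDiff

theorem contDiff_pt {n : WithTop ℕ∞} : ContDiff ℝ n (fun z : ℝ × ℝ => D.pt z.1 z.2) := by
  unfold pt
  fun_prop

theorem pCoord_add (x y : E) : D.pCoord (x + y) = D.pCoord x + D.pCoord y := D.pL.map_add x y

theorem qCoord_add (x y : E) : D.qCoord (x + y) = D.qCoord x + D.qCoord y := D.qL.map_add x y

theorem pCoord_sub (x y : E) : D.pCoord (x - y) = D.pCoord x - D.pCoord y := D.pL.map_sub x y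

theorem qCoord_sub (x y : E) : D.qCoord (x - y) = D.qCoord x - D.qCoord y := D.qL.map_sub x y

theorem ext_coords {x y : E} (hp : D.pCoord x = D.pCoord y) (hq : D.qCoord x = D.qCoord y) :
    x = y := by
  rw [← D.pt_coords x, ← D.pt_coords y, hp, hq]

theorem mem_R_iff {x : E} : x ∈ D.R ↔ ∃ m n : ℤ, x = D.pt m n := by
  rw [R, AddSubgroup.mem_closure_pair]
  refine exists_congr fun m => exists_congr fun n => ?_
  rw [pt, Int.cast_smul_eq_zsmul, Int.cast_smul_eq_zsmul]
  exact eq_comm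

theorem proj_eq_proj_iff {x y : E} : D.proj x = D.proj y ↔ ∃ m n : ℤ, y = x + D.pt m n := by
  rw [proj, proj, QuotientAddGroup.eq, mem_R_iff]
  refine exists_congr fun m => exists_congr fun n => ?_
  rw [neg_add_eq_iff_eq_add]

theorem continuous_proj : Continuous D.proj := QuotientAddGroup.continuous_mk

theorem isOpenMap_proj : IsOpenMap D.proj := QuotientAddGroup.isOpenMap_coe

end QuantumTorus

namespace HalfFormLine

variable {E : Type*} [NormedAddCommGroup E] [NormedSpace ℝ E] {D : QuantumTorus E}
  {δ : Type*} [NormedAddCommGroup δ] [InnerProductSpace ℂ δ] (h : HalfFormLine D δ) {Ω : δ}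

/-- The modulus `T` of the torus: `Ω ^ 2 = dp + T dq` when `Ω ^ 2 (μ) = 1`. -/
noncomputable def modulus (Ω : δ) : ℂ := h.sq Ω D.lam

theorem sq_smul (c : ℂ) (u : δ) : h.sq (c • u) = c ^ 2 • h.sq u := by
  rw [sq, sq, TensorProduct.smul_tmul_smul, map_smul, pow_two]
  rfl

theorem sq_apply (hΩ : h.sq Ω D.μ = 1) (x : E) :
    h.sq Ω x = D.pCoord x + h.modulus Ω * D.qCoord x := by
  conv_lhs => rw [← D.pt_coords x, QuantumTorus.pt, map_add, map_smul, map_smul, hΩ]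
  simp [modulus, mul_comm]

theorem sq_j (x : E) : h.sq Ω (D.j x) = Complex.I * h.sq Ω x :=
  (h.iso (Ω ⊗ₜ Ω)).2 x

/-- Unitarity of the isomorphism `δ ⊗ δ ≃ K_j`, evaluated at `Ω ⊗ Ω`. -/
theorem norm_pow_four (hΩ : h.sq Ω D.μ = 1) : ‖Ω‖ ^ 4 = (h.modulus Ω).im / (2 * Real.pi) := by
  have h1 := h.unitary Ω Ω
  rw [QuantumTorus.canonicalInner] at h1
  change _ = Complex.I * (h.sq Ω D.μ * star (h.sq Ω D.lam) - h.sq Ω D.lam * star (h.sq Ω D.μ)) / _ at h1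
  rw [hΩ, D.om_basis, star_one, one_mul, mul_one] at h1
  have h2 := congrArg Complex.re h1
  rw [Complex.ofReal_re] at h2
  have h3 : ((h.sq Ω D.lam).im : ℂ) = (h.sq Ω D.lam - star (h.sq Ω D.lam)) / (2 * Complex.I) :=
    Complex.im_eq_sub_conj _
  have h4 : Complex.I * (star (h.sq Ω D.lam) - h.sq Ω D.lam) / ((4 * Real.pi : ℝ) : ℂ)
      = (((h.sq Ω D.lam).im / (2 * Real.pi) : ℝ) : ℂ) := by
    push_cast
    rw [h3]
    have := Real.pi_pos.ne'
    have h5 : (Real.pi : ℂ) ≠ 0 := by exact_mod_cast this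
    field_simp
    rw [Complex.I_sq]
    ring
  rw [h4, Complex.ofReal_re] at h2
  rw [modulus, ← h2]
  ring

theorem ne_zero_of_sq (hΩ : h.sq Ω D.μ = 1) : Ω ≠ 0 := by
  rintro rfl
  rw [show (0 : δ) = (0 : ℂ) • (0 : δ) by simp, sq_smul] at hΩ
  simp at hΩ

theorem modulus_im_pos (hΩ : h.sq Ω D.μ = 1) : 0 < (h.modulus Ω).im := by
  have h1 := h.norm_pow_four hΩ
  have h2 : 0 < ‖Ω‖ ^ 4 := pow_pos (norm_pos_iff.2 (h.ne_zero_of_sq hΩ)) 4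
  rw [h1] at h2
  have := Real.pi_pos
  exact (div_pos_iff_of_pos_right (by positivity)).1 h2

/-- The linear coordinate of `δ` with respect to `Ω`. -/
noncomputable def coordL (Ω : δ) : δ →L[ℂ] ℂ := ((‖Ω‖ : ℂ) ^ 2)⁻¹ • innerSL ℂ Ω

theorem coordL_smul (hΩ : Ω ≠ 0) (c : ℂ) : coordL Ω (c • Ω) = c := by
  have : (‖Ω‖ : ℂ) ≠ 0 := by exact_mod_cast norm_ne_zero_iff.2 hΩ
  rw [coordL, smul_apply, innerSL_apply_apply, inner_smul_right, inner_self_eq_norm_sq_to_K,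
    smul_eq_mul]
  simp only [Complex.coe_algebraMap]
  field_simp

/-- The half-form line has dimension one. -/
theorem coordL_apply_smul (hΩ : h.sq Ω D.μ = 1) (u : δ) : coordL Ω u • Ω = u := by
  have hΩ0 := h.ne_zero_of_sq hΩ
  obtain ⟨c, hc⟩ : ∃ c : ℂ, u = c • Ω := by
    refine ⟨(h.iso (u ⊗ₜ Ω)).1 D.μ, ?_⟩
    set c := (h.iso (u ⊗ₜ Ω)).1 D.μ
    have h1 := h.unitary (u - c • Ω) Ω
    set a := (h.iso ((u - c • Ω) ⊗ₜ Ω)) with ha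
    have haμ : a.1 D.μ = 0 := by
      rw [ha, TensorProduct.sub_tmul, ← TensorProduct.smul_tmul', map_sub, map_smul]
      change c - c • (h.sq Ω D.μ) = 0
      rw [hΩ]
      simp
    have h2 : ((‖u - c • Ω‖ * ‖Ω‖) ^ 2 : ℝ) = 0 := by
      rw [QuantumTorus.canonicalInner, haμ] at h1
      simpa using h1
    have h3 := pow_eq_zero_iff (two_ne_zero) |>.1 h2
    rcases mul_eq_zero.1 h3 with h4 | h4
    · exact sub_eq_zero.1 (norm_eq_zero.1 h4)
    · exact absurd (norm_eq_zero.1 h4) hΩ0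
  rw [hc, coordL_smul hΩ0]

theorem norm_eq_coordL (hΩ : h.sq Ω D.μ = 1) (u : δ) : ‖u‖ = ‖coordL Ω u‖ * ‖Ω‖ := by
  conv_lhs => rw [← h.coordL_apply_smul hΩ u, norm_smul]

/-! ### The `∂̄`-operator in coordinates -/

/-- The `∂̄`-operator of `L_E ^ k` in the trivialization `e^{-2iπkpq}` and in coordinates
`(q, p - ψ(q))`. -/
theorem dbar_eq_dbarOp (hΩ : h.sq Ω D.μ = 1) {k : ℕ} {u : E → ℂ} {x : E} {ψ : ℝ → ℝ}
    {G : ℝ × ℝ → ℂ} (hψ : DifferentiableAt ℝ ψ (D.qCoord x))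
    (hG : DifferentiableAt ℝ G (D.qCoord x, D.pCoord x - ψ (D.qCoord x)))
    (hu : u =ᶠ[𝓝 x] fun y => Complex.exp (-(2 * Real.pi * Complex.I * k * D.pCoord y * D.qCoord y))
      * G (D.qCoord y, D.pCoord y - ψ (D.qCoord y))) (X : E) :
    D.dbar k u x X = star (h.sq Ω X) / (star (h.modulus Ω) - h.modulus Ω)
      * Complex.exp (-(2 * Real.pi * Complex.I * k * D.pCoord x * D.qCoord x))
      * dbarOp ψ (h.modulus Ω) k G (D.qCoord x, D.pCoord x - ψ (D.qCoord x)) := by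
  set z : ℝ × ℝ := (D.qCoord x, D.pCoord x - ψ (D.qCoord x)) with hz
  set e : ℂ := Complex.exp (-(2 * Real.pi * Complex.I * k * D.pCoord x * D.qCoord x)) with he
  have hp : HasFDerivAt D.pCoord D.pL x := D.pL.hasFDerivAt
  have hq : HasFDerivAt D.qCoord D.qL x := D.qL.hasFDerivAt
  have hpc : HasFDerivAt (fun y => (D.pCoord y : ℂ)) (Complex.ofRealCLM.comp D.pL) x :=
    Complex.ofRealCLM.hasFDerivAt.comp x hp
  have hqc : HasFDerivAt (fun y => (D.qCoord y : ℂ)) (Complex.ofRealCLM.comp D.qL) x :=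
    Complex.ofRealCLM.hasFDerivAt.comp x hq
  have hmap : HasFDerivAt (fun y => (D.qCoord y, D.pCoord y - ψ (D.qCoord y)))
      (D.qL.prod (D.pL - deriv ψ (D.qCoord x) • D.qL)) x :=
    hq.prodMk (hp.sub (hψ.hasDerivAt.comp_hasFDerivAt x hq))
  have hGc := HasFDerivAt.comp x (f := fun y => (D.qCoord y, D.pCoord y - ψ (D.qCoord y)))
    hG.hasFDerivAt hmap
  have hexp := ((hpc.const_mul (2 * Real.pi * Complex.I * k)).mul hqc).neg.cexp
  have hud := (hexp.mul hGc).congr_of_eventuallyEq hu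
  have hux : u x = e * G z := hu.self_of_nhds
  have hcov : ∀ Y : E, D.covDeriv k u x Y = e * (D.qCoord Y * (pderiv (1, 0) G z
      - deriv ψ (D.qCoord x) * pderiv (0, 1) G z - 4 * Real.pi * Complex.I * k * D.pCoord x * G z)
      + D.pCoord Y * pderiv (0, 1) G z) := by
    intro Y
    rw [QuantumTorus.covDeriv, hud.fderiv, hux, D.om_eq_coords]
    simp only [add_apply, smul_apply, neg_apply, ContinuousLinearMap.comp_apply, smul_eq_mul,
      Pi.mul_apply, Pi.neg_apply, fderiv_eq_pderiv, ContinuousLinearMap.prod_apply, sub_apply,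
      Complex.ofRealCLM_apply, D.pL_apply, D.qL_apply, Function.comp_apply, ← hz, ← he]
    push_cast
    ring
  have him := h.modulus_im_pos hΩ
  have hne : star (h.modulus Ω) - h.modulus Ω ≠ 0 := by
    intro h0
    have := congrArg Complex.im h0
    simp at this
    linarith
  -- `α(jX) = iα(X)` for `α = dp + T dq` determines the coordinates of `jX`
  have hj := h.sq_j (Ω := Ω) X
  rw [h.sq_apply hΩ, h.sq_apply hΩ] at hj
  have hj' := congrArg star hj
  rw [h.sq_apply hΩ]
  simp only [star_add, star_mul', Complex.star_def, Complex.conj_ofReal, Complex.conj_I] at hj' hne ⊢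
  set T := h.modulus Ω
  set T' := (starRingEnd ℂ) T
  have hQ : ((D.qCoord X : ℂ) + Complex.I * D.qCoord (D.j X)) * (T' - T)
      = 2 * (D.pCoord X + T' * D.qCoord X) := by
    linear_combination Complex.I * hj' - Complex.I * hj
      + (-(2 * D.pCoord X + T * D.qCoord X + T' * D.qCoord X : ℂ)) * Complex.I_sq
  have hP : (D.pCoord X : ℂ) + Complex.I * D.pCoord (D.j X)
      = -T * (D.qCoord X + Complex.I * D.qCoord (D.j X)) := by
    linear_combination Complex.I * hj + (D.pCoord X + T * D.qCoord X : ℂ) * Complex.I_sq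
  rw [QuantumTorus.dbar, hcov, hcov, dbarOp, smul_eq_mul, smul_eq_mul]
  have hcomb : ∀ A B C d : ℂ, A / d * B * C = (A * B * C) / d := fun _ _ _ _ => by ring
  rw [hcomb, eq_div_iff hne]
  simp only [hz]
  push_cast
  set b := pderiv (1, 0) G z - deriv ψ (D.qCoord x) * pderiv (0, 1) G z
    - 4 * Real.pi * Complex.I * k * D.pCoord x * G z with hb
  linear_combination e / 2 * (T' - T) * pderiv (0, 1) G z * hP + e / 2 * (b - T * pderiv (0, 1) G z) * hQ

theorem dbar_clm_comp {k : ℕ} (L : δ →L[ℂ] ℂ) {u : E → δ} {x : E} (hu : DifferentiableAt ℝ u x)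
    (X : E) : D.dbar k (fun y => L (u y)) x X = L (D.dbar k u x X) := by
  have h1 : fderiv ℝ (fun y => L (u y)) x = (L.restrictScalars ℝ).comp (fderiv ℝ u x) :=
    ((L.restrictScalars ℝ).hasFDerivAt.comp x hu.hasFDerivAt).fderiv
  simp only [QuantumTorus.dbar, QuantumTorus.covDeriv, h1, map_smul, map_add, map_sub,
    ContinuousLinearMap.comp_apply, ContinuousLinearMap.coe_restrictScalars']

end HalfFormLine

/-! ### The theta basis -/

namespace QuantumTorus

variable {E : Type*} [NormedAddCommGroup E] [NormedSpace ℝ E] (D : QuantumTorus E)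

/-- The expression of a section `u` of `L_E ^ k` in the trivialization `e^{-2iπkpq}` and in the
coordinates `(q, v)` with `v = p - ψ(q)`. -/
noncomputable def chart (ψ : ℝ → ℝ) (k : ℕ) (u : E → ℂ) (z : ℝ × ℝ) : ℂ :=
  u (D.pt (ψ z.1 + z.2) z.1) * Complex.exp (2 * Real.pi * Complex.I * k * (ψ z.1 + z.2) * z.1)

/-- For `u` in `H⁰(M, L_M ^ k)`, the Fourier coefficient of `u` on the circle `q = n / 2k`. -/
noncomputable def thetaCoeff (k : ℕ) (u : E → ℂ) (n : ℤ) : ℂ :=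
  ∫ p in (0 : ℝ)..1, u (D.pt p (n / (2 * k))) * Complex.exp (Real.pi * Complex.I * n * p)

variable {D}

theorem contDiff_chart {ψ : ℝ → ℝ} (hψ : ContDiff ℝ ∞ ψ) (k : ℕ) {u : E → ℂ} (hu : ContDiff ℝ ∞ u) :
    ContDiff ℝ ∞ (D.chart ψ k u) := by
  have h1 : ContDiff ℝ ∞ (fun z : ℝ × ℝ => ψ z.1 + z.2) := (hψ.comp contDiff_fst).add contDiff_snd
  have hof : ContDiff ℝ ∞ (fun t : ℝ => (t : ℂ)) := Complex.ofRealCLM.contDiff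
  have h2 : ContDiff ℝ ∞ (fun z : ℝ × ℝ => ((ψ z.1 + z.2 : ℝ) : ℂ)) := hof.comp h1
  have h3 : ContDiff ℝ ∞ (fun z : ℝ × ℝ => (z.1 : ℂ)) := hof.comp contDiff_fst
  refine (hu.comp (D.contDiff_pt.comp (h1.prodMk contDiff_fst))).mul (ContDiff.cexp ?_)
  have h4 := (contDiff_const (c := (2 * Real.pi * Complex.I * k : ℂ))).mul h2 |>.mul h3
  simpa using h4

theorem chart_eq (ψ : ℝ → ℝ) (k : ℕ) (u : E → ℂ) (y : E) :
    u y = Complex.exp (-(2 * Real.pi * Complex.I * k * D.pCoord y * D.qCoord y))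
      * D.chart ψ k u (D.qCoord y, D.pCoord y - ψ (D.qCoord y)) := by
  simp only [chart, add_sub_cancel, D.pt_coords]
  rw [mul_left_comm, ← Complex.exp_add]
  push_cast
  rw [add_sub_cancel, neg_add_cancel, Complex.exp_zero, mul_one]

variable {δ : Type*} [NormedAddCommGroup δ] [InnerProductSpace ℂ δ] {h : HalfFormLine D δ} {Ω : δ}

theorem dbarOp_chart_eq_zero (hΩ : h.sq Ω D.μ = 1) {ψ : ℝ → ℝ} (hψ : ContDiff ℝ ∞ ψ) {k : ℕ}
    {u : E → ℂ} (hu : u ∈ D.holSections ℂ k) (z : ℝ × ℝ) :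
    dbarOp ψ (h.modulus Ω) k (D.chart ψ k u) z = 0 := by
  have h1 := h.dbar_eq_dbarOp hΩ (k := k) (u := u) (x := D.pt (ψ z.1 + z.2) z.1) (ψ := ψ)
    (G := D.chart ψ k u) (hψ.differentiable (by simp) _)
    ((contDiff_chart hψ k hu.1).differentiable (by simp) _)
    (Eventually.of_forall fun y => chart_eq ψ k u y) D.μ
  rw [hu.2.2, hΩ] at h1
  simp only [D.qCoord_pt, D.pCoord_pt, add_sub_cancel_left, star_one] at h1
  have him := h.modulus_im_pos hΩ
  have hne : star (h.modulus Ω) - h.modulus Ω ≠ 0 := by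
    intro h0
    have := congrArg Complex.im h0
    simp at this
    linarith
  rcases mul_eq_zero.1 h1.symm with h2 | h2
  · rcases mul_eq_zero.1 h2 with h3 | h3
    · rw [one_div, inv_eq_zero] at h3
      exact absurd h3 hne
    · exact absurd h3 (Complex.exp_ne_zero _)
  · exact h2

theorem chart_add_one {k : ℕ} {u : E → ℂ} (hu : u ∈ D.holSections ℂ k) (ψ : ℝ → ℝ) (q v : ℝ) :
    D.chart ψ k u (q, v + 1) = Complex.exp (4 * Real.pi * Complex.I * k * q) * D.chart ψ k u (q, v) := by
  have h1 := hu.2.1 (D.pt 1 0) (D.mem_R_iff.2 ⟨1, 0, by simp⟩) (D.pt (ψ q + v) q) (mem_univ _)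
  simp only [chart]
  rw [D.pt_add, D.om_pt_pt] at h1
  rw [show ψ q + (v + 1) = 1 + (ψ q + v) by ring]
  rw [zero_add] at h1
  rw [h1, smul_eq_mul, mul_right_comm, ← Complex.exp_add, mul_left_comm, ← Complex.exp_add,
    mul_comm]
  congr 2
  push_cast
  ring

theorem exp_int_mul_two_pi {n : ℤ} {w : ℂ} (h : w = n * (2 * Real.pi * Complex.I)) :
    Complex.exp w = 1 := by
  rw [h, Complex.exp_int_mul_two_pi_mul_I]

/-- The integrand of `thetaCoeff` is periodic. -/
theorem periodic_thetaCoeff_integrand {k : ℕ} (hk : 0 < k) {u : E → ℂ} (hu : u ∈ D.holSections ℂ k)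
    (n : ℤ) : Function.Periodic (fun p : ℝ => u (D.pt p (n / (2 * k))) *
      Complex.exp (Real.pi * Complex.I * n * p)) 1 := by
  intro p
  have h1 := hu.2.1 (D.pt 1 0) (D.mem_R_iff.2 ⟨1, 0, by simp⟩) (D.pt p (n / (2 * k))) (mem_univ _)
  rw [D.pt_add, D.om_pt_pt, zero_add, add_comm] at h1
  simp only
  rw [h1, smul_eq_mul, mul_right_comm, ← Complex.exp_add, mul_comm]
  congr 1
  rw [← mul_one (Complex.exp (Real.pi * Complex.I * n * p)), ← exp_int_mul_two_pi (n := n) rfl,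
    ← Complex.exp_add]
  congr 1
  have : (k : ℂ) ≠ 0 := by exact_mod_cast hk.ne'
  push_cast
  field_simp
  ring

theorem fiberCoeff_chart_self {k : ℕ} (hk : 0 < k) {u : E → ℂ} (hu : u ∈ D.holSections ℂ k)
    (ψ : ℝ → ℝ) (n : ℤ) :
    fiberCoeff ψ k (D.chart ψ k u) (n / (2 * k)) (n / (2 * k)) = D.thetaCoeff k u n := by
  set y : ℝ := n / (2 * k) with hy
  have h1 := (periodic_thetaCoeff_integrand hk hu n).intervalIntegral_add_eq 0 (-(1 / 2) + ψ y)
  rw [zero_add] at h1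
  rw [thetaCoeff, h1, fiberCoeff]
  have h2 := intervalIntegral.integral_comp_add_right (a := -(1 / 2 : ℝ)) (b := 1 / 2)
    (fun p : ℝ => u (D.pt p (n / (2 * k))) * Complex.exp (Real.pi * Complex.I * n * p)) (ψ y)
  rw [show -(1 / 2) + ψ y + 1 = 1 / 2 + ψ y by ring, ← h2]
  refine intervalIntegral.integral_congr fun v _ => ?_
  simp only [chart, sub_self, mul_zero, neg_zero, Complex.exp_zero, mul_one]
  rw [add_comm v, ← hy]
  congr 2
  have : (k : ℂ) ≠ 0 := by exact_mod_cast hk.ne'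
  rw [hy]
  push_cast
  field_simp

/-- The boundary condition for `fiberCoeff`. -/
theorem chart_boundary {k : ℕ} (hk : 0 < k) {u : E → ℂ} (hu : u ∈ D.holSections ℂ k) (ψ : ℝ → ℝ)
    (n : ℤ) (q : ℝ) :
    D.chart ψ k u (q, 1 / 2) * Complex.exp (-(4 * Real.pi * Complex.I * (k : ℝ) *
        (ψ q + (1 / 2 : ℝ)) * (q - (n / (2 * k) : ℝ))))
      = D.chart ψ k u (q, -(1 / 2)) * Complex.exp (-(4 * Real.pi * Complex.I * (k : ℝ) *
        (ψ q + (-(1 / 2) : ℝ)) * (q - (n / (2 * k) : ℝ)))) := by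
  have h1 := chart_add_one hu ψ q (-(1 / 2))
  rw [show -(1 / 2 : ℝ) + 1 = 1 / 2 by norm_num] at h1
  rw [h1, mul_right_comm, ← Complex.exp_add, mul_comm]
  congr 1
  rw [← mul_one (Complex.exp (-_)), ← exp_int_mul_two_pi (n := n) rfl, ← Complex.exp_add]
  congr 1
  have : (k : ℂ) ≠ 0 := by exact_mod_cast hk.ne'
  push_cast
  field_simp
  ring

/-- The fiber coefficients of a holomorphic section are Gaussian. -/
theorem fiberCoeff_chart (hΩ : h.sq Ω D.μ = 1) {ψ : ℝ → ℝ} (hψ : ContDiff ℝ ∞ ψ) {k : ℕ}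
    (hk : 0 < k) {u : E → ℂ} (hu : u ∈ D.holSections ℂ k) (n : ℤ) (q : ℝ) :
    fiberCoeff ψ k (D.chart ψ k u) (n / (2 * k)) q
      = Complex.exp (2 * Real.pi * Complex.I * (k : ℝ) * h.modulus Ω *
        (((q - n / (2 * k)) ^ 2 : ℝ) : ℂ)) * D.thetaCoeff k u n := by
  set y : ℝ := n / (2 * k) with hy
  have hzero : ∀ s, fiberCoeff ψ k (dbarOp ψ (h.modulus Ω) k (D.chart ψ k u)) y s = 0 := fun s => by
    simp [fiberCoeff, dbarOp_chart_eq_zero hΩ hψ hu]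
  have h1 := norm_sub_propagator_mul_le (b := fiberCoeff ψ k (D.chart ψ k u) y) (r := 0)
    (T := h.modulus Ω) (k := k) (y := y) (ε := 0) (q := q) (q' := y) (Nat.cast_nonneg k)
    (h.modulus_im_pos hΩ).le (fun s _ => by
      have := hasDerivAt_fiberCoeff hψ (k := k) (h.modulus Ω) (contDiff_chart hψ k hu.1) (y := y)
        (chart_boundary hk hu ψ n) s
      rwa [hzero] at this) (by simp) (fun s hs => ?_)
  · rw [zero_mul, norm_le_zero_iff, sub_eq_zero] at h1
    rw [h1, hy, fiberCoeff_chart_self hk hu ψ n, ← hy]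
    simp
  · rcases le_total q y with hqy | hqy
    · rw [uIcc_of_le hqy] at hs
      rw [abs_of_nonpos (by linarith [hs.2]), abs_of_nonpos (by linarith)]
      linarith [hs.1]
    · rw [uIcc_of_ge hqy] at hs
      rw [abs_of_nonneg (by linarith [hs.1]), abs_of_nonneg (by linarith)]
      linarith [hs.2]

/-- `fiberCoeff` as a genuine Fourier coefficient, up to a factor of modulus one. -/
theorem fiberCoeff_eq_fourier (ψ : ℝ → ℝ) {k : ℕ} (hk : 0 < k) (G : ℝ × ℝ → ℂ) (n : ℤ) (q : ℝ) :
    ∫ v in (-(1 / 2) : ℝ)..(1 / 2), (G (q, v) * Complex.exp (-(4 * Real.pi * Complex.I * k * v * q)))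
        * Complex.exp (2 * Real.pi * Complex.I * n * v)
      = Complex.exp (4 * Real.pi * Complex.I * k * ψ q * (q - (n / (2 * k) : ℝ))) *
        fiberCoeff ψ k G (n / (2 * k)) q := by
  rw [fiberCoeff, ← intervalIntegral.integral_const_mul]
  refine intervalIntegral.integral_congr fun v _ => ?_
  rw [mul_left_comm, ← Complex.exp_add, mul_assoc, ← Complex.exp_add]
  congr 2
  have : (k : ℂ) ≠ 0 := by exact_mod_cast hk.ne'
  push_cast
  field_simp
  ring

theorem norm_exp_imaginary (w : ℂ) (r : ℝ) (hw : w = r * Complex.I) : ‖Complex.exp w‖ = 1 := by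
  rw [hw, Complex.norm_exp_ofReal_mul_I]

theorem norm_fourier_eq (ψ : ℝ → ℝ) {k : ℕ} (hk : 0 < k) (G : ℝ × ℝ → ℂ) (n : ℤ) (q : ℝ) :
    ‖∫ v in (-(1 / 2) : ℝ)..(1 / 2), (G (q, v) * Complex.exp (-(4 * Real.pi * Complex.I * k * v * q)))
        * Complex.exp (2 * Real.pi * Complex.I * n * v)‖ = ‖fiberCoeff ψ k G (n / (2 * k)) q‖ := by
  rw [fiberCoeff_eq_fourier ψ hk, norm_mul, norm_exp_imaginary _
    (4 * Real.pi * k * ψ q * (q - (n / (2 * k) : ℝ))) (by push_cast; ring), one_mul]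

theorem norm_gaussian_modulus (T : ℂ) (k x : ℝ) :
    ‖Complex.exp (2 * Real.pi * Complex.I * k * T * (x : ℂ))‖
      = Real.exp (-(2 * Real.pi * k * T.im * x)) := by
  rw [Complex.norm_exp, Complex.re_mul_ofReal]
  have : (2 * Real.pi * Complex.I * k * T) = ((2 * Real.pi * k : ℝ) : ℂ) * (Complex.I * T) := by
    push_cast; ring
  rw [this, Complex.re_ofReal_mul, Complex.I_mul_re]
  congr 1
  ring

theorem thetaCoeff_add (k : ℕ) (hk : 0 < k) {u : E → ℂ} (hu : u ∈ D.holSections ℂ k) (n : ℤ) :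
    D.thetaCoeff k u (n + 2 * k) = D.thetaCoeff k u n := by
  refine intervalIntegral.integral_congr fun p _ => ?_
  have h1 := hu.2.1 (D.pt 0 1) (D.mem_R_iff.2 ⟨0, 1, by simp⟩) (D.pt p (n / (2 * k))) (mem_univ _)
  rw [D.pt_add, D.om_pt_pt, zero_add] at h1
  have hk' : (k : ℝ) ≠ 0 := by exact_mod_cast hk.ne'
  have e1 : ((n + 2 * k : ℤ) : ℝ) / (2 * k) = 1 + n / (2 * k) := by
    push_cast
    field_simp
    ring
  rw [e1, h1, smul_eq_mul, mul_right_comm, ← Complex.exp_add, mul_comm]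
  congr 2
  push_cast
  ring

theorem thetaCoeff_add_mul (k : ℕ) (hk : 0 < k) {u : E → ℂ} (hu : u ∈ D.holSections ℂ k) (n j : ℤ) :
    D.thetaCoeff k u (n + 2 * k * j) = D.thetaCoeff k u n := by
  induction j with
  | zero => simp
  | succ j ih =>
    rw [← ih, ← thetaCoeff_add k hk hu (n + 2 * k * j)]
    congr 1
    ring
  | pred j ih =>
    rw [← ih, ← thetaCoeff_add k hk hu (n + 2 * k * (-j - 1))]
    congr 1
    ring

theorem continuous_thetaCoeff_integrand {u : E → ℂ} (hu : ContDiff ℝ ∞ u) (y : ℝ) (n : ℤ) :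
    Continuous (fun p : ℝ => u (D.pt p y) * Complex.exp (Real.pi * Complex.I * n * p)) := by
  have h1 : Continuous fun p : ℝ => u (D.pt p y) :=
    hu.continuous.comp ((D.contDiff_pt (n := 0)).continuous.comp (by fun_prop : Continuous fun p : ℝ => (p, y)))
  exact h1.mul (by fun_prop)

theorem coordL_comp_mem {k : ℕ} (L : δ →L[ℂ] ℂ) {u : E → δ} (hu : u ∈ D.holSections δ k) :
    (fun y => L (u y)) ∈ D.holSections ℂ k := by
  refine ⟨(L.restrictScalars ℝ).contDiff.comp hu.1, fun r hr x hx => ?_, fun x X => ?_⟩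
  · simp only [hu.2.1 r hr x hx, map_smul]
  · rw [HalfFormLine.dbar_clm_comp L (hu.1.differentiable (by simp) x), hu.2.2, map_zero]

section Basis

variable {k : ℕ} {Ψ : Module.Basis (ZMod (2 * k)) ℂ (D.holSections δ k)}

theorem thetaCoeff_basis_add_one (hk : 0 < k) (hΨ : D.IsThetaBasis Ω k Ψ) (L : δ →L[ℂ] ℂ)
    (l : ZMod (2 * k)) (n : ℤ) :
    D.thetaCoeff k (fun y => L ((Ψ (l + 1)).1 y)) n = D.thetaCoeff k (fun y => L ((Ψ l).1 y)) (n + 1) := by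
  refine intervalIntegral.integral_congr fun p _ => ?_
  have hk' : (k : ℝ) ≠ 0 := by exact_mod_cast hk.ne'
  have hk'' : (k : ℂ) ≠ 0 := by exact_mod_cast hk.ne'
  have h1 := congrFun (hΨ.translate_lam l) (D.pt p (n / (2 * k)))
  have e1 : (1 / (2 * k) : ℝ) • D.lam = D.pt 0 (1 / (2 * k)) := by simp [pt]
  rw [translate, e1, D.om_pt_pt, D.pt_add, zero_add] at h1
  have e2 : (1 / (2 * k) + n / (2 * k) : ℝ) = ((n + 1 : ℤ) : ℝ) / (2 * k) := by
    push_cast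
    ring
  rw [e2] at h1
  simp only
  rw [← h1, map_smul, smul_eq_mul, mul_right_comm, ← Complex.exp_add, mul_comm]
  congr 2
  push_cast
  field_simp
  ring

/-- The invariance of `Ψ 0` under the translation by `μ / 2k` makes its Fourier coefficients vanish
unless `2k` divides the index. -/
theorem thetaCoeff_basis_zero (hk : 0 < k) (hΨ : D.IsThetaBasis Ω k Ψ) (L : δ →L[ℂ] ℂ) {n : ℤ}
    (hn : ((n : ℤ) : ZMod (2 * k)) ≠ 0) : D.thetaCoeff k (fun y => L ((Ψ 0).1 y)) n = 0 := by
  have hk' : (k : ℝ) ≠ 0 := by exact_mod_cast hk.ne'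
  have hk'' : (k : ℂ) ≠ 0 := by exact_mod_cast hk.ne'
  have hmem := coordL_comp_mem L (Ψ 0).2
  set I : ℝ → ℂ := fun p : ℝ => L ((Ψ 0).1 (D.pt p (n / (2 * k)))) *
      Complex.exp (Real.pi * Complex.I * n * p) with hI
  have hper : Function.Periodic I 1 := periodic_thetaCoeff_integrand hk hmem n
  -- `Ψ 0` is invariant under the translation by `μ / 2k`, which multiplies the integrand by a constant
  have h1 : ∀ p, I (1 / (2 * k) + p) = Complex.exp (Real.pi * Complex.I * n / k) * I p := by
    intro p
    have h1 := congrFun (hΨ.translate_μ 0) (D.pt p (n / (2 * k)))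
    have e1 : (1 / (2 * k) : ℝ) • D.μ = D.pt (1 / (2 * k)) 0 := by simp [pt]
    rw [translate, e1, D.om_pt_pt, D.pt_add, zero_add] at h1
    simp only [Int.cast_zero, mul_zero, zero_div, Complex.exp_zero, one_smul] at h1
    simp only [hI]
    have h2 := congrArg L h1
    rw [map_smul, smul_eq_mul] at h2
    have h3 : Complex.exp (Real.pi * Complex.I * n * (1 / (2 * k) + p : ℝ))
        = Complex.exp (Real.pi * Complex.I * n / k) * Complex.exp (-(Complex.I * k *
          ((4 * Real.pi * (1 / (2 * k) * (n / (2 * k)) - 0 * p) : ℝ) : ℂ) / 2)) *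
          Complex.exp (Real.pi * Complex.I * n * p) := by
      rw [← Complex.exp_add, ← Complex.exp_add]
      congr 1
      push_cast
      field_simp
      ring
    rw [← h2, h3]
    ring
  have h2 : D.thetaCoeff k (fun y => L ((Ψ 0).1 y)) n = ∫ p in (0 : ℝ)..1, I p := rfl
  have h3 : ∫ p in (0 : ℝ)..1, I (1 / (2 * k) + p) = ∫ p in (0 : ℝ)..1, I p := by
    rw [intervalIntegral.integral_comp_add_left I, add_zero]
    have := hper.intervalIntegral_add_eq (1 / (2 * k)) 0
    rwa [zero_add] at this
  simp only [h1] at h3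
  rw [intervalIntegral.integral_const_mul] at h3
  rw [h2]
  have h4 : (Complex.exp (Real.pi * Complex.I * n / k) - 1) * ∫ p in (0 : ℝ)..1, I p = 0 := by
    linear_combination h3
  refine (mul_eq_zero.1 h4).resolve_left fun h5 => hn ?_
  rw [sub_eq_zero, Complex.exp_eq_one_iff] at h5
  obtain ⟨j, hj⟩ := h5
  have hπ : (Real.pi : ℂ) ≠ 0 := by exact_mod_cast Real.pi_pos.ne'
  have hj' : (n : ℂ) = ((2 * k : ℕ) * j : ℤ) := by
    have hI := Complex.I_ne_zero
    field_simp at hj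
    push_cast
    linear_combination hj
  have hj'' : n = (2 * k : ℕ) * j := by exact_mod_cast hj'
  rw [hj'']
  push_cast
  rw [show ((2 : ZMod (2 * k)) * (k : ZMod (2 * k))) = ((2 * k : ℕ) : ZMod (2 * k)) by push_cast; rfl,
    ZMod.natCast_self, zero_mul]

theorem thetaCoeff_basis_natCast (hk : 0 < k) (hΨ : D.IsThetaBasis Ω k Ψ) (L : δ →L[ℂ] ℂ) (a : ℕ) :
    ∀ n : ℤ, D.thetaCoeff k (fun y => L ((Ψ (a : ZMod (2 * k))).1 y)) n
      = D.thetaCoeff k (fun y => L ((Ψ 0).1 y)) (n + a) := by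
  induction a with
  | zero => intro n; simp
  | succ a ih =>
    intro n
    rw [Nat.cast_succ, thetaCoeff_basis_add_one hk hΨ, ih]
    congr 1
    push_cast
    ring

theorem thetaCoeff_basis (hk : 0 < k) (hΨ : D.IsThetaBasis Ω k Ψ) (L : δ →L[ℂ] ℂ)
    (l : ZMod (2 * k)) (n : ℤ) :
    D.thetaCoeff k (fun y => L ((Ψ l).1 y)) n
      = if l = -(n : ZMod (2 * k)) then D.thetaCoeff k (fun y => L ((Ψ 0).1 y)) 0 else 0 := by
  have : NeZero (2 * k) := ⟨by omega⟩
  obtain ⟨a, rfl⟩ := ZMod.natCast_zmod_surjective l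
  rw [thetaCoeff_basis_natCast hk hΨ]
  split_ifs with h
  · have h1 : ((n + a : ℤ) : ZMod (2 * k)) = 0 := by
      push_cast
      rw [h]
      ring
    rw [ZMod.intCast_zmod_eq_zero_iff_dvd] at h1
    obtain ⟨j, hj⟩ := h1
    rw [hj]
    have := thetaCoeff_add_mul k hk (coordL_comp_mem L (Ψ 0).2) 0 j
    rw [zero_add] at this
    rw [← this]
    push_cast
    rfl
  · refine thetaCoeff_basis_zero hk hΨ L fun h1 => h ?_
    push_cast at h1
    linear_combination h1

/-- The coefficients of a holomorphic section in the theta basis are its Fourier coefficients on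
the circles `q = n / 2k`, up to a constant. -/
theorem thetaCoeff_eq_repr (hk : 0 < k) (hΨ : D.IsThetaBasis Ω k Ψ) (L : δ →L[ℂ] ℂ)
    (ξ : D.holSections δ k) (n : ℤ) :
    D.thetaCoeff k (fun y => L (ξ.1 y)) n
      = D.thetaCoeff k (fun y => L ((Ψ 0).1 y)) 0 * Ψ.repr ξ (-(n : ZMod (2 * k))) := by
  have : NeZero (2 * k) := ⟨by omega⟩
  have h1 : ∀ y, L (ξ.1 y) = ∑ l, Ψ.repr ξ l * L ((Ψ l).1 y) := by
    intro y
    have h2 : ξ.1 = ∑ l, Ψ.repr ξ l • (Ψ l).1 := by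
      have h3 := congrArg Subtype.val (Ψ.sum_repr ξ).symm
      rwa [Submodule.coe_sum] at h3
    rw [h2, Finset.sum_apply, map_sum]
    simp
  have h2 : D.thetaCoeff k (fun y => L (ξ.1 y)) n
      = ∑ l, Ψ.repr ξ l * D.thetaCoeff k (fun y => L ((Ψ l).1 y)) n := by
    simp only [thetaCoeff]
    simp only [← intervalIntegral.integral_const_mul]
    rw [← intervalIntegral.integral_finsetSum]
    · refine intervalIntegral.integral_congr fun p _ => ?_
      simp only [h1, Finset.sum_mul, mul_assoc]
    · intro l _
      exact (continuous_const.mul (continuous_thetaCoeff_integrand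
        (coordL_comp_mem L (Ψ l).2).1 _ n)).intervalIntegrable _ _
  rw [h2]
  rw [Finset.sum_congr rfl fun l _ => congrArg (Ψ.repr ξ l * ·) (thetaCoeff_basis hk hΨ L l n)]
  rw [Finset.sum_eq_single (-(n : ZMod (2 * k)))]
  · rw [if_pos rfl, mul_comm]
  · intro l _ hl
    rw [if_neg hl, mul_zero]
  · intro h
    exact absurd (Finset.mem_univ _) h

end Basis

end QuantumTorus

/-! ### Normalization of the theta basis -/

theorem hasSum_integral_gaussian_comp_add_int {c : ℝ} (hc : 0 < c) (y : ℝ) :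
    HasSum (fun j : ℤ => ∫ q in (0 : ℝ)..1, Real.exp (-(c * (q + j - y) ^ 2))) (√(Real.pi / c)) := by
  have h1 : MeasureTheory.Integrable fun x : ℝ => Real.exp (-(c * (x - y) ^ 2)) := by
    have := (integrable_exp_neg_mul_sq hc).comp_sub_right y
    simpa only [neg_mul] using this
  have h2 : ∫ x : ℝ, Real.exp (-(c * (x - y) ^ 2)) = √(Real.pi / c) := by
    rw [MeasureTheory.integral_sub_right_eq_self (fun x => Real.exp (-(c * x ^ 2))) y,
      ← integral_gaussian]
    simp only [neg_mul]
  rw [← h2]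
  exact h1.hasSum_intervalIntegral_comp_add_int

theorem summable_exp_neg_mul_abs_int {b : ℝ} (hb : 0 < b) :
    Summable fun n : ℤ => Real.exp (-(b * |(n : ℝ)|)) := by
  have h1 : Summable fun n : ℕ => Real.exp (-b) ^ n :=
    summable_geometric_of_lt_one (Real.exp_pos _).le (by rw [Real.exp_lt_one_iff]; linarith)
  have h2 : ∀ n : ℕ, Real.exp (-(b * n)) = Real.exp (-b) ^ n := fun n => by
    rw [← Real.exp_nat_mul]
    congr 1
    ring
  refine Summable.of_nat_of_neg ?_ ?_
  · simpa only [Int.cast_natCast, Nat.abs_cast, h2] using h1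
  · simpa only [Int.cast_neg, abs_neg, Int.cast_natCast, Nat.abs_cast, h2] using h1

namespace QuantumTorus

variable {E : Type*} [NormedAddCommGroup E] [NormedSpace ℝ E] {D : QuantumTorus E}
  {δ : Type*} [NormedAddCommGroup δ] [InnerProductSpace ℂ δ] {h : HalfFormLine D δ} {Ω : δ}

theorem norm_chart (ψ : ℝ → ℝ) (k : ℕ) (u : E → ℂ) (q v : ℝ) :
    ‖D.chart ψ k u (q, v)‖ = ‖u (D.pt (ψ q + v) q)‖ := by
  rw [chart, norm_mul, norm_exp_imaginary _ (2 * Real.pi * k * (ψ q + v) * q) (by push_cast; ring),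
    mul_one]

/-- Parseval's identity on a fiber of `q`. -/
theorem hasSum_sq_thetaCoeff (hΩ : h.sq Ω D.μ = 1) {k : ℕ} (hk : 0 < k) {u : E → ℂ}
    (hu : u ∈ D.holSections ℂ k) (q : ℝ) :
    HasSum (fun n : ℤ => Real.exp (-(4 * Real.pi * k * (h.modulus Ω).im * (q - n / (2 * k)) ^ 2))
      * ‖D.thetaCoeff k u n‖ ^ 2) (∫ p in (0 : ℝ)..1, ‖u (D.pt p q)‖ ^ 2) := by
  have hψ : ContDiff ℝ ∞ (fun _ : ℝ => (1 / 2 : ℝ)) := contDiff_const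
  set G := D.chart (fun _ : ℝ => (1 / 2 : ℝ)) k u with hG
  have hGc : Continuous G := (contDiff_chart hψ k hu.1).continuous
  have h1 := hasSum_sq_fourier (a := -(1 / 2))
    (f := fun v : ℝ => G (q, v) * Complex.exp (-(4 * Real.pi * Complex.I * k * v * q)))
    (by fun_prop) (fun n => rfl)
  rw [show -(1 / 2 : ℝ) + 1 = 1 / 2 by norm_num] at h1
  simp only [norm_fourier_eq (fun _ : ℝ => (1 / 2 : ℝ)) hk G] at h1
  have h2 : ∫ v in (-(1 / 2) : ℝ)..(1 / 2),
      ‖G (q, v) * Complex.exp (-(4 * Real.pi * Complex.I * k * v * q))‖ ^ 2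
      = ∫ p in (0 : ℝ)..1, ‖u (D.pt p q)‖ ^ 2 := by
    have := intervalIntegral.integral_comp_add_left (a := -(1 / 2)) (b := 1 / 2)
      (fun p : ℝ => ‖u (D.pt p q)‖ ^ 2) (1 / 2)
    rw [show (1 / 2 + -(1 / 2) : ℝ) = 0 by norm_num, show (1 / 2 + 1 / 2 : ℝ) = 1 by norm_num] at this
    rw [← this]
    refine intervalIntegral.integral_congr fun v _ => ?_
    rw [norm_mul, hG, norm_chart, norm_exp_imaginary _ (-(4 * Real.pi * k * v * q)) (by push_cast; ring),
      mul_one]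
  rw [h2] at h1
  convert h1 using 2 with n
  rw [hG, fiberCoeff_chart hΩ hψ hk hu, norm_mul, norm_gaussian_modulus, mul_pow, ← Real.exp_nat_mul]
  congr 2
  push_cast
  ring

theorem torusIntegral_norm_sq {u : E → ℂ} (hu : Continuous u) :
    D.torusIntegral (fun x => ‖u x‖ ^ 2)
      = 4 * Real.pi * ∫ q in (0 : ℝ)..1, ∫ p in (0 : ℝ)..1, ‖u (D.pt p q)‖ ^ 2 := by
  have hc : Continuous (Function.uncurry fun p q : ℝ => ‖u (D.pt p q)‖ ^ 2) := by
    have h1 : Continuous fun z : ℝ × ℝ => u (D.pt z.1 z.2) :=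
      hu.comp (D.contDiff_pt (n := 0)).continuous
    exact h1.norm.pow 2
  rw [torusIntegral, smul_eq_mul]
  congr 1
  refine MeasureTheory.intervalIntegral_intervalIntegral_swap (F := fun p q : ℝ => ‖u (D.pt p q)‖ ^ 2) ?_
  rw [uIoc_of_le zero_le_one]
  exact (hc.continuousOn.integrableOn_compact (isCompact_Icc.prod isCompact_Icc)).mono_set
    (prod_mono Ioc_subset_Icc_self Ioc_subset_Icc_self)

theorem continuous_integral_norm_sq {u : E → ℂ} (hu : Continuous u) :
    Continuous fun q : ℝ => ∫ p in (0 : ℝ)..1, ‖u (D.pt p q)‖ ^ 2 := by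
  refine intervalIntegral.continuous_parametric_intervalIntegral_of_continuous' ?_ 0 1
  have h1 : Continuous fun z : ℝ × ℝ => u (D.pt z.2 z.1) :=
    hu.comp ((D.contDiff_pt (n := 0)).continuous.comp continuous_swap)
  exact h1.norm.pow 2

theorem two_mul_index (k : ℕ) (hk : 0 < k) (n j : ℤ) :
    ((n + 2 * k * j : ℤ) : ℝ) / (2 * k) = n / (2 * k) + j := by
  have hk' : (k : ℝ) ≠ 0 := by exact_mod_cast hk.ne'
  push_cast
  field_simp

/-- Bessel's inequality for the Fourier coefficients of a holomorphic section. -/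
theorem norm_thetaCoeff_sq_le (hΩ : h.sq Ω D.μ = 1) {k : ℕ} (hk : 0 < k) {u : E → ℂ}
    (hu : u ∈ D.holSections ℂ k) (n : ℤ) :
    ‖D.thetaCoeff k u n‖ ^ 2 * (4 * Real.pi * √(Real.pi / (4 * Real.pi * k * (h.modulus Ω).im)))
      ≤ D.torusIntegral (fun x => ‖u x‖ ^ 2) := by
  have him := h.modulus_im_pos hΩ
  have hk' : (0 : ℝ) < k := by exact_mod_cast hk
  set c := 4 * Real.pi * k * (h.modulus Ω).im with hc
  have hc0 : 0 < c := by have := Real.pi_pos; positivity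
  have hcont := hu.1.continuous
  rw [torusIntegral_norm_sq hcont, mul_left_comm]
  refine mul_le_mul_of_nonneg_left ?_ (by have := Real.pi_pos; positivity)
  have h1 := (hasSum_integral_gaussian_comp_add_int hc0 (n / (2 * k))).mul_left (‖D.thetaCoeff k u n‖ ^ 2)
  refine hasSum_le_of_sum_le h1 fun s => ?_
  rw [← Finset.mul_sum, ← intervalIntegral.integral_finsetSum, ← intervalIntegral.integral_const_mul]
  swap
  · intro j _
    exact Continuous.intervalIntegrable (by fun_prop) _ _
  refine intervalIntegral.integral_mono_on zero_le_one (Continuous.intervalIntegrable (by fun_prop) _ _)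
    ((continuous_integral_norm_sq hcont).intervalIntegrable _ _) fun q _ => ?_
  have h2 := hasSum_sq_thetaCoeff hΩ hk hu q
  have hinj : Function.Injective fun j : ℤ => n + 2 * k * -j := by
    intro i j hij
    have hk2 : (2 * k : ℤ) ≠ 0 := by exact_mod_cast (by omega : 2 * k ≠ 0)
    have h3 := mul_left_cancel₀ hk2 (add_left_cancel hij)
    exact neg_injective h3
  refine le_trans (le_of_eq ?_) (sum_le_hasSum (s.map ⟨_, hinj⟩) (fun i _ => by positivity) h2)
  rw [Finset.sum_map, Finset.mul_sum]
  refine Finset.sum_congr rfl fun j _ => ?_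
  simp only [Function.Embedding.coeFn_mk]
  rw [thetaCoeff_add_mul k hk hu, two_mul_index k hk, mul_comm, ← hc]
  congr 4
  push_cast
  ring

/-- The norm of a section whose Fourier coefficients are supported on `2kℤ`. -/
theorem norm_thetaCoeff_sq_eq (hΩ : h.sq Ω D.μ = 1) {k : ℕ} (hk : 0 < k) {u : E → ℂ}
    (hu : u ∈ D.holSections ℂ k)
    (h0 : ∀ n : ℤ, ((n : ℤ) : ZMod (2 * k)) ≠ 0 → D.thetaCoeff k u n = 0) :
    ‖D.thetaCoeff k u 0‖ ^ 2 * (4 * Real.pi * √(Real.pi / (4 * Real.pi * k * (h.modulus Ω).im)))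
      = D.torusIntegral (fun x => ‖u x‖ ^ 2) := by
  have him := h.modulus_im_pos hΩ
  have hk' : (0 : ℝ) < k := by exact_mod_cast hk
  set c := 4 * Real.pi * k * (h.modulus Ω).im with hc
  have hc0 : 0 < c := by have := Real.pi_pos; positivity
  have hcont := hu.1.continuous
  rw [torusIntegral_norm_sq hcont, mul_left_comm]
  congr 1
  -- the coefficients with index in `2kℤ` have the same modulus: Parseval gives a periodized Gaussian
  have hinj : Function.Injective fun j : ℤ => 2 * k * -j := by
    intro i j hij
    have hk2 : (2 * k : ℤ) ≠ 0 := by exact_mod_cast (by omega : 2 * k ≠ 0)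
    exact neg_injective (mul_left_cancel₀ hk2 hij)
  have h2 : ∀ q : ℝ, HasSum (fun j : ℤ => Real.exp (-(c * (q + j - 0) ^ 2)) * ‖D.thetaCoeff k u 0‖ ^ 2)
      (∫ p in (0 : ℝ)..1, ‖u (D.pt p q)‖ ^ 2) := by
    intro q
    have h3 := hasSum_sq_thetaCoeff hΩ hk hu q
    rw [← hinj.hasSum_iff] at h3
    · convert h3 using 2 with j
      simp only [Function.comp_apply]
      have h4 := thetaCoeff_add_mul k hk hu 0 (-j)
      have h5 := two_mul_index k hk 0 (-j)
      rw [zero_add] at h4 h5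
      rw [h4, h5, ← hc]
      congr 4
      push_cast
      ring
    · intro n hn
      rw [h0 n, norm_zero]
      · ring
      · intro hz
        rw [ZMod.intCast_zmod_eq_zero_iff_dvd] at hz
        obtain ⟨j, hj⟩ := hz
        exact hn ⟨-j, by simp only [neg_neg]; rw [hj]; push_cast; rfl⟩
  have h1 := hasSum_integral_gaussian_comp_add_int hc0 0
  have h6 := MeasureTheory.hasSum_integral_of_summable_integral_norm
    (μ := MeasureTheory.volume.restrict (Ioc (0 : ℝ) 1))
    (F := fun (j : ℤ) (q : ℝ) => Real.exp (-(c * (q + j - 0) ^ 2)) * ‖D.thetaCoeff k u 0‖ ^ 2)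
    (fun j => (Continuous.integrableOn_Ioc (by fun_prop))) (by
      refine (summable_congr fun j => ?_).1 (h1.mul_right (‖D.thetaCoeff k u 0‖ ^ 2)).summable
      rw [intervalIntegral.integral_of_le zero_le_one, ← MeasureTheory.integral_mul_const]
      refine MeasureTheory.integral_congr_ae (MeasureTheory.ae_of_all _ fun q => ?_)
      exact (Real.norm_of_nonneg (by positivity)).symm)
  simp only [fun q => (h2 q).tsum_eq, MeasureTheory.integral_mul_const] at h6
  rw [mul_comm, intervalIntegral.integral_of_le zero_le_one]
  simp only [← intervalIntegral.integral_of_le (zero_le_one (α := ℝ))] at h6 ⊢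
  exact (h1.mul_right _).unique h6

section Basis

variable {k : ℕ} {Ψ : Module.Basis (ZMod (2 * k)) ℂ (D.holSections δ k)}

theorem torusIntegral_const_mul (g : E → ℝ) (c : ℝ) :
    D.torusIntegral (fun x => c * g x) = c * D.torusIntegral g := by
  simp only [torusIntegral, intervalIntegral.integral_const_mul, smul_eq_mul]
  ring

theorem torusIntegral_norm_coordL (hΩ : h.sq Ω D.μ = 1) (u : E → δ) :
    D.torusIntegral (fun x => ‖u x‖ ^ 2)
      = ‖Ω‖ ^ 2 * D.torusIntegral (fun x => ‖HalfFormLine.coordL Ω (u x)‖ ^ 2) := by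
  rw [← torusIntegral_const_mul]
  congr 1
  funext x
  rw [h.norm_eq_coordL hΩ (u x), mul_pow, mul_comm]

theorem norm_sq_mul_sqrt (hΩ : h.sq Ω D.μ = 1) {k : ℕ} (hk : 0 < k) :
    4 * Real.pi * √(Real.pi / (4 * Real.pi * k * (h.modulus Ω).im)) * ‖Ω‖ ^ 2
      * √((k : ℝ) / (2 * Real.pi)) = 1 := by
  have him := h.modulus_im_pos hΩ
  have hk' : (0 : ℝ) < k := by exact_mod_cast hk
  have hπ := Real.pi_pos
  have h1 : ‖Ω‖ ^ 2 = √((h.modulus Ω).im / (2 * Real.pi)) := by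
    rw [← h.norm_pow_four hΩ, show ‖Ω‖ ^ 4 = (‖Ω‖ ^ 2) ^ 2 by ring, Real.sqrt_sq (by positivity)]
  rw [h1, mul_assoc, mul_assoc, ← Real.sqrt_mul (by positivity), ← Real.sqrt_mul (by positivity)]
  have h2 : Real.pi / (4 * Real.pi * k * (h.modulus Ω).im) *
      ((h.modulus Ω).im / (2 * Real.pi) * (k / (2 * Real.pi))) = (1 / (4 * Real.pi)) ^ 2 := by
    field_simp
    norm_num
  rw [h2, Real.sqrt_sq (by positivity)]
  field_simp

/-- The modulus of the constant of proportionality between Fourier coefficients and coefficients in the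
theta basis. -/
theorem norm_thetaCoeff_basis (hΩ : h.sq Ω D.μ = 1) (hk : 0 < k) (hΨ : D.IsThetaBasis Ω k Ψ) :
    ‖D.thetaCoeff k (fun y => HalfFormLine.coordL Ω ((Ψ 0).1 y)) 0‖
      = ((k : ℝ) / (2 * Real.pi)) ^ (1 / 4 : ℝ) := by
  have hπ := Real.pi_pos
  have h1 := norm_thetaCoeff_sq_eq hΩ hk (coordL_comp_mem (HalfFormLine.coordL Ω) (Ψ 0).2)
    (fun n hn => thetaCoeff_basis_zero hk hΨ _ hn)
  have h2 := hΨ.orthonormal 0 0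
  rw [if_pos rfl] at h2
  have h3 : D.torusIntegral (fun x => ‖(Ψ 0).1 x‖ ^ 2) = 1 := by
    have h4 : ((D.torusIntegral (fun x => ‖(Ψ 0).1 x‖ ^ 2) : ℝ) : ℂ) = 1 := by
      rw [← h2]
      simp only [torusIntegral, inner_self_eq_norm_sq_to_K, Complex.coe_algebraMap, smul_eq_mul,
        Complex.real_smul]
      rw [Complex.ofReal_mul, ← intervalIntegral.integral_ofReal]
      simp only [← intervalIntegral.integral_ofReal, Complex.ofReal_pow]
    exact_mod_cast h4
  rw [torusIntegral_norm_coordL hΩ, ← h1] at h3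
  have h5 := norm_sq_mul_sqrt hΩ hk
  set β := ‖D.thetaCoeff k (fun y => HalfFormLine.coordL Ω ((Ψ 0).1 y)) 0‖
  set A := 4 * Real.pi * √(Real.pi / (4 * Real.pi * k * (h.modulus Ω).im))
  have hA : A * ‖Ω‖ ^ 2 ≠ 0 := fun h0 => by rw [h0, zero_mul] at h5; exact zero_ne_one h5
  have h6 : β ^ 2 = √((k : ℝ) / (2 * Real.pi)) := by
    refine mul_left_cancel₀ hA ?_
    rw [h5]
    linarith
  have hB : (0 : ℝ) ≤ k / (2 * Real.pi) := by positivity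
  have h7 : (((k : ℝ) / (2 * Real.pi)) ^ (1 / 4 : ℝ)) ^ 2 = √((k : ℝ) / (2 * Real.pi)) := by
    rw [Real.sqrt_eq_rpow, ← Real.rpow_natCast, ← Real.rpow_mul hB]
    norm_num
  exact (pow_left_inj₀ (norm_nonneg _) (Real.rpow_nonneg hB _) two_ne_zero).1 (h6.trans h7.symm)

theorem norm_repr_le (hΩ : h.sq Ω D.μ = 1) (hk : 0 < k) (hΨ : D.IsThetaBasis Ω k Ψ)
    (ξ : D.holSections δ k) (n : ℤ) :
    ‖Ψ.repr ξ (-(n : ZMod (2 * k)))‖ ≤ √(D.torusIntegral (fun x => ‖ξ.1 x‖ ^ 2)) := by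
  have hπ := Real.pi_pos
  refine Real.le_sqrt_of_sq_le ?_
  have h1 := norm_thetaCoeff_sq_le hΩ hk (coordL_comp_mem (HalfFormLine.coordL Ω) ξ.2) n
  rw [thetaCoeff_eq_repr hk hΨ, norm_mul, norm_thetaCoeff_basis hΩ hk hΨ] at h1
  rw [torusIntegral_norm_coordL hΩ]
  have h5 := norm_sq_mul_sqrt hΩ hk
  have hB : (0 : ℝ) ≤ k / (2 * Real.pi) := by positivity
  have h7 : (((k : ℝ) / (2 * Real.pi)) ^ (1 / 4 : ℝ)) ^ 2 = √((k : ℝ) / (2 * Real.pi)) := by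
    rw [Real.sqrt_eq_rpow, ← Real.rpow_natCast, ← Real.rpow_mul hB]
    norm_num
  rw [mul_pow, h7] at h1
  refine le_trans (le_of_eq ?_) (mul_le_mul_of_nonneg_left h1 (sq_nonneg ‖Ω‖))
  linear_combination (-‖Ψ.repr ξ (-(n : ZMod (2 * k)))‖ ^ 2) * h5

/-- The constant of proportionality is almost positive: by Fourier inversion, the positive number
`Ψ_0(0) / Ω` is the sum of the Fourier coefficients on the circle `q = 0`, of which only the one with
index `0` is not exponentially small. -/
theorem norm_thetaCoeff_basis_sub_le (hΩ : h.sq Ω D.μ = 1) (hk : 0 < k) (hΨ : D.IsThetaBasis Ω k Ψ) :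
    ‖D.thetaCoeff k (fun y => HalfFormLine.coordL Ω ((Ψ 0).1 y)) 0
        - (((k : ℝ) / (2 * Real.pi)) ^ (1 / 4 : ℝ) : ℝ)‖
      ≤ 2 * (((k : ℝ) / (2 * Real.pi)) ^ (1 / 4 : ℝ) * (Real.exp (-(Real.pi * (h.modulus Ω).im * k)) *
        ∑' n : ℤ, Real.exp (-(Real.pi * (h.modulus Ω).im / 2 * |(n : ℝ)|)))) := by
  have hπ := Real.pi_pos
  have him := h.modulus_im_pos hΩ
  have hk' : (0 : ℝ) < k := by exact_mod_cast hk
  set u : E → ℂ := fun y => HalfFormLine.coordL Ω ((Ψ 0).1 y) with hu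
  have hmem : u ∈ D.holSections ℂ k := coordL_comp_mem (HalfFormLine.coordL Ω) (Ψ 0).2
  have hβ := norm_thetaCoeff_basis hΩ hk hΨ
  rw [← hu] at hβ
  set β := D.thetaCoeff k u 0 with hβdef
  set B := ((k : ℝ) / (2 * Real.pi)) ^ (1 / 4 : ℝ) with hBdef
  have hB0 : 0 ≤ B := by rw [← hβ]; positivity
  set a := Real.pi * (h.modulus Ω).im with ha
  have ha0 : 0 < a := by positivity
  have hψ : ContDiff ℝ ∞ (fun _ : ℝ => (0 : ℝ)) := contDiff_const
  set G := D.chart (fun _ : ℝ => (0 : ℝ)) k u with hG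
  have hGc : Continuous G := (contDiff_chart hψ k hmem.1).continuous
  set c : ℤ → ℂ := fun n => Complex.exp (2 * Real.pi * Complex.I * (k : ℝ) * h.modulus Ω *
        (((0 - n / (2 * k)) ^ 2 : ℝ) : ℂ)) * D.thetaCoeff k u n with hc
  -- the nonzero Fourier coefficients of `Ψ 0` on the circle `q = 0` have index `2kj` and are small for
  -- `j ≠ 0`
  have hcn : ∀ n : ℤ, n ≠ 0 → ‖c n‖ ≤ B * Real.exp (-(a * k)) * Real.exp (-(a / 2 * |(n : ℝ)|)) := by
    intro n hn
    by_cases hz : ((n : ℤ) : ZMod (2 * k)) = 0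
    · rw [ZMod.intCast_zmod_eq_zero_iff_dvd] at hz
      obtain ⟨j, hj⟩ := hz
      have hj0 : j ≠ 0 := by rintro rfl; simp at hj; exact hn hj
      have hj1 : (1 : ℝ) ≤ |(j : ℝ)| := by exact_mod_cast Int.one_le_abs hj0
      have hnj : (n : ℝ) = 2 * k * j := by rw [hj]; push_cast; ring
      have h4 := thetaCoeff_add_mul k hk hmem 0 j
      rw [zero_add] at h4
      have h5 : D.thetaCoeff k u n = β := by rw [hj, hβdef, ← h4]; push_cast; rfl
      simp only [hc]
      rw [norm_mul, norm_gaussian_modulus, h5, hβ, mul_comm, mul_assoc B, ← Real.exp_add]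
      refine mul_le_mul_of_nonneg_left (Real.exp_le_exp.2 ?_) hB0
      have h6 : |(n : ℝ)| = 2 * k * |(j : ℝ)| := by
        rw [hnj, abs_mul, abs_of_pos (by positivity)]
      have h7 : (0 - (n : ℝ) / (2 * k)) ^ 2 = |(j : ℝ)| ^ 2 := by
        rw [hnj, sq_abs]
        field_simp
        ring
      rw [h6, h7, ha]
      have h8 : |(j : ℝ)| + 1 ≤ 2 * |(j : ℝ)| ^ 2 := by nlinarith
      have h9 : 0 < Real.pi * (h.modulus Ω).im * k := by positivity
      nlinarith
    · have : c n = 0 := by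
        simp only [hc]
        rw [thetaCoeff_basis_zero hk hΨ _ hz, mul_zero]
      rw [this, norm_zero]
      positivity
  have hsum := summable_exp_neg_mul_abs_int (half_pos ha0)
  have hcs : Summable c := by
    refine Summable.of_norm_bounded_eventually ((hsum.mul_left (B * Real.exp (-(a * k))))) ?_
    rw [Filter.eventually_cofinite]
    refine (Set.finite_singleton (0 : ℤ)).subset fun n hn => ?_
    by_contra hn0
    exact hn (hcn n hn0)
  have hF := hasSum_fourier_of_summable (f := fun v : ℝ => G (0, v)) (a := -(1 / 2)) (c := c) (x := 0)
    (by fun_prop) ?_ ?_ hcs ⟨by norm_num, by norm_num⟩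
  · simp only [Complex.ofReal_zero, mul_zero, neg_zero, Complex.exp_zero, mul_one] at hF
    obtain ⟨r, hr, hr0⟩ := hΨ.normalized
    have hG0 : G (0, 0) = r := by
      have : D.pt 0 0 = 0 := by simp [pt]
      rw [hG, chart, hu]
      simp only [add_zero, this, hr0, HalfFormLine.coordL_smul (h.ne_zero_of_sq hΩ)]
      simp
    have hc0 : c 0 = β := by
      simp [hc, hβdef]
    have h1 : HasSum (fun n : ℤ => if n = 0 then 0 else c n) (r - β) := by
      have h0 := hF.update 0 0
      rw [hG0, hc0, zero_sub, neg_add_eq_sub] at h0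
      have h1 : (fun n : ℤ => if n = 0 then 0 else c n) = Function.update (fun n => c n) 0 0 := by
        funext n
        by_cases hn : n = 0
        · rw [hn]; simp
        · simp [hn]
      rw [h1]
      exact h0
    have h2 : ‖(r : ℂ) - β‖ ≤ B * Real.exp (-(a * k)) * ∑' n : ℤ, Real.exp (-(a / 2 * |(n : ℝ)|)) := by
      rw [← h1.tsum_eq]
      refine tsum_of_norm_bounded (hsum.hasSum.mul_left _) fun n => ?_
      split_ifs with hn
      · rw [norm_zero]; positivity
      · exact hcn n hn
    -- `r` is positive and the modulus of `β` is `B`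
    have h3 : ‖(r : ℂ) - B‖ ≤ ‖(r : ℂ) - β‖ := by
      rw [← Complex.ofReal_sub, Complex.norm_real, ← hβ]
      have := abs_norm_sub_norm_le (r : ℂ) β
      rwa [Complex.norm_of_nonneg hr.le] at this
    have h4 : β - (B : ℂ) = ((r : ℂ) - B) - ((r : ℂ) - β) := by ring
    rw [h4]
    refine (norm_sub_le _ _).trans ?_
    rw [← mul_assoc]
    linarith
  · have := chart_add_one hmem (fun _ => (0 : ℝ)) 0 (-(1 / 2))
    simp only [Complex.ofReal_zero, mul_zero, Complex.exp_zero, one_mul] at this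
    exact this.symm
  · intro n
    rw [show -(1 / 2 : ℝ) + 1 = 1 / 2 by norm_num]
    have h1 := fiberCoeff_eq_fourier (fun _ => (0 : ℝ)) hk G n 0
    rw [hG, fiberCoeff_chart hΩ hψ hk hmem] at h1
    simp only [Complex.ofReal_zero, mul_zero, neg_zero, Complex.exp_zero, mul_one, zero_mul, one_mul] at h1
    exact h1

end Basis

end QuantumTorus

/-! ### Sections which are flat and holomorphic along the graph -/

/-- Smooth logarithm of `1 + w`, divided by `w`. -/
theorem exists_smooth_log_division : ∃ l : ℂ → ℂ, ContDiffOn ℝ ∞ l (Metric.ball 0 1) ∧ l 0 = 1 ∧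
    ∀ w ∈ Metric.ball (0 : ℂ) 1, Complex.exp (w * l w) = 1 + w := by
  set g : ℂ → ℂ := fun w => Complex.log (1 + w) with hg
  have hslit : ∀ w ∈ Metric.ball (0 : ℂ) 1, 1 + w ∈ Complex.slitPlane := fun w hw =>
    Complex.mem_slitPlane_of_norm_lt_one (by simpa using hw)
  have hgd : ∀ w ∈ Metric.ball (0 : ℂ) 1, HasDerivAt g (1 + w)⁻¹ w := fun w hw => by
    have := ((hasDerivAt_id w).const_add 1).clog (hslit w hw)
    simpa using this
  have h0 : (0 : ℂ) ∈ Metric.ball (0 : ℂ) 1 := Metric.mem_ball_self one_pos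
  have hd : DifferentiableOn ℂ (dslope g 0) (Metric.ball 0 1) :=
    (Complex.differentiableOn_dslope (Metric.ball_mem_nhds _ one_pos)).2 fun w hw =>
      (hgd w hw).differentiableAt.differentiableWithinAt
  refine ⟨dslope g 0, ?_, ?_, fun w hw => ?_⟩
  · exact (hd.contDiffOn Metric.isOpen_ball).restrict_scalars ℝ
  · rw [dslope_same, (hgd 0 h0).deriv]
    simp
  · have h1 := sub_smul_dslope g 0 w
    have h2 : g 0 = 0 := by simp [hg]
    rw [h2, sub_zero, sub_zero, smul_eq_mul] at h1
    rw [h1, hg]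
    refine Complex.exp_log fun h3 => ?_
    have := hslit w hw
    rw [h3] at this
    exact Complex.zero_notMem_slitPlane this

theorem re_two_pi_I_div_pos {w : ℂ} (hw : 0 < w.im) : 0 < (2 * Real.pi * Complex.I / w).re := by
  have h0 : w ≠ 0 := by rintro rfl; simp at hw
  have h1 : 0 < Complex.normSq w := Complex.normSq_pos.2 h0
  rw [Complex.div_re]
  simp
  have := Real.pi_pos
  positivity

theorem pderiv_congr {e : ℝ × ℝ} {f g : ℝ × ℝ → ℂ} {z : ℝ × ℝ} (hfg : f =ᶠ[𝓝 z] g) :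
    pderiv e f z = pderiv e g z := by
  rw [pderiv, pderiv, hfg.fderiv_eq]

theorem hasDerivAt_pderiv_fst {f : ℝ × ℝ → ℂ} {q v : ℝ} (hf : DifferentiableAt ℝ f (q, v)) :
    HasDerivAt (fun q => f (q, v)) (pderiv (1, 0) f (q, v)) q :=
  hf.hasFDerivAt.comp_hasDerivAt q ((hasDerivAt_id q).prodMk (hasDerivAt_const q v))

theorem hasDerivAt_pderiv_snd {f : ℝ × ℝ → ℂ} {q v : ℝ} (hf : DifferentiableAt ℝ f (q, v)) :
    HasDerivAt (fun v => f (q, v)) (pderiv (0, 1) f (q, v)) v :=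
  hf.hasFDerivAt.comp_hasDerivAt v ((hasDerivAt_const v q).prodMk (hasDerivAt_id v))

/-- A smooth function which equals `1` along `v = 0` and which is annihilated to first order there by
the `∂̄`-operator is Gaussian transversally to `v = 0`. -/
theorem exists_gaussian_form {O : Set (ℝ × ℝ)} (hO : IsOpen O) {q' : ℝ} (hq' : (q', (0 : ℝ)) ∈ O)
    {Λ : ℝ → ℂ} (hΛ : ∀ q, 0 < (Λ q).im) {B : ℝ × ℝ → ℂ} (hB : ContDiffOn ℝ ∞ B O)
    (hB1 : ∀ q : ℝ, (q, (0 : ℝ)) ∈ O → B (q, 0) = 1)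
    (hD : ∀ q : ℝ, (q, (0 : ℝ)) ∈ O → pderiv (1, 0) B (q, 0) - Λ q * pderiv (0, 1) B (q, 0) = 0)
    (hD' : ∀ q : ℝ, (q, (0 : ℝ)) ∈ O → HasDerivAt (fun v : ℝ => pderiv (1, 0) B (q, v)
      - Λ q * pderiv (0, 1) B (q, v) - 4 * Real.pi * Complex.I * v * B (q, v)) 0 0) :
    ∃ O' : Set (ℝ × ℝ), IsOpen O' ∧ (q', (0 : ℝ)) ∈ O' ∧ O' ⊆ O ∧ ∃ W : ℝ × ℝ → ℂ,
      ContDiffOn ℝ ∞ W O' ∧ (∀ z ∈ O', 0 < (W z).re) ∧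
      (∀ q : ℝ, (q, (0 : ℝ)) ∈ O' → W (q, 0) = 2 * Real.pi * Complex.I / Λ q) ∧
      ∀ z ∈ O', B z = Complex.exp (-((z.2 : ℂ) ^ 2 * W z)) := by
  have hΛ0 : ∀ q, Λ q ≠ 0 := fun q h0 => by have := hΛ q; rw [h0] at this; simp at this
  obtain ⟨G, hG, -, O₁, hO₁, hqO₁, hO₁O, hGB⟩ :=
    exists_smooth_extension isCompact_singleton hO (singleton_subset_iff.2 hq') hB
  rw [singleton_subset_iff] at hqO₁
  obtain ⟨B₁, hB₁, hB₁e⟩ := exists_smooth_division hG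
  obtain ⟨B₂, hB₂, hB₂e⟩ := exists_smooth_division hB₁
  have hev : ∀ z ∈ O₁, G =ᶠ[𝓝 z] B := fun z hz => by
    filter_upwards [hO₁.mem_nhds hz] with w hw using hGB hw
  have hGd : Differentiable ℝ G := hG.differentiable (by simp)
  have hG1 : ∀ q : ℝ, (q, (0 : ℝ)) ∈ O₁ → G (q, 0) = 1 := fun q hq => by
    rw [hGB hq, hB1 q (hO₁O hq)]
  have hnear : ∀ q : ℝ, (q, (0 : ℝ)) ∈ O₁ → ∀ᶠ s in 𝓝 q, (s, (0 : ℝ)) ∈ O₁ := fun q hq =>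
    (by fun_prop : Continuous fun s : ℝ => (s, (0 : ℝ))).continuousAt.eventually (hO₁.mem_nhds hq)
  -- the equation along `v = 0` kills the linear term in `v`
  have hB₁0 : ∀ q : ℝ, (q, (0 : ℝ)) ∈ O₁ → B₁ (q, 0) = 0 := by
    intro q hq
    have h1 := hD q (hO₁O hq)
    rw [← pderiv_congr (hev _ hq), ← pderiv_congr (hev _ hq)] at h1
    have h2 : pderiv (1, 0) G (q, 0) = 0 := by
      refine (hasDerivAt_pderiv_fst (hGd (q, 0))).unique ?_
      refine (hasDerivAt_const q (1 : ℂ)).congr_of_eventuallyEq ?_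
      filter_upwards [hnear q hq] with s hs using hG1 s hs
    have h3 : pderiv (0, 1) G (q, 0) = B₁ (q, 0) := by
      refine (hasDerivAt_pderiv_snd (hGd (q, 0))).unique ?_
      have h4 := ((hasDerivAt_id (0 : ℝ)).ofReal_comp.mul (hasDerivAt_pderiv_snd (q := q) (v := 0)
        (hB₁.differentiable (by simp) _))).const_add (G (q, 0))
      simp only [id] at h4
      refine (h4.congr_deriv ?_).congr_of_eventuallyEq (Eventually.of_forall fun v => hB₁e q v)
      simp
    rw [h2, h3, zero_sub, neg_eq_zero] at h1
    exact (mul_eq_zero.1 h1).resolve_left (hΛ0 q)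
  have hGe : ∀ q v : ℝ, (q, (0 : ℝ)) ∈ O₁ → G (q, v) = 1 + (v : ℂ) ^ 2 * B₂ (q, v) := by
    intro q v hq
    rw [hB₁e q v, hB₂e q v, hG1 q hq, hB₁0 q hq]
    ring
  -- the equation to first order in `v` determines the quadratic term
  have hB₂0 : ∀ q : ℝ, (q, (0 : ℝ)) ∈ O₁ → B₂ (q, 0) = -(2 * Real.pi * Complex.I / Λ q) := by
    intro q hq
    have hB₂d := hB₂.differentiable (by simp)
    have h1 := hD' q (hO₁O hq)
    set H : ℝ → ℂ := fun v => v * pderiv (1, 0) B₂ (q, v) -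
      Λ q * (2 * B₂ (q, v) + v * pderiv (0, 1) B₂ (q, v)) - 4 * Real.pi * Complex.I * G (q, v) with hH
    have hHd : HasDerivAt H (deriv H 0) 0 := by
      have e1 : ContDiff ℝ ∞ (fun v : ℝ => pderiv (1, 0) B₂ (q, v)) :=
        (contDiff_pderiv hB₂ (1, 0)).comp (by fun_prop)
      have e2 : ContDiff ℝ ∞ (fun v : ℝ => pderiv (0, 1) B₂ (q, v)) :=
        (contDiff_pderiv hB₂ (0, 1)).comp (by fun_prop)
      have e3 : ContDiff ℝ ∞ (fun v : ℝ => B₂ (q, v)) := hB₂.comp (by fun_prop)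
      have e4 : ContDiff ℝ ∞ (fun v : ℝ => G (q, v)) := hG.comp (by fun_prop)
      have e5 : ContDiff ℝ ∞ (fun v : ℝ => (v : ℂ)) := Complex.ofRealCLM.contDiff
      have : ContDiff ℝ ∞ H :=
        ((e5.mul e1).sub (contDiff_const.mul ((contDiff_const.mul e3).add (e5.mul e2)))).sub
          (contDiff_const.mul e4)
      exact (this.differentiable (by simp) 0).hasDerivAt
    have h2 : HasDerivAt (fun v : ℝ => (v : ℂ) * H v) (H 0) 0 := by
      have := (hasDerivAt_id (0 : ℝ)).ofReal_comp.mul hHd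
      refine this.congr_deriv ?_
      simp
    have h3 : H 0 = 0 := by
      refine h2.unique (h1.congr_of_eventuallyEq ?_)
      have hnv : ∀ᶠ v in 𝓝 (0 : ℝ), (q, v) ∈ O₁ :=
        (by fun_prop : Continuous fun v : ℝ => (q, v)).continuousAt.eventually (hO₁.mem_nhds hq)
      filter_upwards [hnv] with v hv
      rw [← pderiv_congr (hev _ hv), ← pderiv_congr (hev _ hv), ← hGB hv]
      have h4 : pderiv (1, 0) G (q, v) = (v : ℂ) ^ 2 * pderiv (1, 0) B₂ (q, v) := by
        refine (hasDerivAt_pderiv_fst (hGd (q, v))).unique ?_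
        have := ((hasDerivAt_pderiv_fst (hB₂d (q, v))).const_mul ((v : ℂ) ^ 2)).const_add 1
        refine this.congr_of_eventuallyEq ?_
        filter_upwards [hnear q hq] with s hs using hGe s v hs
      have h5 : pderiv (0, 1) G (q, v) = 2 * v * B₂ (q, v) + (v : ℂ) ^ 2 * pderiv (0, 1) B₂ (q, v) := by
        refine (hasDerivAt_pderiv_snd (hGd (q, v))).unique ?_
        have := (((hasDerivAt_id v).ofReal_comp.pow 2).mul
          (hasDerivAt_pderiv_snd (hB₂d (q, v)))).const_add 1
        refine (this.congr_deriv ?_).congr_of_eventuallyEq (Eventually.of_forall fun s => hGe q s hq)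
        simp
      rw [h4, h5, hH]
      ring
    simp only [hH, Complex.ofReal_zero, zero_mul, add_zero, zero_sub, hG1 q hq] at h3
    have h6 := hΛ0 q
    field_simp
    linear_combination (-1 / 2 : ℂ) * h3
  -- taking the logarithm of `1 + v² B₂`
  obtain ⟨l, hl, hl0, hle⟩ := exists_smooth_log_division
  set w : ℝ × ℝ → ℂ := fun z => (z.2 : ℂ) ^ 2 * B₂ z with hw
  have hws : ContDiff ℝ ∞ w := by
    have h1 : ContDiff ℝ ∞ (fun z : ℝ × ℝ => (z.2 : ℂ)) := Complex.ofRealCLM.contDiff.comp contDiff_snd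
    exact (h1.pow 2).mul hB₂
  set O₂ : Set (ℝ × ℝ) := (O₁ ∩ (fun z : ℝ × ℝ => (z.1, (0 : ℝ))) ⁻¹' O₁) ∩ w ⁻¹' Metric.ball 0 1 with hO₂
  have hO₂o : IsOpen O₂ := (hO₁.inter (hO₁.preimage (by fun_prop))).inter
    (Metric.isOpen_ball.preimage hws.continuous)
  set W : ℝ × ℝ → ℂ := fun z => -(B₂ z * l (w z)) with hW
  have hWs : ContDiffOn ℝ ∞ W O₂ :=
    (hB₂.contDiffOn.mul (hl.comp hws.contDiffOn fun z hz => hz.2)).neg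
  have hW0 : ∀ q : ℝ, (q, (0 : ℝ)) ∈ O₁ → W (q, 0) = 2 * Real.pi * Complex.I / Λ q := fun q hq => by
    simp [hW, hw, hl0, hB₂0 q hq]
  have hqO₂ : (q', (0 : ℝ)) ∈ O₂ := ⟨⟨hqO₁, hqO₁⟩, by simp [hw]⟩
  refine ⟨O₂ ∩ W ⁻¹' {z | 0 < z.re}, hWs.continuousOn.isOpen_inter_preimage hO₂o
    (isOpen_lt continuous_const Complex.continuous_re), ⟨hqO₂, ?_⟩, fun z hz => hO₁O hz.1.1.1, W,
    hWs.mono inter_subset_left, fun z hz => hz.2, fun q hq => hW0 q hq.1.1.1, fun z hz => ?_⟩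
  · rw [mem_preimage, hW0 q' hqO₁]
    exact re_two_pi_I_div_pos (hΛ q')
  · rw [← hGB hz.1.1.1, hGe z.1 z.2 hz.1.1.2]
    rw [← hle (w z) hz.1.2]
    congr 1
    simp only [hW, hw]
    ring

namespace QuantumTorus

variable {E : Type*} [NormedAddCommGroup E] [NormedSpace ℝ E] {D : QuantumTorus E}
  {δ : Type*} [NormedAddCommGroup δ] [InnerProductSpace ℂ δ] {h : HalfFormLine D δ} {Ω : δ}

theorem contDiff_pt_graph {ψ : ℝ → ℝ} (hψ : ContDiff ℝ ∞ ψ) :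
    ContDiff ℝ ∞ (fun z : ℝ × ℝ => D.pt (ψ z.1 + z.2) z.1) :=
  D.contDiff_pt.comp (((hψ.comp contDiff_fst).add contDiff_snd).prodMk contDiff_fst)

theorem contDiffOn_chart {ψ : ℝ → ℝ} (hψ : ContDiff ℝ ∞ ψ) (k : ℕ) {u : E → ℂ} {S : Set E}
    (hu : ContDiffOn ℝ ∞ u S) :
    ContDiffOn ℝ ∞ (D.chart ψ k u) ((fun z : ℝ × ℝ => D.pt (ψ z.1 + z.2) z.1) ⁻¹' S) := by
  have h1 : ContDiff ℝ ∞ (fun z : ℝ × ℝ => ψ z.1 + z.2) := (hψ.comp contDiff_fst).add contDiff_snd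
  have hof : ContDiff ℝ ∞ (fun t : ℝ => (t : ℂ)) := Complex.ofRealCLM.contDiff
  have h2 : ContDiff ℝ ∞ (fun z : ℝ × ℝ => ((ψ z.1 + z.2 : ℝ) : ℂ)) := hof.comp h1
  have h3 : ContDiff ℝ ∞ (fun z : ℝ × ℝ => (z.1 : ℂ)) := hof.comp contDiff_fst
  refine (hu.comp (contDiff_pt_graph hψ).contDiffOn fun z hz => hz).mul (ContDiff.contDiffOn
    (ContDiff.cexp ?_))
  have h4 := (contDiff_const (c := (2 * Real.pi * Complex.I * k : ℂ))).mul h2 |>.mul h3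
  simpa using h4

theorem contDiffOn_pderiv {f : ℝ × ℝ → ℂ} {O : Set (ℝ × ℝ)} (hO : IsOpen O)
    (hf : ContDiffOn ℝ ∞ f O) (e : ℝ × ℝ) : ContDiffOn ℝ ∞ (pderiv e f) O :=
  (hf.fderiv_of_isOpen hO (m := ∞) (by simp)).clm_apply contDiffOn_const

/-- A section of `L_M` which equals `Θ` on `Γ` and whose `∂̄`-derivative vanishes to first order there
has the form `e^{4πiφ(q)} e^{-v² W(q, v)}` near `Γ`. -/
theorem exists_phase_of_dbar (hΩ : h.sq Ω D.μ = 1) {φ : ℝ → ℝ} (hφ : ContDiff ℝ ∞ φ)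
    {O₁ : Set ℝ} (hO₁ : IsOpen O₁) {S : Set E} (hS : IsOpen S) {e : E → ℂ}
    (he : ContDiffOn ℝ ∞ e S)
    (hΘ : ∀ q ∈ O₁, D.pt (deriv φ q) q ∈ S → e (D.pt (deriv φ q) q)
      = Complex.exp (4 * Complex.I * Real.pi * φ q) * D.flatSection (D.pt (deriv φ q) q))
    (hdb : ∀ q ∈ O₁, D.pt (deriv φ q) q ∈ S → ∀ n : ℕ,
      iteratedFDeriv ℝ n (fun z => D.dbar 1 e z D.μ) (D.pt (deriv φ q) q) = 0)
    {q' : ℝ} (hq' : q' ∈ O₁) (hqS : D.pt (deriv φ q') q' ∈ S) :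
    ∃ O' : Set (ℝ × ℝ), IsOpen O' ∧ (q', (0 : ℝ)) ∈ O' ∧
      (∀ z ∈ O', D.pt (deriv φ z.1 + z.2) z.1 ∈ S) ∧ ∃ W : ℝ × ℝ → ℂ,
      ContDiffOn ℝ ∞ W O' ∧ (∀ z ∈ O', 0 < (W z).re) ∧
      (∀ q : ℝ, (q, (0 : ℝ)) ∈ O' →
        W (q, 0) = 2 * Real.pi * Complex.I / (deriv (deriv φ) q + h.modulus Ω)) ∧
      ∀ z ∈ O', D.chart (deriv φ) 1 e z
        = Complex.exp (4 * Real.pi * Complex.I * φ z.1) * Complex.exp (-((z.2 : ℂ) ^ 2 * W z)) := by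
  set ψ := deriv φ with hψdef
  have hψ : ContDiff ℝ ∞ ψ := (contDiff_infty_iff_deriv.1 hφ).2
  set T := h.modulus Ω with hT
  have him := h.modulus_im_pos hΩ
  set Y : ℝ × ℝ → E := fun z => D.pt (ψ z.1 + z.2) z.1 with hY
  have hYc : Continuous Y := (contDiff_pt_graph hψ).continuous
  set O : Set (ℝ × ℝ) := Y ⁻¹' S ∩ Prod.fst ⁻¹' O₁ with hOdef
  have hO : IsOpen O := (hS.preimage hYc).inter (hO₁.preimage continuous_fst)
  set A := D.chart ψ 1 e with hA
  have hAs : ContDiffOn ℝ ∞ A O := (contDiffOn_chart hψ 1 he).mono inter_subset_left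
  have hAd : ∀ z ∈ O, DifferentiableAt ℝ A z := fun z hz =>
    (hAs.contDiffAt (hO.mem_nhds hz)).differentiableAt (by simp)
  -- `B` is the expression of `e`, divided by its value along the graph
  set ε : ℝ → ℂ := fun q => Complex.exp (-(4 * Real.pi * Complex.I * φ q)) with hε
  have hof : ContDiff ℝ ∞ (fun t : ℝ => (t : ℂ)) := Complex.ofRealCLM.contDiff
  have hεs : ContDiff ℝ ∞ ε := (contDiff_const.mul (hof.comp hφ)).neg.cexp
  have hεd : ∀ q, HasDerivAt ε (-(4 * Real.pi * Complex.I * ψ q) * ε q) q := fun q => by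
    have h1 := ((hφ.differentiable (by simp) q).hasDerivAt.ofReal_comp.const_mul
      (4 * Real.pi * Complex.I)).neg.cexp
    refine h1.congr_deriv ?_
    simp only [hε, hψdef, Pi.neg_apply]
    ring
  set B : ℝ × ℝ → ℂ := fun z => A z * ε z.1 with hB
  have hBs : ContDiffOn ℝ ∞ B O := hAs.mul (hεs.comp contDiff_fst).contDiffOn
  have hBd : ∀ z ∈ O, DifferentiableAt ℝ B z := fun z hz =>
    (hBs.contDiffAt (hO.mem_nhds hz)).differentiableAt (by simp)
  set R : ℝ × ℝ → ℂ := dbarOp ψ T 1 A with hR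
  have hRs : ContDiffOn ℝ ∞ R O := by
    have h1 : ContDiffOn ℝ ∞ (fun z : ℝ × ℝ => ((deriv ψ z.1 : ℝ) : ℂ)) O :=
      (hof.comp ((contDiff_infty_iff_deriv.1 hψ).2.comp contDiff_fst)).contDiffOn
    have h2 : ContDiffOn ℝ ∞ (fun z : ℝ × ℝ => ((ψ z.1 : ℝ) : ℂ)) O :=
      (hof.comp (hψ.comp contDiff_fst)).contDiffOn
    have h3 : ContDiffOn ℝ ∞ (fun z : ℝ × ℝ => (z.2 : ℂ)) O := (hof.comp contDiff_snd).contDiffOn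
    exact ((contDiffOn_pderiv hO hAs _).sub ((h1.add contDiffOn_const).mul
      (contDiffOn_pderiv hO hAs _))).sub ((contDiffOn_const.mul (h2.add h3)).mul hAs)
  have hBR : ∀ z ∈ O, pderiv (1, 0) B z - (deriv ψ z.1 + T) * pderiv (0, 1) B z
      - 4 * Real.pi * Complex.I * z.2 * B z = ε z.1 * R z := by
    rintro ⟨q, v⟩ hz
    have h1 : pderiv (1, 0) B (q, v) = pderiv (1, 0) A (q, v) * ε q
        + A (q, v) * (-(4 * Real.pi * Complex.I * ψ q) * ε q) :=
      (hasDerivAt_pderiv_fst (hBd _ hz)).unique ((hasDerivAt_pderiv_fst (hAd _ hz)).mul (hεd q))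
    have h2 : pderiv (0, 1) B (q, v) = pderiv (0, 1) A (q, v) * ε q :=
      (hasDerivAt_pderiv_snd (hBd _ hz)).unique ((hasDerivAt_pderiv_snd (hAd _ hz)).mul_const (ε q))
    rw [h1, h2, hR, dbarOp, hB]
    push_cast
    ring
  set c : ℂ := 1 / (star T - T) with hc
  have hne : star T - T ≠ 0 := by
    intro h0
    have := congrArg Complex.im h0
    simp at this
    linarith
  have hc0 : c ≠ 0 := one_div_ne_zero hne
  set g : E → ℂ := fun y => D.dbar 1 e y D.μ with hg
  have hgR : ∀ y : E, (D.qCoord y, D.pCoord y - ψ (D.qCoord y)) ∈ O → g y =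
      c * Complex.exp (-(2 * Real.pi * Complex.I * (1 : ℕ) * D.pCoord y * D.qCoord y)) *
        R (D.qCoord y, D.pCoord y - ψ (D.qCoord y)) := by
    intro y hy
    have h1 := h.dbar_eq_dbarOp hΩ (k := 1) (u := e) (x := y) (ψ := ψ) (G := A)
      (hψ.differentiable (by simp) _) (hAd _ hy) (Eventually.of_forall fun y => chart_eq ψ 1 e y) D.μ
    rw [hΩ, star_one, Nat.cast_one] at h1
    rw [hg]
    simp only [h1, Nat.cast_one]
    rw [hc, hR]
  -- the equation holds to first order along the graph
  have hline : ∀ q : ℝ, (q, (0 : ℝ)) ∈ O → R (q, 0) = 0 ∧ pderiv (0, 1) R (q, 0) = 0 := by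
    intro q hq
    set y := D.pt (ψ q) q with hy
    have hz : (D.qCoord y, D.pCoord y - ψ (D.qCoord y)) = (q, (0 : ℝ)) := by simp [hy]
    have hyS : D.pt (ψ q) q ∈ S := by simpa [hY] using hq.1
    have h0 := hdb q hq.2 hyS 0
    have h1 := hdb q hq.2 hyS 1
    have hgy : g y = 0 := by
      rw [← norm_eq_zero, ← norm_iteratedFDeriv_zero (𝕜 := ℝ) (f := g), h0, norm_zero]
    have hR0 : R (q, 0) = 0 := by
      have h2 := hgR y (by rw [hz]; exact hq)
      rw [hgy, hz] at h2
      exact (mul_eq_zero.1 h2.symm).resolve_left (mul_ne_zero hc0 (Complex.exp_ne_zero _))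
    refine ⟨hR0, ?_⟩
    have hRd : DifferentiableAt ℝ R (q, 0) :=
      (hRs.contDiffAt (hO.mem_nhds hq)).differentiableAt (by simp)
    have hmap : ContDiff ℝ ∞ (fun y : E => (D.qCoord y, D.pCoord y - ψ (D.qCoord y))) :=
      D.contDiff_qCoord.prodMk (D.contDiff_pCoord.sub (hψ.comp D.contDiff_qCoord))
    have hgd : DifferentiableAt ℝ g y := by
      have h2 : DifferentiableAt ℝ (fun y : E => c *
          Complex.exp (-(2 * Real.pi * Complex.I * (1 : ℕ) * D.pCoord y * D.qCoord y)) *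
          R (D.qCoord y, D.pCoord y - ψ (D.qCoord y))) y := by
        refine DifferentiableAt.mul ?_ ?_
        · have hp : ContDiff ℝ ∞ (fun y : E => (D.pCoord y : ℂ)) := hof.comp D.contDiff_pCoord
          have hq : ContDiff ℝ ∞ (fun y : E => (D.qCoord y : ℂ)) := hof.comp D.contDiff_qCoord
          have : ContDiff ℝ ∞ (fun y : E => c *
              Complex.exp (-(2 * Real.pi * Complex.I * (1 : ℕ) * D.pCoord y * D.qCoord y))) :=
            contDiff_const.mul (((contDiff_const.mul hp).mul hq).neg.cexp)
          exact this.differentiable (by simp) y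
        · exact DifferentiableAt.comp y (by rw [hz]; exact hRd) (hmap.differentiable (by simp) y)
      refine h2.congr_of_eventuallyEq ?_
      have : ∀ᶠ w in 𝓝 y, (D.qCoord w, D.pCoord w - ψ (D.qCoord w)) ∈ O :=
        hmap.continuous.continuousAt.eventually (by beta_reduce; rw [hz]; exact hO.mem_nhds hq)
      filter_upwards [this] with w hw using hgR w hw
    have hg' : HasFDerivAt g (0 : E →L[ℝ] ℂ) y := by
      have h2 := hgd.hasFDerivAt
      have h3 : fderiv ℝ g y = 0 := by
        rw [← norm_eq_zero, ← norm_iteratedFDeriv_one (𝕜 := ℝ) (f := g), h1, norm_zero]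
      rwa [h3] at h2
    have hYd : HasDerivAt (fun v : ℝ => Y (q, v)) (D.pt 1 0) 0 := by
      have h2 : HasDerivAt (fun v : ℝ => (ψ q + v) • D.μ + q • D.lam) ((1 : ℝ) • D.μ) 0 :=
        (((hasDerivAt_id (0 : ℝ)).const_add (ψ q)).smul_const D.μ).add_const _
      refine h2.congr_deriv ?_
      simp [pt]
    have hY0 : Y (q, 0) = y := by simp [hY, hy]
    have hgY : HasDerivAt (fun v : ℝ => g (Y (q, v))) 0 0 := by
      have := HasFDerivAt.comp_hasDerivAt (0 : ℝ) (f := fun v : ℝ => Y (q, v)) (by rw [hY0]; exact hg') hYd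
      exact this
    have hRv := hasDerivAt_pderiv_snd hRd
    have hEd : DifferentiableAt ℝ (fun v : ℝ => c *
        Complex.exp (-(2 * Real.pi * Complex.I * (1 : ℕ) * ((ψ q + v : ℝ) : ℂ) * q))) 0 := by
      have h2 : ContDiff ℝ ∞ (fun v : ℝ => ((ψ q + v : ℝ) : ℂ)) :=
        hof.comp (contDiff_const.add contDiff_id)
      have : ContDiff ℝ ∞ (fun v : ℝ => c *
          Complex.exp (-(2 * Real.pi * Complex.I * (1 : ℕ) * ((ψ q + v : ℝ) : ℂ) * q))) :=
        contDiff_const.mul (((contDiff_const.mul h2).mul contDiff_const).neg.cexp)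
      exact this.differentiable (by simp) 0
    have h5 := hEd.hasDerivAt.mul hRv
    have h6 := h5.unique (hgY.congr_of_eventuallyEq (by
      have : ∀ᶠ v in 𝓝 (0 : ℝ), (q, v) ∈ O :=
        (by fun_prop : Continuous fun v : ℝ => (q, v)).continuousAt.eventually (hO.mem_nhds hq)
      filter_upwards [this] with v hv
      have := hgR (Y (q, v)) (by simpa [hY] using hv)
      rw [this]
      simp [hY]))
    rw [hR0, mul_zero, zero_add] at h6
    exact (mul_eq_zero.1 h6).resolve_left (mul_ne_zero hc0 (Complex.exp_ne_zero _))
  have hqO : (q', (0 : ℝ)) ∈ O := ⟨by simpa [hY] using hqS, hq'⟩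
  obtain ⟨O', hO', hqO', hO'O, W, hW1, hW2, hW3, hW4⟩ := exists_gaussian_form hO hqO
    (Λ := fun q => deriv ψ q + T) (fun q => by simpa using him) hBs
    (fun q hq => by
      have hyS : D.pt (ψ q) q ∈ S := by simpa [hY] using hq.1
      simp only [hB, hA, chart, add_zero, hΘ q hq.2 hyS, flatSection, D.pCoord_pt, D.qCoord_pt, hε,
        Complex.ofReal_zero]
      rw [← Complex.exp_add, ← Complex.exp_add, ← Complex.exp_add, ← Complex.exp_zero]
      congr 1
      push_cast
      ring)
    (fun q hq => by
      have := hBR _ hq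
      simp only [Complex.ofReal_zero, mul_zero, zero_mul, sub_zero, (hline q hq).1] at this
      exact this)
    (fun q hq => by
      have hRd : DifferentiableAt ℝ R (q, 0) :=
        (hRs.contDiffAt (hO.mem_nhds hq)).differentiableAt (by simp)
      have h1 := (hasDerivAt_pderiv_snd hRd).const_mul (ε q)
      rw [(hline q hq).2, mul_zero] at h1
      refine h1.congr_of_eventuallyEq ?_
      have : ∀ᶠ v in 𝓝 (0 : ℝ), (q, v) ∈ O :=
        (by fun_prop : Continuous fun v : ℝ => (q, v)).continuousAt.eventually (hO.mem_nhds hq)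
      filter_upwards [this] with v hv using hBR (q, v) hv)
  refine ⟨O', hO', hqO', fun z hz => (hO'O hz).1, W, hW1, hW2, hW3, fun z hz => ?_⟩
  rw [← hW4 z hz]
  simp only [hB, hε]
  rw [mul_left_comm, ← Complex.exp_add, add_neg_cancel, Complex.exp_zero, mul_one]

/-- Outside of the microsupport, the decay is uniform on compact sets. -/
theorem exists_bound_of_disjoint_microsupport (ξ : (k : ℕ+) → D.holSections δ k) {K : Set D.M}
    (hK : IsCompact K) (hd : ∀ x ∈ K, x ∉ D.microsupport ξ) (n : ℕ) :
    ∃ C : ℝ, ∀ (k : ℕ+) (y : E), D.proj y ∈ K → ‖(ξ k).1 y‖ ≤ C * (k : ℝ) ^ (-(n : ℝ)) := by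
  refine hK.induction_on (p := fun K => ∃ C : ℝ, ∀ (k : ℕ+) (y : E), D.proj y ∈ K →
    ‖(ξ k).1 y‖ ≤ C * (k : ℝ) ^ (-(n : ℝ))) ⟨0, fun k y hy => hy.elim⟩
    (fun s t hst ⟨C, hC⟩ => ⟨C, fun k y hy => hC k y (hst hy)⟩) ?_ ?_
  · rintro s t ⟨C, hC⟩ ⟨C', hC'⟩
    refine ⟨max C C', fun k y hy => ?_⟩
    have hk : (0 : ℝ) ≤ (k : ℝ) ^ (-(n : ℝ)) := by positivity
    rcases hy with hy | hy
    · exact (hC k y hy).trans (mul_le_mul_of_nonneg_right (le_max_left _ _) hk)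
    · exact (hC' k y hy).trans (mul_le_mul_of_nonneg_right (le_max_right _ _) hk)
  · intro x hx
    obtain ⟨W, hW, C, hC⟩ := not_not.1 (hd x hx)
    exact ⟨W, mem_nhdsWithin_of_mem_nhds hW, C n, fun k y hy => hC n k y hy⟩

theorem graphSection_graphPoint {φ : ℝ → ℝ} {q₀ q₁ q : ℝ} (hq' : q₁ ≤ q₀ + 1) (hq : q ∈ Ioo q₀ q₁) :
    D.graphSection φ q₀ (D.graphPoint φ q)
      = Complex.exp (4 * Complex.I * Real.pi * φ q) * D.flatSection (D.graphPoint φ q) := by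
  have h1 : D.qCoord (D.graphPoint φ q) = q := D.qCoord_pt _ _
  have h2 : ⌊q - q₀⌋ = 0 := Int.floor_eq_zero_iff.2 ⟨by linarith [hq.1], by linarith [hq.2]⟩
  simp only [graphSection, h1, h2, Int.cast_zero, sub_zero, sub_self, map_zero, LinearMap.zero_apply,
    Complex.ofReal_zero, mul_zero, zero_div, Complex.exp_zero, one_mul]

theorem mem_graph_iff {φ : ℝ → ℝ} {q₀ q₁ q v : ℝ} (hq' : q₁ ≤ q₀ + 1) (hq : q ∈ Ioo q₀ q₁) :
    D.proj (D.pt (deriv φ q + v) q) ∈ D.graph φ q₀ q₁ ↔ ∃ m : ℤ, v = m := by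
  constructor
  · rintro ⟨q', hq'', he⟩
    obtain ⟨m, n, hmn⟩ := D.proj_eq_proj_iff.1 he
    rw [graphPoint, ← pt, D.pt_add] at hmn
    have h1 := congrArg D.qCoord hmn
    have h2 := congrArg D.pCoord hmn
    simp only [D.qCoord_pt, D.pCoord_pt] at h1 h2
    have hn : n = 0 := by
      have h3 : |(n : ℝ)| < 1 := by
        rw [abs_lt]
        constructor <;> linarith [hq.1, hq.2, hq''.1, hq''.2]
      have : |n| < 1 := by exact_mod_cast h3
      exact Int.abs_lt_one_iff.1 this
    rw [hn, Int.cast_zero, add_zero] at h1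
    rw [h1] at h2
    exact ⟨-m, by push_cast; linarith⟩
  · rintro ⟨m, rfl⟩
    refine ⟨q, hq, D.proj_eq_proj_iff.2 ⟨-m, 0, ?_⟩⟩
    rw [D.pt_add]
    simp [graphPoint, pt]

theorem proj_pt_mem_strip {q₀ q₁ q : ℝ} (p : ℝ) (hq : q ∈ Ioo q₀ q₁) :
    D.proj (D.pt p q) ∈ D.strip q₀ q₁ := ⟨p, q, hq, rfl⟩

end QuantumTorus

/-! ### Asymptotic expansions along `q = m / 2k` -/

/-- `c k (2kq) = k ^ s e^{4πikφ(q)} ∑ k^{-l} g_l(q) + O(k^{-∞})`, uniformly for `q ∈ I ∩ (1/2k)ℤ`. -/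
def HasExpansionOn (c : ℕ+ → ℤ → ℂ) (φ : ℝ → ℝ) (s : ℝ) (I : Set ℝ) (g : ℕ → ℝ → ℂ) : Prop :=
  ∀ L : ℕ, ∃ C : ℝ, ∀ (k : ℕ+) (m : ℤ) (q : ℝ), q ∈ I → 2 * (k : ℝ) * q = m →
    ‖c k m - (((k : ℝ) ^ s : ℝ) : ℂ) * Complex.exp (4 * Complex.I * Real.pi * k * φ q)
      * ∑ l ∈ Finset.range L, ((k : ℂ) ^ l)⁻¹ * g l q‖ ≤ C * (k : ℝ) ^ (s - L)

theorem PNat.one_le_cast_real (k : ℕ+) : (1 : ℝ) ≤ (k : ℝ) := Nat.one_le_cast.2 k.pos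

theorem norm_exp_phase (k t : ℝ) : ‖Complex.exp (4 * Complex.I * Real.pi * k * t)‖ = 1 :=
  QuantumTorus.norm_exp_imaginary _ (4 * Real.pi * k * t) (by push_cast; ring)

namespace HasExpansionOn

variable {c c' : ℕ+ → ℤ → ℂ} {φ φ' : ℝ → ℝ} {s : ℝ} {I J : Set ℝ} {g g' : ℕ → ℝ → ℂ}

theorem mono (h : HasExpansionOn c φ s J g) (hIJ : I ⊆ J) : HasExpansionOn c φ s I g := fun L => by
  obtain ⟨C, hC⟩ := h L
  exact ⟨C, fun k m q hq => hC k m q (hIJ hq)⟩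

theorem congr (h : HasExpansionOn c φ s I g) (hφ : ∀ q ∈ I, φ q = φ' q)
    (hg : ∀ l, ∀ q ∈ I, g l q = g' l q) : HasExpansionOn c φ' s I g' := fun L => by
  obtain ⟨C, hC⟩ := h L
  refine ⟨C, fun k m q hq hm => ?_⟩
  have := hC k m q hq hm
  rw [hφ q hq, Finset.sum_congr rfl fun l _ => by rw [hg l q hq]] at this
  exact this

theorem union (h : HasExpansionOn c φ s I g) (h' : HasExpansionOn c φ s J g) :
    HasExpansionOn c φ s (I ∪ J) g := fun L => by
  obtain ⟨C, hC⟩ := h L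
  obtain ⟨C', hC'⟩ := h' L
  refine ⟨max C C', fun k m q hq hm => ?_⟩
  have hk : (0 : ℝ) ≤ (k : ℝ) ^ (s - L) := by positivity
  rcases hq with hq | hq
  · exact (hC k m q hq hm).trans (mul_le_mul_of_nonneg_right (le_max_left _ _) hk)
  · exact (hC' k m q hq hm).trans (mul_le_mul_of_nonneg_right (le_max_right _ _) hk)

theorem of_isCompact {U K : Set ℝ} (hK : IsCompact K) (hKU : K ⊆ U)
    (h : ∀ q ∈ U, ∃ O, IsOpen O ∧ q ∈ O ∧ HasExpansionOn c φ s O g) : HasExpansionOn c φ s K g := by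
  refine hK.induction_on (p := fun K => HasExpansionOn c φ s K g) (fun L => ⟨0, fun k m q hq => hq.elim⟩)
    (fun s t hst ht => ht.mono hst) (fun s t hs ht => hs.union ht) fun q hq => ?_
  obtain ⟨O, hO, hqO, hexp⟩ := h q (hKU hq)
  exact ⟨O, mem_nhdsWithin_of_mem_nhds (hO.mem_nhds hqO), hexp⟩

/-- The coefficients of an asymptotic expansion are unique. -/
theorem unique (hI : IsOpen I) (hg : ∀ l, ContinuousOn (g l) I) (hg' : ∀ l, ContinuousOn (g' l) I)
    (h : HasExpansionOn c φ s I g) (h' : HasExpansionOn c φ s I g') (l : ℕ) :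
    ∀ q ∈ I, g l q = g' l q := by
  have hrat : ∀ r : ℚ, (r : ℝ) ∈ I → ∀ l, g l r = g' l r := by
    intro r hr l
    induction l using Nat.strong_induction_on with
    | _ l ih =>
    obtain ⟨C, hC⟩ := h (l + 1)
    obtain ⟨C', hC'⟩ := h' (l + 1)
    have hden : (r.den : ℝ) ≠ 0 := by exact_mod_cast r.den_ne_zero
    -- the indices `k` divisible by the denominator of `r`
    have key : ∀ t : ℕ, ‖g l r - g' l r‖ ≤ (C + C') * (1 / ((t : ℝ) + 1)) := by
      intro t
      set k : ℕ+ := ⟨r.den * (t + 1), Nat.mul_pos r.den_pos (Nat.succ_pos t)⟩ with hk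
      have hkc : ((k : ℕ) : ℝ) = r.den * (t + 1) := by simp [hk]
      have hk1 := PNat.one_le_cast_real k
      have hk0 : (0 : ℝ) < k := by linarith
      have hm : 2 * (k : ℝ) * (r : ℝ) = ((2 * r.num * (t + 1) : ℤ) : ℝ) := by
        have hr' : (r : ℝ) * r.den = r.num := by exact_mod_cast Rat.mul_den_eq_num r
        rw [hkc]
        push_cast
        rw [← hr']
        ring
      have h1 := hC k _ r hr hm
      have h2 := hC' k _ r hr hm
      have h3 := (norm_sub_le _ _).trans (add_le_add h2 h1)
      rw [sub_sub_sub_cancel_left, ← mul_sub, ← Finset.sum_sub_distrib, norm_mul, norm_mul,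
        Finset.sum_range_succ, Finset.sum_eq_zero, zero_add, ← mul_sub, norm_mul] at h3
      · have h4 := norm_exp_phase k (φ r)
        rw [Complex.ofReal_natCast] at h4
        rw [h4, mul_one, norm_inv, norm_pow, Complex.norm_natCast, Complex.norm_real,
          Real.norm_of_nonneg (by positivity), ← add_mul, Real.rpow_sub hk0, Real.rpow_natCast,
          pow_succ] at h3
        have hs : 0 < (k : ℝ) ^ s := by positivity
        have hkl : 0 < (k : ℝ) ^ l := by positivity
        have h5 : ‖g l r - g' l r‖ ≤ (C + C') * (1 / (k : ℝ)) := by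
          refine le_of_mul_le_mul_left ?_ (mul_pos hs (inv_pos.2 hkl))
          calc _ = (k : ℝ) ^ s * (((k : ℝ) ^ l)⁻¹ * ‖g l r - g' l r‖) := by ring
            _ ≤ _ := h3
            _ = _ := by field_simp; ring
        have h6 : 0 ≤ C + C' := by
          have := (norm_nonneg _).trans h5
          exact nonneg_of_mul_nonneg_left this (by positivity)
        refine h5.trans (mul_le_mul_of_nonneg_left ?_ h6)
        rw [hkc]
        have : (1 : ℝ) ≤ r.den := by exact_mod_cast r.den_pos
        refine one_div_le_one_div_of_le (by positivity) ?_
        nlinarith [(Nat.cast_nonneg t : (0 : ℝ) ≤ t)]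
      · intro i hi
        rw [ih i (Finset.mem_range.1 hi), sub_self]
    have hlim : Tendsto (fun t : ℕ => (C + C') * (1 / ((t : ℝ) + 1))) atTop (𝓝 0) := by
      simpa using tendsto_one_div_add_atTop_nhds_zero_nat.const_mul (C + C')
    exact sub_eq_zero.1 (norm_le_zero_iff.1 (ge_of_tendsto' hlim key))
  -- density of the rational points
  intro q hq
  have hcl : q ∈ closure (I ∩ range ((↑) : ℚ → ℝ)) := by
    rw [mem_closure_iff_nhds]
    intro t ht
    obtain ⟨x, hx1, hx2⟩ := Rat.denseRange_cast (𝕜 := ℝ) |>.inter_nhds_nonempty (inter_mem ht (hI.mem_nhds hq))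
    exact ⟨x, hx2.1, hx2.2, hx1⟩
  have hne : (𝓝[I ∩ range ((↑) : ℚ → ℝ)] q).NeBot := mem_closure_iff_nhdsWithin_neBot.1 hcl
  have t1 := ((hg l q hq).mono (inter_subset_left (t := range ((↑) : ℚ → ℝ)))).tendsto
  have t2 := ((hg' l q hq).mono (inter_subset_left (t := range ((↑) : ℚ → ℝ)))).tendsto
  refine tendsto_nhds_unique (t1.congr' ?_) t2
  filter_upwards [self_mem_nhdsWithin] with x hx
  obtain ⟨hxI, r, rfl⟩ := hx
  exact hrat r hxI l

/-- Local asymptotic expansions glue. -/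
theorem exists_of_local {U : Set ℝ}
    (h : ∀ q ∈ U, ∃ O, IsOpen O ∧ q ∈ O ∧ O ⊆ U ∧ ∃ g : ℕ → ℝ → ℂ, (∀ l, ContDiffOn ℝ ∞ (g l) O) ∧
      HasExpansionOn c φ s O g) :
    ∃ g : ℕ → ℝ → ℂ, (∀ l, ContDiffOn ℝ ∞ (g l) U) ∧
      ∀ q ∈ U, ∃ O, IsOpen O ∧ q ∈ O ∧ O ⊆ U ∧ HasExpansionOn c φ s O g := by
  choose! O hO hqO hOU g hg hexp using h
  have heq : ∀ q ∈ U, ∀ l, ∀ x ∈ O q, g x l x = g q l x := by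
    intro q hq l x hx
    refine unique ((hO q hq).inter (hO x (hOU q hq hx)))
      (fun l => ((hg x (hOU q hq hx) l).continuousOn).mono inter_subset_right)
      (fun l => ((hg q hq l).continuousOn).mono inter_subset_left)
      ((hexp x (hOU q hq hx)).mono inter_subset_right) ((hexp q hq).mono inter_subset_left) l x
      ⟨hx, hqO x (hOU q hq hx)⟩
  refine ⟨fun l x => g x l x, fun l q hq => ?_, fun q hq => ⟨O q, hO q hq, hqO q hq, hOU q hq, ?_⟩⟩
  · refine ContDiffAt.contDiffWithinAt ?_
    refine ((hg q hq l).contDiffAt ((hO q hq).mem_nhds (hqO q hq))).congr_of_eventuallyEq ?_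
    filter_upwards [(hO q hq).mem_nhds (hqO q hq)] with x hx using heq q hq l x hx
  · exact (hexp q hq).congr (fun _ _ => rfl) fun l x hx => (heq q hq l x hx).symm

/-- A perturbation of size `O(k^{-∞})` does not change the expansion. -/
theorem of_sub_le (h : HasExpansionOn c φ s I g)
    (hc : ∀ n : ℕ, ∃ C : ℝ, ∀ (k : ℕ+) (m : ℤ), ‖c' k m - c k m‖ ≤ C * (k : ℝ) ^ (-(n : ℝ))) :
    HasExpansionOn c' φ s I g := fun L => by
  obtain ⟨C, hC⟩ := h L
  obtain ⟨n, hn⟩ := exists_nat_ge ((L : ℝ) - s)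
  obtain ⟨C', hC'⟩ := hc n
  refine ⟨|C'| + C, fun k m q hq hm => ?_⟩
  refine (norm_sub_le_norm_sub_add_norm_sub _ (c k m) _).trans ?_
  rw [add_mul]
  refine add_le_add ((hC' k m).trans ?_) (hC k m q hq hm)
  refine mul_le_mul (le_abs_self _) (Real.rpow_le_rpow_of_exponent_le (PNat.one_le_cast_real k)
    (by linarith)) (by positivity) (abs_nonneg _)

/-- Multiplication by a constant times a power of `k`. -/
theorem rpow_mul (h : HasExpansionOn c φ s I g) (a : ℂ) (t : ℝ) :
    HasExpansionOn (fun k m => a * (((k : ℝ) ^ t : ℝ) : ℂ) * c k m) φ (s + t) I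
      (fun l q => a * g l q) := fun L => by
  obtain ⟨C, hC⟩ := h L
  refine ⟨‖a‖ * C, fun k m q hq hm => ?_⟩
  have hk0 : (0 : ℝ) < k := by linarith [PNat.one_le_cast_real k]
  have h1 : (((k : ℝ) ^ (s + t) : ℝ) : ℂ) * Complex.exp (4 * Complex.I * Real.pi * k * φ q)
      * ∑ l ∈ Finset.range L, ((k : ℂ) ^ l)⁻¹ * (a * g l q) = a * (((k : ℝ) ^ t : ℝ) : ℂ) *
        ((((k : ℝ) ^ s : ℝ) : ℂ) * Complex.exp (4 * Complex.I * Real.pi * k * φ q)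
          * ∑ l ∈ Finset.range L, ((k : ℂ) ^ l)⁻¹ * g l q) := by
    have h2 : ∑ l ∈ Finset.range L, ((k : ℂ) ^ l)⁻¹ * (a * g l q)
        = a * ∑ l ∈ Finset.range L, ((k : ℂ) ^ l)⁻¹ * g l q := by
      rw [Finset.mul_sum]
      exact Finset.sum_congr rfl fun l _ => by ring
    rw [h2, Real.rpow_add hk0]
    push_cast
    ring
  rw [h1, ← mul_sub, norm_mul, norm_mul, Complex.norm_real, Real.norm_of_nonneg (by positivity)]
  calc _ ≤ ‖a‖ * (k : ℝ) ^ t * (C * (k : ℝ) ^ (s - L)) := by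
        gcongr
        exact hC k m q hq hm
    _ = _ := by
        rw [show s + t - L = (s - L) + t by ring, Real.rpow_add hk0]
        ring

end HasExpansionOn

namespace QuantumTorus

variable {E : Type*} [NormedAddCommGroup E] [NormedSpace ℝ E] {D : QuantumTorus E}
  {δ : Type*} [NormedAddCommGroup δ] [InnerProductSpace ℂ δ] {h : HalfFormLine D δ} {Ω : δ}

/-! ### The Fourier coefficients of a Lagrangian state -/

theorem thetaCoeff_eq_integral_chart {k : ℕ} (hk : 0 < k) {u : E → ℂ} (hu : u ∈ D.holSections ℂ k)
    (ψ : ℝ → ℝ) {m : ℤ} {q : ℝ} (hm : 2 * (k : ℝ) * q = m) :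
    D.thetaCoeff k u m = ∫ v in (-(1 / 2) : ℝ)..(1 / 2), D.chart ψ k u (q, v) := by
  have hk' : (k : ℝ) ≠ 0 := by exact_mod_cast hk.ne'
  have hq : (m : ℝ) / (2 * k) = q := by
    rw [← hm]
    field_simp
  rw [← fiberCoeff_chart_self hk hu ψ m, fiberCoeff, hq]
  simp

/-- Expansion of the Fourier coefficients near a point of `]q₀, q₁[`: away from `Γ`, the section is
negligible on the circle of equation `q = m / 2k`, and Laplace's method applies near `Γ`. -/
theorem exists_local_expansion (hΩ : h.sq Ω D.μ = 1) {q₀ q₁ : ℝ} (hq' : q₁ ≤ q₀ + 1) {φ : ℝ → ℝ}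
    (hφ : ContDiffOn ℝ ∞ φ (Ioo q₀ q₁)) {ξ : (k : ℕ+) → D.holSections δ k} {σ : D.M → δ} {N : ℝ}
    (hL : D.IsLagrangianState ξ (D.strip q₀ q₁) (D.graph φ q₀ q₁) (D.graphSection φ q₀) σ N)
    {x : ℝ} (hx : x ∈ Ioo q₀ q₁) :
    ∃ O, IsOpen O ∧ x ∈ O ∧ O ⊆ Ioo q₀ q₁ ∧ ∃ g : ℕ → ℝ → ℂ, (∀ l, ContDiff ℝ ∞ (g l)) ∧
      (∀ q ∈ O, g 0 q = (((2 * Real.pi) ^ (-(1 / 4 + N)) : ℝ) : ℂ) *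
        ((Real.pi / (2 * Real.pi * Complex.I / (deriv (deriv φ) q + h.modulus Ω))) ^ (1 / 2 : ℂ)
          * HalfFormLine.coordL Ω (σ (D.proj (D.graphPoint φ q))))) ∧
      HasExpansionOn (fun k m => D.thetaCoeff k (fun y => HalfFormLine.coordL Ω ((ξ k).1 y)) m) φ
        (N - 1 / 4) O g := by
  obtain ⟨φ', hφ', -, O₁, hO₁, hxO₁, hO₁I, hφφ⟩ :=
    exists_smooth_extension isCompact_singleton isOpen_Ioo (singleton_subset_iff.2 hx) hφ
  rw [singleton_subset_iff] at hxO₁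
  have hev : ∀ q ∈ O₁, φ' =ᶠ[𝓝 q] φ := fun q hq => by
    filter_upwards [hO₁.mem_nhds hq] with w hw using hφφ hw
  have hd1 : ∀ q ∈ O₁, deriv φ' q = deriv φ q := fun q hq => (hev q hq).deriv_eq
  have hd2 : ∀ q ∈ O₁, deriv (deriv φ') q = deriv (deriv φ) q := fun q hq => (hev q hq).deriv.deriv_eq
  have hgp : ∀ q ∈ O₁, D.pt (deriv φ' q) q = D.graphPoint φ q := fun q hq => by
    rw [hd1 q hq, graphPoint, pt]
  set ψ := deriv φ' with hψdef
  have hψ : ContDiff ℝ ∞ ψ := (contDiff_infty_iff_deriv.1 hφ').2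
  set T := h.modulus Ω with hT
  set Y : ℝ × ℝ → E := fun z => D.pt (ψ z.1 + z.2) z.1 with hY
  have hYc : Continuous Y := (contDiff_pt_graph hψ).continuous
  have hgraph : ∀ q ∈ O₁, D.proj (D.pt (ψ q) q) ∈ D.graph φ q₀ q₁ := fun q hq =>
    ⟨q, hO₁I hq, by rw [hgp q hq]⟩
  obtain ⟨V, hVo, hxV, hVU, e, f, a, he, heq, heΘ, he1, hedb, ⟨hf1, ha, hfa⟩, haσ, hξ⟩ :=
    hL.2 (D.proj (D.graphPoint φ x)) ⟨x, hx, rfl⟩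
  obtain ⟨O', hO', hxO', hO'S, W, hW, hWpos, hW0, hWe⟩ := exists_phase_of_dbar hΩ hφ' hO₁
    (S := D.proj ⁻¹' V) (hVo.preimage D.continuous_proj) he
    (fun q hq hqS => by
      rw [heΘ _ ⟨hgraph q hq, hqS⟩, hgp q hq, graphSection_graphPoint hq' (hO₁I hq), hφφ hq])
    (fun q hq hqS n => hedb _ ⟨hgraph q hq, hqS⟩ D.μ n) hxO₁ (by
      rw [mem_preimage, hgp x hxO₁]; exact hxV)
  -- a compact box around the point
  obtain ⟨r, hr, hrO⟩ := Metric.isOpen_iff.1 (hO'.inter (hO₁.preimage continuous_fst)) (x, (0 : ℝ))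
    ⟨hxO', hxO₁⟩
  set d := min (r / 2) (1 / 4) with hd
  have hd0 : 0 < d := lt_min (half_pos hr) (by norm_num)
  have hd4 : d ≤ 1 / 4 := min_le_right _ _
  have hbox' : Icc (x - d) (x + d) ×ˢ Icc (-d) d ⊆ O' ∩ Prod.fst ⁻¹' O₁ := by
    rintro ⟨q, v⟩ ⟨hq, hv⟩
    refine hrO ?_
    have hdr : d < r := (min_le_left _ _).trans_lt (half_lt_self hr)
    rw [Metric.mem_ball, Prod.dist_eq, max_lt_iff, Real.dist_eq, Real.dist_eq, abs_lt, abs_lt]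
    have h1 := hq.1; have h2 := hq.2; have h3 := hv.1; have h4 := hv.2
    dsimp only at h1 h2 h3 h4 ⊢
    refine ⟨⟨?_, ?_⟩, ?_, ?_⟩ <;> linarith
  have hbox : Icc (x - d) (x + d) ×ˢ Icc (-d) d ⊆ O' := fun z hz => (hbox' hz).1
  have hJ : ∀ q ∈ Icc (x - d) (x + d), q ∈ O₁ := fun q hq =>
    (hbox' (show (q, (0 : ℝ)) ∈ _ from ⟨hq, by constructor <;> simp [hd0.le]⟩)).2
  have hJ0 : ∀ q ∈ Icc (x - d) (x + d), (q, (0 : ℝ)) ∈ O' := fun q hq =>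
    hbox ⟨hq, by constructor <;> simp [hd0.le]⟩
  set A := HalfFormLine.coordL Ω with hA
  have hAs : ContDiff ℝ ∞ A := (A.restrictScalars ℝ).contDiff
  set a' : ℕ → ℝ × ℝ → ℂ := fun l z => A (a l (D.proj (Y z))) with ha'
  set f' : ℕ+ → ℝ × ℝ → ℂ := fun k z => A (f k (D.proj (Y z))) with hf'
  have ha's : ∀ l, ContDiffOn ℝ ∞ (a' l) O' := fun l =>
    hAs.comp_contDiffOn ((ha l).comp (contDiff_pt_graph hψ).contDiffOn hO'S)
  have hf's : ∀ k, ContDiffOn ℝ ∞ (f' k) O' := fun k =>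
    hAs.comp_contDiffOn ((hf1 k).comp (contDiff_pt_graph hψ).contDiffOn hO'S)
  choose P hP hP0 hPe using fun l => exists_laplace_expansion hO' hd0 hbox hW hWpos (ha's l)
  have hKc : IsCompact (Icc (x - d) (x + d) ×ˢ Icc (-d) d) := isCompact_Icc.prod isCompact_Icc
  have hexp := laplace_expansion_of_amplitude_expansion hd0 le_rfl (hW.continuousOn.mono hbox)
    (fun z hz => (hWpos z (hbox hz)).le) (fun l => (ha's l).continuousOn.mono hbox) hPe
    (f := f') (fun k => (hf's k).continuousOn.mono hbox) (fun L => by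
      have hK : IsCompact (D.proj '' (Y '' (Icc (x - d) (x + d) ×ˢ Icc (-d) d))) :=
        (hKc.image hYc).image D.continuous_proj
      obtain ⟨C, hC⟩ := hfa _ (by
        rintro _ ⟨_, ⟨z, hz, rfl⟩, rfl⟩
        exact hO'S z (hbox hz)) hK 0 L
      refine ⟨‖A‖ * C, fun k z hz => ?_⟩
      have h1 := hC k (Y z) ⟨_, ⟨z, hz, rfl⟩, rfl⟩
      rw [norm_iteratedFDeriv_zero] at h1
      have h2 : f' k z - ∑ l ∈ Finset.range L, ((k : ℂ) ^ l)⁻¹ * a' l z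
          = A (f k (D.proj (Y z)) - ∑ l ∈ Finset.range L, ((k : ℂ) ^ l)⁻¹ • a l (D.proj (Y z))) := by
        rw [map_sub, map_sum]
        simp only [map_smul, smul_eq_mul, hf', ha']
      rw [h2, mul_assoc]
      exact (A.le_opNorm _).trans (mul_le_mul_of_nonneg_left h1 (norm_nonneg _)))
  -- the complement of a neighbourhood of `Γ` in the circles under consideration
  have hout : ∀ n : ℕ, ∃ C : ℝ, ∀ (k : ℕ+), ∀ q ∈ Icc (x - d) (x + d), ∀ v ∈ Icc d (1 / 2) ∪ Icc (-(1 / 2)) (-d),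
      ‖(ξ k).1 (Y (q, v))‖ ≤ C * (k : ℝ) ^ (-(n : ℝ)) := by
    intro n
    have hK : IsCompact (D.proj '' (Y '' (Icc (x - d) (x + d) ×ˢ (Icc d (1 / 2) ∪ Icc (-(1 / 2)) (-d))))) :=
      ((isCompact_Icc.prod (isCompact_Icc.union isCompact_Icc)).image hYc).image D.continuous_proj
    obtain ⟨C, hC⟩ := exists_bound_of_disjoint_microsupport ξ hK (by
      rintro _ ⟨_, ⟨⟨q, v⟩, ⟨hq, hv⟩, rfl⟩, rfl⟩ hMS
      have hqI := hO₁I (hJ q hq)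
      have h1 := hL.1 ⟨hMS, proj_pt_mem_strip _ hqI⟩
      simp only [hY, hd1 q (hJ q hq)] at h1
      obtain ⟨m, rfl⟩ := (mem_graph_iff hq' hqI).1 h1
      have hm : |(m : ℝ)| < 1 := by
        rw [abs_lt]
        rcases hv with hv | hv <;> dsimp only at hv <;> constructor <;> linarith [hv.1, hv.2]
      have hm' : |m| < 1 := by exact_mod_cast hm
      rw [Int.abs_lt_one_iff.1 hm'] at hv
      rcases hv with hv | hv <;> simp only [Int.cast_zero, mem_Icc] at hv <;> linarith [hv.1, hv.2]) n
    exact ⟨C, fun k q hq v hv => hC k _ ⟨_, ⟨(q, v), ⟨hq, hv⟩, rfl⟩, rfl⟩⟩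
  set M : ℝ := (2 * Real.pi) ^ (-(1 / 4 + N)) with hM
  have hM0 : 0 < M := Real.rpow_pos_of_pos (by have := Real.pi_pos; positivity) _
  refine ⟨Ioo (x - d) (x + d), isOpen_Ioo, ⟨by linarith, by linarith⟩, fun q hq =>
    hO₁I (hJ q (Ioo_subset_Icc_self hq)),
    fun n q => (M : ℂ) * ∑ i ∈ Finset.range (n + 1), P i (n - i) q, fun n => ?_, fun q hq => ?_,
    fun L => ?_⟩
  · exact contDiff_const.mul (ContDiff.sum fun i _ => hP i _)
  · have hq2 := Ioo_subset_Icc_self hq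
    have hqO₁ := hJ q hq2
    simp only [zero_add, Finset.range_one, Finset.sum_singleton, Nat.sub_zero]
    rw [hP0 0 q hq2, hW0 q (hJ0 q hq2), hd2 q hqO₁]
    simp only [ha', hY, add_zero, hgp q hqO₁]
    rw [haσ]
    have := hO'S _ (hJ0 q hq2)
    simp only [add_zero] at this
    rw [← hgp q hqO₁]
    exact ⟨hgraph q hqO₁, this⟩
  · obtain ⟨n, hn⟩ := exists_nat_ge ((L : ℝ) - (N - 1 / 4))
    obtain ⟨C₁, hC₁⟩ := hout n
    obtain ⟨C₂, hC₂⟩ := hξ n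
    obtain ⟨C₃, hC₃⟩ := hexp L
    refine ⟨‖A‖ * |C₁| + ‖A‖ * |C₂| + M * |C₃|, fun k m q hq hm => ?_⟩
    have hq2 := Ioo_subset_Icc_self hq
    have hqO₁ := hJ q hq2
    have hk1 := PNat.one_le_cast_real k
    have hk0 : (0 : ℝ) < k := by linarith
    set u : E → ℂ := fun y => A ((ξ k).1 y) with hu
    have hmem : u ∈ D.holSections ℂ k := coordL_comp_mem A (ξ k).2
    set G : ℝ → ℂ := fun v => D.chart ψ k u (q, v) with hG
    have hGc : Continuous G := by
      have := (contDiff_chart (D := D) hψ k hmem.1).continuous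
      simp only [hG]
      fun_prop
    have hGi : ∀ α β, IntervalIntegrable G MeasureTheory.volume α β := fun α β => hGc.intervalIntegrable _ _
    have hpow : (k : ℝ) ^ (-(n : ℝ)) ≤ (k : ℝ) ^ (N - 1 / 4 - L) :=
      Real.rpow_le_rpow_of_exponent_le hk1 (by linarith)
    set R : ℝ := (k : ℝ) ^ (N - 1 / 4 - L) with hR
    have hR0 : 0 ≤ R := by positivity
    have hGout : ∀ v ∈ Icc d (1 / 2) ∪ Icc (-(1 / 2)) (-d), ‖G v‖ ≤ ‖A‖ * |C₁| * R := by
      intro v hv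
      simp only [hG]
      rw [norm_chart, mul_assoc]
      refine (A.le_opNorm _).trans (mul_le_mul_of_nonneg_left ?_ (norm_nonneg _))
      exact (hC₁ k q hq2 v hv).trans (mul_le_mul (le_abs_self _) hpow (by positivity) (abs_nonneg _))
    set pre : ℂ := ((((k : ℝ) / (2 * Real.pi)) ^ (1 / 4 + N) : ℝ) : ℂ) with hpre
    set ph : ℂ := Complex.exp (4 * Complex.I * Real.pi * k * φ q) with hph
    have hph1 : ‖ph‖ = 1 := by
      have := norm_exp_phase k (φ q)
      rwa [Complex.ofReal_natCast] at this
    set Q : ℝ → ℂ := fun v => pre * ph * (Complex.exp (-((k : ℂ) * (v : ℂ) ^ 2 * W (q, v))) * f' k (q, v))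
      with hQ
    have hsl : ∀ v ∈ Icc (-d) d, (q, v) ∈ Icc (x - d) (x + d) ×ˢ Icc (-d) d := fun v hv => ⟨hq2, hv⟩
    have hQc : ContinuousOn Q (Icc (-d) d) := by
      have c1 : ContinuousOn (fun v : ℝ => W (q, v)) (Icc (-d) d) :=
        (hW.continuousOn.mono hbox).comp (by fun_prop) hsl
      have c2 : ContinuousOn (fun v : ℝ => f' k (q, v)) (Icc (-d) d) :=
        ((hf's k).continuousOn.mono hbox).comp (by fun_prop) hsl
      refine continuousOn_const.mul (ContinuousOn.mul (ContinuousOn.cexp (ContinuousOn.neg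
        (ContinuousOn.mul ?_ c1))) c2)
      fun_prop
    have hGin : ∀ v ∈ Icc (-d) d, ‖G v - Q v‖ ≤ ‖A‖ * |C₂| * R := by
      intro v hv
      have hz := hbox (hsl v hv)
      have h1 := hC₂ k (Y (q, v)) (hO'S _ hz)
      have h2 := hWe _ hz
      set ε : ℂ := Complex.exp (2 * Real.pi * Complex.I * k * (ψ q + v) * q) with hε
      have hεe : ε = Complex.exp (2 * Real.pi * Complex.I * (1 : ℕ) * (ψ q + v) * q) ^ (k : ℕ) := by
        rw [hε, ← Complex.exp_nat_mul]
        congr 1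
        push_cast
        ring
      have h3 : e (Y (q, v)) ^ (k : ℕ) * ε
          = ph * Complex.exp (-((k : ℂ) * (v : ℂ) ^ 2 * W (q, v))) := by
        rw [hεe, ← mul_pow]
        change (D.chart ψ 1 e (q, v)) ^ (k : ℕ) = _
        rw [h2, mul_pow, ← Complex.exp_nat_mul, ← Complex.exp_nat_mul, hph, hφφ hqO₁]
        congr 2 <;> ring
      have h4 : G v - Q v = ε * A ((ξ k).1 (Y (q, v)) - ((((k : ℝ) / (2 * Real.pi)) ^ (1 / 4 + N) : ℝ)
          * e (Y (q, v)) ^ (k : ℕ)) • f k (D.proj (Y (q, v)))) := by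
        rw [map_sub, map_smul, smul_eq_mul]
        simp only [hG, hQ, chart, hu, hf', ← hpre]
        linear_combination (pre * A (f k (D.proj (Y (q, v))))) * h3
      have hε1 : ‖ε‖ = 1 := norm_exp_imaginary _ (2 * Real.pi * k * (ψ q + v) * q) (by
        push_cast
        ring)
      rw [h4, norm_mul, hε1, one_mul, mul_assoc]
      refine (A.le_opNorm _).trans (mul_le_mul_of_nonneg_left ?_ (norm_nonneg _))
      exact h1.trans (mul_le_mul (le_abs_self _) hpow (by positivity) (abs_nonneg _))
    -- the integral over a circle is cut into the parts near and away from `Γ`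
    have hsplit : D.thetaCoeff k u m - pre * ph * ((((k : ℝ) ^ (-(1 / 2) : ℝ) : ℝ) : ℂ) *
        ∑ n ∈ Finset.range L, ((k : ℂ) ^ n)⁻¹ * ∑ i ∈ Finset.range (n + 1), P i (n - i) q)
        = (∫ v in (-(1 / 2) : ℝ)..(-d), G v) + (∫ v in d..(1 / 2), G v) + (∫ v in (-d)..d, (G v - Q v))
          + pre * ph * ((∫ v in (-d)..d, Complex.exp (-((k : ℂ) * (v : ℂ) ^ 2 * W (q, v))) * f' k (q, v))
            - ((((k : ℝ) ^ (-(1 / 2) : ℝ) : ℝ) : ℂ) *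
        ∑ n ∈ Finset.range L, ((k : ℂ) ^ n)⁻¹ * ∑ i ∈ Finset.range (n + 1), P i (n - i) q)) := by
      rw [thetaCoeff_eq_integral_chart k.pos hmem ψ hm, intervalIntegral.integral_sub (hGi _ _)
        (hQc.intervalIntegrable_of_Icc (by linarith)), hQ, intervalIntegral.integral_const_mul]
      have e1 := intervalIntegral.integral_add_adjacent_intervals (hGi (-(1 / 2)) (-d)) (hGi (-d) d)
      have e2 := intervalIntegral.integral_add_adjacent_intervals (hGi (-(1 / 2)) d) (hGi d (1 / 2))
      linear_combination -e2 - e1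
    have hfinal : (((k : ℝ) ^ (N - 1 / 4) : ℝ) : ℂ) * ph * ∑ n ∈ Finset.range L, ((k : ℂ) ^ n)⁻¹ *
        ((M : ℂ) * ∑ i ∈ Finset.range (n + 1), P i (n - i) q)
        = pre * ph * ((((k : ℝ) ^ (-(1 / 2) : ℝ) : ℝ) : ℂ) *
        ∑ n ∈ Finset.range L, ((k : ℂ) ^ n)⁻¹ * ∑ i ∈ Finset.range (n + 1), P i (n - i) q) := by
      have h1 : ((k : ℝ) / (2 * Real.pi)) ^ (1 / 4 + N) = (k : ℝ) ^ (1 / 4 + N) * M := by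
        rw [Real.div_rpow hk0.le (by have := Real.pi_pos; positivity), hM, Real.rpow_neg
          (by have := Real.pi_pos; positivity), div_eq_mul_inv]
      have h2 : (k : ℝ) ^ (N - 1 / 4) = (k : ℝ) ^ (1 / 4 + N) * (k : ℝ) ^ (-(1 / 2) : ℝ) := by
        rw [← Real.rpow_add hk0]
        congr 1
        ring
      have h3 : ∑ n ∈ Finset.range L, ((k : ℂ) ^ n)⁻¹ *
          ((M : ℂ) * ∑ i ∈ Finset.range (n + 1), P i (n - i) q) = M * ∑ n ∈ Finset.range L,
            ((k : ℂ) ^ n)⁻¹ * ∑ i ∈ Finset.range (n + 1), P i (n - i) q := by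
        rw [Finset.mul_sum]
        exact Finset.sum_congr rfl fun n _ => by ring
      rw [h3, hpre, h1, h2]
      push_cast
      ring
    have hI : ∀ {F : ℝ → ℂ} {α β B : ℝ}, α ≤ β → β - α ≤ 1 / 2 → 0 ≤ B → (∀ v ∈ Icc α β, ‖F v‖ ≤ B) →
        ‖∫ v in α..β, F v‖ ≤ B / 2 := by
      intro F α β B h1 h2 h3 h4
      refine (intervalIntegral.norm_integral_le_of_norm_le_const (C := B) fun v hv => ?_).trans ?_
      · rw [uIoc_of_le h1] at hv
        exact h4 v (Ioc_subset_Icc_self hv)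
      · rw [abs_of_nonneg (by linarith)]
        nlinarith
    have b1 := hI (α := -(1 / 2)) (β := -d) (by linarith) (by linarith) (by positivity)
      fun v hv => hGout v (Or.inr hv)
    have b2 := hI (α := d) (β := 1 / 2) (by linarith) (by linarith) (by positivity)
      fun v hv => hGout v (Or.inl hv)
    have b3 := hI (α := -d) (β := d) (by linarith) (by linarith) (by positivity) hGin
    have b4 := hC₃ k q hq2
    rw [hfinal, hsplit]
    refine (norm_add_le _ _).trans ?_
    have b5 : ‖pre * ph * ((∫ v in (-d)..d, Complex.exp (-((k : ℂ) * (v : ℂ) ^ 2 * W (q, v))) * f' k (q, v))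
            - ((((k : ℝ) ^ (-(1 / 2) : ℝ) : ℝ) : ℂ) *
        ∑ n ∈ Finset.range L, ((k : ℂ) ^ n)⁻¹ * ∑ i ∈ Finset.range (n + 1), P i (n - i) q))‖
        ≤ M * |C₃| * R := by
      rw [norm_mul, norm_mul, hph1, mul_one, hpre, Complex.norm_real, Real.norm_of_nonneg (by positivity)]
      have h1 : ((k : ℝ) / (2 * Real.pi)) ^ (1 / 4 + N) = (k : ℝ) ^ (1 / 4 + N) * M := by
        rw [Real.div_rpow hk0.le (by have := Real.pi_pos; positivity), hM, Real.rpow_neg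
          (by have := Real.pi_pos; positivity), div_eq_mul_inv]
      have h2 : R = (k : ℝ) ^ (1 / 4 + N) * (k : ℝ) ^ (-(1 / 2) - (L : ℝ)) := by
        rw [hR, ← Real.rpow_add hk0]
        congr 1
        ring
      rw [h1, h2]
      calc _ ≤ (k : ℝ) ^ (1 / 4 + N) * M * (C₃ * (k : ℝ) ^ (-(1 / 2) - (L : ℝ))) := by gcongr
        _ ≤ (k : ℝ) ^ (1 / 4 + N) * M * (|C₃| * (k : ℝ) ^ (-(1 / 2) - (L : ℝ))) := by
          gcongr
          exact le_abs_self _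
        _ = _ := by ring
    have b6 : ‖(∫ v in (-(1 / 2) : ℝ)..(-d), G v) + (∫ v in d..(1 / 2), G v)
        + (∫ v in (-d)..d, (G v - Q v))‖ ≤ ‖A‖ * |C₁| * R + ‖A‖ * |C₂| * R := by
      refine (norm_add₃_le).trans ?_
      have : 0 ≤ ‖A‖ * |C₂| * R := by positivity
      linarith
    rw [add_mul, add_mul]
    exact add_le_add b6 b5

end QuantumTorus

/-! ### Formal solutions of the transport equation -/

/-- Every function of `q` extends to a solution of `∂_q S - Λ ∂_v S = O(v^∞)`. -/
theorem exists_transport_extension {Λ : ℝ → ℂ} (hΛ : ContDiff ℝ ∞ Λ) (hΛ0 : ∀ q, Λ q ≠ 0)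
    {α : ℝ → ℂ} (hα : ContDiff ℝ ∞ α) (hαc : HasCompactSupport α) :
    ∃ S : ℝ × ℝ → ℂ, ContDiff ℝ ∞ S ∧ (∀ q : ℝ, S (q, 0) = α q) ∧
      ∀ J : ℕ, ∃ R : ℝ × ℝ → ℂ, ContDiff ℝ ∞ R ∧
        ∀ z, pderiv (1, 0) S z - Λ z.1 * pderiv (0, 1) S z = (z.2 : ℂ) ^ J * R z := by
  -- the Taylor coefficients are determined by `(n + 1) Λ A_{n + 1} = A_n'`
  let A : ℕ → ℝ → ℂ := fun n =>
    Nat.rec α (fun n f q => deriv f q * (((n : ℂ) + 1) * Λ q)⁻¹) n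
  have hA1 : ∀ n q, A (n + 1) q = deriv (A n) q * (((n : ℂ) + 1) * Λ q)⁻¹ := fun n q => rfl
  have hn : ∀ n : ℕ, ((n : ℂ) + 1) ≠ 0 := fun n => by exact_mod_cast n.succ_ne_zero
  have hA : ∀ n, ContDiff ℝ ∞ (A n) ∧ HasCompactSupport (A n) := by
    intro n
    induction n with
    | zero => exact ⟨hα, hαc⟩
    | succ n ih =>
      refine ⟨(contDiff_infty_iff_deriv.1 ih.1).2.mul ((contDiff_const.mul hΛ).inv fun q =>
        mul_ne_zero (hn n) (hΛ0 q)), ih.2.deriv.mul_right⟩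
  obtain ⟨S, hS, hSA⟩ := exists_borel_sum (fun n => (hA n).1) fun n => (hA n).2
  refine ⟨S 0, hS 0, fun q => by
    have := hSA 0 q 0
    simp only [Complex.ofReal_zero, zero_mul, add_zero] at this
    exact this, fun J => ?_⟩
  have hofs : ContDiff ℝ ∞ (fun z : ℝ × ℝ => Λ z.1) := hΛ.comp contDiff_fst
  refine ⟨fun z => pderiv (1, 0) (S J) z - Λ z.1 * pderiv (0, 1) (S J) z - J * Λ z.1 * S (J + 1) z,
    (((contDiff_pderiv (hS J) _).sub (hofs.mul (contDiff_pderiv (hS J) _)))).sub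
      ((contDiff_const.mul hofs).mul (hS _)), ?_⟩
  induction J with
  | zero => intro z; simp
  | succ J ih =>
    rintro ⟨q, v⟩
    rw [ih]
    have hd := fun j => (hS j).differentiable (by simp)
    have h1 : pderiv (1, 0) (S J) (q, v) = deriv (A J) q + v * pderiv (1, 0) (S (J + 1)) (q, v) := by
      refine (hasDerivAt_pderiv_fst (hd J (q, v))).unique ?_
      have := (((hA J).1.differentiable (by simp) q).hasDerivAt).add
        ((hasDerivAt_pderiv_fst (hd (J + 1) (q, v))).const_mul (v : ℂ))
      exact this.congr_of_eventuallyEq (Eventually.of_forall fun s => hSA J s v)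
    have h2 : pderiv (0, 1) (S J) (q, v) = S (J + 1) (q, v) + v * pderiv (0, 1) (S (J + 1)) (q, v) := by
      refine (hasDerivAt_pderiv_snd (hd J (q, v))).unique ?_
      have := ((hasDerivAt_id v).ofReal_comp.mul (hasDerivAt_pderiv_snd (hd (J + 1) (q, v)))).const_add (A J q)
      refine (this.congr_deriv ?_).congr_of_eventuallyEq (Eventually.of_forall fun s => hSA J q s)
      simp
    have h3 := hSA (J + 1) q v
    have h4 := hA1 J q
    have h5 : deriv (A J) q = ((J : ℂ) + 1) * Λ q * A (J + 1) q := by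
      rw [h4]
      have := hn J
      have := hΛ0 q
      field_simp
    simp only [h1, h2, h5, h3]
    push_cast
    ring

/-- The phase of a section of `L_M` which is flat along the graph of `φ'` and holomorphic to infinite
order there. -/
theorem exists_holomorphic_phase {φ : ℝ → ℝ} (hφ : ContDiff ℝ ∞ φ) {T : ℂ} (hT : 0 < T.im) (x : ℝ) :
    ∃ Φ : ℝ × ℝ → ℂ, ContDiff ℝ ∞ Φ ∧ (∀ J : ℕ, ∃ R : ℝ × ℝ → ℂ, ContDiff ℝ ∞ R ∧ ∀ z,
        pderiv (1, 0) Φ z - (deriv (deriv φ) z.1 + T) * pderiv (0, 1) Φ z - (deriv φ z.1 + z.2)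
          = (z.2 : ℂ) ^ J * R z) ∧
      ∃ O' : Set (ℝ × ℝ), IsOpen O' ∧ (x, (0 : ℝ)) ∈ O' ∧ ∃ W : ℝ × ℝ → ℂ, ContDiffOn ℝ ∞ W O' ∧
        (∀ z ∈ O', 0 < (W z).re) ∧ (∀ q : ℝ, (q, (0 : ℝ)) ∈ O' →
          W (q, 0) = 2 * Real.pi * Complex.I / (deriv (deriv φ) q + T)) ∧
        ∀ z ∈ O', Complex.exp (4 * Real.pi * Complex.I * Φ z)
          = Complex.exp (4 * Real.pi * Complex.I * φ z.1) * Complex.exp (-((z.2 : ℂ) ^ 2 * W z)) := by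
  set ψ := deriv φ with hψdef
  have hψ : ContDiff ℝ ∞ ψ := (contDiff_infty_iff_deriv.1 hφ).2
  have hof : ContDiff ℝ ∞ (fun t : ℝ => (t : ℂ)) := Complex.ofRealCLM.contDiff
  have hφc : ContDiff ℝ ∞ (fun q => (φ q : ℂ)) := hof.comp hφ
  have hψc : ContDiff ℝ ∞ (fun q => (ψ q : ℂ)) := hof.comp hψ
  have hψ'c : ContDiff ℝ ∞ (fun q => ((deriv ψ q : ℝ) : ℂ)) := hof.comp (contDiff_infty_iff_deriv.1 hψ).2
  have hΛ : ∀ q : ℝ, 0 < (((deriv ψ q : ℝ) : ℂ) + T).im := fun q => by simpa using hT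
  have hΛ0 : ∀ q : ℝ, ((deriv ψ q : ℝ) : ℂ) + T ≠ 0 := fun q h0 => by
    have := hΛ q; rw [h0] at this; simp at this
  -- `(ψ + v) q + T q² / 2` is an exact solution; it remains to adjust the value along `v = 0`
  have hα : ContDiff ℝ ∞ (fun q : ℝ => (φ q : ℂ) - ψ q * q - T * (q : ℂ) ^ 2 / 2) :=
    (hφc.sub (hψc.mul hof)).sub ((contDiff_const.mul (hof.pow 2)).div_const 2)
  obtain ⟨α, hαs, hαc, O₁, hO₁, hxO₁, -, hαe⟩ := exists_smooth_extension
    (isCompact_singleton (x := x)) isOpen_univ (subset_univ _) hα.contDiffOn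
  rw [singleton_subset_iff] at hxO₁
  obtain ⟨S, hS, hS0, hSR⟩ := exists_transport_extension (hψ'c.add contDiff_const) hΛ0 hαs hαc
  have h1c : ContDiff ℝ ∞ (fun z : ℝ × ℝ => (z.1 : ℂ)) := hof.comp contDiff_fst
  have h2c : ContDiff ℝ ∞ (fun z : ℝ × ℝ => (z.2 : ℂ)) := hof.comp contDiff_snd
  have hψ1 : ContDiff ℝ ∞ (fun z : ℝ × ℝ => (ψ z.1 : ℂ)) := hψc.comp contDiff_fst
  set Φ : ℝ × ℝ → ℂ := fun z => ((ψ z.1 + z.2) * z.1 + T * (z.1 : ℂ) ^ 2 / 2) + S z with hΦ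
  have hΦs : ContDiff ℝ ∞ Φ :=
    (((hψ1.add h2c).mul h1c).add ((contDiff_const.mul (h1c.pow 2)).div_const 2)).add hS
  have hΦd := hΦs.differentiable (by simp)
  have hSd := hS.differentiable (by simp)
  have hΦq : ∀ q v : ℝ, pderiv (1, 0) Φ (q, v)
      = deriv ψ q * q + (ψ q + v) + T * q + pderiv (1, 0) S (q, v) := by
    intro q v
    refine (hasDerivAt_pderiv_fst (hΦd (q, v))).unique ?_
    have hid : HasDerivAt (fun s : ℝ => (s : ℂ)) 1 q := by simpa using (hasDerivAt_id q).ofReal_comp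
    have e1 : HasDerivAt (fun s : ℝ => (ψ s : ℂ) + v) ((deriv ψ q : ℝ) : ℂ) q :=
      ((hψ.differentiable (by simp) q).hasDerivAt.ofReal_comp).add_const _
    have e2 := ((e1.mul hid).add (((hid.pow 2).const_mul T).div_const 2)).add
      (hasDerivAt_pderiv_fst (hSd (q, v)))
    refine e2.congr_deriv ?_
    simp only [Nat.cast_ofNat]
    ring
  have hΦv : ∀ q v : ℝ, pderiv (0, 1) Φ (q, v) = q + pderiv (0, 1) S (q, v) := by
    intro q v
    refine (hasDerivAt_pderiv_snd (hΦd (q, v))).unique ?_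
    have hid : HasDerivAt (fun s : ℝ => (s : ℂ)) 1 v := by simpa using (hasDerivAt_id v).ofReal_comp
    have e2 := (((hid.const_add (ψ q : ℂ)).mul_const (q : ℂ)).add_const (T * (q : ℂ) ^ 2 / 2)).add
      (hasDerivAt_pderiv_snd (hSd (q, v)))
    refine e2.congr_deriv ?_
    ring
  have hΦe : ∀ z : ℝ × ℝ, pderiv (1, 0) Φ z - (deriv ψ z.1 + T) * pderiv (0, 1) Φ z - (ψ z.1 + z.2)
      = pderiv (1, 0) S z - (deriv ψ z.1 + T) * pderiv (0, 1) S z := by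
    rintro ⟨q, v⟩
    simp only [hΦq, hΦv]
    ring
  have hΦR : ∀ J : ℕ, ∃ R : ℝ × ℝ → ℂ, ContDiff ℝ ∞ R ∧ ∀ z,
        pderiv (1, 0) Φ z - (deriv ψ z.1 + T) * pderiv (0, 1) Φ z - (ψ z.1 + z.2)
          = (z.2 : ℂ) ^ J * R z := fun J => by
    obtain ⟨R, hR, hRe⟩ := hSR J
    exact ⟨R, hR, fun z => by rw [hΦe, ← hRe]⟩
  refine ⟨Φ, hΦs, hΦR, ?_⟩
  have hΦ0 : ∀ q ∈ O₁, Φ (q, 0) = φ q := fun q hq => by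
    simp only [hΦ, hS0, hαe hq, Complex.ofReal_zero]
    ring
  -- the Gaussian form of the exponential
  set B : ℝ × ℝ → ℂ := fun z => Complex.exp (4 * Real.pi * Complex.I * (Φ z - φ z.1)) with hB
  have hφ1 : ContDiff ℝ ∞ (fun z : ℝ × ℝ => (φ z.1 : ℂ)) := hφc.comp contDiff_fst
  have hBs : ContDiff ℝ ∞ B := (contDiff_const.mul (hΦs.sub hφ1)).cexp
  have hBd := hBs.differentiable (by simp)
  have hBL : ∀ q v : ℝ, pderiv (1, 0) B (q, v) - (deriv ψ q + T) * pderiv (0, 1) B (q, v)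
      - 4 * Real.pi * Complex.I * v * B (q, v) = 4 * Real.pi * Complex.I * B (q, v) *
        (pderiv (1, 0) Φ (q, v) - (deriv ψ q + T) * pderiv (0, 1) Φ (q, v) - (ψ q + v)) := by
    intro q v
    have e1 : pderiv (1, 0) B (q, v)
        = 4 * Real.pi * Complex.I * B (q, v) * (pderiv (1, 0) Φ (q, v) - ψ q) := by
      refine (hasDerivAt_pderiv_fst (hBd (q, v))).unique ?_
      have := (((hasDerivAt_pderiv_fst (hΦd (q, v))).sub
        ((hφ.differentiable (by simp) q).hasDerivAt.ofReal_comp)).const_mul (4 * Real.pi * Complex.I)).cexp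
      refine this.congr_deriv ?_
      simp only [hB, hψdef, Pi.sub_apply]
      ring
    have e2 : pderiv (0, 1) B (q, v) = 4 * Real.pi * Complex.I * B (q, v) * pderiv (0, 1) Φ (q, v) := by
      refine (hasDerivAt_pderiv_snd (hBd (q, v))).unique ?_
      have := (((hasDerivAt_pderiv_snd (hΦd (q, v))).sub_const
        (φ q : ℂ)).const_mul (4 * Real.pi * Complex.I)).cexp
      refine this.congr_deriv ?_
      simp only [hB]
      ring
    rw [e1, e2]
    ring
  obtain ⟨O', hO', hxO', -, W, hW, hW1, hW2, hW3⟩ := exists_gaussian_form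
    (hO₁.preimage continuous_fst) (q' := x) hxO₁ (Λ := fun q => deriv ψ q + T) hΛ hBs.contDiffOn
    (fun q hq => by simp [hB, hΦ0 q hq])
    (fun q hq => by
      obtain ⟨R, hR, hRe⟩ := hΦR 1
      have := hBL q 0
      have h1 := hRe (q, 0)
      simp only [Complex.ofReal_zero, add_zero, pow_one, zero_mul, mul_zero, sub_zero] at this h1
      rw [this, h1, mul_zero])
    (fun q hq => by
      obtain ⟨R, hR, hRe⟩ := hΦR 2
      have hs : DifferentiableAt ℝ (fun v : ℝ => B (q, v) * R (q, v)) 0 :=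
        ((hBs.mul hR).differentiable (by simp)).comp (by fun_prop : Differentiable ℝ fun v : ℝ => (q, v)) 0
      have h1 := ((hasDerivAt_id (0 : ℝ)).ofReal_comp.pow 2).mul hs.hasDerivAt |>.const_mul
        (4 * Real.pi * Complex.I)
      refine (h1.congr_of_eventuallyEq (Eventually.of_forall fun v => ?_)).congr_deriv ?_
      · beta_reduce
        rw [hBL q v, hRe (q, v)]
        simp
        ring
      · simp)
  refine ⟨O', hO', hxO', W, hW, hW1, hW2, fun z hz => ?_⟩
  rw [← hW3 z hz, ← Complex.exp_add]
  congr 1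
  ring

theorem pi_div_mem_slitPlane {w : ℂ} (hw : 0 < w.re) : (Real.pi : ℂ) / w ∈ Complex.slitPlane := by
  left
  have h0 : w ≠ 0 := by rintro rfl; simp at hw
  have h1 : 0 < Complex.normSq w := Complex.normSq_pos.2 h0
  rw [Complex.div_re]
  simp only [Complex.ofReal_re, Complex.ofReal_im, zero_mul, zero_div, add_zero]
  have := Real.pi_pos
  positivity

/-- The factor `(π / κ) ^ (1 / 2)`, `κ = 2πi / Λ`, produced by Laplace's method is smooth. -/
theorem contDiff_sqrt_pi_div {Λ : ℝ → ℂ} (hΛ : ContDiff ℝ ∞ Λ) (him : ∀ q, 0 < (Λ q).im) :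
    ContDiff ℝ ∞ (fun q => (Real.pi / (2 * Real.pi * Complex.I / Λ q)) ^ (1 / 2 : ℂ)) := by
  have h0 : ∀ q, Λ q ≠ 0 := fun q h0 => by have := him q; rw [h0] at this; simp at this
  have h1 : ContDiff ℝ ∞ (fun q => (Real.pi : ℂ) / (2 * Real.pi * Complex.I / Λ q)) := by
    simp only [div_eq_mul_inv]
    refine contDiff_const.mul ((contDiff_const.mul (hΛ.inv h0)).inv fun q => ?_)
    have := Real.pi_pos.ne'
    simp [h0 q]
  have h2 : ∀ q, (Real.pi : ℂ) / (2 * Real.pi * Complex.I / Λ q) ∈ Complex.slitPlane := fun q =>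
    pi_div_mem_slitPlane (re_two_pi_I_div_pos (him q))
  have h3 : (fun q => (Real.pi / (2 * Real.pi * Complex.I / Λ q)) ^ (1 / 2 : ℂ))
      = fun q => Complex.exp (Complex.log (Real.pi / (2 * Real.pi * Complex.I / Λ q)) * (1 / 2)) := by
    funext q
    rw [Complex.cpow_def_of_ne_zero (Complex.slitPlane_ne_zero (h2 q))]
  rw [h3]
  refine (ContDiff.mul ?_ contDiff_const).cexp
  refine contDiff_iff_contDiffAt.2 fun q => ?_
  exact ((Complex.contDiffAt_log (h2 q) (n := ∞)).restrict_scalars ℝ).comp q h1.contDiffAt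

theorem sqrt_pi_div_ne_zero {w : ℂ} (hw : 0 < w.im) :
    ((Real.pi : ℂ) / (2 * Real.pi * Complex.I / w)) ^ (1 / 2 : ℂ) ≠ 0 := by
  rw [Complex.cpow_ne_zero_iff]
  exact Or.inl (Complex.slitPlane_ne_zero (pi_div_mem_slitPlane (re_two_pi_I_div_pos hw)))

/-- Construction by strong recursion of a sequence with prescribed relations to its predecessors. -/
theorem exists_seq_of_forall_prev {X : Type*} [Nonempty X] {r : ℕ → (ℕ → X) → X → Prop}
    (hr : ∀ n f, ∃ x, r n f x)
    (hloc : ∀ n f f' x, (∀ i < n, f i = f' i) → r n f x → r n f' x) :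
    ∃ f : ℕ → X, ∀ n, r n f (f n) := by
  choose next hnext using hr
  let x₀ : X := Classical.arbitrary X
  let F : ℕ → ℕ → X := fun n => Nat.rec (fun _ => x₀) (fun n f => Function.update f n (next n f)) n
  have hF : ∀ n, F (n + 1) = Function.update (F n) n (next n (F n)) := fun n => rfl
  have hstab : ∀ i n, i < n → F n i = F (i + 1) i := by
    intro i n hin
    induction n, hin using Nat.le_induction with
    | base => rfl
    | succ n hn ih => rw [hF, Function.update_of_ne (by omega), ih]
  refine ⟨fun n => F (n + 1) n, fun n => ?_⟩
  have h1 : F (n + 1) n = next n (F n) := by rw [hF, Function.update_self]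
  beta_reduce
  rw [h1]
  exact hloc n (F n) _ _ (fun i hi => hstab i n hi) (hnext n (F n))

/-- Amplitudes which are holomorphic to infinite order along `v = 0` and for which Laplace's method
produces a prescribed expansion. -/
theorem exists_holomorphic_amplitudes {Λ : ℝ → ℂ} (hΛ : ContDiff ℝ ∞ Λ) (him : ∀ q, 0 < (Λ q).im)
    {O' : Set (ℝ × ℝ)} (hO' : IsOpen O') {x d : ℝ} (hd : 0 < d)
    (hbox : Icc (x - d) (x + d) ×ˢ Icc (-d) d ⊆ O') {W : ℝ × ℝ → ℂ} (hW : ContDiffOn ℝ ∞ W O')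
    (hpos : ∀ z ∈ O', 0 < (W z).re)
    (hW0 : ∀ q : ℝ, (q, (0 : ℝ)) ∈ O' → W (q, 0) = 2 * Real.pi * Complex.I / Λ q)
    {U : Set ℝ} (hU : IsOpen U) (hxU : Icc (x - d) (x + d) ⊆ U) {g : ℕ → ℝ → ℂ}
    (hg : ∀ l, ContDiffOn ℝ ∞ (g l) U) {M : ℂ} (hM : M ≠ 0) :
    ∃ a : ℕ → ℝ × ℝ → ℂ, (∀ l, ContDiff ℝ ∞ (a l)) ∧ (∀ l, HasCompactSupport (a l)) ∧
      (∃ O₁ : Set (ℝ × ℝ), IsOpen O₁ ∧ Icc (x - d) (x + d) ×ˢ Icc (-d) d ⊆ O₁ ∧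
        ∀ l J : ℕ, ∃ R : ℝ × ℝ → ℂ, ContDiff ℝ ∞ R ∧ ∀ z ∈ O₁,
          pderiv (1, 0) (a l) z - Λ z.1 * pderiv (0, 1) (a l) z = (z.2 : ℂ) ^ J * R z) ∧
      (∀ q ∈ Icc (x - d) (x + d), M * ((Real.pi / (2 * Real.pi * Complex.I / Λ q)) ^ (1 / 2 : ℂ)
        * a 0 (q, 0)) = g 0 q) ∧
      ∃ P : ℕ → ℕ → ℝ → ℂ,
        (∀ l L : ℕ, ∃ C : ℝ, ∀ k : ℝ, 1 ≤ k → ∀ q ∈ Icc (x - d) (x + d),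
          ‖(∫ v in (-d)..d, Complex.exp (-((k : ℂ) * (v : ℂ) ^ 2 * W (q, v))) * a l (q, v))
            - ((k ^ (-(1 / 2) : ℝ) : ℝ) : ℂ) * ∑ j ∈ Finset.range L, ((k : ℂ) ^ j)⁻¹ * P l j q‖
          ≤ C * k ^ (-(1 / 2) - (L : ℝ))) ∧
        ∀ n, ∀ q ∈ Icc (x - d) (x + d), M * ∑ i ∈ Finset.range (n + 1), P i (n - i) q = g n q := by
  have hΛ0 : ∀ q, Λ q ≠ 0 := fun q h0 => by have := him q; rw [h0] at this; simp at this
  set K := Icc (x - d) (x + d) ×ˢ Icc (-d) d with hK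
  have hKc : IsCompact K := isCompact_Icc.prod isCompact_Icc
  have h0K : ∀ q ∈ Icc (x - d) (x + d), (q, (0 : ℝ)) ∈ K := fun q hq =>
    ⟨hq, by constructor <;> simp [hd.le]⟩
  obtain ⟨χ, hχ, hχc, -, -, O₁, hO₁, hKO₁, -, hχ1⟩ := exists_smooth_cutoff hKc isOpen_univ (subset_univ _)
  set s : ℝ → ℂ := fun q => (Real.pi / (2 * Real.pi * Complex.I / Λ q)) ^ (1 / 2 : ℂ) with hs
  have hss : ContDiff ℝ ∞ s := contDiff_sqrt_pi_div hΛ him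
  have hs0 : ∀ q, s q ≠ 0 := fun q => sqrt_pi_div_ne_zero (him q)
  let X := {α : ℝ → ℂ // ContDiff ℝ ∞ α ∧ HasCompactSupport α}
  have : Nonempty X := ⟨⟨0, contDiff_const, HasCompactSupport.zero⟩⟩
  -- the extension of a function of `q` and the coefficients which Laplace's method attaches to it
  have hext : ∀ α : X, ∃ (a : ℝ × ℝ → ℂ) (P : ℕ → ℝ → ℂ), ContDiff ℝ ∞ a ∧ HasCompactSupport a ∧
      (∀ J : ℕ, ∃ R : ℝ × ℝ → ℂ, ContDiff ℝ ∞ R ∧ ∀ z ∈ O₁,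
        pderiv (1, 0) a z - Λ z.1 * pderiv (0, 1) a z = (z.2 : ℂ) ^ J * R z) ∧
      (∀ q ∈ Icc (x - d) (x + d), a (q, 0) = α.1 q) ∧ (∀ j, ContDiff ℝ ∞ (P j)) ∧
      (∀ q ∈ Icc (x - d) (x + d), P 0 q = s q * α.1 q) ∧
      (∀ L : ℕ, ∃ C : ℝ, ∀ k : ℝ, 1 ≤ k → ∀ q ∈ Icc (x - d) (x + d),
          ‖(∫ v in (-d)..d, Complex.exp (-((k : ℂ) * (v : ℂ) ^ 2 * W (q, v))) * a (q, v))
            - ((k ^ (-(1 / 2) : ℝ) : ℝ) : ℂ) * ∑ j ∈ Finset.range L, ((k : ℂ) ^ j)⁻¹ * P j q‖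
          ≤ C * k ^ (-(1 / 2) - (L : ℝ))) := by
    rintro ⟨α, hα, hαc⟩
    obtain ⟨S, hS, hS0, hSR⟩ := exists_transport_extension hΛ hΛ0 hα hαc
    have has : ContDiff ℝ ∞ (fun z => (χ z : ℂ) * S z) := (Complex.ofRealCLM.contDiff.comp hχ).mul hS
    have hχe : ∀ z ∈ O₁, (fun z => (χ z : ℂ) * S z) =ᶠ[𝓝 z] S := fun z hz => by
      filter_upwards [hO₁.mem_nhds hz] with w hw
      rw [hχ1 w hw, Complex.ofReal_one, one_mul]
    obtain ⟨P, hP, hP0, hPe⟩ := exists_laplace_expansion hO' hd hbox hW hpos has.contDiffOn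
    refine ⟨_, P, has, ?_, fun J => ?_, fun q hq => ?_, hP, fun q hq => ?_, hPe⟩
    · exact (hχc.comp_left (g := fun t : ℝ => (t : ℂ)) Complex.ofReal_zero).mul_right
    · obtain ⟨R, hR, hRe⟩ := hSR J
      refine ⟨R, hR, fun z hz => ?_⟩
      rw [pderiv_congr (hχe z hz), pderiv_congr (hχe z hz), hRe]
    · exact ((hχe _ (hKO₁ (h0K q hq))).self_of_nhds).trans (hS0 q)
    · rw [hP0 q hq, hW0 q (hbox (h0K q hq))]
      exact congrArg (s q * ·) (((hχe _ (hKO₁ (h0K q hq))).self_of_nhds).trans (hS0 q))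
  choose a P ha hac haR ha0 hP hP0 hPe using hext
  -- the `n`-th coefficient of the expansion contains `α n` through the factor `s`, which does not vanish
  obtain ⟨α, hα⟩ := exists_seq_of_forall_prev (X := X)
    (r := fun n f α => ∀ q ∈ Icc (x - d) (x + d),
      M * (∑ i ∈ Finset.range n, P (f i) (n - i) q + s q * α.1 q) = g n q)
    (fun n f => by
      have hsm : ContDiffOn ℝ ∞ (fun q => (M⁻¹ * g n q - ∑ i ∈ Finset.range n, P (f i) (n - i) q)
          * (s q)⁻¹) U :=
        ((contDiffOn_const.mul (hg n)).sub (ContDiff.sum fun i _ => hP _ _).contDiffOn).mul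
          (hss.inv hs0).contDiffOn
      obtain ⟨α, hα, hαc, O₂, -, hO₂, -, hαe⟩ := exists_smooth_extension isCompact_Icc hU hxU hsm
      refine ⟨⟨α, hα, hαc⟩, fun q hq => ?_⟩
      have := hαe (hO₂ hq)
      simp only [this]
      have := hs0 q
      field_simp
      ring)
    (fun n f f' α hff h q hq => by
      rw [← h q hq, Finset.sum_congr rfl fun i hi =>
        congrArg (P · (n - i) q) (hff i (Finset.mem_range.1 hi)).symm])
  refine ⟨fun l => a (α l), fun l => ha _, fun l => hac _, ⟨O₁, hO₁, hKO₁, fun l J => haR _ J⟩,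
    fun q hq => ?_, fun l => P (α l), fun l => hPe _, fun n q hq => ?_⟩
  · beta_reduce
    rw [ha0 _ q hq, ← hα 0 q hq]
    simp [hs]
  · beta_reduce
    rw [Finset.sum_range_succ, Nat.sub_self, hP0 _ q hq, hα n q hq]

/-! ### Quasimodes concentrated on the graph -/

/-- The compact neighbourhood of `(x, 0)` on which quasimodes are considered. -/
def graphBox (x d : ℝ) : Set (ℝ × ℝ) := Icc (x - d) (x + d) ×ˢ Icc (-d) d

theorem isCompact_graphBox (x d : ℝ) : IsCompact (graphBox x d) := isCompact_Icc.prod isCompact_Icc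

/-- The ingredients of a quasimode: a phase `Φ` and amplitudes `a l`, both holomorphic to infinite
order along `v = 0`, a smooth function `S 0` of `(q, v)` and `κ = 1 / k` with Taylor series
`∑ κ ^ l a_l` and with remainders `S j`, and a cut-off function `χ` of `v`. -/
structure Quasimode (φ : ℝ → ℝ) (T : ℂ) (x d : ℝ) where
  contDiff_φ : ContDiff ℝ ∞ φ
  im_pos : 0 < T.im
  d_pos : 0 < d
  d_le : d ≤ 1 / 4
  Φ : ℝ × ℝ → ℂ
  contDiff_Φ : ContDiff ℝ ∞ Φ
  transport_Φ : ∀ J : ℕ, ∃ R : ℝ × ℝ → ℂ, ContDiff ℝ ∞ R ∧ ∀ z,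
    pderiv (1, 0) Φ z - (deriv (deriv φ) z.1 + T) * pderiv (0, 1) Φ z - (deriv φ z.1 + z.2)
      = (z.2 : ℂ) ^ J * R z
  W : ℝ × ℝ → ℂ
  continuousOn_W : ContinuousOn W (graphBox x d)
  c : ℝ
  c_pos : 0 < c
  c_le : ∀ z ∈ graphBox x d, c ≤ (W z).re
  exp_Φ : ∀ z ∈ graphBox x d, Complex.exp (4 * Real.pi * Complex.I * Φ z)
    = Complex.exp (4 * Real.pi * Complex.I * φ z.1) * Complex.exp (-((z.2 : ℂ) ^ 2 * W z))
  a : ℕ → ℝ × ℝ → ℂ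
  contDiff_a : ∀ l, ContDiff ℝ ∞ (a l)
  transport_a : ∀ l J : ℕ, ∃ R : ℝ × ℝ → ℂ, ContDiff ℝ ∞ R ∧ ∀ z ∈ graphBox x d,
    pderiv (1, 0) (a l) z - (deriv (deriv φ) z.1 + T) * pderiv (0, 1) (a l) z = (z.2 : ℂ) ^ J * R z
  S : ℕ → (ℝ × ℝ) × ℝ → ℂ
  contDiff_S : ∀ j, ContDiff ℝ ∞ (S j)
  S_eq : ∀ j z κ, S j (z, κ) = a j z + κ * S (j + 1) (z, κ)
  χ : ℝ → ℝ
  contDiff_χ : ContDiff ℝ ∞ χ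
  χ_mem : ∀ v, χ v ∈ Icc (0 : ℝ) 1
  tsupport_χ : tsupport χ ⊆ Ioo (-d) d
  χ_one : ∀ v ∈ Icc (-(d / 2)) (d / 2), χ =ᶠ[𝓝 v] fun _ => 1

theorem sq_pow_mul_exp_le {c : ℝ} (hc : 0 < c) (m : ℕ) {k : ℝ} (hk : 0 < k) (v : ℝ) :
    (v ^ 2) ^ m * Real.exp (-(k * (c * v ^ 2))) ≤ m.factorial / c ^ m * k ^ (-(m : ℝ)) := by
  have h1 := Real.pow_div_factorial_le_exp (k * (c * v ^ 2)) (by positivity) m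
  rw [div_le_iff₀ (by positivity)] at h1
  rw [Real.exp_neg, Real.rpow_neg hk.le, Real.rpow_natCast]
  have h2 : (k * (c * v ^ 2)) ^ m = k ^ m * (c ^ m * (v ^ 2) ^ m) := by rw [mul_pow, mul_pow]
  rw [h2] at h1
  have he := Real.exp_pos (k * (c * v ^ 2))
  rw [← div_eq_mul_inv, ← div_eq_mul_inv, div_div, div_le_div_iff₀ he (by positivity)]
  linarith

namespace Quasimode

theorem contDiff_ψ {φ : ℝ → ℝ} {T : ℂ} {x d : ℝ} (Q : Quasimode φ T x d) : ContDiff ℝ ∞ (deriv φ) :=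
  (contDiff_infty_iff_deriv.1 Q.contDiff_φ).2

variable {φ : ℝ → ℝ} {T : ℂ} {x d : ℝ} (Q : Quasimode φ T x d)

/-- The amplitude of the quasimode. -/
noncomputable def amp (k : ℕ+) (z : ℝ × ℝ) : ℂ := (Q.χ z.2 : ℂ) * Q.S 0 (z, (k : ℝ)⁻¹)

/-- The quasimode. -/
noncomputable def wave (k : ℕ+) (z : ℝ × ℝ) : ℂ :=
  Complex.exp (4 * Real.pi * Complex.I * k * Q.Φ z) * Q.amp k z

theorem contDiff_ofReal : ContDiff ℝ ∞ (fun t : ℝ => (t : ℂ)) := Complex.ofRealCLM.contDiff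

theorem contDiff_slice (j : ℕ) (κ : ℝ) : ContDiff ℝ ∞ (fun z => Q.S j (z, κ)) :=
  (Q.contDiff_S j).comp (contDiff_id.prodMk contDiff_const)

theorem contDiff_amp (k : ℕ+) : ContDiff ℝ ∞ (Q.amp k) :=
  (contDiff_ofReal.comp (Q.contDiff_χ.comp contDiff_snd)).mul (Q.contDiff_slice 0 _)

theorem contDiff_wave (k : ℕ+) : ContDiff ℝ ∞ (Q.wave k) :=
  ((contDiff_const.mul Q.contDiff_Φ).cexp).mul (Q.contDiff_amp k)

theorem χ_eq_zero {v : ℝ} (hv : v ∉ Ioo (-d) d) : Q.χ v = 0 :=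
  image_eq_zero_of_notMem_tsupport fun h => hv (Q.tsupport_χ h)

theorem deriv_χ_eq_zero {v : ℝ} (hv : v ∉ Ioo (-d) d) : deriv Q.χ v = 0 := by
  have h1 : Q.χ =ᶠ[𝓝 v] fun _ => 0 := by
    filter_upwards [(isClosed_tsupport Q.χ).isOpen_compl.mem_nhds fun h => hv (Q.tsupport_χ h)] with w hw
    exact image_eq_zero_of_notMem_tsupport hw
  rw [h1.deriv_eq, deriv_const]

theorem norm_exp_Φ {z : ℝ × ℝ} (hz : z ∈ graphBox x d) (k : ℕ+) :
    ‖Complex.exp (4 * Real.pi * Complex.I * k * Q.Φ z)‖ ≤ Real.exp (-(k * (Q.c * z.2 ^ 2))) := by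
  have h1 : Complex.exp (4 * Real.pi * Complex.I * k * Q.Φ z)
      = Complex.exp (4 * Real.pi * Complex.I * Q.Φ z) ^ (k : ℕ) := by
    rw [← Complex.exp_nat_mul]
    congr 1
    ring
  rw [h1, Q.exp_Φ z hz, mul_pow, ← Complex.exp_nat_mul, ← Complex.exp_nat_mul, norm_mul,
    QuantumTorus.norm_exp_imaginary _ (4 * Real.pi * k * φ z.1) (by push_cast; ring), one_mul]
  have := norm_exp_phase_le (z := z) (Q.c_le z hz) (Nat.cast_nonneg (k : ℕ)) z.2
  refine le_trans (le_of_eq ?_) this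
  congr 2
  push_cast
  ring

theorem inv_mem (k : ℕ+) : (k : ℝ)⁻¹ ∈ Icc (0 : ℝ) 1 :=
  ⟨by positivity, inv_le_one_of_one_le₀ (PNat.one_le_cast_real k)⟩

theorem exists_bound_S {f : (ℝ × ℝ) × ℝ → ℂ} (hf : Continuous f) (x d : ℝ) :
    ∃ C : ℝ, 0 ≤ C ∧ ∀ z ∈ graphBox x d, ∀ k : ℕ+, ‖f (z, (k : ℝ)⁻¹)‖ ≤ C := by
  obtain ⟨C, hC⟩ := ((isCompact_graphBox x d).prod isCompact_Icc).exists_bound_of_continuousOn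
    (s := graphBox x d ×ˢ Icc (0 : ℝ) 1) hf.continuousOn
  exact ⟨|C|, abs_nonneg _, fun z hz k => (hC _ ⟨hz, inv_mem k⟩).trans (le_abs_self C)⟩

theorem mem_graphBox {q v : ℝ} (hq : q ∈ Icc (x - d) (x + d)) (hv : v ∈ Ioo (-d) d) :
    (q, v) ∈ graphBox x d := ⟨hq, Ioo_subset_Icc_self hv⟩

theorem norm_χ_le (v : ℝ) : ‖(Q.χ v : ℂ)‖ ≤ 1 := by
  rw [Complex.norm_real, Real.norm_of_nonneg (Q.χ_mem v).1]
  exact (Q.χ_mem v).2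

theorem exists_norm_wave_le : ∃ C : ℝ, 0 ≤ C ∧ ∀ k : ℕ+, ∀ q ∈ Icc (x - d) (x + d), ∀ v : ℝ,
    ‖Q.wave k (q, v)‖ ≤ C * Real.exp (-(k * (Q.c * v ^ 2))) := by
  obtain ⟨C, hC0, hC⟩ := exists_bound_S (Q.contDiff_S 0).continuous x d
  refine ⟨C, hC0, fun k q hq v => ?_⟩
  by_cases hv : v ∈ Ioo (-d) d
  · have hz := mem_graphBox hq hv
    rw [wave, amp, norm_mul, norm_mul, mul_comm]
    refine mul_le_mul ?_ (Q.norm_exp_Φ hz k) (norm_nonneg _) hC0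
    exact (mul_le_of_le_one_left (norm_nonneg _) (Q.norm_χ_le v)).trans (hC _ hz k)
  · rw [wave, amp, Q.χ_eq_zero hv]
    simp only [Complex.ofReal_zero, zero_mul, mul_zero, norm_zero]
    positivity

theorem S_zero_eq (L : ℕ) (z : ℝ × ℝ) (κ : ℝ) :
    Q.S 0 (z, κ) = ∑ l ∈ Finset.range L, (κ : ℂ) ^ l * Q.a l z + (κ : ℂ) ^ L * Q.S L (z, κ) := by
  induction L with
  | zero => simp
  | succ L ih =>
    rw [ih, Finset.sum_range_succ, Q.S_eq L]
    ring

/-- The `∂̄`-operator acting on the quasimode. -/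
theorem dbarOp_wave (k : ℕ+) (z : ℝ × ℝ) :
    dbarOp (deriv φ) T k (Q.wave k) z = Complex.exp (4 * Real.pi * Complex.I * k * Q.Φ z) *
      (4 * Real.pi * Complex.I * k * (pderiv (1, 0) Q.Φ z - (deriv (deriv φ) z.1 + T)
          * pderiv (0, 1) Q.Φ z - (deriv φ z.1 + z.2)) * Q.amp k z
        + Q.χ z.2 * (pderiv (1, 0) (fun z => Q.S 0 (z, (k : ℝ)⁻¹)) z - (deriv (deriv φ) z.1 + T)
          * pderiv (0, 1) (fun z => Q.S 0 (z, (k : ℝ)⁻¹)) z)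
        - (deriv (deriv φ) z.1 + T) * deriv Q.χ z.2 * Q.S 0 (z, (k : ℝ)⁻¹)) := by
  obtain ⟨q, v⟩ := z
  set F : ℝ × ℝ → ℂ := fun z => Q.S 0 (z, (k : ℝ)⁻¹) with hF
  have hFd : DifferentiableAt ℝ F (q, v) := (Q.contDiff_slice 0 _).differentiable (by simp) _
  have hΦd : DifferentiableAt ℝ Q.Φ (q, v) := Q.contDiff_Φ.differentiable (by simp) _
  have hwd : DifferentiableAt ℝ (Q.wave k) (q, v) := (Q.contDiff_wave k).differentiable (by simp) _
  have hχd : HasDerivAt (fun v => (Q.χ v : ℂ)) ((deriv Q.χ v : ℝ) : ℂ) v :=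
    (Q.contDiff_χ.differentiable (by simp) v).hasDerivAt.ofReal_comp
  have e1 : pderiv (1, 0) (Q.wave k) (q, v) = Complex.exp (4 * Real.pi * Complex.I * k * Q.Φ (q, v)) *
      (4 * Real.pi * Complex.I * k * pderiv (1, 0) Q.Φ (q, v) * Q.amp k (q, v)
        + Q.χ v * pderiv (1, 0) F (q, v)) := by
    refine (hasDerivAt_pderiv_fst hwd).unique ?_
    have := ((hasDerivAt_pderiv_fst hΦd).const_mul (4 * Real.pi * Complex.I * k)).cexp.mul
      ((hasDerivAt_pderiv_fst hFd).const_mul (Q.χ v : ℂ))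
    refine this.congr_deriv ?_
    simp only [amp, hF]
    ring
  have e2 : pderiv (0, 1) (Q.wave k) (q, v) = Complex.exp (4 * Real.pi * Complex.I * k * Q.Φ (q, v)) *
      (4 * Real.pi * Complex.I * k * pderiv (0, 1) Q.Φ (q, v) * Q.amp k (q, v)
        + Q.χ v * pderiv (0, 1) F (q, v) + deriv Q.χ v * F (q, v)) := by
    refine (hasDerivAt_pderiv_snd hwd).unique ?_
    have := ((hasDerivAt_pderiv_snd hΦd).const_mul (4 * Real.pi * Complex.I * k)).cexp.mul
      (hχd.mul (hasDerivAt_pderiv_snd hFd))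
    refine this.congr_deriv ?_
    simp only [amp, hF, Pi.mul_apply]
    ring
  rw [dbarOp, e1, e2, wave]
  simp only [hF, Complex.ofReal_natCast]
  ring

/-- The quasimode is holomorphic up to `O(k^{-∞})`. -/
theorem exists_norm_dbarOp_wave_le (n : ℕ) : ∃ C : ℝ, 0 ≤ C ∧ ∀ k : ℕ+, ∀ q ∈ Icc (x - d) (x + d),
    ∀ v : ℝ, ‖dbarOp (deriv φ) T k (Q.wave k) (q, v)‖ ≤ C * (k : ℝ) ^ (-(n : ℝ)) := by
  set m := n + 1 with hm
  obtain ⟨R, hR, hRe⟩ := Q.transport_Φ (2 * m)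
  choose Ra hRa hRae using fun l => Q.transport_a l (2 * m)
  obtain ⟨C₀, hC₀0, hC₀⟩ := exists_bound_S (Q.contDiff_S 0).continuous x d
  obtain ⟨C₁, hC₁⟩ := (isCompact_graphBox x d).exists_bound_of_continuousOn hR.continuous.continuousOn
  choose C₂ hC₂ using fun l =>
    (isCompact_graphBox x d).exists_bound_of_continuousOn (hRa l).continuous.continuousOn
  have hΛc : Continuous fun q : ℝ => ((deriv (deriv φ) q : ℝ) : ℂ) + T :=
    (contDiff_ofReal.comp (contDiff_infty_iff_deriv.1 Q.contDiff_ψ).2).continuous.add continuous_const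
  -- the transport operator applied to the remainder
  have hrem : ∀ e : ℝ × ℝ, ∀ κ z, pderiv e (fun z => Q.S m (z, κ)) z
      = fderiv ℝ (Q.S m) (z, κ) (e, 0) := by
    intro e κ z
    have h1 := HasFDerivAt.comp (g := Q.S m) (f := fun z => (z, κ)) z
      ((Q.contDiff_S m).differentiable (by simp) (z, κ)).hasFDerivAt
      ((hasFDerivAt_id z).prodMk (hasFDerivAt_const κ z))
    rw [pderiv]
    have h2 : fderiv ℝ (fun z => Q.S m (z, κ)) z
        = (fderiv ℝ (Q.S m) (z, κ)).comp ((ContinuousLinearMap.id ℝ (ℝ × ℝ)).prod 0) := h1.fderiv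
    rw [h2]
    rfl
  have hfd : Continuous (fderiv ℝ (Q.S m)) := (Q.contDiff_S m).continuous_fderiv (by simp)
  obtain ⟨C₃, hC₃0, hC₃⟩ := exists_bound_S
    (f := fun w => fderiv ℝ (Q.S m) w ((1, 0), 0) - (((deriv (deriv φ) w.1.1 : ℝ) : ℂ) + T)
      * fderiv ℝ (Q.S m) w ((0, 1), 0)) (by
        have : Continuous fun w : (ℝ × ℝ) × ℝ => ((deriv (deriv φ) w.1.1 : ℝ) : ℂ) + T :=
          hΛc.comp (by fun_prop)
        fun_prop) x d
  have hχ'c : Continuous fun z : ℝ × ℝ => (((deriv (deriv φ) z.1 : ℝ) : ℂ) + T) * ((deriv Q.χ z.2 : ℝ) : ℂ) := by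
    have h1 : Continuous (deriv Q.χ) := (contDiff_infty_iff_deriv.1 Q.contDiff_χ).2.continuous
    have := hΛc.comp (continuous_fst (X := ℝ) (Y := ℝ))
    exact this.mul (Complex.continuous_ofReal.comp (h1.comp continuous_snd))
  obtain ⟨C₄, hC₄⟩ := (isCompact_graphBox x d).exists_bound_of_continuousOn hχ'c.continuousOn
  set A : ℝ := 4 * Real.pi * |C₁| * C₀ + ∑ l ∈ Finset.range m, |C₂ l| + (4 / d ^ 2) ^ m * |C₄| * C₀ with hA
  have hπ := Real.pi_pos
  have hd := Q.d_pos
  have hA0 : 0 ≤ A := by positivity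
  set B : ℝ := m.factorial / Q.c ^ m with hB
  have hB0 : 0 ≤ B := by have := Q.c_pos; positivity
  refine ⟨A * B + C₃, by positivity, fun k q hq v => ?_⟩
  have hk1 := PNat.one_le_cast_real k
  have hk0 : (0 : ℝ) < k := by linarith
  have hkn : 0 < (k : ℝ) ^ (-(n : ℝ)) := by positivity
  by_cases hv : v ∈ Ioo (-d) d
  swap
  · rw [dbarOp_wave, amp, Q.χ_eq_zero hv, Q.deriv_χ_eq_zero hv]
    simp only [Complex.ofReal_zero, zero_mul, mul_zero, norm_zero, add_zero, sub_zero]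
    positivity
  have hz := mem_graphBox hq hv
  set κ : ℝ := (k : ℝ)⁻¹ with hκ
  have hκ1 : κ ∈ Icc (0 : ℝ) 1 := inv_mem k
  have hvm : ‖(v : ℂ) ^ (2 * m)‖ = (v ^ 2) ^ m := by
    rw [norm_pow, Complex.norm_real, Real.norm_eq_abs, pow_mul, sq_abs]
  have hS0 := hC₀ _ hz k
  have hχ1 := Q.norm_χ_le v
  have hamp : ‖Q.amp k (q, v)‖ ≤ C₀ := by
    rw [amp, norm_mul]
    exact (mul_le_of_le_one_left (norm_nonneg _) hχ1).trans hS0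
  -- the first `m` terms are solutions up to `v ^ (2m)`, and the remainder carries a factor `k ^ (-m)`
  have hLF : pderiv (1, 0) (fun z => Q.S 0 (z, κ)) (q, v) - (((deriv (deriv φ) q : ℝ) : ℂ) + T)
          * pderiv (0, 1) (fun z => Q.S 0 (z, κ)) (q, v)
      = (v : ℂ) ^ (2 * m) * (∑ l ∈ Finset.range m, (κ : ℂ) ^ l * Ra l (q, v)) + (κ : ℂ) ^ m *
        (fderiv ℝ (Q.S m) ((q, v), κ) ((1, 0), 0) - (((deriv (deriv φ) q : ℝ) : ℂ) + T)
      * fderiv ℝ (Q.S m) ((q, v), κ) ((0, 1), 0)) := by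
    have hp : ∀ e : ℝ × ℝ, pderiv e (fun z => Q.S 0 (z, κ)) (q, v)
        = ∑ l ∈ Finset.range m, (κ : ℂ) ^ l * pderiv e (Q.a l) (q, v)
          + (κ : ℂ) ^ m * fderiv ℝ (Q.S m) ((q, v), κ) (e, 0) := by
      intro e
      have h1 : (fun z => Q.S 0 (z, κ)) = fun z => ∑ l ∈ Finset.range m, (κ : ℂ) ^ l * Q.a l z
          + (κ : ℂ) ^ m * Q.S m (z, κ) := funext fun z => Q.S_zero_eq m z κ
      have hd1 : ∀ l, DifferentiableAt ℝ (Q.a l) (q, v) := fun l =>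
        (Q.contDiff_a l).differentiable (by simp) _
      have hd2 : DifferentiableAt ℝ (fun z => Q.S m (z, κ)) (q, v) :=
        (Q.contDiff_slice m κ).differentiable (by simp) _
      have h2 := (HasFDerivAt.fun_sum (u := Finset.range m)
        (fun l _ => (hd1 l).hasFDerivAt.const_mul ((κ : ℂ) ^ l))).add
        (hd2.hasFDerivAt.const_mul ((κ : ℂ) ^ m))
      have h2' : fderiv ℝ (fun z => ∑ l ∈ Finset.range m, (κ : ℂ) ^ l * Q.a l z
          + (κ : ℂ) ^ m * Q.S m (z, κ)) (q, v) = _ := h2.fderiv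
      rw [h1, pderiv, h2', ← hrem e κ (q, v)]
      simp only [add_apply, _root_.sum_apply, smul_apply, smul_eq_mul, pderiv]
    rw [hp, hp, Finset.mul_sum]
    have h3 : ∀ l, pderiv (1, 0) (Q.a l) (q, v) = (((deriv (deriv φ) q : ℝ) : ℂ) + T)
        * pderiv (0, 1) (Q.a l) (q, v) + (v : ℂ) ^ (2 * m) * Ra l (q, v) := fun l => by
      rw [← hRae l (q, v) hz]
      ring
    simp only [h3, mul_add, Finset.sum_add_distrib, Finset.mul_sum]
    have h4 : ∀ l, (κ : ℂ) ^ l * ((((deriv (deriv φ) q : ℝ) : ℂ) + T) * pderiv (0, 1) (Q.a l) (q, v))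
      = (((deriv (deriv φ) q : ℝ) : ℂ) + T) * ((κ : ℂ) ^ l * pderiv (0, 1) (Q.a l) (q, v)) := fun l => by ring
    have h5 : ∀ l, (κ : ℂ) ^ l * ((v : ℂ) ^ (2 * m) * Ra l (q, v))
      = (v : ℂ) ^ (2 * m) * ((κ : ℂ) ^ l * Ra l (q, v)) := fun l => by ring
    simp only [h4, h5]
    ring
  have hsum : ‖∑ l ∈ Finset.range m, (κ : ℂ) ^ l * Ra l (q, v)‖ ≤ ∑ l ∈ Finset.range m, |C₂ l| := by
    refine (norm_sum_le _ _).trans (Finset.sum_le_sum fun l _ => ?_)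
    rw [norm_mul, norm_pow, Complex.norm_real, Real.norm_of_nonneg hκ1.1]
    exact (mul_le_of_le_one_left (norm_nonneg _) (pow_le_one₀ hκ1.1 hκ1.2)).trans
      ((hC₂ l _ hz).trans (le_abs_self _))
  -- the derivative of the cut-off is supported away from `v = 0`
  have hdχ : ‖(((deriv (deriv φ) q : ℝ) : ℂ) + T) * ((deriv Q.χ v : ℝ) : ℂ)‖
      ≤ (4 / d ^ 2) ^ m * |C₄| * (v ^ 2) ^ m := by
    by_cases hv2 : v ∈ Icc (-(d / 2)) (d / 2)
    · rw [(Q.χ_one v hv2).deriv_eq, deriv_const]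
      simp only [Complex.ofReal_zero, mul_zero, norm_zero]
      positivity
    · refine ((hC₄ _ hz).trans (le_abs_self _)).trans ?_
      have h6 : d ^ 2 / 4 ≤ v ^ 2 := by
        rw [mem_Icc, not_and_or, not_le, not_le] at hv2
        rcases hv2 with h | h <;> nlinarith
      have h7 : 1 ≤ 4 / d ^ 2 * v ^ 2 := by
        rw [div_mul_eq_mul_div, one_le_div (by positivity)]
        linarith
      have h8 := one_le_pow₀ h7 (n := m)
      rw [mul_pow] at h8
      nlinarith [abs_nonneg C₄]
  rw [dbarOp_wave, norm_mul]
  simp only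
  rw [hLF, hRe (q, v)]
  set X := (v ^ 2) ^ m with hX
  have hX0 : 0 ≤ X := by positivity
  have hκm : ‖(κ : ℂ) ^ m‖ ≤ (k : ℝ) ^ (-(n : ℝ)) := by
    rw [norm_pow, Complex.norm_real, Real.norm_of_nonneg hκ1.1, hκ, inv_pow, ← Real.rpow_natCast,
      ← Real.rpow_neg hk0.le]
    refine Real.rpow_le_rpow_of_exponent_le hk1 ?_
    rw [hm]
    push_cast
    linarith
  have t1 : ‖4 * Real.pi * Complex.I * k * ((v : ℂ) ^ (2 * m) * R (q, v)) * Q.amp k (q, v)‖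
      ≤ k * (4 * Real.pi * |C₁| * C₀ * X) := by
    rw [norm_mul, norm_mul, norm_mul, norm_mul, norm_mul, norm_mul, hvm, Complex.norm_I, Complex.norm_natCast,
      Complex.norm_real, Real.norm_of_nonneg hπ.le, Complex.norm_ofNat, mul_one]
    calc _ ≤ 4 * Real.pi * k * (X * |C₁|) * C₀ := by
          gcongr
          exact (hC₁ _ hz).trans (le_abs_self _)
      _ = _ := by ring
  have t2 : ‖(Q.χ v : ℂ) * ((v : ℂ) ^ (2 * m) * (∑ l ∈ Finset.range m, (κ : ℂ) ^ l * Ra l (q, v)) + (κ : ℂ) ^ m *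
        (fderiv ℝ (Q.S m) ((q, v), κ) ((1, 0), 0) - (((deriv (deriv φ) q : ℝ) : ℂ) + T)
      * fderiv ℝ (Q.S m) ((q, v), κ) ((0, 1), 0)))‖
      ≤ X * (∑ l ∈ Finset.range m, |C₂ l|) + (k : ℝ) ^ (-(n : ℝ)) * C₃ := by
    rw [norm_mul]
    refine (mul_le_of_le_one_left (norm_nonneg _) hχ1).trans ((norm_add_le _ _).trans ?_)
    rw [norm_mul, norm_mul, hvm]
    have := hC₃ _ hz k
    gcongr
  have t3 : ‖(((deriv (deriv φ) q : ℝ) : ℂ) + T) * ((deriv Q.χ v : ℝ) : ℂ) * Q.S 0 ((q, v), κ)‖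
      ≤ (4 / d ^ 2) ^ m * |C₄| * X * C₀ := by
    rw [norm_mul]
    gcongr
  have ht := (norm_sub_le (4 * Real.pi * Complex.I * k * ((v : ℂ) ^ (2 * m) * R (q, v)) * Q.amp k (q, v)
      + (Q.χ v : ℂ) * ((v : ℂ) ^ (2 * m) * (∑ l ∈ Finset.range m, (κ : ℂ) ^ l * Ra l (q, v)) + (κ : ℂ) ^ m *
        (fderiv ℝ (Q.S m) ((q, v), κ) ((1, 0), 0) - (((deriv (deriv φ) q : ℝ) : ℂ) + T)
      * fderiv ℝ (Q.S m) ((q, v), κ) ((0, 1), 0))))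
      ((((deriv (deriv φ) q : ℝ) : ℂ) + T) * ((deriv Q.χ v : ℝ) : ℂ) * Q.S 0 ((q, v), κ))).trans
    (add_le_add ((norm_add_le _ _).trans (add_le_add t1 t2)) t3)
  have hexp := Q.norm_exp_Φ hz k
  have hexp1 : Real.exp (-(k * (Q.c * v ^ 2))) ≤ 1 := by
    refine Real.exp_le_one_iff.2 ?_
    have := Q.c_pos
    have : 0 ≤ k * (Q.c * v ^ 2) := by positivity
    linarith
  have hXe := sq_pow_mul_exp_le Q.c_pos m hk0 v
  set ex := Real.exp (-(k * (Q.c * v ^ 2))) with hex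
  have hex0 : 0 ≤ ex := (Real.exp_pos _).le
  calc _ ≤ ex * _ := mul_le_mul hexp ht (norm_nonneg _) hex0
    _ ≤ ex * (k * (A * X) + (k : ℝ) ^ (-(n : ℝ)) * C₃) := by
        refine mul_le_mul_of_nonneg_left ?_ hex0
        have h1 : X * (∑ l ∈ Finset.range m, |C₂ l|) ≤ k * (X * (∑ l ∈ Finset.range m, |C₂ l|)) :=
          le_mul_of_one_le_left (by positivity) hk1
        have h2 : (4 / d ^ 2) ^ m * |C₄| * X * C₀ ≤ k * ((4 / d ^ 2) ^ m * |C₄| * X * C₀) :=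
          le_mul_of_one_le_left (by positivity) hk1
        have h3 : k * (A * X) = k * (4 * Real.pi * |C₁| * C₀ * X) + k * (X * (∑ l ∈ Finset.range m, |C₂ l|))
            + k * ((4 / d ^ 2) ^ m * |C₄| * X * C₀) := by rw [hA]; ring
        linarith
    _ = k * A * (X * ex) + ex * ((k : ℝ) ^ (-(n : ℝ)) * C₃) := by ring
    _ ≤ k * A * (B * (k : ℝ) ^ (-(m : ℝ))) + 1 * ((k : ℝ) ^ (-(n : ℝ)) * C₃) := by gcongr
    _ = _ := by
        have : (k : ℝ) ^ (-(n : ℝ)) = k * (k : ℝ) ^ (-(m : ℝ)) := by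
          have h1 := Real.rpow_add hk0 1 (-(m : ℝ))
          rw [Real.rpow_one] at h1
          rw [← h1, hm]
          congr 1
          push_cast
          ring
        rw [this]
        ring

end Quasimode

theorem hasDerivAt_exp_mul {w w' A A' : ℝ → ℂ} {v : ℝ} (hw : HasDerivAt w (w' v) v)
    (hA : HasDerivAt A (A' v) v) :
    HasDerivAt (fun v => Complex.exp (w v) * A v) (Complex.exp (w v) * (w' v * A v + A' v)) v := by
  refine (hw.cexp.mul hA).congr_deriv ?_
  ring

namespace Quasimode

variable {φ : ℝ → ℝ} {T : ℂ} {x d : ℝ} (Q : Quasimode φ T x d)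

theorem wave_eq_zero (k : ℕ+) {q v : ℝ} (hv : v ∉ Ioo (-d) d) : Q.wave k (q, v) = 0 := by
  rw [wave, amp, Q.χ_eq_zero hv]
  simp

/-- Decay of the Fourier coefficients of the quasimode. -/
theorem exists_sq_mul_norm_fiberCoeff_wave_le :
    ∃ C : ℝ, 0 ≤ C ∧ ∀ k : ℕ+, ∀ q ∈ Icc (x - d) (x + d), ∀ n : ℤ,
      (n : ℝ) ^ 2 * ‖fiberCoeff (deriv φ) k (Q.wave k) (n / (2 * k)) q‖ ≤ C * (k : ℝ) ^ 2 := by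
  have hd := Q.d_pos
  have hd4 := Q.d_le
  -- the amplitude and its derivatives in `v`, as functions of `(q, v)` and `κ`
  let D1 : ((ℝ × ℝ) × ℝ → ℂ) → (ℝ × ℝ) × ℝ → ℂ := fun f w => fderiv ℝ f w ((0, 1), 0)
  have hD1 : ∀ f, ContDiff ℝ ∞ f → ContDiff ℝ ∞ (D1 f) := fun f hf =>
    (hf.fderiv_right (m := ∞) (by simp)).clm_apply contDiff_const
  have hD1d : ∀ f, ContDiff ℝ ∞ f → ∀ q κ v, HasDerivAt (fun v => f ((q, v), κ)) (D1 f ((q, v), κ)) v :=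
    fun f hf q κ v => HasFDerivAt.comp_hasDerivAt (l := f) (f := fun v : ℝ => ((q, v), κ)) v
      (hf.differentiable (by simp) _).hasFDerivAt
      (((hasDerivAt_const v q).prodMk (hasDerivAt_id v)).prodMk (hasDerivAt_const v κ))
  set A : (ℝ × ℝ) × ℝ → ℂ := fun w => (Q.χ w.1.2 : ℂ) * Q.S 0 w with hA
  have hAs : ContDiff ℝ ∞ A :=
    (contDiff_ofReal.comp (Q.contDiff_χ.comp (contDiff_snd.comp contDiff_fst))).mul (Q.contDiff_S 0)
  have hA1 := hD1 A hAs
  have hA2 := hD1 _ hA1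
  have hΦ1 := contDiff_pderiv Q.contDiff_Φ (0, 1)
  have hΦ2 := contDiff_pderiv hΦ1 (0, 1)
  have hzero : ∀ f : (ℝ × ℝ) × ℝ → ℂ, (∀ q κ, ∀ v ∉ tsupport Q.χ, f ((q, v), κ) = 0) →
      ∀ q κ, ∀ v ∉ tsupport Q.χ, D1 f ((q, v), κ) = 0 := by
    intro f hf q κ v hv
    have h1 : f =ᶠ[𝓝 ((q, v), κ)] fun _ => 0 := by
      have hc : Continuous fun w : (ℝ × ℝ) × ℝ => w.1.2 := by fun_prop
      filter_upwards [hc.continuousAt.preimage_mem_nhds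
        ((isClosed_tsupport Q.χ).isOpen_compl.mem_nhds hv)] with w hw
      exact hf w.1.1 w.2 w.1.2 hw
    simp only [D1, h1.fderiv_eq, fderiv_const_apply, zero_apply]
  have hA00 : ∀ q κ, ∀ v ∉ tsupport Q.χ, A ((q, v), κ) = 0 := by
    intro q κ v hv
    simp [hA, image_eq_zero_of_notMem_tsupport hv]
  have hA10 := hzero A hA00
  have hA20 := hzero _ hA10
  obtain ⟨a0, ha0, ba0⟩ := exists_bound_S hAs.continuous x d
  obtain ⟨a1, ha1, ba1⟩ := exists_bound_S hA1.continuous x d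
  obtain ⟨a2, ha2, ba2⟩ := exists_bound_S hA2.continuous x d
  obtain ⟨p1, bp1⟩ := (isCompact_graphBox x d).exists_bound_of_continuousOn
    (f := fun z => pderiv (0, 1) Q.Φ z - z.1) (by
      have := hΦ1.continuous
      fun_prop)
  obtain ⟨p2, bp2⟩ := (isCompact_graphBox x d).exists_bound_of_continuousOn hΦ2.continuous.continuousOn
  set π4 : ℝ := 4 * Real.pi with hπ4
  have hπ := Real.pi_pos
  set B : ℝ := π4 * |p1| * (π4 * |p1| * a0 + a1) + (π4 * |p2| * a0 + π4 * |p1| * a1 + a2) with hB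
  have hB0 : 0 ≤ B := by positivity
  refine ⟨B, hB0, fun k q hq n => ?_⟩
  have hk1 := PNat.one_le_cast_real k
  set κ : ℝ := (k : ℝ)⁻¹ with hκ
  set c : ℂ := 4 * Real.pi * Complex.I * k with hc
  have hcn : ‖c‖ = π4 * k := by
    rw [hc, norm_mul, norm_mul, norm_mul, Complex.norm_I, Complex.norm_natCast, Complex.norm_real,
      Real.norm_of_nonneg hπ.le, Complex.norm_ofNat, mul_one]
  -- the integrand and its first two derivatives
  set w : ℝ → ℂ := fun v => c * (Q.Φ (q, v) - v * q) with hw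
  set w1 : ℝ → ℂ := fun v => c * (pderiv (0, 1) Q.Φ (q, v) - q) with hw1
  set w2 : ℝ → ℂ := fun v => c * pderiv (0, 1) (pderiv (0, 1) Q.Φ) (q, v) with hw2
  have hwd : ∀ v, HasDerivAt w (w1 v) v := fun v => by
    have h1 := hasDerivAt_pderiv_snd (Q.contDiff_Φ.differentiable (by simp) (q, v))
    have h2 := (((hasDerivAt_id v).ofReal_comp).mul_const (q : ℂ))
    refine ((h1.sub h2).const_mul c).congr_deriv ?_
    simp [hw1]
  have hw1d : ∀ v, HasDerivAt w1 (w2 v) v := fun v =>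
    ((hasDerivAt_pderiv_snd (hΦ1.differentiable (by simp) (q, v))).sub_const (q : ℂ)).const_mul c
  set A0 : ℝ → ℂ := fun v => A ((q, v), κ) with hA0
  set A1 : ℝ → ℂ := fun v => w1 v * A0 v + D1 A ((q, v), κ) with hA1'
  set A2 : ℝ → ℂ := fun v => w1 v * A1 v + (w2 v * A0 v + w1 v * D1 A ((q, v), κ)
    + D1 (D1 A) ((q, v), κ)) with hA2'
  have hK1 : ∀ v, HasDerivAt (fun v => Complex.exp (w v) * A0 v) (Complex.exp (w v) * A1 v) v :=
    fun v => hasDerivAt_exp_mul (A' := fun v => D1 A ((q, v), κ)) (hwd v) (hD1d A hAs q κ v)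
  have hK2 : ∀ v, HasDerivAt (fun v => Complex.exp (w v) * A1 v) (Complex.exp (w v) * A2 v) v :=
    fun v => hasDerivAt_exp_mul (A' := fun v => w2 v * A0 v + w1 v * D1 A ((q, v), κ)
      + D1 (D1 A) ((q, v), κ)) (hwd v) (((hw1d v).mul (hD1d A hAs q κ v)).add (hD1d _ hA1 q κ v))
  have hcA : ∀ f : (ℝ × ℝ) × ℝ → ℂ, ContDiff ℝ ∞ f → Continuous fun v : ℝ => f ((q, v), κ) :=
    fun f hf => hf.continuous.comp (by fun_prop)
  have hwc : Continuous w := continuous_iff_continuousAt.2 fun v => (hwd v).continuousAt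
  have hw1c : Continuous w1 := continuous_iff_continuousAt.2 fun v => (hw1d v).continuousAt
  have hw2c : Continuous w2 := continuous_const.mul (hΦ2.continuous.comp (by fun_prop))
  have hA0c : Continuous A0 := hcA A hAs
  have hA1c : Continuous A1 := (hw1c.mul hA0c).add (hcA _ hA1)
  have hKc : Continuous fun v => Complex.exp (w v) * A2 v :=
    hwc.cexp.mul ((hw1c.mul hA1c).add (((hw2c.mul hA0c).add (hw1c.mul (hcA _ hA1))).add (hcA _ hA2)))
  have hout : ∀ v ∉ tsupport Q.χ, A0 v = 0 ∧ A1 v = 0 ∧ A2 v = 0 := by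
    intro v hv
    have e0 : A0 v = 0 := hA00 q κ v hv
    have e1 : A1 v = 0 := by simp only [hA1', e0, hA10 q κ v hv, mul_zero, add_zero]
    exact ⟨e0, e1, by simp only [hA2', e0, e1, hA10 q κ v hv, hA20 q κ v hv, mul_zero, add_zero]⟩
  have hne : ∀ v : ℝ, v ∉ Ioo (-d) d → v ∉ tsupport Q.χ := fun v hv h => hv (Q.tsupport_χ h)
  have h12 : (1 / 2 : ℝ) ∉ tsupport Q.χ := hne _ fun h => by linarith [h.2]
  have h12' : (-(1 / 2) : ℝ) ∉ tsupport Q.χ := hne _ fun h => by linarith [h.1]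
  have hM : ∀ v ∈ Icc (-(1 / 2) : ℝ) (1 / 2), ‖Complex.exp (w v) * A2 v‖ ≤ B * (k : ℝ) ^ 2 := by
    intro v _
    by_cases hv : v ∈ Ioo (-d) d
    swap
    · rw [(hout v (hne v hv)).2.2, mul_zero, norm_zero]
      positivity
    have hz := mem_graphBox hq hv
    have hex : ‖Complex.exp (w v)‖ ≤ 1 := by
      have h1 : Complex.exp (w v) = Complex.exp (4 * Real.pi * Complex.I * k * Q.Φ (q, v))
          * Complex.exp (-(4 * Real.pi * Complex.I * k * v * q)) := by
        rw [← Complex.exp_add]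
        congr 1
        simp only [hw, hc]
        ring
      rw [h1, norm_mul, QuantumTorus.norm_exp_imaginary (-(4 * Real.pi * Complex.I * k * v * q))
        (-(4 * Real.pi * k * v * q)) (by push_cast; ring), mul_one]
      refine (Q.norm_exp_Φ hz k).trans (Real.exp_le_one_iff.2 ?_)
      have := Q.c_pos
      have : 0 ≤ k * (Q.c * v ^ 2) := by positivity
      linarith
    have b0 : ‖A0 v‖ ≤ a0 := ba0 _ hz k
    have b1 : ‖D1 A ((q, v), κ)‖ ≤ a1 := ba1 _ hz k
    have b2 : ‖D1 (D1 A) ((q, v), κ)‖ ≤ a2 := ba2 _ hz k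
    have bw1 : ‖w1 v‖ ≤ k * (π4 * |p1|) := by
      rw [hw1]
      beta_reduce
      rw [norm_mul, hcn, mul_comm π4, mul_assoc]
      gcongr
      exact (bp1 _ hz).trans (le_abs_self _)
    have bw2 : ‖w2 v‖ ≤ k * (π4 * |p2|) := by
      rw [hw2]
      beta_reduce
      rw [norm_mul, hcn, mul_comm π4, mul_assoc]
      gcongr
      exact (bp2 _ hz).trans (le_abs_self _)
    have bA1 : ‖A1 v‖ ≤ k * (π4 * |p1|) * a0 + k * a1 := by
      refine (norm_add_le _ _).trans (add_le_add ?_ (b1.trans (le_mul_of_one_le_left ha1 hk1)))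
      rw [norm_mul]
      gcongr
    rw [norm_mul]
    refine (mul_le_of_le_one_left (norm_nonneg _) hex).trans ?_
    have bA2 : ‖A2 v‖ ≤ k * (π4 * |p1|) * (k * (π4 * |p1|) * a0 + k * a1)
        + (k * (π4 * |p2|) * a0 + k * (π4 * |p1|) * a1 + a2) := by
      refine (norm_add_le _ _).trans (add_le_add ?_ ((norm_add_le _ _).trans
        (add_le_add ((norm_add_le _ _).trans (add_le_add ?_ ?_)) b2)))
      · rw [norm_mul]
        gcongr
      · rw [norm_mul]
        gcongr
      · rw [norm_mul]
        gcongr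
    refine bA2.trans ?_
    have hk2 : (k : ℝ) ≤ (k : ℝ) ^ 2 := by nlinarith
    have i1 : k * (π4 * |p2|) * a0 ≤ (k : ℝ) ^ 2 * (π4 * |p2| * a0) := by
      rw [mul_assoc]
      gcongr
    have i2 : k * (π4 * |p1|) * a1 ≤ (k : ℝ) ^ 2 * (π4 * |p1| * a1) := by
      rw [mul_assoc]
      gcongr
    have i3 : a2 ≤ (k : ℝ) ^ 2 * a2 := le_mul_of_one_le_left ha2 (hk1.trans hk2)
    calc _ ≤ k * (π4 * |p1|) * (k * (π4 * |p1|) * a0 + k * a1) + ((k : ℝ) ^ 2 * (π4 * |p2| * a0)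
          + (k : ℝ) ^ 2 * (π4 * |p1| * a1) + (k : ℝ) ^ 2 * a2) := by gcongr
      _ = _ := by rw [hB]; ring
  have := sq_mul_norm_fourier_le hK1 hK2 hKc (by rw [(hout _ h12).1, (hout _ h12').1]; simp)
    (by rw [(hout _ h12).2.1, (hout _ h12').2.1]; simp) hM n
  have hfun : (fun v : ℝ => Complex.exp (w v) * A0 v * Complex.exp (2 * Real.pi * Complex.I * n * v))
      = fun v : ℝ => (Q.wave k (q, v) * Complex.exp (-(4 * Real.pi * Complex.I * k * v * q)))
        * Complex.exp (2 * Real.pi * Complex.I * n * v) := by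
    funext v
    have h1 : Complex.exp (w v) = Complex.exp (4 * Real.pi * Complex.I * k * Q.Φ (q, v))
          * Complex.exp (-(4 * Real.pi * Complex.I * k * v * q)) := by
      rw [← Complex.exp_add]
      congr 1
      simp only [hw, hc]
      ring
    rw [h1, wave, amp]
    simp only [hA0, hA, hκ]
    ring
  rw [hfun, QuantumTorus.norm_fourier_eq (deriv φ) k.pos] at this
  exact this

/-- The quasimode is integrated on the circles `q = m / 2k` by Laplace's method. -/
theorem exists_integral_wave_sub_le {P : ℕ → ℕ → ℝ → ℂ}
    (hP : ∀ l L : ℕ, ∃ C : ℝ, ∀ k : ℝ, 1 ≤ k → ∀ q ∈ Icc (x - d) (x + d),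
      ‖(∫ v in (-d)..d, Complex.exp (-((k : ℂ) * (v : ℂ) ^ 2 * Q.W (q, v))) * Q.a l (q, v))
        - ((k ^ (-(1 / 2) : ℝ) : ℝ) : ℂ) * ∑ j ∈ Finset.range L, ((k : ℂ) ^ j)⁻¹ * P l j q‖
      ≤ C * k ^ (-(1 / 2) - (L : ℝ))) (L : ℕ) :
    ∃ C : ℝ, ∀ k : ℕ+, ∀ q ∈ Icc (x - d) (x + d),
      ‖(∫ v in (-(1 / 2) : ℝ)..(1 / 2), Q.wave k (q, v))
        - Complex.exp (4 * Complex.I * Real.pi * k * φ q) * ((((k : ℝ) ^ (-(1 / 2) : ℝ) : ℝ) : ℂ) *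
          ∑ n ∈ Finset.range L, ((k : ℂ) ^ n)⁻¹ * ∑ i ∈ Finset.range (n + 1), P i (n - i) q)‖
      ≤ C * (k : ℝ) ^ (-(1 / 2) - (L : ℝ)) := by
  have hd := Q.d_pos
  have hd4 := Q.d_le
  obtain ⟨C₁, hC₁⟩ := laplace_expansion_of_amplitude_expansion hd Q.c_pos.le Q.continuousOn_W Q.c_le
    (fun l => (Q.contDiff_a l).continuous.continuousOn) hP
    (f := fun k z => Q.S 0 (z, (k : ℝ)⁻¹)) (fun k => (Q.contDiff_slice 0 _).continuous.continuousOn)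
    (fun L => by
      obtain ⟨C, -, hC⟩ := exists_bound_S (Q.contDiff_S L).continuous x d
      refine ⟨C, fun k z hz => ?_⟩
      have hk1 := PNat.one_le_cast_real k
      have hk0 : (0 : ℝ) < k := by linarith
      rw [Q.S_zero_eq L]
      have : ∀ l, (((k : ℝ)⁻¹ : ℝ) : ℂ) ^ l = ((k : ℂ) ^ l)⁻¹ := fun l => by push_cast; rw [inv_pow]
      simp only [this, add_sub_cancel_left]
      rw [norm_mul, norm_inv, norm_pow, Complex.norm_natCast, Real.rpow_neg hk0.le, Real.rpow_natCast,
        mul_comm C]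
      exact mul_le_mul_of_nonneg_left (hC z hz k) (by positivity)) L
  obtain ⟨C₀, hC₀0, hC₀⟩ := exists_bound_S (Q.contDiff_S 0).continuous x d
  obtain ⟨C₂, hC₂0, hC₂⟩ := exists_exp_neg_le_rpow (a := Q.c * (d / 2) ^ 2)
    (by have := Q.c_pos; positivity) (1 / 2 + (L : ℝ))
  refine ⟨C₀ * C₂ * (2 * d) + C₁, fun k q hq => ?_⟩
  have hk1 := PNat.one_le_cast_real k
  have hk0 : (0 : ℝ) < k := by linarith
  have hcw : ∀ q, Continuous fun v => Q.wave k (q, v) := fun q =>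
    (Q.contDiff_wave k).continuous.comp (by fun_prop)
  have e1 : (∫ v in (-(1 / 2) : ℝ)..(1 / 2), Q.wave k (q, v)) = ∫ v in (-d)..d, Q.wave k (q, v) := by
    have h0 : ∀ a b : ℝ, (∀ v ∈ uIcc a b, v ∉ Ioo (-d) d) → ∫ v in a..b, Q.wave k (q, v) = 0 := by
      intro a b hab
      rw [intervalIntegral.integral_congr (g := fun _ => (0 : ℂ)) fun v hv => Q.wave_eq_zero k (hab v hv)]
      simp
    have hi : ∀ a b : ℝ, IntervalIntegrable (fun v => Q.wave k (q, v)) MeasureTheory.volume a b :=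
      fun a b => (hcw q).intervalIntegrable a b
    rw [← intervalIntegral.integral_add_adjacent_intervals (hi (-(1 / 2)) (-d)) (hi _ _),
      ← intervalIntegral.integral_add_adjacent_intervals (hi (-d) d) (hi _ _), h0, h0 d]
    · ring
    · intro v hv h
      rw [uIcc_of_le (by linarith)] at hv
      exact absurd h.2 (not_lt.2 hv.1)
    · intro v hv h
      rw [uIcc_of_le (by linarith)] at hv
      exact absurd h.1 (not_lt.2 hv.2)
  set E : ℂ := Complex.exp (4 * Complex.I * Real.pi * k * φ q) with hE
  have hEn : ‖E‖ = 1 := norm_exp_phase k (φ q)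
  set f : ℝ → ℂ := fun v => Complex.exp (-((k : ℂ) * (v : ℂ) ^ 2 * Q.W (q, v))) * Q.S 0 ((q, v), (k : ℝ)⁻¹)
    with hf
  have hfc : ContinuousOn f (Icc (-d) d) := by
    have h1 : ContinuousOn (fun v => Q.W (q, v)) (Icc (-d) d) :=
      Q.continuousOn_W.comp (by fun_prop) fun v hv => ⟨hq, hv⟩
    have h2 : Continuous fun v => Q.S 0 ((q, v), (k : ℝ)⁻¹) :=
      (Q.contDiff_S 0).continuous.comp (by fun_prop)
    exact ((Continuous.continuousOn (by fun_prop)).mul h1).neg.cexp.mul h2.continuousOn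
  have hfw : ∀ v ∈ Icc (-d) d, Q.wave k (q, v) = E * (Q.χ v * f v) := by
    intro v hv
    have hz : (q, v) ∈ graphBox x d := ⟨hq, hv⟩
    have h1 : Complex.exp (4 * Real.pi * Complex.I * k * Q.Φ (q, v))
        = E * Complex.exp (-((k : ℂ) * (v : ℂ) ^ 2 * Q.W (q, v))) := by
      have h2 : Complex.exp (4 * Real.pi * Complex.I * k * Q.Φ (q, v))
          = Complex.exp (4 * Real.pi * Complex.I * Q.Φ (q, v)) ^ (k : ℕ) := by
        rw [← Complex.exp_nat_mul]
        congr 1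
        ring
      rw [h2, Q.exp_Φ _ hz, mul_pow, ← Complex.exp_nat_mul, ← Complex.exp_nat_mul, hE]
      congr 2 <;> ring
    rw [wave, amp, h1, hf]
    ring
  have hfi : IntervalIntegrable f MeasureTheory.volume (-d) d :=
    (hfc.mono (by rw [uIcc_of_le (by linarith)])).intervalIntegrable
  have e2 : ∫ v in (-d)..d, Q.wave k (q, v)
      = E * ((∫ v in (-d)..d, ((Q.χ v : ℂ) - 1) * f v) + ∫ v in (-d)..d, f v) := by
    have hcχ : ContinuousOn (fun v => ((Q.χ v : ℂ) - 1) * f v) (uIcc (-d) d) := by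
      rw [uIcc_of_le (by linarith)]
      have := Q.contDiff_χ.continuous
      exact (Continuous.continuousOn (by fun_prop)).mul hfc
    rw [← intervalIntegral.integral_add hcχ.intervalIntegrable hfi,
      ← intervalIntegral.integral_const_mul]
    refine intervalIntegral.integral_congr fun v hv => ?_
    rw [uIcc_of_le (by linarith)] at hv
    rw [hfw v hv]
    ring
  -- the cut-off only changes the integral where the exponential is small
  have e3 : ‖∫ v in (-d)..d, ((Q.χ v : ℂ) - 1) * f v‖ ≤ C₀ * C₂ * (k : ℝ) ^ (-(1 / 2 + (L : ℝ))) * (2 * d) := by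
    refine (intervalIntegral.norm_integral_le_of_norm_le_const
      (C := C₀ * C₂ * (k : ℝ) ^ (-(1 / 2 + (L : ℝ)))) fun v hv => ?_).trans (le_of_eq ?_)
    · rw [uIoc_of_le (by linarith)] at hv
      have hv' : v ∈ Icc (-d) d := ⟨hv.1.le, hv.2⟩
      have hz : (q, v) ∈ graphBox x d := ⟨hq, hv'⟩
      by_cases hv2 : v ∈ Icc (-(d / 2)) (d / 2)
      · rw [(Q.χ_one v hv2).eq_of_nhds]
        simp only [Complex.ofReal_one, sub_self, zero_mul, norm_zero]
        positivity
      have hχ1 : ‖(Q.χ v : ℂ) - 1‖ ≤ 1 := by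
        have := Q.χ_mem v
        rw [← Complex.ofReal_one, ← Complex.ofReal_sub, Complex.norm_real, Real.norm_eq_abs, abs_le]
        exact ⟨by linarith [this.1], by linarith [this.2]⟩
      rw [norm_mul]
      refine (mul_le_of_le_one_left (norm_nonneg _) hχ1).trans ?_
      rw [hf, norm_mul, mul_comm, mul_assoc C₀]
      have hv3 : (d / 2) ^ 2 ≤ v ^ 2 := by
        rw [mem_Icc, not_and_or, not_le, not_le] at hv2
        rcases hv2 with h | h <;> nlinarith
      refine mul_le_mul (hC₀ _ hz k) ?_ (norm_nonneg _) hC₀0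
      have h3 := norm_exp_phase_le (Q.c_le _ hz) hk0.le v
      rw [Complex.ofReal_natCast] at h3
      refine h3.trans (le_trans ?_ (hC₂ k hk1))
      refine Real.exp_le_exp.2 ?_
      have := mul_le_mul_of_nonneg_left hv3 (mul_pos hk0 Q.c_pos).le
      linarith
    · rw [sub_neg_eq_add, abs_of_pos (by linarith)]
      ring
  have h5 := hC₁ k q hq
  rw [e1, e2, ← mul_sub, norm_mul, hEn, one_mul, add_sub_assoc]
  refine (norm_add_le _ _).trans ?_
  rw [add_mul]
  refine add_le_add (e3.trans (le_of_eq ?_)) h5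
  rw [show -(1 / 2 + (L : ℝ)) = -(1 / 2) - (L : ℝ) by ring]
  ring

end Quasimode

/-! ### Comparison of a holomorphic section with a quasimode -/

theorem norm_fiberCoeff_le {ψ : ℝ → ℝ} {k : ℝ} {G : ℝ × ℝ → ℂ} {y q ε : ℝ} (hε : ∀ v, ‖G (q, v)‖ ≤ ε) :
    ‖fiberCoeff ψ k G y q‖ ≤ ε := by
  rw [fiberCoeff]
  refine (intervalIntegral.norm_integral_le_of_norm_le_const (C := ε) fun v _ => ?_).trans
    (le_of_eq (by norm_num))
  rw [norm_mul, QuantumTorus.norm_exp_imaginary _ (-(4 * Real.pi * k * (ψ q + v) * (q - y)))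
    (by push_cast; ring), mul_one]
  exact hε v

theorem fiberCoeff_sub_const_mul {ψ : ℝ → ℝ} {k : ℝ} {G G' : ℝ × ℝ → ℂ} (hG : Continuous G)
    (hG' : Continuous G') (a : ℂ) (y q : ℝ) :
    fiberCoeff ψ k (fun z => G z - a * G' z) y q = fiberCoeff ψ k G y q - a * fiberCoeff ψ k G' y q := by
  simp only [fiberCoeff]
  rw [← intervalIntegral.integral_const_mul, ← intervalIntegral.integral_sub]
  · refine intervalIntegral.integral_congr fun v _ => ?_
    ring
  · exact Continuous.intervalIntegrable (by fun_prop) _ _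
  · exact Continuous.intervalIntegrable (by fun_prop) _ _

theorem fiberCoeff_self (ψ : ℝ → ℝ) (k : ℝ) (G : ℝ × ℝ → ℂ) (y : ℝ) :
    fiberCoeff ψ k G y y = ∫ v in (-(1 / 2) : ℝ)..(1 / 2), G (y, v) := by
  simp [fiberCoeff]

namespace Quasimode

variable {φ : ℝ → ℝ} {T : ℂ} {x d : ℝ}

theorem half_notMem (Q : Quasimode φ T x d) : (1 / 2 : ℝ) ∉ Ioo (-d) d := fun h => by linarith [Q.d_le, h.2]

theorem neg_half_notMem (Q : Quasimode φ T x d) : (-(1 / 2) : ℝ) ∉ Ioo (-d) d := fun h => by linarith [Q.d_le, h.1]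

variable (Q : Quasimode φ T x d)

/-- The fiber coefficients of the quasimode propagate like those of a holomorphic section, up to
`O(k^{-∞})`. -/
theorem exists_norm_fiberCoeff_wave_sub_le (n : ℕ) : ∃ C : ℝ, 0 ≤ C ∧ ∀ k : ℕ+,
    ∀ q ∈ Icc (x - d) (x + d), ∀ q' ∈ Icc (x - d) (x + d), ∀ y : ℝ,
      (∀ s ∈ uIcc q q', |s - y| ≤ |q - y|) →
      ‖fiberCoeff (deriv φ) k (Q.wave k) y q
        - Complex.exp (2 * Real.pi * Complex.I * k * T * (((q - y) ^ 2 - (q' - y) ^ 2 : ℝ) : ℂ))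
          * fiberCoeff (deriv φ) k (Q.wave k) y q'‖ ≤ C * (k : ℝ) ^ (-(n : ℝ)) := by
  obtain ⟨C, hC0, hC⟩ := Q.exists_norm_dbarOp_wave_le n
  refine ⟨C, hC0, fun k q hq q' hq' y hs => ?_⟩
  have h1 := norm_sub_propagator_mul_le (b := fiberCoeff (deriv φ) k (Q.wave k) y)
    (r := fiberCoeff (deriv φ) k (dbarOp (deriv φ) T k (Q.wave k)) y) (T := T) (k := k) (y := y)
    (ε := C * (k : ℝ) ^ (-(n : ℝ))) (q := q) (q' := q') (Nat.cast_nonneg _) Q.im_pos.le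
    (fun s _ => hasDerivAt_fiberCoeff Q.contDiff_ψ T (Q.contDiff_wave k) (fun q => by
      rw [Q.wave_eq_zero k Q.half_notMem, Q.wave_eq_zero k Q.neg_half_notMem]; simp) s)
    (fun s hs => norm_fiberCoeff_le (hC k s (uIcc_subset_Icc hq hq' hs))) hs
  rw [Complex.ofReal_natCast] at h1
  refine h1.trans (mul_le_of_le_one_right (by positivity) ?_)
  rw [abs_le]
  have := Q.d_le
  exact ⟨by linarith [hq.1, hq'.2], by linarith [hq.2, hq'.1]⟩

end Quasimode

/-- Two constants bounding respectively the size and the quadratic decay of Fourier coefficients give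
a rapidly decreasing bound of the sum. -/
theorem rpow_interpolation_le {C₁ C₂ : ℝ} (h1 : 0 ≤ C₁) (h2 : 0 ≤ C₂) {n M : ℕ} {k : ℝ} (hk : 1 ≤ k) :
    (C₁ * k ^ (-((4 * n + 3 * M : ℕ) : ℝ))) ^ (1 / 4 : ℝ)
      * (C₁ * k ^ (-((4 * n + 3 * M : ℕ) : ℝ)) + C₂ * k ^ (M : ℝ)) ^ (3 / 4 : ℝ)
      ≤ C₁ ^ (1 / 4 : ℝ) * (C₁ + C₂) ^ (3 / 4 : ℝ) * k ^ (-(n : ℝ)) := by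
  have hk0 : 0 < k := by linarith
  have h3 : C₁ * k ^ (-((4 * n + 3 * M : ℕ) : ℝ)) + C₂ * k ^ (M : ℝ) ≤ (C₁ + C₂) * k ^ (M : ℝ) := by
    rw [add_mul]
    refine add_le_add (mul_le_mul_of_nonneg_left (Real.rpow_le_rpow_of_exponent_le hk ?_) h1) le_rfl
    have : (0 : ℝ) ≤ ((4 * n + 3 * M : ℕ) : ℝ) := Nat.cast_nonneg _
    have : (0 : ℝ) ≤ (M : ℝ) := Nat.cast_nonneg _
    linarith
  have h4 := Real.rpow_le_rpow (z := 3 / 4) (by positivity) h3 (by norm_num)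
  refine (mul_le_mul_of_nonneg_left h4 (by positivity)).trans (le_of_eq ?_)
  rw [Real.mul_rpow h1 (by positivity), Real.mul_rpow (by positivity) (by positivity),
    ← Real.rpow_mul hk0.le, ← Real.rpow_mul hk0.le]
  have : k ^ (-(n : ℝ)) = k ^ (-((4 * n + 3 * M : ℕ) : ℝ) * (1 / 4)) * k ^ ((M : ℝ) * (3 / 4)) := by
    rw [← Real.rpow_add hk0]
    congr 1
    push_cast
    ring
  rw [this]
  ring

namespace QuantumTorus

variable {E : Type*} [NormedAddCommGroup E] [NormedSpace ℝ E] {D : QuantumTorus E}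
  {δ : Type*} [NormedAddCommGroup δ] [InnerProductSpace ℂ δ] {h : HalfFormLine D δ} {Ω : δ}

/-- The Fourier coefficients of a section and of a quasimode which agree on the circles `q = m / 2k`
over an interval agree on every circle over a smaller interval. -/
theorem exists_norm_fiberCoeff_sub_le (hΩ : h.sq Ω D.μ = 1) {φ : ℝ → ℝ} {x d : ℝ}
    (Q : Quasimode φ (h.modulus Ω) x d) {u : ℕ+ → E → ℂ} (hu : ∀ k : ℕ+, u k ∈ D.holSections ℂ k)
    {M : ℕ} {C₀ : ℝ} (hC₀ : 0 ≤ C₀) (hθ : ∀ (k : ℕ+) (m : ℤ), ‖D.thetaCoeff k (u k) m‖ ≤ C₀ * (k : ℝ) ^ (M : ℝ))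
    {A : ℕ+ → ℂ} (hA : ∀ k, ‖A k‖ ≤ C₀ * (k : ℝ) ^ (M : ℝ))
    (hnode : ∀ n : ℕ, ∃ C : ℝ, ∀ (k : ℕ+) (m : ℤ), (m / (2 * k) : ℝ) ∈ Icc (x - d) (x + d) →
      ‖D.thetaCoeff k (u k) m - A k * ∫ v in (-(1 / 2) : ℝ)..(1 / 2), Q.wave k (m / (2 * k), v)‖
        ≤ C * (k : ℝ) ^ (-(n : ℝ))) (n : ℕ) :
    ∃ C : ℝ, 0 ≤ C ∧ ∀ (k : ℕ+) (m : ℤ), ∀ q ∈ Icc (x - d / 2) (x + d / 2),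
      ‖fiberCoeff (deriv φ) k (D.chart (deriv φ) k (u k)) (m / (2 * k)) q
        - A k * fiberCoeff (deriv φ) k (Q.wave k) (m / (2 * k)) q‖ ≤ C * (k : ℝ) ^ (-(n : ℝ)) := by
  have hd := Q.d_pos
  have hT := Q.im_pos
  have hπ := Real.pi_pos
  obtain ⟨C₁, hC₁⟩ := hnode n
  obtain ⟨C₂, hC₂0, hC₂⟩ := Q.exists_norm_fiberCoeff_wave_sub_le (n + M)
  obtain ⟨C₃, hC₃0, hC₃⟩ := Q.exists_norm_wave_le
  obtain ⟨C₄, hC₄0, hC₄⟩ := exists_exp_neg_le_rpow (a := 2 * Real.pi * (h.modulus Ω).im * (d ^ 2 / 4)) (by positivity)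
    ((n + M : ℕ) : ℝ)
  refine ⟨|C₁| + C₀ * C₂ + C₀ * C₄ + C₀ * C₃ * C₄, by positivity, fun k m q hq => ?_⟩
  have hk1 := PNat.one_le_cast_real k
  have hk0 : (0 : ℝ) < k := by linarith
  have hq2 : q ∈ Icc (x - d) (x + d) := ⟨by linarith [hq.1], by linarith [hq.2]⟩
  set y : ℝ := m / (2 * k) with hy
  set b := fiberCoeff (deriv φ) k (Q.wave k) y with hb
  set θ := D.thetaCoeff k (u k) m with hθd
  have hkn : 0 < (k : ℝ) ^ (-(n : ℝ)) := by positivity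
  have hsplit : (k : ℝ) ^ (-(n : ℝ)) = (k : ℝ) ^ (M : ℝ) * (k : ℝ) ^ (-((n + M : ℕ) : ℝ)) := by
    rw [← Real.rpow_add hk0]
    congr 1
    push_cast
    ring
  -- products of a polynomially bounded and of a rapidly decreasing term
  have hprod : ∀ {a c : ℂ} {C : ℝ}, 0 ≤ C → ‖a‖ ≤ C₀ * (k : ℝ) ^ (M : ℝ) →
      ‖c‖ ≤ C * (k : ℝ) ^ (-((n + M : ℕ) : ℝ)) → ‖a * c‖ ≤ C₀ * C * (k : ℝ) ^ (-(n : ℝ)) := by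
    intro a c C hC ha hc
    rw [norm_mul, hsplit]
    refine (mul_le_mul ha hc (norm_nonneg _) (by positivity)).trans (le_of_eq ?_)
    ring
  have hgau : ∀ t : ℝ, ‖Complex.exp (2 * Real.pi * Complex.I * k * h.modulus Ω * (t : ℂ))‖
      = Real.exp (-(2 * Real.pi * k * (h.modulus Ω).im * t)) := fun t => by
    have := norm_gaussian_modulus (h.modulus Ω) k t
    rwa [Complex.ofReal_natCast] at this
  have hsmall : ∀ t : ℝ, d ^ 2 / 4 ≤ t → ‖Complex.exp (2 * Real.pi * Complex.I * k * h.modulus Ω * (t : ℂ))‖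
      ≤ C₄ * (k : ℝ) ^ (-((n + M : ℕ) : ℝ)) := by
    intro t ht
    rw [hgau]
    refine le_trans (Real.exp_le_exp.2 ?_) (hC₄ k hk1)
    have : 2 * Real.pi * k * (h.modulus Ω).im * (d ^ 2 / 4) ≤ 2 * Real.pi * k * (h.modulus Ω).im * t := by gcongr
    linarith
  have hfc := fiberCoeff_chart hΩ Q.contDiff_ψ k.pos (hu k) m q
  rw [← hy, ← hθd, Complex.ofReal_natCast] at hfc
  rw [hfc]
  -- either the circle `q = y` belongs to the interval, and the coefficients are compared there, or both
  -- coefficients are negligible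
  by_cases hyI : y ∈ Icc (x - d) (x + d)
  · have h1 := hC₂ k q hq2 y hyI y fun s hs => by
      have := abs_sub_right_of_mem_uIcc hs
      rw [abs_sub_comm, abs_sub_comm q]
      exact this
    rw [← hb, sub_self, zero_pow two_ne_zero, sub_zero] at h1
    have h2 := hC₁ k m hyI
    rw [← hy, ← fiberCoeff_self (deriv φ) k, ← hb] at h2
    set g := Complex.exp (2 * Real.pi * Complex.I * k * h.modulus Ω * (((q - y) ^ 2 : ℝ) : ℂ)) with hg
    have hg1 : ‖g‖ ≤ 1 := by
      rw [hg, hgau]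
      refine Real.exp_le_one_iff.2 ?_
      have : 0 ≤ 2 * Real.pi * k * (h.modulus Ω).im * (q - y) ^ 2 := by positivity
      linarith
    have e1 : g * θ - A k * b q = g * (θ - A k * b y) + -(A k * (b q - g * b y)) := by ring
    rw [e1]
    refine (norm_add_le _ _).trans ?_
    rw [norm_neg, norm_mul]
    have h3 : ‖g‖ * ‖θ - A k * b y‖ ≤ |C₁| * (k : ℝ) ^ (-(n : ℝ)) :=
      (mul_le_of_le_one_left (norm_nonneg _) hg1).trans
        (h2.trans (mul_le_mul_of_nonneg_right (le_abs_self _) hkn.le))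
    have h4 := hprod hC₂0 (hA k) h1
    refine (add_le_add h3 h4).trans ?_
    rw [← add_mul]
    refine mul_le_mul_of_nonneg_right ?_ hkn.le
    have : 0 ≤ C₀ * C₄ + C₀ * C₃ * C₄ := by positivity
    linarith
  · -- the endpoint of the interval which lies between `q` and `y`
    obtain ⟨q', hq', hs, hfar, hfar'⟩ : ∃ q' ∈ Icc (x - d) (x + d),
        (∀ s ∈ uIcc q q', |s - y| ≤ |q - y|) ∧ d ^ 2 / 4 ≤ (q - y) ^ 2 - (q' - y) ^ 2
          ∧ d ^ 2 / 4 ≤ (q - y) ^ 2 := by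
      rw [mem_Icc, not_and_or, not_le, not_le] at hyI
      rcases hyI with hlt | hlt
      · refine ⟨x - d, ⟨le_rfl, by linarith⟩, fun s hs => ?_, ?_, ?_⟩
        · rw [uIcc_of_ge hq2.1] at hs
          rw [abs_of_pos (by linarith [hs.1]), abs_of_pos (by linarith [hq2.1])]
          linarith [hs.2]
        · nlinarith [hq.1]
        · nlinarith [hq.1]
      · refine ⟨x + d, ⟨by linarith, le_rfl⟩, fun s hs => ?_, ?_, ?_⟩
        · rw [uIcc_of_le hq2.2] at hs
          rw [abs_of_neg (by linarith [hs.2]), abs_of_neg (by linarith [hq2.2])]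
          linarith [hs.1]
        · nlinarith [hq.2]
        · nlinarith [hq.2]
    have h1 := hC₂ k q hq2 q' hq' y hs
    rw [← hb] at h1
    have hg1 := hsmall _ hfar
    have hg2 := hsmall _ hfar'
    set g := Complex.exp (2 * Real.pi * Complex.I * k * h.modulus Ω * (((q - y) ^ 2 - (q' - y) ^ 2 : ℝ) : ℂ)) with hg
    set g' := Complex.exp (2 * Real.pi * Complex.I * k * h.modulus Ω * (((q - y) ^ 2 : ℝ) : ℂ)) with hg'
    have hbq : ‖b q'‖ ≤ C₃ := norm_fiberCoeff_le fun v => (hC₃ k q' hq' v).trans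
      (mul_le_of_le_one_right hC₃0 (Real.exp_le_one_iff.2 (by
        have := Q.c_pos
        have : 0 ≤ k * (Q.c * v ^ 2) := by positivity
        linarith)))
    have e1 : g' * θ - A k * b q = θ * g' + -(A k * (b q - g * b q')) + -(A k * (g * b q')) := by ring
    rw [e1]
    have h3 : ‖θ * g'‖ ≤ C₀ * C₄ * (k : ℝ) ^ (-(n : ℝ)) := hprod hC₄0 (hθ k m) hg2
    have h4 := hprod hC₂0 (hA k) h1
    have h5 : ‖A k * (g * b q')‖ ≤ C₀ * (C₃ * C₄) * (k : ℝ) ^ (-(n : ℝ)) := by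
      refine hprod (by positivity) (hA k) ?_
      rw [norm_mul]
      refine (mul_le_mul hg1 hbq (norm_nonneg _) (by positivity)).trans (le_of_eq ?_)
      ring
    refine (norm_add_le _ _).trans ((add_le_add (norm_add_le _ _) le_rfl).trans ?_)
    rw [norm_neg, norm_neg]
    refine (add_le_add (add_le_add h3 h4) h5).trans ?_
    rw [← add_mul, ← add_mul]
    refine mul_le_mul_of_nonneg_right ?_ hkn.le
    have : 0 ≤ |C₁| := abs_nonneg _
    linarith

/-- Decay of the Fourier coefficients of a holomorphic section on the circles. -/
theorem sq_mul_norm_fiberCoeff_chart_le (hΩ : h.sq Ω D.μ = 1) {ψ : ℝ → ℝ} (hψ : ContDiff ℝ ∞ ψ) (k : ℕ+)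
    {u : E → ℂ} (hu : u ∈ D.holSections ℂ k) (m : ℤ) {q X B : ℝ} (hq : |q| ≤ X)
    (hB : ‖D.thetaCoeff k u m‖ ≤ B) :
    (m : ℝ) ^ 2 * ‖fiberCoeff ψ k (D.chart ψ k u) (m / (2 * k)) q‖
      ≤ (8 * X ^ 2 + 4 / (Real.pi * (h.modulus Ω).im)) * (k : ℝ) ^ 2 * B := by
  have hT := HalfFormLine.modulus_im_pos h hΩ
  have hπ := Real.pi_pos
  have hk1 := PNat.one_le_cast_real k
  have hk0 : (0 : ℝ) < k := by linarith
  have hX : 0 ≤ X := (abs_nonneg _).trans hq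
  have hB0 : 0 ≤ B := (norm_nonneg _).trans hB
  have hfc := fiberCoeff_chart hΩ hψ k.pos hu m q
  have hg := norm_gaussian_modulus (h.modulus Ω) k ((q - m / (2 * k)) ^ 2)
  rw [hfc, norm_mul, hg]
  set y : ℝ := m / (2 * k) with hy
  have hm : (m : ℝ) = 2 * k * y := by rw [hy]; field_simp
  set e := Real.exp (-(2 * Real.pi * k * (h.modulus Ω).im * (q - y) ^ 2)) with he
  have he0 : 0 < e := Real.exp_pos _
  have he1 : e ≤ 1 := Real.exp_le_one_iff.2 (by
    have : 0 ≤ 2 * Real.pi * k * (h.modulus Ω).im * (q - y) ^ 2 := by positivity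
    linarith)
  have he2 : (q - y) ^ 2 * e ≤ 1 / (2 * Real.pi * (h.modulus Ω).im) := by
    have h1 := Real.add_one_le_exp (2 * Real.pi * k * (h.modulus Ω).im * (q - y) ^ 2)
    have h2 : e * Real.exp (2 * Real.pi * k * (h.modulus Ω).im * (q - y) ^ 2) = 1 := by
      rw [he, ← Real.exp_add]
      simp
    have h3 : 2 * Real.pi * (h.modulus Ω).im * (q - y) ^ 2
        ≤ 2 * Real.pi * k * (h.modulus Ω).im * (q - y) ^ 2 := by
      have : 0 ≤ 2 * Real.pi * (h.modulus Ω).im * (q - y) ^ 2 := by positivity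
      nlinarith
    rw [le_div_iff₀ (by positivity)]
    nlinarith [mul_le_mul_of_nonneg_left (h3.trans (by linarith : _ ≤ Real.exp _)) he0.le]
  have hy2 : y ^ 2 * e ≤ 2 * X ^ 2 + 1 / (Real.pi * (h.modulus Ω).im) := by
    have h1 : y ^ 2 ≤ 2 * q ^ 2 + 2 * (q - y) ^ 2 := by nlinarith [sq_nonneg (2 * q - y)]
    have h2 : q ^ 2 ≤ X ^ 2 := by rw [← sq_abs]; gcongr
    have h3 : y ^ 2 * e ≤ (2 * q ^ 2 + 2 * (q - y) ^ 2) * e := by gcongr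
    have h4 : q ^ 2 * e ≤ X ^ 2 := (mul_le_of_le_one_right (sq_nonneg _) he1).trans h2
    have h5 : 1 / (Real.pi * (h.modulus Ω).im) = 2 * (1 / (2 * Real.pi * (h.modulus Ω).im)) := by
      field_simp
    rw [h5]
    linarith
  calc (m : ℝ) ^ 2 * (e * ‖D.thetaCoeff k u m‖)
      = 4 * (y ^ 2 * e) * (k : ℝ) ^ 2 * ‖D.thetaCoeff k u m‖ := by rw [hm]; ring
    _ ≤ 4 * (2 * X ^ 2 + 1 / (Real.pi * (h.modulus Ω).im)) * (k : ℝ) ^ 2 * B := by gcongr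
    _ = _ := by ring

/-- A holomorphic section and a quasimode with the same Fourier coefficients on the circles
`q = m / 2k` agree up to `O(k^{-∞})`. -/
theorem exists_norm_chart_sub_wave_le (hΩ : h.sq Ω D.μ = 1) {φ : ℝ → ℝ} {x d : ℝ}
    (Q : Quasimode φ (h.modulus Ω) x d) {u : ℕ+ → E → ℂ} (hu : ∀ k : ℕ+, u k ∈ D.holSections ℂ k)
    {M : ℕ} {C₀ : ℝ} (hC₀ : 0 ≤ C₀) (hθ : ∀ (k : ℕ+) (m : ℤ), ‖D.thetaCoeff k (u k) m‖ ≤ C₀ * (k : ℝ) ^ (M : ℝ))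
    {A : ℕ+ → ℂ} (hA : ∀ k, ‖A k‖ ≤ C₀ * (k : ℝ) ^ (M : ℝ))
    (hnode : ∀ n : ℕ, ∃ C : ℝ, ∀ (k : ℕ+) (m : ℤ), (m / (2 * k) : ℝ) ∈ Icc (x - d) (x + d) →
      ‖D.thetaCoeff k (u k) m - A k * ∫ v in (-(1 / 2) : ℝ)..(1 / 2), Q.wave k (m / (2 * k), v)‖
        ≤ C * (k : ℝ) ^ (-(n : ℝ))) (n : ℕ) :
    ∃ C : ℝ, ∀ k : ℕ+, ∀ q ∈ Icc (x - d / 2) (x + d / 2), ∀ v ∈ Ico (-(1 / 2) : ℝ) (1 / 2),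
      ‖D.chart (deriv φ) k (u k) (q, v) - A k * Q.wave k (q, v)‖ ≤ C * (k : ℝ) ^ (-(n : ℝ)) := by
  have hd := Q.d_pos
  have hd4 := Q.d_le
  have hT := Q.im_pos
  have hπ := Real.pi_pos
  obtain ⟨C₁, hC₁0, hC₁⟩ := exists_norm_fiberCoeff_sub_le hΩ Q hu hC₀ hθ hA hnode (4 * n + 3 * (M + 2))
  obtain ⟨C₂, hC₂0, hC₂⟩ := Q.exists_sq_mul_norm_fiberCoeff_wave_le
  set X : ℝ := |x| + 1 with hX
  set C₃ : ℝ := (8 * X ^ 2 + 4 / (Real.pi * (h.modulus Ω).im)) * C₀ + C₀ * C₂ with hC₃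
  have hC₃0 : 0 ≤ C₃ := by positivity
  refine ⟨C₁ ^ (1 / 4 : ℝ) * (C₁ + C₃) ^ (3 / 4 : ℝ) * ∑' m : ℤ, fourierWeight m, fun k q hq v hv => ?_⟩
  have hk1 := PNat.one_le_cast_real k
  have hk0 : (0 : ℝ) < k := by linarith
  have hq2 : q ∈ Icc (x - d) (x + d) := ⟨by linarith [hq.1], by linarith [hq.2]⟩
  have hqX : |q| ≤ X := by
    have h1 : |q - x| ≤ 1 := by rw [abs_le]; constructor <;> linarith [hq.1, hq.2]
    have h2 := abs_add_le (q - x) x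
    rw [sub_add_cancel] at h2
    linarith
  set G : ℝ × ℝ → ℂ := fun z => D.chart (deriv φ) k (u k) z - A k * Q.wave k z with hG
  have hc1 : Continuous (D.chart (deriv φ) k (u k)) := (contDiff_chart Q.contDiff_ψ k (hu k).1).continuous
  have hc2 : Continuous (Q.wave k) := (Q.contDiff_wave k).continuous
  have hGc : Continuous G := hc1.sub (continuous_const.mul hc2)
  set f : ℝ → ℂ := fun v => G (q, v) * Complex.exp (-(4 * Real.pi * Complex.I * k * v * q)) with hf
  have hfc : Continuous f := by
    have : Continuous fun v : ℝ => G (q, v) := hGc.comp (by fun_prop)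
    fun_prop
  set c : ℤ → ℂ := fun m => ∫ v in (-(1 / 2) : ℝ)..(1 / 2),
    f v * Complex.exp (2 * Real.pi * Complex.I * m * v) with hc
  have hcn : ∀ m, ‖c m‖ = ‖fiberCoeff (deriv φ) k (D.chart (deriv φ) k (u k)) (m / (2 * k)) q
        - A k * fiberCoeff (deriv φ) k (Q.wave k) (m / (2 * k)) q‖ := fun m => by
    rw [← fiberCoeff_sub_const_mul hc1 hc2]
    exact norm_fourier_eq (deriv φ) k.pos G m q
  have hper : f (-(1 / 2)) = f (-(1 / 2) + 1) := by
    have h1 := chart_add_one (hu k) (deriv φ) q (-(1 / 2))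
    have h2 : (-(1 / 2) + 1 : ℝ) = 1 / 2 := by norm_num
    rw [h2] at h1 ⊢
    simp only [hf, hG]
    rw [h1, Q.wave_eq_zero k Q.half_notMem, Q.wave_eq_zero k Q.neg_half_notMem, mul_zero, sub_zero,
      sub_zero]
    have key : ∀ X a b c : ℂ, a = b + c → X * Complex.exp a = Complex.exp b * X * Complex.exp c := by
      intro X a b c habc
      rw [habc, Complex.exp_add]
      ring
    refine key _ _ _ _ ?_
    push_cast
    ring
  have hkM : (k : ℝ) ^ ((M + 2 : ℕ) : ℝ) = (k : ℝ) ^ (M : ℝ) * (k : ℝ) ^ 2 := by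
    rw [Real.rpow_natCast, Real.rpow_natCast, pow_add]
  set a : ℝ := C₁ * (k : ℝ) ^ (-((4 * n + 3 * (M + 2) : ℕ) : ℝ)) with ha
  -- interpolation between the smallness and the quadratic decay of the coefficients
  have hbound : ∀ m : ℤ, ‖c m‖ ≤ C₁ ^ (1 / 4 : ℝ) * (C₁ + C₃) ^ (3 / 4 : ℝ) * (k : ℝ) ^ (-(n : ℝ))
      * fourierWeight m := by
    intro m
    have h1 : ‖c m‖ ≤ a := (hcn m).le.trans (hC₁ k m q hq)
    have h2 : (m : ℝ) ^ 2 * ‖c m‖ ≤ C₃ * (k : ℝ) ^ ((M + 2 : ℕ) : ℝ) := by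
      rw [hcn]
      have b1 := sq_mul_norm_fiberCoeff_chart_le hΩ Q.contDiff_ψ k (hu k) m hqX (hθ k m)
      have b2 := hC₂ k q hq2 m
      refine (mul_le_mul_of_nonneg_left (norm_sub_le _ _) (sq_nonneg _)).trans ?_
      rw [mul_add, norm_mul]
      have b3 : (m : ℝ) ^ 2 * (‖A k‖ * ‖fiberCoeff (deriv φ) k (Q.wave k) (m / (2 * k)) q‖)
          ≤ C₀ * (k : ℝ) ^ (M : ℝ) * (C₂ * (k : ℝ) ^ 2) := by
        rw [mul_left_comm]
        exact mul_le_mul (hA k) b2 (by positivity) (by positivity)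
      refine (add_le_add b1 b3).trans (le_of_eq ?_)
      rw [hkM, hC₃]
      ring
    refine (le_rpow_mul_fourierWeight (norm_nonneg _) h1 (by positivity) h2).trans ?_
    refine mul_le_mul_of_nonneg_right (rpow_interpolation_le hC₁0 hC₃0 hk1) ?_
    rw [fourierWeight]
    positivity
  have hsw := summable_fourierWeight.mul_left
    (C₁ ^ (1 / 4 : ℝ) * (C₁ + C₃) ^ (3 / 4 : ℝ) * (k : ℝ) ^ (-(n : ℝ)))
  have hs : Summable c := Summable.of_norm_bounded hsw hbound
  have hH := hasSum_fourier_of_summable (f := f) (a := -(1 / 2)) hfc.continuousOn hper (c := c)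
    (fun m => by rw [show (-(1 / 2) + 1 : ℝ) = 1 / 2 by norm_num]) hs (x := v)
    (by rw [show (-(1 / 2) + 1 : ℝ) = 1 / 2 by norm_num]; exact hv)
  have hfn : ‖f v‖ = ‖G (q, v)‖ := by
    rw [hf]
    beta_reduce
    rw [norm_mul, norm_exp_imaginary _ (-(4 * Real.pi * k * v * q)) (by push_cast; ring), mul_one]
  have hle : ‖f v‖ ≤ ∑' m : ℤ, C₁ ^ (1 / 4 : ℝ) * (C₁ + C₃) ^ (3 / 4 : ℝ) * (k : ℝ) ^ (-(n : ℝ))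
      * fourierWeight m := by
    rw [← hH.tsum_eq]
    refine tsum_of_norm_bounded hsw.hasSum fun m => ?_
    rw [norm_mul, norm_exp_imaginary _ (-(2 * Real.pi * m * v)) (by push_cast; ring), mul_one]
    exact hbound m
  rw [tsum_mul_left, hfn] at hle
  refine hle.trans (le_of_eq ?_)
  ring

end QuantumTorus

/-! ### Construction of quasimodes -/

/-- There is a quasimode with prescribed integrals over the circles `q = m / 2k`. -/
theorem exists_quasimode {φ : ℝ → ℝ} (hφ : ContDiff ℝ ∞ φ) {T : ℂ} (hT : 0 < T.im) {U : Set ℝ}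
    (hU : IsOpen U) {x : ℝ} (hx : x ∈ U) {g : ℕ → ℝ → ℂ} (hg : ∀ l, ContDiffOn ℝ ∞ (g l) U) {M : ℂ}
    (hM : M ≠ 0) :
    ∃ d : ℝ, Icc (x - d) (x + d) ⊆ U ∧ ∃ Q : Quasimode φ T x d,
      (∀ q ∈ Icc (x - d) (x + d), M * ((Real.pi / (2 * Real.pi * Complex.I
        / (deriv (deriv φ) q + T))) ^ (1 / 2 : ℂ) * Q.a 0 (q, 0)) = g 0 q) ∧
      ∃ P : ℕ → ℕ → ℝ → ℂ,
        (∀ l L : ℕ, ∃ C : ℝ, ∀ k : ℝ, 1 ≤ k → ∀ q ∈ Icc (x - d) (x + d),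
          ‖(∫ v in (-d)..d, Complex.exp (-((k : ℂ) * (v : ℂ) ^ 2 * Q.W (q, v))) * Q.a l (q, v))
            - ((k ^ (-(1 / 2) : ℝ) : ℝ) : ℂ) * ∑ j ∈ Finset.range L, ((k : ℂ) ^ j)⁻¹ * P l j q‖
          ≤ C * k ^ (-(1 / 2) - (L : ℝ))) ∧
        ∀ n, ∀ q ∈ Icc (x - d) (x + d), M * ∑ i ∈ Finset.range (n + 1), P i (n - i) q = g n q := by
  obtain ⟨Φ, hΦ, hΦt, O', hO', hxO', W, hW, hWpos, hW0, hWe⟩ := exists_holomorphic_phase hφ hT x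
  obtain ⟨r, hr, hrO⟩ := Metric.isOpen_iff.1 (hO'.inter (hU.preimage continuous_fst)) (x, (0 : ℝ))
    ⟨hxO', hx⟩
  set d := min (r / 2) (1 / 4) with hd
  have hd0 : 0 < d := lt_min (half_pos hr) (by norm_num)
  have hbox' : Icc (x - d) (x + d) ×ˢ Icc (-d) d ⊆ O' ∩ Prod.fst ⁻¹' U := by
    rintro ⟨q, v⟩ ⟨hq, hv⟩
    refine hrO ?_
    have hdr : d < r := (min_le_left _ _).trans_lt (half_lt_self hr)
    rw [Metric.mem_ball, Prod.dist_eq, max_lt_iff, Real.dist_eq, Real.dist_eq, abs_lt, abs_lt]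
    have h1 := hq.1; have h2 := hq.2; have h3 := hv.1; have h4 := hv.2
    dsimp only at h1 h2 h3 h4 ⊢
    refine ⟨⟨?_, ?_⟩, ?_, ?_⟩ <;> linarith
  have hbox : graphBox x d ⊆ O' := fun z hz => (hbox' hz).1
  have hJ : Icc (x - d) (x + d) ⊆ U := fun q hq =>
    (hbox' (show (q, (0 : ℝ)) ∈ _ from ⟨hq, by constructor <;> simp [hd0.le]⟩)).2
  have hΛ : ContDiff ℝ ∞ fun q : ℝ => ((deriv (deriv φ) q : ℝ) : ℂ) + T :=
    (Quasimode.contDiff_ofReal.comp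
      (contDiff_infty_iff_deriv.1 (contDiff_infty_iff_deriv.1 hφ).2).2).add contDiff_const
  obtain ⟨a, ha, hac, ⟨O₁, hO₁, hbox₁, hat⟩, ha0, P, hP, hPg⟩ := exists_holomorphic_amplitudes hΛ
    (fun q => by simpa using hT) hO' hd0 hbox hW hWpos hW0 hU hJ hg hM
  obtain ⟨S, hS, hSe⟩ := exists_borel_sum ha hac
  obtain ⟨χ, hχ, -, hχs, hχ01, O₂, hO₂, hO₂s, -, hχ1⟩ := exists_smooth_cutoff
    (isCompact_Icc (a := -(d / 2)) (b := d / 2)) (isOpen_Ioo (a := -d) (b := d))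
    (fun v hv => ⟨by linarith [hv.1], by linarith [hv.2]⟩)
  obtain ⟨z₀, hz₀, hmin⟩ := (isCompact_graphBox x d).exists_isMinOn
    ⟨(x, 0), by constructor <;> constructor <;> simp [hd0.le]⟩
    (Complex.continuous_re.comp_continuousOn (hW.continuousOn.mono hbox))
  refine ⟨d, hJ, ⟨hφ, hT, hd0, min_le_right _ _, Φ, hΦ, hΦt, W, hW.continuousOn.mono hbox, (W z₀).re,
    hWpos z₀ (hbox hz₀), fun z hz => hmin hz, fun z hz => hWe z (hbox hz), a, ha, fun l J => ?_, S, hS,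
    hSe, χ, hχ, ?_, hχs, fun v hv => ?_⟩, ha0, P, hP, hPg⟩
  · obtain ⟨R, hR, hRe⟩ := hat l J
    exact ⟨R, hR, fun z hz => hRe z (hbox₁ hz)⟩
  · exact hχ01
  · filter_upwards [hO₂.mem_nhds (hO₂s hv)] with w hw using hχ1 w hw

namespace QuantumTorus

variable {E : Type*} [NormedAddCommGroup E] [NormedSpace ℝ E] {D : QuantumTorus E}
  {δ : Type*} [NormedAddCommGroup δ] [InnerProductSpace ℂ δ] {h : HalfFormLine D δ} {Ω : δ}

/-- A section whose Fourier coefficients have an asymptotic expansion is locally a quasimode, up to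
`O(k^{-∞})`. -/
theorem exists_quasimode_of_expansion (hΩ : h.sq Ω D.μ = 1) {φ : ℝ → ℝ} (hφ : ContDiff ℝ ∞ φ)
    {u : ℕ+ → E → ℂ} (hu : ∀ k : ℕ+, u k ∈ D.holSections ℂ k)
    {C₀ B : ℝ} (hθ : ∀ (k : ℕ+) (m : ℤ), ‖D.thetaCoeff k (u k) m‖ ≤ C₀ * (k : ℝ) ^ B)
    {N : ℝ} {U : Set ℝ} (hU : IsOpen U) {x : ℝ} (hx : x ∈ U) {g : ℕ → ℝ → ℂ}
    (hg : ∀ l, ContDiffOn ℝ ∞ (g l) U)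
    (hexp : ∀ K ⊆ U, IsCompact K → HasExpansionOn (fun k m => D.thetaCoeff k (u k) m) φ (N - 1 / 4) K g) :
    ∃ d : ℝ, Icc (x - d) (x + d) ⊆ U ∧ ∃ Q : Quasimode φ (h.modulus Ω) x d,
      (∀ q ∈ Icc (x - d) (x + d), (((2 * Real.pi) ^ (-(1 / 4 + N)) : ℝ) : ℂ) *
        ((Real.pi / (2 * Real.pi * Complex.I
        / (deriv (deriv φ) q + h.modulus Ω))) ^ (1 / 2 : ℂ) * Q.a 0 (q, 0)) = g 0 q) ∧
      ∀ n : ℕ, ∃ C : ℝ, ∀ k : ℕ+, ∀ q ∈ Icc (x - d / 2) (x + d / 2), ∀ v ∈ Ico (-(1 / 2) : ℝ) (1 / 2),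
        ‖D.chart (deriv φ) k (u k) (q, v)
          - ((((k : ℝ) / (2 * Real.pi)) ^ (1 / 4 + N) : ℝ) : ℂ) * Q.wave k (q, v)‖
          ≤ C * (k : ℝ) ^ (-(n : ℝ)) := by
  have hπ := Real.pi_pos
  have hM0 : 0 < (2 * Real.pi) ^ (-(1 / 4 + N)) := by positivity
  set Mr : ℝ := (2 * Real.pi) ^ (-(1 / 4 + N)) with hMr
  obtain ⟨d, hdU, Q, hQ0, P, hP, hPg⟩ := exists_quasimode hφ (HalfFormLine.modulus_im_pos h hΩ) hU hx hg
    (M := (Mr : ℂ)) (Complex.ofReal_ne_zero.2 hM0.ne')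
  refine ⟨d, hdU, Q, hQ0, ?_⟩
  have hAM : ∀ k : ℕ+, ((k : ℝ) / (2 * Real.pi)) ^ (1 / 4 + N) = Mr * (k : ℝ) ^ (1 / 4 + N) := fun k => by
    rw [Real.div_rpow (by positivity) (by positivity), hMr, Real.rpow_neg (by positivity),
      div_eq_mul_inv, mul_comm]
  obtain ⟨M, hM⟩ := exists_nat_ge (max B (1 / 4 + N))
  have hpow : ∀ (k : ℕ+) (s : ℝ), s ≤ M → (k : ℝ) ^ s ≤ (k : ℝ) ^ (M : ℝ) := fun k s hs =>
    Real.rpow_le_rpow_of_exponent_le (PNat.one_le_cast_real k) hs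
  refine exists_norm_chart_sub_wave_le hΩ Q hu (M := M) (C₀ := |C₀| + Mr) (by positivity)
    (fun k m => (hθ k m).trans ?_) (fun k => ?_) fun n => ?_
  · have h1 := hpow k B ((le_max_left _ _).trans hM)
    have h2 : 0 ≤ Mr * (k : ℝ) ^ (M : ℝ) := by positivity
    have h3 : C₀ * (k : ℝ) ^ B ≤ |C₀| * (k : ℝ) ^ (M : ℝ) := by
      gcongr
      exact le_abs_self _
    linarith
  · have h1 := hpow k (1 / 4 + N) ((le_max_right _ _).trans hM)
    rw [Complex.norm_real, Real.norm_of_nonneg (by positivity), hAM, add_mul]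
    have h2 : 0 ≤ |C₀| * (k : ℝ) ^ (M : ℝ) := by positivity
    have h3 : Mr * (k : ℝ) ^ (1 / 4 + N) ≤ Mr * (k : ℝ) ^ (M : ℝ) := by gcongr
    linarith
  · obtain ⟨L, hL⟩ := exists_nat_ge (n + (N - 1 / 4))
    obtain ⟨C₁, hC₁⟩ := Q.exists_integral_wave_sub_le hP L
    obtain ⟨C₂, hC₂⟩ := hexp _ hdU isCompact_Icc L
    refine ⟨|C₂| + Mr * |C₁|, fun k m hq => ?_⟩
    have hk1 := PNat.one_le_cast_real k
    have hk0 : (0 : ℝ) < k := by linarith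
    set q : ℝ := m / (2 * k) with hqd
    have h1 := hC₁ k q hq
    have h2 := hC₂ k m q hq (by rw [hqd]; field_simp)
    rw [← Finset.sum_congr rfl fun l _ => congrArg (((k : ℂ) ^ l)⁻¹ * ·) (hPg l q hq)] at h2
    set I := ∫ v in (-(1 / 2) : ℝ)..(1 / 2), Q.wave k (q, v) with hI
    set E := Complex.exp (4 * Complex.I * Real.pi * k * φ q) with hE
    set s := ∑ n ∈ Finset.range L, ((k : ℂ) ^ n)⁻¹ * ∑ i ∈ Finset.range (n + 1), P i (n - i) q with hs
    have hs2 : ∑ l ∈ Finset.range L, ((k : ℂ) ^ l)⁻¹ * ((Mr : ℂ) * ∑ i ∈ Finset.range (l + 1), P i (l - i) q)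
        = Mr * s := by
      rw [hs, Finset.mul_sum]
      exact Finset.sum_congr rfl fun l _ => by ring
    rw [hs2] at h2
    set X : ℂ := (((k : ℝ) ^ (1 / 4 + N) : ℝ) : ℂ) with hX
    set Y : ℂ := (((k : ℝ) ^ (-(1 / 2) : ℝ) : ℝ) : ℂ) with hY
    have hXY : (((k : ℝ) ^ (N - 1 / 4) : ℝ) : ℂ) = X * Y := by
      rw [hX, hY, ← Complex.ofReal_mul, ← Real.rpow_add hk0]
      congr 2
      ring
    rw [hXY] at h2
    rw [hAM, Complex.ofReal_mul, ← hX]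
    have e1 : D.thetaCoeff k (u k) m - (Mr : ℂ) * X * I
        = (D.thetaCoeff k (u k) m - X * Y * E * (Mr * s)) + -((Mr : ℂ) * X * (I - E * (Y * s))) := by ring
    rw [e1]
    refine (norm_add_le _ _).trans ?_
    rw [norm_neg, norm_mul, norm_mul, hX, Complex.norm_real, Complex.norm_real, Real.norm_of_nonneg hM0.le,
      Real.norm_of_nonneg (by positivity : (0 : ℝ) ≤ (k : ℝ) ^ (1 / 4 + N)), add_mul]
    have hexpo : (k : ℝ) ^ (N - 1 / 4 - (L : ℝ)) ≤ (k : ℝ) ^ (-(n : ℝ)) :=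
      Real.rpow_le_rpow_of_exponent_le hk1 (by linarith)
    have hsum : (k : ℝ) ^ (1 / 4 + N) * (k : ℝ) ^ (-(1 / 2) - (L : ℝ)) = (k : ℝ) ^ (N - 1 / 4 - (L : ℝ)) := by
      rw [← Real.rpow_add hk0]
      congr 1
      ring
    refine add_le_add ?_ ?_
    · calc _ ≤ C₂ * (k : ℝ) ^ (N - 1 / 4 - (L : ℝ)) := h2
        _ ≤ |C₂| * (k : ℝ) ^ (-(n : ℝ)) := by
          gcongr
          exact le_abs_self _
    · calc _ ≤ Mr * (k : ℝ) ^ (1 / 4 + N) * (C₁ * (k : ℝ) ^ (-(1 / 2) - (L : ℝ))) := by gcongr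
        _ = Mr * C₁ * ((k : ℝ) ^ (1 / 4 + N) * (k : ℝ) ^ (-(1 / 2) - (L : ℝ))) := by ring
        _ = Mr * C₁ * (k : ℝ) ^ (N - 1 / 4 - (L : ℝ)) := by rw [hsum]
        _ ≤ Mr * |C₁| * (k : ℝ) ^ (-(n : ℝ)) := by
          gcongr
          exact le_abs_self _

end QuantumTorus

/-! ### Tubular neighbourhoods of the graph -/

/-- The derivatives in `x` of a smooth function of `(x, κ)` are bounded uniformly in `κ`. -/
theorem exists_norm_iteratedFDeriv_slice_le {F G : Type*} [NormedAddCommGroup F] [NormedSpace ℝ F]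
    [NormedAddCommGroup G] [NormedSpace ℝ G] {H : F × ℝ → G} (hH : ContDiff ℝ ∞ H) {K : Set F}
    (hK : IsCompact K) (n : ℕ) : ∃ C : ℝ, ∀ x ∈ K, ∀ κ ∈ Icc (0 : ℝ) 1,
      ‖iteratedFDeriv ℝ n (fun x => H (x, κ)) x‖ ≤ C := by
  obtain ⟨C, hC⟩ := (hK.prod (isCompact_Icc (a := (0 : ℝ)) (b := 1))).exists_bound_of_continuousOn
    (hH.continuous_iteratedFDeriv (m := n) (by exact_mod_cast le_top)).continuousOn
  refine ⟨C * 1 ^ n, fun x hx κ hκ => ?_⟩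
  have hC0 := (norm_nonneg _).trans (hC (x, κ) ⟨hx, hκ⟩)
  have h1 : (fun x => H (x, κ)) = (fun w => H (w + (0, κ))) ∘ (ContinuousLinearMap.inl ℝ F ℝ) := by
    funext x
    simp
  have h2 : ContDiff ℝ ∞ (fun w : F × ℝ => H (w + (0, κ))) := hH.comp (contDiff_id.add contDiff_const)
  rw [h1, ContinuousLinearMap.iteratedFDeriv_comp_right _ h2 x (i := n) (by exact_mod_cast le_top)]
  refine (ContinuousMultilinearMap.norm_compContinuousLinearMap_le _ _).trans ?_
  rw [iteratedFDeriv_comp_add_right]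
  have h3 := hC (x, κ) ⟨hx, hκ⟩
  simp only [ContinuousLinearMap.inl_apply, Prod.mk_add_mk, add_zero, zero_add, Finset.prod_const,
    Finset.card_univ, Fintype.card_fin]
  have h4 : ‖ContinuousLinearMap.inl ℝ F ℝ‖ ≤ 1 := ContinuousLinearMap.norm_inl_le_one ℝ F ℝ
  gcongr

namespace QuantumTorus

variable {E : Type*} [NormedAddCommGroup E] [NormedSpace ℝ E] (D : QuantumTorus E)

/-- The coordinates `(q, p - ψ(q))`. -/
noncomputable def graphCoords (ψ : ℝ → ℝ) (y : E) : ℝ × ℝ := (D.qCoord y, D.pCoord y - ψ (D.qCoord y))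

/-- A tubular neighbourhood in `E` of a piece of the graph of `ψ`. -/
def tube (ψ : ℝ → ℝ) (x d : ℝ) : Set E :=
  {y | D.qCoord y ∈ Ioo (x - d / 2) (x + d / 2) ∧ D.pCoord y - ψ (D.qCoord y) ∈ Ioo (-(d / 2)) (d / 2)}

/-- The inverse of the projection from the tubular neighbourhood to `M`. -/
noncomputable def tubeLift (ψ : ℝ → ℝ) (x d : ℝ) (w : D.M) : E := Function.invFunOn D.proj (D.tube ψ x d) w

/-- The equivariant extension to the preimage of the projection of the tube of a function on the
tube. -/
noncomputable def tubeExtend (ψ : ℝ → ℝ) (x d : ℝ) (e : E → ℂ) (y : E) : ℂ :=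
  Complex.exp (Complex.I * D.om (y - D.tubeLift ψ x d (D.proj y)) (D.tubeLift ψ x d (D.proj y)) / 2)
    * e (D.tubeLift ψ x d (D.proj y))

variable {D} {ψ : ℝ → ℝ} {x d : ℝ}

theorem contDiff_graphCoords (hψ : ContDiff ℝ ∞ ψ) : ContDiff ℝ ∞ (D.graphCoords ψ) :=
  D.contDiff_qCoord.prodMk (D.contDiff_pCoord.sub (hψ.comp D.contDiff_qCoord))

theorem isOpen_tube (hψ : Continuous ψ) : IsOpen (D.tube ψ x d) := by
  have h1 : Continuous D.qCoord := (D.contDiff_qCoord (n := 0)).continuous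
  have h2 : Continuous D.pCoord := (D.contDiff_pCoord (n := 0)).continuous
  exact (isOpen_Ioo.preimage h1).inter (isOpen_Ioo.preimage (h2.sub (hψ.comp h1)))

theorem proj_add_of_mem {r : E} (hr : r ∈ D.R) (s : E) : D.proj (r + s) = D.proj s := by
  obtain ⟨m, n, rfl⟩ := D.mem_R_iff.1 hr
  exact (D.proj_eq_proj_iff.2 ⟨m, n, add_comm _ _⟩).symm

theorem exists_add_of_proj_eq {y s : E} (hs : D.proj s = D.proj y) : ∃ r ∈ D.R, y = r + s := by
  obtain ⟨m, n, h⟩ := D.proj_eq_proj_iff.1 hs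
  exact ⟨_, D.mem_R_iff.2 ⟨m, n, rfl⟩, h.trans (add_comm _ _)⟩

theorem injOn_proj_tube (hd : d ≤ 1 / 4) : InjOn D.proj (D.tube ψ x d) := by
  rintro s hs t ht hst
  obtain ⟨m, n, hmn⟩ := D.proj_eq_proj_iff.1 hst
  have h1 : D.qCoord t = D.qCoord s + n := by rw [hmn, D.qCoord_add, D.qCoord_pt]
  have h2 : D.pCoord t = D.pCoord s + m := by rw [hmn, D.pCoord_add, D.pCoord_pt]
  have hn : n = 0 := by
    have h3 : |(n : ℝ)| < 1 := by
      rw [abs_lt]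
      constructor <;> linarith [hs.1.1, hs.1.2, ht.1.1, ht.1.2]
    have : |n| < 1 := by exact_mod_cast h3
    exact Int.abs_lt_one_iff.1 this
  rw [hn, Int.cast_zero, add_zero] at h1
  have hm : m = 0 := by
    have h4 := ht.2
    rw [h1, h2] at h4
    have h3 : |(m : ℝ)| < 1 := by
      rw [abs_lt]
      constructor <;> linarith [hs.2.1, hs.2.2, h4.1, h4.2]
    have : |m| < 1 := by exact_mod_cast h3
    exact Int.abs_lt_one_iff.1 this
  rw [hm, Int.cast_zero, add_zero] at h2
  exact D.ext_coords h2.symm h1.symm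

theorem tubeLift_proj (hd : d ≤ 1 / 4) {r s : E} (hr : r ∈ D.R) (hs : s ∈ D.tube ψ x d) :
    D.tubeLift ψ x d (D.proj (r + s)) = s := by
  rw [proj_add_of_mem hr]
  exact (injOn_proj_tube hd).leftInvOn_invFunOn hs

theorem exists_add_tube {y : E} (hy : D.proj y ∈ D.proj '' D.tube ψ x d) :
    ∃ r ∈ D.R, ∃ s ∈ D.tube ψ x d, y = r + s := by
  obtain ⟨s, hs, hsy⟩ := hy
  obtain ⟨r, hr, rfl⟩ := exists_add_of_proj_eq hsy
  exact ⟨r, hr, s, hs, rfl⟩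

theorem eventually_tubeLift_proj (hψ : Continuous ψ) (hd : d ≤ 1 / 4) {r s : E} (hr : r ∈ D.R)
    (hs : s ∈ D.tube ψ x d) : ∀ᶠ z in 𝓝 (r + s), D.tubeLift ψ x d (D.proj z) = z - r := by
  have h1 : ∀ᶠ z in 𝓝 (r + s), z - r ∈ D.tube ψ x d := by
    have hc : Continuous fun z : E => z - r := by fun_prop
    exact hc.continuousAt.preimage_mem_nhds (by
      rw [add_sub_cancel_left]
      exact (isOpen_tube hψ).mem_nhds hs)
  filter_upwards [h1] with z hz
  have := tubeLift_proj hd hr hz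
  rwa [add_sub_cancel] at this

theorem tubeExtend_add (hd : d ≤ 1 / 4) (e : E → ℂ) {r s : E} (hr : r ∈ D.R)
    (hs : s ∈ D.tube ψ x d) :
    D.tubeExtend ψ x d e (r + s) = Complex.exp (Complex.I * D.om r s / 2) * e s := by
  rw [tubeExtend, tubeLift_proj hd hr hs, add_sub_cancel_right]

theorem eventually_tubeExtend (hψ : Continuous ψ) (hd : d ≤ 1 / 4) (e : E → ℂ) {r s : E} (hr : r ∈ D.R)
    (hs : s ∈ D.tube ψ x d) : D.tubeExtend ψ x d e =ᶠ[𝓝 (r + s)]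
      fun z => Complex.exp (Complex.I * D.om r (z - r) / 2) * e (z - r) := by
  filter_upwards [eventually_tubeLift_proj hψ hd hr hs] with z hz
  rw [tubeExtend, hz, sub_sub_cancel]

theorem exp_om_lattice {r r' : E} (hr : r ∈ D.R) (hr' : r' ∈ D.R) :
    Complex.exp (Complex.I * D.om r r' / 2) = 1 := by
  obtain ⟨m, n, rfl⟩ := D.mem_R_iff.1 hr
  obtain ⟨m', n', rfl⟩ := D.mem_R_iff.1 hr'
  refine exp_int_mul_two_pi (n := m * n' - n * m') ?_
  rw [D.om_pt_pt]
  push_cast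
  ring

theorem equivariantOn_tubeExtend (hd : d ≤ 1 / 4) (e : E → ℂ) :
    D.EquivariantOn 1 (D.tubeExtend ψ x d e) (D.proj ⁻¹' (D.proj '' D.tube ψ x d)) := by
  intro r' hr' y hy
  obtain ⟨r, hr, s, hs, rfl⟩ := exists_add_tube hy
  rw [← add_assoc, tubeExtend_add hd e (add_mem hr' hr) hs, tubeExtend_add hd e hr hs, smul_eq_mul,
    ← mul_assoc, ← Complex.exp_add]
  have h1 := exp_om_lattice hr' hr
  have h2 : Complex.exp (Complex.I * (1 : ℕ) * D.om r' (r + s) / 2 + Complex.I * D.om r s / 2)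
      = Complex.exp (Complex.I * D.om (r' + r) s / 2) * Complex.exp (Complex.I * D.om r' r / 2) := by
    rw [← Complex.exp_add]
    congr 1
    simp only [map_add, LinearMap.add_apply]
    push_cast
    ring
  rw [h2, h1, mul_one]

theorem contDiff_om_left (r : E) : ContDiff ℝ ∞ fun z => D.om r (z - r) := by
  have : (fun z => D.om r (z - r)) = fun z => 4 * Real.pi * (D.pCoord r * D.qCoord (z - r)
      - D.qCoord r * D.pCoord (z - r)) := funext fun z => D.om_eq_coords _ _
  rw [this]
  have h1 : ContDiff ℝ ∞ fun z : E => z - r := contDiff_id.sub contDiff_const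
  exact contDiff_const.mul ((contDiff_const.mul (D.contDiff_qCoord.comp h1)).sub
    (contDiff_const.mul (D.contDiff_pCoord.comp h1)))

theorem contDiffOn_tubeExtend (hψ : Continuous ψ) (hd : d ≤ 1 / 4) {e : E → ℂ} (he : ContDiff ℝ ∞ e) :
    ContDiffOn ℝ ∞ (D.tubeExtend ψ x d e) (D.proj ⁻¹' (D.proj '' D.tube ψ x d)) := by
  intro y hy
  obtain ⟨r, hr, s, hs, rfl⟩ := exists_add_tube hy
  refine ContDiffAt.contDiffWithinAt (ContDiffAt.congr_of_eventuallyEq ?_ (eventually_tubeExtend hψ hd e hr hs))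
  refine ContDiff.contDiffAt ?_
  have h1 : ContDiff ℝ ∞ fun z : E => z - r := contDiff_id.sub contDiff_const
  exact ((contDiff_const.mul (Quasimode.contDiff_ofReal.comp (contDiff_om_left r))).div_const _).cexp.mul
    (he.comp h1)

/-- On the graph, the section `Θ` is the equivariant extension of its expression over
`]q₀, q₁[`. -/
theorem graphSection_add {φ : ℝ → ℝ} {q₀ q₁ q : ℝ} (hq' : q₁ ≤ q₀ + 1) (hq : q ∈ Ioo q₀ q₁) {r : E}
    (hr : r ∈ D.R) :
    D.graphSection φ q₀ (r + D.graphPoint φ q) = Complex.exp (Complex.I * D.om r (D.graphPoint φ q) / 2)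
      * (Complex.exp (4 * Complex.I * Real.pi * φ q) * D.flatSection (D.graphPoint φ q)) := by
  obtain ⟨m, n, rfl⟩ := D.mem_R_iff.1 hr
  have h1 : D.qCoord (D.pt m n + D.graphPoint φ q) = n + q := by
    rw [D.qCoord_add, D.qCoord_pt]
    congr 1
    exact D.qCoord_pt _ _
  have h2 : ⌊(n : ℝ) + q - q₀⌋ = n := by
    rw [add_sub_assoc, Int.floor_intCast_add,
      Int.floor_eq_zero_iff.2 ⟨by linarith [hq.1], by linarith [hq.2]⟩, add_zero]
  simp only [graphSection, h1, h2, add_sub_cancel_left, add_sub_cancel_right]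

end QuantumTorus

namespace QuantumTorus

variable {E : Type*} [NormedAddCommGroup E] [NormedSpace ℝ E] {D : QuantumTorus E}
  {δ : Type*} [NormedAddCommGroup δ] [InnerProductSpace ℂ δ] {h : HalfFormLine D δ} {Ω : δ}
  {φ : ℝ → ℝ} {x d : ℝ}

/-- The section of `L_E` whose powers carry the quasimode. -/
noncomputable def phaseSection (D : QuantumTorus E) (ψ : ℝ → ℝ) (Φ : ℝ × ℝ → ℂ) (y : E) : ℂ :=
  D.flatSection y * Complex.exp (4 * Real.pi * Complex.I * Φ (D.graphCoords ψ y))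

theorem contDiff_phaseSection {ψ : ℝ → ℝ} (hψ : ContDiff ℝ ∞ ψ) {Φ : ℝ × ℝ → ℂ} (hΦ : ContDiff ℝ ∞ Φ) :
    ContDiff ℝ ∞ (D.phaseSection ψ Φ) := by
  have hp : ContDiff ℝ ∞ fun y => (D.pCoord y : ℂ) := Quasimode.contDiff_ofReal.comp D.contDiff_pCoord
  have hq : ContDiff ℝ ∞ fun y => (D.qCoord y : ℂ) := Quasimode.contDiff_ofReal.comp D.contDiff_qCoord
  exact (((contDiff_const.mul hp).mul hq).neg.cexp).mul
    (contDiff_const.mul (hΦ.comp (contDiff_graphCoords hψ))).cexp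

/-- The phase is holomorphic to infinite order along the graph, also after translation by the
lattice. -/
theorem iteratedFDeriv_dbar_phaseSection (hΩ : h.sq Ω D.μ = 1) (Q : Quasimode φ (h.modulus Ω) x d)
    {r s : E} (hr : r ∈ D.R) (hs : D.pCoord s = deriv φ (D.qCoord s)) (X : E) (j : ℕ) :
    iteratedFDeriv ℝ j (fun z => D.dbar 1 (fun z => Complex.exp (Complex.I * D.om r (z - r) / 2)
      * D.phaseSection (deriv φ) Q.Φ (z - r)) z X) (r + s) = 0 := by
  obtain ⟨m, n, rfl⟩ := D.mem_R_iff.1 hr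
  obtain ⟨R, hR, hRe⟩ := Q.transport_Φ (j + 1)
  -- after translation by `m μ + n lam`, the graph is that of `q ↦ m + φ'(q - n)`
  set ψ' : ℝ → ℝ := fun q => m + deriv φ (q - n) with hψ'
  have hsh : ContDiff ℝ ∞ fun q : ℝ => q - n := contDiff_id.sub contDiff_const
  have hψs : ContDiff ℝ ∞ ψ' := contDiff_const.add (Q.contDiff_ψ.comp hsh)
  set A : ℝ × ℝ → ℂ := fun z => Complex.exp (4 * Real.pi * Complex.I * (m * z.1 + Q.Φ (z.1 - n, z.2))
    - 2 * Real.pi * Complex.I * m * n) with hA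
  have hsh2 : ContDiff ℝ ∞ fun z : ℝ × ℝ => (z.1 - (n : ℝ), z.2) :=
    (contDiff_fst.sub contDiff_const).prodMk contDiff_snd
  have hAs : ContDiff ℝ ∞ A := ((contDiff_const.mul ((contDiff_const.mul
    (Quasimode.contDiff_ofReal.comp contDiff_fst)).add (Q.contDiff_Φ.comp hsh2))).sub contDiff_const).cexp
  set u : E → ℂ := fun z => Complex.exp (Complex.I * D.om (D.pt m n) (z - D.pt m n) / 2)
      * D.phaseSection (deriv φ) Q.Φ (z - D.pt m n) with hu
  have hue : ∀ y, u y = Complex.exp (-(2 * Real.pi * Complex.I * (1 : ℕ) * D.pCoord y * D.qCoord y))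
      * A (D.qCoord y, D.pCoord y - ψ' (D.qCoord y)) := by
    intro y
    simp only [hu, hA, hψ', phaseSection, flatSection, graphCoords, D.om_eq_coords, D.pCoord_sub, D.qCoord_sub,
      D.pCoord_pt, D.qCoord_pt]
    have h1 : D.pCoord y - (m : ℝ) - deriv φ (D.qCoord y - n) = D.pCoord y - (m + deriv φ (D.qCoord y - n)) := by
      ring
    rw [h1, ← Complex.exp_add, ← Complex.exp_add, ← Complex.exp_add]
    congr 1
    push_cast
    ring
  have hdbA : ∀ q v : ℝ, dbarOp ψ' (h.modulus Ω) (1 : ℕ) A (q, v) = 4 * Real.pi * Complex.I * A (q, v)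
      * ((v : ℂ) ^ (j + 1) * R (q - n, v)) := by
    intro q v
    have hAd : DifferentiableAt ℝ A (q, v) := hAs.differentiable (by simp) _
    have hΦd : DifferentiableAt ℝ Q.Φ (q - n, v) := Q.contDiff_Φ.differentiable (by simp) _
    have e1 : pderiv (1, 0) A (q, v)
        = A (q, v) * (4 * Real.pi * Complex.I * (m + pderiv (1, 0) Q.Φ (q - n, v))) := by
      refine (hasDerivAt_pderiv_fst hAd).unique ?_
      have h1 : HasDerivAt (fun q : ℝ => Q.Φ (q - n, v)) (pderiv (1, 0) Q.Φ (q - n, v)) q :=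
        HasDerivAt.comp_sub_const (f := fun q => Q.Φ (q, v)) q (n : ℝ) (hasDerivAt_pderiv_fst hΦd)
      have h2 := ((((((hasDerivAt_id q).ofReal_comp.const_mul (m : ℂ)).add h1)).const_mul
        (4 * Real.pi * Complex.I)).sub_const (2 * Real.pi * Complex.I * m * n)).cexp
      refine h2.congr_deriv ?_
      simp [hA]
    have e2 : pderiv (0, 1) A (q, v)
        = A (q, v) * (4 * Real.pi * Complex.I * pderiv (0, 1) Q.Φ (q - n, v)) := by
      refine (hasDerivAt_pderiv_snd hAd).unique ?_
      have h2 := ((((hasDerivAt_pderiv_snd hΦd).const_add ((m : ℂ) * q)).const_mul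
        (4 * Real.pi * Complex.I)).sub_const (2 * Real.pi * Complex.I * m * n)).cexp
      exact h2
    have e3 : deriv ψ' q = deriv (deriv φ) (q - n) := by
      have h1 : HasDerivAt (deriv φ) (deriv (deriv φ) (q - n)) (q - n) :=
        (Q.contDiff_ψ.differentiable (by simp) _).hasDerivAt
      exact ((h1.comp_sub_const q (n : ℝ)).const_add (m : ℝ)).deriv
    have h3 := hRe (q - n, v)
    dsimp only at h3
    rw [← h3, dbarOp, e1, e2, e3]
    simp only [hψ']
    push_cast
    ring
  set V : E → ℂ := fun z => ((D.pCoord z - ψ' (D.qCoord z) : ℝ) : ℂ) with hV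
  have hVs : ContDiff ℝ ∞ V := Quasimode.contDiff_ofReal.comp
    (D.contDiff_pCoord.sub (hψs.comp D.contDiff_qCoord))
  set B : E → ℂ := fun z => star (h.sq Ω X) / (star (h.modulus Ω) - h.modulus Ω)
      * Complex.exp (-(2 * Real.pi * Complex.I * (1 : ℕ) * D.pCoord z * D.qCoord z))
      * (4 * Real.pi * Complex.I * A (D.graphCoords ψ' z)
        * R (D.qCoord z - n, D.pCoord z - ψ' (D.qCoord z))) with hB
  have hBs : ContDiff ℝ ∞ B := by
    have hp : ContDiff ℝ ∞ fun y => (D.pCoord y : ℂ) := Quasimode.contDiff_ofReal.comp D.contDiff_pCoord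
    have hq : ContDiff ℝ ∞ fun y => (D.qCoord y : ℂ) := Quasimode.contDiff_ofReal.comp D.contDiff_qCoord
    have h1 := contDiff_graphCoords (D := D) hψs
    have h2 : ContDiff ℝ ∞ fun z => R (D.qCoord z - n, D.pCoord z - ψ' (D.qCoord z)) :=
      hR.comp (hsh2.comp h1)
    exact (contDiff_const.mul (((contDiff_const.mul hp).mul hq).neg.cexp)).mul
      ((contDiff_const.mul (hAs.comp h1)).mul h2)
  -- the `∂̄`-derivative is divisible by every power of a function vanishing on the graph
  have hfun : (fun z => D.dbar 1 u z X) = fun z => V z ^ (j + 1) * B z := by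
    funext z
    have h1 := HalfFormLine.dbar_eq_dbarOp h hΩ (k := 1) (u := u) (x := z) (ψ := ψ') (G := A)
      (hψs.differentiable (by simp) _) (hAs.differentiable (by simp) _)
      (Eventually.of_forall hue) X
    rw [h1, hdbA]
    simp only [hV, hB, graphCoords]
    ring
  rw [hfun]
  refine iteratedFDeriv_pow_mul_eq_zero hVs hBs ?_ (j + 1) j (Nat.lt_succ_self j)
  simp only [hV, hψ', D.pCoord_add, D.qCoord_add, D.pCoord_pt, D.qCoord_pt, add_sub_cancel_left, hs]
  simp

/-- The amplitudes of a quasimode, seen as sections over the projection of the tube. -/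
theorem hasSmoothExpansion_quasimode {T : ℂ} (Q : Quasimode φ T x d) (Ω : δ) :
    D.HasSmoothExpansion (D.proj '' D.tube (deriv φ) x d)
      (fun k w => Q.S 0 (D.graphCoords (deriv φ) (D.tubeLift (deriv φ) x d w), (k : ℝ)⁻¹) • Ω)
      (fun l w => Q.a l (D.graphCoords (deriv φ) (D.tubeLift (deriv φ) x d w)) • Ω) := by
  have hd := Q.d_pos
  have hgc : ContDiff ℝ ∞ (D.graphCoords (deriv φ)) := contDiff_graphCoords Q.contDiff_ψ
  have hsub : ∀ r : E, ContDiff ℝ ∞ fun z : E => z - r := fun r => contDiff_id.sub contDiff_const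
  have hH : ∀ j, ContDiff ℝ ∞ fun w : E × ℝ => Q.S j (D.graphCoords (deriv φ) w.1, w.2) • Ω := fun j =>
    ((Q.contDiff_S j).comp ((hgc.comp contDiff_fst).prodMk contDiff_snd)).smul contDiff_const
  -- a function of the lift is smooth
  have hlift : ∀ f : E → δ, ContDiff ℝ ∞ f → ContDiffOn ℝ ∞
      (fun y => f (D.tubeLift (deriv φ) x d (D.proj y))) (D.proj ⁻¹' (D.proj '' D.tube (deriv φ) x d)) := by
    intro f hf y hy
    obtain ⟨r, hr, s, hs, rfl⟩ := exists_add_tube hy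
    refine ContDiffAt.contDiffWithinAt (ContDiffAt.congr_of_eventuallyEq
      (f := fun z => f (z - r)) ((hf.comp (hsub r)).contDiffAt) ?_)
    filter_upwards [eventually_tubeLift_proj Q.contDiff_ψ.continuous Q.d_le hr hs] with z hz
    rw [hz]
  refine ⟨fun k => hlift (fun s => Q.S 0 (D.graphCoords (deriv φ) s, (k : ℝ)⁻¹) • Ω)
    ((hH 0).comp (contDiff_id.prodMk contDiff_const)), fun l =>
    hlift (fun s => Q.a l (D.graphCoords (deriv φ) s) • Ω)
    (((Q.contDiff_a l).comp hgc).smul contDiff_const), fun K hKV _ n L => ?_⟩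
  have hKc : IsCompact ((fun z : ℝ × ℝ => D.pt (deriv φ z.1 + z.2) z.1) '' graphBox x d) :=
    (isCompact_graphBox x d).image (contDiff_pt_graph Q.contDiff_ψ).continuous
  obtain ⟨C, hC⟩ := exists_norm_iteratedFDeriv_slice_le (hH L) hKc n
  refine ⟨C, fun k y hy => ?_⟩
  have hk0 : (0 : ℝ) < k := by have := PNat.one_le_cast_real k; linarith
  obtain ⟨r, hr, s, hs, rfl⟩ := exists_add_tube (hKV hy)
  -- the remainder is `k ^ (-L)` times a smooth function of the lift and of `1 / k`
  have hev : (fun z => Q.S 0 (D.graphCoords (deriv φ) (D.tubeLift (deriv φ) x d (D.proj z)), (k : ℝ)⁻¹) • Ω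
      - ∑ l ∈ Finset.range L, ((k : ℂ) ^ l)⁻¹ •
        Q.a l (D.graphCoords (deriv φ) (D.tubeLift (deriv φ) x d (D.proj z))) • Ω)
      =ᶠ[𝓝 (r + s)] fun z => ((k : ℝ) ^ (-(L : ℝ)) : ℝ) •
        (fun s => Q.S L (D.graphCoords (deriv φ) s, (k : ℝ)⁻¹) • Ω) (z - r) := by
    filter_upwards [eventually_tubeLift_proj Q.contDiff_ψ.continuous Q.d_le hr hs] with z hz
    rw [hz, Q.S_zero_eq L, add_smul, Finset.sum_smul]
    have h1 : ∀ l, ((((k : ℝ)⁻¹ : ℝ) : ℂ) ^ l * Q.a l (D.graphCoords (deriv φ) (z - r))) • Ω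
        = ((k : ℂ) ^ l)⁻¹ • Q.a l (D.graphCoords (deriv φ) (z - r)) • Ω := fun l => by
      rw [mul_smul]
      push_cast
      rw [inv_pow]
    rw [Finset.sum_congr rfl fun l _ => h1 l, add_sub_cancel_left, mul_smul, Real.rpow_neg hk0.le,
      Real.rpow_natCast, ← Complex.coe_smul]
    push_cast
    rw [inv_pow]
  have hSL : ContDiff ℝ ∞ fun s => Q.S L (D.graphCoords (deriv φ) s, (k : ℝ)⁻¹) • Ω :=
    (hH L).comp (contDiff_id.prodMk contDiff_const)
  have hsh : iteratedFDeriv ℝ n (fun z => (fun s => Q.S L (D.graphCoords (deriv φ) s, (k : ℝ)⁻¹) • Ω) (z - r)) (r + s)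
      = iteratedFDeriv ℝ n (fun s => Q.S L (D.graphCoords (deriv φ) s, (k : ℝ)⁻¹) • Ω) (r + s - r) :=
    iteratedFDeriv_comp_sub (f := fun s => Q.S L (D.graphCoords (deriv φ) s, (k : ℝ)⁻¹) • Ω) n r (r + s)
  rw [(Filter.EventuallyEq.iteratedFDeriv ℝ hev n).eq_of_nhds,
    iteratedFDeriv_const_smul_apply'
      (f := fun z => (fun s => Q.S L (D.graphCoords (deriv φ) s, (k : ℝ)⁻¹) • Ω) (z - r))
      ((hSL.comp (hsub r)).contDiffAt.of_le (by exact_mod_cast le_top)),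
    hsh, add_sub_cancel_left, norm_smul, Real.norm_of_nonneg (by positivity), mul_comm]
  refine mul_le_mul_of_nonneg_right (hC s ⟨D.graphCoords (deriv φ) s, ?_, ?_⟩ _ (Quasimode.inv_mem k))
    (by positivity)
  · exact ⟨⟨by have := hs.1.1; simp only [graphCoords]; linarith, by have := hs.1.2; simp only [graphCoords]; linarith⟩,
      ⟨by have := hs.2.1; simp only [graphCoords]; linarith, by have := hs.2.2; simp only [graphCoords]; linarith⟩⟩
  · simp only [graphCoords, add_sub_cancel, D.pt_coords]

end QuantumTorus

/-! ### From expansions of the coefficients to Lagrangian states -/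

namespace QuantumTorus

variable {E : Type*} [NormedAddCommGroup E] [NormedSpace ℝ E] {D : QuantumTorus E}
  {δ : Type*} [NormedAddCommGroup δ] [InnerProductSpace ℂ δ] {h : HalfFormLine D δ} {Ω : δ}

/-- The norm of a half-form valued section in the chart. -/
theorem norm_eq_norm_chart (hΩ : h.sq Ω D.μ = 1) (ψ : ℝ → ℝ) (k : ℕ) (u : E → δ) (q v : ℝ) :
    ‖u (D.pt (ψ q + v) q)‖ = ‖D.chart ψ k (fun y => HalfFormLine.coordL Ω (u y)) (q, v)‖ * ‖Ω‖ := by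
  rw [norm_chart, HalfFormLine.norm_eq_coordL h hΩ]

theorem norm_add_of_mem {k : ℕ} {u : E → δ} (hu : u ∈ D.holSections δ k) {r : E} (hr : r ∈ D.R) (s : E) :
    ‖u (r + s)‖ = ‖u s‖ := by
  rw [hu.2.1 r hr s (mem_univ s), norm_smul, norm_exp_imaginary _ (k * D.om r s / 2) (by push_cast; ring),
    one_mul]

/-- A section which agrees with a quasimode is negligible away from the graph. -/
theorem notMem_microsupport_of_quasimode (hΩ : h.sq Ω D.μ = 1) {φ : ℝ → ℝ} {x d : ℝ}
    (Q : Quasimode φ (h.modulus Ω) x d) {ξ : (k : ℕ+) → D.holSections δ k} {N : ℝ}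
    (hξ : ∀ n : ℕ, ∃ C : ℝ, ∀ k : ℕ+, ∀ q ∈ Icc (x - d / 2) (x + d / 2), ∀ v ∈ Ico (-(1 / 2) : ℝ) (1 / 2),
        ‖D.chart (deriv φ) k (fun y => HalfFormLine.coordL Ω ((ξ k).1 y)) (q, v)
          - ((((k : ℝ) / (2 * Real.pi)) ^ (1 / 4 + N) : ℝ) : ℂ) * Q.wave k (q, v)‖
          ≤ C * (k : ℝ) ^ (-(n : ℝ)))
    {v : ℝ} (hv : v ∈ Ioo (0 : ℝ) 1) : D.proj (D.pt (deriv φ x + v) x) ∉ D.microsupport ξ := by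
  have hπ := Real.pi_pos
  have hd := Q.d_pos
  have hψ := Q.contDiff_ψ
  set ψ := deriv φ with hψd
  -- on `S`, the distance of `p - ψ(q)` to the integers is at least `η`
  set η : ℝ := min v (1 - v) / 2 with hη
  have hη0 : 0 < η := half_pos (lt_min hv.1 (by linarith [hv.2]))
  have hηv : 2 * η ≤ v := by rw [hη]; linarith [min_le_left v (1 - v)]
  have hηv' : 2 * η ≤ 1 - v := by rw [hη]; linarith [min_le_right v (1 - v)]
  set S : Set E := {y | D.qCoord y ∈ Ioo (x - d / 2) (x + d / 2) ∧
    D.pCoord y - ψ (D.qCoord y) ∈ Ioo η (1 - η)} with hS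
  have h1 : Continuous D.qCoord := (D.contDiff_qCoord (n := 0)).continuous
  have h2 : Continuous D.pCoord := (D.contDiff_pCoord (n := 0)).continuous
  have hSo : IsOpen S := (isOpen_Ioo.preimage h1).inter (isOpen_Ioo.preimage (h2.sub (hψ.continuous.comp h1)))
  obtain ⟨C₁, hC₁0, hC₁⟩ := Q.exists_norm_wave_le
  have key : ∀ n : ℕ, ∃ C : ℝ, ∀ (k : ℕ+) (y : E), D.proj y ∈ D.proj '' S →
      ‖(ξ k).1 y‖ ≤ C * (k : ℝ) ^ (-(n : ℝ)) := by
    intro n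
    obtain ⟨C₂, hC₂⟩ := hξ n
    obtain ⟨C₃, hC₃0, hC₃⟩ := exists_exp_neg_le_rpow (a := Q.c * η ^ 2) (by have := Q.c_pos; positivity)
      (n + (1 / 4 + N))
    set Mr : ℝ := ((2 * Real.pi) ^ (1 / 4 + N))⁻¹ with hMr
    have hMr0 : 0 < Mr := by positivity
    refine ⟨(|C₂| + Mr * (C₁ * C₃)) * ‖Ω‖, fun k y hy => ?_⟩
    have hk1 := PNat.one_le_cast_real k
    have hk0 : (0 : ℝ) < k := by linarith
    obtain ⟨s, hs, hsy⟩ := hy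
    obtain ⟨r, hr, rfl⟩ := exists_add_of_proj_eq hsy
    rw [norm_add_of_mem (ξ k).2 hr]
    set u : E → ℂ := fun y => HalfFormLine.coordL Ω ((ξ k).1 y) with hu
    have hmem : u ∈ D.holSections ℂ k := coordL_comp_mem _ (ξ k).2
    set q := D.qCoord s with hq
    set w := D.pCoord s - ψ q with hw
    have hse : s = D.pt (ψ q + w) q := by rw [hw, add_sub_cancel, hq, D.pt_coords]
    have hqI : q ∈ Icc (x - d / 2) (x + d / 2) := ⟨hs.1.1.le, hs.1.2.le⟩
    have hqI2 : q ∈ Icc (x - d) (x + d) := ⟨by linarith [hqI.1], by linarith [hqI.2]⟩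
    have hwη : η < w ∧ w < 1 - η := hs.2
    -- the representative of `w` modulo `1` in `[-1/2, 1/2[`
    obtain ⟨w', hw', hwη', hnw⟩ : ∃ w' ∈ Ico (-(1 / 2) : ℝ) (1 / 2), η ^ 2 ≤ w' ^ 2 ∧
        ‖D.chart ψ k u (q, w)‖ = ‖D.chart ψ k u (q, w')‖ := by
      rcases lt_or_ge w (1 / 2) with hlt | hge
      · exact ⟨w, ⟨by linarith, hlt⟩, by nlinarith, rfl⟩
      · refine ⟨w - 1, ⟨by linarith, by linarith⟩, by nlinarith, ?_⟩
        have := chart_add_one hmem ψ q (w - 1)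
        rw [sub_add_cancel] at this
        rw [this, norm_mul, norm_exp_imaginary _ (4 * Real.pi * k * q) (by push_cast; ring), one_mul]
    rw [hse, norm_eq_norm_chart hΩ ψ k, hnw, mul_right_comm]
    refine mul_le_mul_of_nonneg_right ?_ (norm_nonneg _)
    have h3 := hC₂ k q hqI w' hw'
    have h4 := hC₁ k q hqI2 w'
    have h5 : ‖((((k : ℝ) / (2 * Real.pi)) ^ (1 / 4 + N) : ℝ) : ℂ) * Q.wave k (q, w')‖
        ≤ Mr * (C₁ * C₃) * (k : ℝ) ^ (-(n : ℝ)) := by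
      rw [norm_mul, Complex.norm_real, Real.norm_of_nonneg (by positivity),
        Real.div_rpow (by positivity) (by positivity), div_eq_mul_inv, ← hMr]
      have h6 : Real.exp (-(k * (Q.c * w' ^ 2))) ≤ C₃ * (k : ℝ) ^ (-(n + (1 / 4 + N))) := by
        refine le_trans (Real.exp_le_exp.2 ?_) (hC₃ k hk1)
        have := Q.c_pos
        have : (k : ℝ) * (Q.c * η ^ 2) ≤ k * (Q.c * w' ^ 2) := by gcongr
        linarith
      have h7 : (k : ℝ) ^ (-(n : ℝ)) = (k : ℝ) ^ (1 / 4 + N) * (k : ℝ) ^ (-(n + (1 / 4 + N))) := by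
        rw [← Real.rpow_add hk0]
        congr 1
        ring
      rw [h7]
      calc _ ≤ (k : ℝ) ^ (1 / 4 + N) * Mr * (C₁ * (C₃ * (k : ℝ) ^ (-(n + (1 / 4 + N))))) := by
            gcongr
            exact h4.trans (by gcongr)
        _ = _ := by ring
    have h8 := norm_le_norm_sub_add (D.chart ψ k u (q, w'))
      (((((k : ℝ) / (2 * Real.pi)) ^ (1 / 4 + N) : ℝ) : ℂ) * Q.wave k (q, w'))
    rw [add_mul]
    refine h8.trans (add_le_add (h3.trans ?_) h5)
    exact mul_le_mul_of_nonneg_right (le_abs_self _) (by positivity)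
  choose C hC using key
  rw [microsupport, mem_ofPred_eq, not_not]
  refine ⟨D.proj '' S, (D.isOpenMap_proj S hSo).mem_nhds ⟨_, ?_, rfl⟩, C, fun n k y hy => hC n k y hy⟩
  refine ⟨?_, ?_⟩
  · rw [D.qCoord_pt]
    constructor <;> linarith
  · rw [D.qCoord_pt, D.pCoord_pt, add_sub_cancel_left]
    constructor <;> linarith

/-- The quasimode attached to the asymptotic expansion of the Fourier coefficients near a point. -/
theorem exists_local_quasimode (hΩ : h.sq Ω D.μ = 1) {q₀ q₁ : ℝ} {φ : ℝ → ℝ}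
    (hφ : ContDiffOn ℝ ∞ φ (Ioo q₀ q₁)) {ξ : (k : ℕ+) → D.holSections δ k} {σ : D.M → δ} {N C₀ B : ℝ}
    (hθ : ∀ (k : ℕ+) (m : ℤ), ‖D.thetaCoeff k (fun y => HalfFormLine.coordL Ω ((ξ k).1 y)) m‖
      ≤ C₀ * (k : ℝ) ^ B)
    {g : ℕ → ℝ → ℂ} (hg : ∀ l, ContDiffOn ℝ ∞ (g l) (Ioo q₀ q₁))
    (hexp : ∀ K ⊆ Ioo q₀ q₁, IsCompact K → HasExpansionOn
      (fun k m => D.thetaCoeff k (fun y => HalfFormLine.coordL Ω ((ξ k).1 y)) m) φ (N - 1 / 4) K g)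
    (hσ : ∀ q ∈ Ioo q₀ q₁, g 0 q = (((2 * Real.pi) ^ (-(1 / 4 + N)) : ℝ) : ℂ) *
        ((Real.pi / (2 * Real.pi * Complex.I / (deriv (deriv φ) q + h.modulus Ω))) ^ (1 / 2 : ℂ)
          * HalfFormLine.coordL Ω (σ (D.proj (D.graphPoint φ q)))))
    {x : ℝ} (hx : x ∈ Ioo q₀ q₁) :
    ∃ (φ' : ℝ → ℝ) (d : ℝ) (Q : Quasimode φ' (h.modulus Ω) x d), Icc (x - d) (x + d) ⊆ Ioo q₀ q₁ ∧
      (∀ q ∈ Icc (x - d) (x + d), φ' q = φ q ∧ deriv φ' q = deriv φ q) ∧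
      (∀ q ∈ Icc (x - d) (x + d), Q.a 0 (q, 0)
        = HalfFormLine.coordL Ω (σ (D.proj (D.graphPoint φ q)))) ∧
      ∀ n : ℕ, ∃ C : ℝ, ∀ k : ℕ+, ∀ q ∈ Icc (x - d / 2) (x + d / 2), ∀ v ∈ Ico (-(1 / 2) : ℝ) (1 / 2),
        ‖D.chart (deriv φ') k (fun y => HalfFormLine.coordL Ω ((ξ k).1 y)) (q, v)
          - ((((k : ℝ) / (2 * Real.pi)) ^ (1 / 4 + N) : ℝ) : ℂ) * Q.wave k (q, v)‖
          ≤ C * (k : ℝ) ^ (-(n : ℝ)) := by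
  have hT := HalfFormLine.modulus_im_pos h hΩ
  obtain ⟨φ', hφ', -, O₁, hO₁, hxO₁, hO₁I, hφφ⟩ :=
    exists_smooth_extension isCompact_singleton isOpen_Ioo (singleton_subset_iff.2 hx) hφ
  rw [singleton_subset_iff] at hxO₁
  have hev : ∀ q ∈ O₁, φ' =ᶠ[𝓝 q] φ := fun q hq => by
    filter_upwards [hO₁.mem_nhds hq] with w hw using hφφ hw
  obtain ⟨d, hdO, Q, hQ0, hQ⟩ := exists_quasimode_of_expansion hΩ hφ'
    (fun k => coordL_comp_mem (HalfFormLine.coordL Ω) (ξ k).2) hθ (N := N) hO₁ hxO₁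
    (fun l => (hg l).mono hO₁I) fun K hK hKc => (hexp K (hK.trans hO₁I) hKc).congr
      (fun q hq => (hφφ (hK hq)).symm) fun _ _ _ => rfl
  refine ⟨φ', d, Q, hdO.trans hO₁I, fun q hq => ⟨hφφ (hdO hq), (hev q (hdO hq)).deriv_eq⟩,
    fun q hq => ?_, hQ⟩
  have h1 := hQ0 q hq
  rw [hσ q (hO₁I (hdO hq)), (hev q (hdO hq)).deriv.deriv_eq] at h1
  have hπ := Real.pi_pos
  have hM : (((2 * Real.pi) ^ (-(1 / 4 + N)) : ℝ) : ℂ) ≠ 0 := Complex.ofReal_ne_zero.2 (by positivity)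
  exact mul_left_cancel₀ (sqrt_pi_div_ne_zero (by simpa using hT)) (mul_left_cancel₀ hM h1)

/-- A section whose Fourier coefficients have an asymptotic expansion is a Lagrangian state. -/
theorem isLagrangianState_of_expansion (hΩ : h.sq Ω D.μ = 1) {q₀ q₁ : ℝ} (hq' : q₁ ≤ q₀ + 1)
    {φ : ℝ → ℝ} (hφ : ContDiffOn ℝ ∞ φ (Ioo q₀ q₁)) {ξ : (k : ℕ+) → D.holSections δ k} {σ : D.M → δ}
    {N C₀ B : ℝ}
    (hθ : ∀ (k : ℕ+) (m : ℤ), ‖D.thetaCoeff k (fun y => HalfFormLine.coordL Ω ((ξ k).1 y)) m‖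
      ≤ C₀ * (k : ℝ) ^ B)
    {g : ℕ → ℝ → ℂ} (hg : ∀ l, ContDiffOn ℝ ∞ (g l) (Ioo q₀ q₁))
    (hexp : ∀ K ⊆ Ioo q₀ q₁, IsCompact K → HasExpansionOn
      (fun k m => D.thetaCoeff k (fun y => HalfFormLine.coordL Ω ((ξ k).1 y)) m) φ (N - 1 / 4) K g)
    (hσ : ∀ q ∈ Ioo q₀ q₁, g 0 q = (((2 * Real.pi) ^ (-(1 / 4 + N)) : ℝ) : ℂ) *
        ((Real.pi / (2 * Real.pi * Complex.I / (deriv (deriv φ) q + h.modulus Ω))) ^ (1 / 2 : ℂ)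
          * HalfFormLine.coordL Ω (σ (D.proj (D.graphPoint φ q))))) :
    D.IsLagrangianState ξ (D.strip q₀ q₁) (D.graph φ q₀ q₁) (D.graphSection φ q₀) σ N := by
  have hloc := fun x (hx : x ∈ Ioo q₀ q₁) => exists_local_quasimode hΩ hφ hθ hg hexp hσ hx
  refine ⟨?_, ?_⟩
  · rintro w ⟨hw, p, x, hx, rfl⟩
    by_contra hΓ
    obtain ⟨φ', d, Q, hdI, hφφ, -, hQ⟩ := hloc x hx
    have hd := Q.d_pos
    have hxd := (hφφ x ⟨by linarith, by linarith⟩).2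
    have hp : D.proj (p • D.μ + x • D.lam) = D.proj (D.pt (deriv φ' x + Int.fract (p - deriv φ' x)) x) := by
      refine D.proj_eq_proj_iff.2 ⟨-⌊p - deriv φ' x⌋, 0, ?_⟩
      rw [← pt, D.pt_add, Int.fract]
      congr 1
      · push_cast; ring
      · push_cast; ring
    rw [hp] at hw hΓ
    refine notMem_microsupport_of_quasimode hΩ Q hQ ⟨?_, Int.fract_lt_one _⟩ hw
    refine lt_of_le_of_ne (Int.fract_nonneg _) fun h0 => hΓ ?_
    rw [hxd] at h0 ⊢
    exact (mem_graph_iff hq' hx).2 ⟨0, by rw [← h0]; simp⟩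
  · rintro _ ⟨x, hx, rfl⟩
    obtain ⟨φ', d, Q, hdI, hφφ, hQa, hQ⟩ := hloc x hx
    have hd := Q.d_pos
    have hd4 := Q.d_le
    have hψ := Q.contDiff_ψ
    have hψc := hψ.continuous
    set ψ := deriv φ' with hψd
    set S := D.tube ψ x d with hS
    have hSI : ∀ s ∈ S, D.qCoord s ∈ Icc (x - d) (x + d) := fun s hs =>
      ⟨by linarith [hs.1.1], by linarith [hs.1.2]⟩
    have hSbox : ∀ s ∈ S, D.graphCoords ψ s ∈ graphBox x d := fun s hs =>
      ⟨hSI s hs, ⟨by have := hs.2.1; simp only [graphCoords]; linarith,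
        by have := hs.2.2; simp only [graphCoords]; linarith⟩⟩
    have hgp : ∀ q ∈ Icc (x - d) (x + d), D.pt (ψ q) q = D.graphPoint φ q := fun q hq => by
      rw [(hφφ q hq).2, graphPoint, pt]
    have hcoord : ∀ s : E, s = D.pt (ψ (D.qCoord s) + (D.pCoord s - ψ (D.qCoord s))) (D.qCoord s) := fun s => by
      rw [add_sub_cancel, D.pt_coords]
    -- the points of the tube which project to the graph
    have hΓ : ∀ s ∈ S, D.proj s ∈ D.graph φ q₀ q₁ → D.pCoord s = ψ (D.qCoord s) ∧
        s = D.graphPoint φ (D.qCoord s) := by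
      intro s hs hsΓ
      have hqI := hSI s hs
      have h1 := hsΓ
      rw [hcoord s, (hφφ _ hqI).2, mem_graph_iff hq' (hdI hqI)] at h1
      obtain ⟨m, hm⟩ := h1
      rw [← (hφφ _ hqI).2] at hm
      have h2 := hs.2
      rw [hm] at h2
      have h3 : |(m : ℝ)| < 1 := by rw [abs_lt]; constructor <;> linarith [h2.1, h2.2]
      have h4 : |m| < 1 := by exact_mod_cast h3
      rw [Int.abs_lt_one_iff.1 h4, Int.cast_zero] at hm
      have h5 : D.pCoord s = ψ (D.qCoord s) := by linarith
      refine ⟨h5, ?_⟩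
      rw [← hgp _ hqI, ← h5, D.pt_coords]
    have hΓ' : ∀ s ∈ S, D.pCoord s = ψ (D.qCoord s) → D.proj s ∈ D.graph φ q₀ q₁ := fun s hs h0 =>
      ⟨D.qCoord s, hdI (hSI s hs), by rw [← hgp _ (hSI s hs), ← h0, D.pt_coords]⟩
    have hexpΦ : ∀ s ∈ S, Complex.exp (4 * Real.pi * Complex.I * Q.Φ (D.graphCoords ψ s))
        = Complex.exp (4 * Real.pi * Complex.I * φ (D.qCoord s)) * Complex.exp (-(((D.pCoord s
          - ψ (D.qCoord s) : ℝ) : ℂ) ^ 2 * Q.W (D.graphCoords ψ s))) := fun s hs => by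
      rw [Q.exp_Φ _ (hSbox s hs)]
      simp only [graphCoords]
      rw [(hφφ _ (hSI s hs)).1]
    refine ⟨D.proj '' S, D.isOpenMap_proj S (isOpen_tube hψc), ⟨D.graphPoint φ x, ?_, rfl⟩, ?_,
      D.tubeExtend ψ x d (D.phaseSection ψ Q.Φ), _, _,
      contDiffOn_tubeExtend hψc hd4 (contDiff_phaseSection hψ Q.contDiff_Φ),
      equivariantOn_tubeExtend hd4 _, ?_, ?_, ?_, hasSmoothExpansion_quasimode Q Ω, ?_, fun n => ?_⟩
    · rw [← hgp x ⟨by linarith, by linarith⟩]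
      refine ⟨?_, ?_⟩
      · rw [D.qCoord_pt]
        constructor <;> linarith
      · rw [D.qCoord_pt, D.pCoord_pt, sub_self]
        constructor <;> linarith
    · rintro _ ⟨s, hs, rfl⟩
      rw [← D.pt_coords s]
      exact proj_pt_mem_strip _ (hdI (hSI s hs))
    · rintro y ⟨hyΓ, hy⟩
      obtain ⟨r, hr, s, hs, rfl⟩ := exists_add_tube hy
      rw [proj_add_of_mem hr] at hyΓ
      obtain ⟨h1, h2⟩ := hΓ s hs hyΓ
      rw [tubeExtend_add hd4 _ hr hs, phaseSection, hexpΦ s hs, h1, sub_self]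
      have h3 := graphSection_add (D := D) (φ := φ) hq' (hdI (hSI s hs)) hr
      rw [← h2] at h3
      rw [h3]
      simp only [Complex.ofReal_zero, ne_eq, OfNat.ofNat_ne_zero, not_false_eq_true, zero_pow, zero_mul,
        neg_zero, Complex.exp_zero, mul_one]
      rw [mul_comm (D.flatSection s), mul_right_comm 4 (Real.pi : ℂ)]
    · rintro y ⟨hy, hyΓ⟩
      obtain ⟨r, hr, s, hs, rfl⟩ := exists_add_tube hy
      rw [proj_add_of_mem hr] at hyΓ
      rw [tubeExtend_add hd4 _ hr hs, phaseSection, hexpΦ s hs, flatSection, norm_mul, norm_mul, norm_mul,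
        norm_exp_imaginary _ (D.om r s / 2) (by push_cast; ring),
        norm_exp_imaginary _ (-(2 * Real.pi * D.pCoord s * D.qCoord s)) (by push_cast; ring),
        norm_exp_imaginary _ (4 * Real.pi * φ (D.qCoord s)) (by push_cast; ring), one_mul, one_mul, one_mul,
        Complex.norm_exp]
      rw [Real.exp_lt_one_iff, Complex.neg_re, ← Complex.ofReal_pow, Complex.re_ofReal_mul, neg_lt_zero]
      have hne : D.pCoord s - ψ (D.qCoord s) ≠ 0 := fun h0 => hyΓ (hΓ' s hs (sub_eq_zero.1 h0))
      have := Q.c_pos.trans_le (Q.c_le _ (hSbox s hs))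
      positivity
    · rintro y ⟨hyΓ, hy⟩ X j
      obtain ⟨r, hr, s, hs, rfl⟩ := exists_add_tube hy
      rw [proj_add_of_mem hr] at hyΓ
      rw [← iteratedFDeriv_dbar_phaseSection hΩ Q hr (hΓ s hs hyΓ).1 X j]
      refine (Filter.EventuallyEq.iteratedFDeriv ℝ ?_ j).eq_of_nhds
      filter_upwards [(eventually_tubeExtend hψc hd4 (D.phaseSection ψ Q.Φ) hr hs).eventuallyEq_nhds] with z hz
      simp only [dbar, covDeriv, hz.fderiv_eq, hz.eq_of_nhds]
      rfl
    · rintro _ ⟨hyΓ, s, hs, rfl⟩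
      obtain ⟨h1, h2⟩ := hΓ s hs hyΓ
      have h3 : D.tubeLift ψ x d (D.proj s) = s := by
        have := tubeLift_proj hd4 (zero_mem D.R) hs
        rwa [zero_add] at this
      rw [h3, graphCoords, h1, sub_self, hQa _ (hSI s hs), ← h2, HalfFormLine.coordL_apply_smul h hΩ]
    · obtain ⟨C, hC⟩ := hQ n
      refine ⟨C * ‖Ω‖, fun k y hy => ?_⟩
      obtain ⟨r, hr, s, hs, rfl⟩ := exists_add_tube hy
      set A : ℝ := ((k : ℝ) / (2 * Real.pi)) ^ (1 / 4 + N) with hA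
      set u : E → ℂ := fun y => HalfFormLine.coordL Ω ((ξ k).1 y) with hu
      have hkA : (((((k : ℝ) / (2 * Real.pi)) ^ (1 / 4 + N) : ℝ) : ℝ) : ℂ) = (A : ℂ) := rfl
      set e1 := Complex.exp (Complex.I * k * D.om r s / 2) with he1
      have he1n : ‖e1‖ = 1 := norm_exp_imaginary _ (k * D.om r s / 2) (by push_cast; ring)
      set e2 := Complex.exp (-(2 * Real.pi * Complex.I * k * D.pCoord s * D.qCoord s)) with he2
      have he2n : ‖e2‖ = 1 :=
        norm_exp_imaginary _ (-(2 * Real.pi * k * D.pCoord s * D.qCoord s)) (by push_cast; ring)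
      set a := Q.S 0 (D.graphCoords ψ s, (k : ℝ)⁻¹) with ha
      have hχ : Q.χ (D.graphCoords ψ s).2 = 1 := by
        refine (Q.χ_one _ ⟨?_, ?_⟩).eq_of_nhds
        · exact hs.2.1.le
        · exact hs.2.2.le
      have h1 : (ξ k).1 (r + s) = (e1 * (e2 * D.chart ψ k u (D.graphCoords ψ s))) • Ω := by
        rw [(ξ k).2.2.1 r hr s (mem_univ s), mul_smul, ← HalfFormLine.coordL_apply_smul h hΩ ((ξ k).1 s)]
        congr 2
        exact chart_eq ψ k u s
      have h2 : D.tubeExtend ψ x d (D.phaseSection ψ Q.Φ) (r + s) ^ (k : ℕ)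
          = e1 * (e2 * Complex.exp (4 * Real.pi * Complex.I * k * Q.Φ (D.graphCoords ψ s))) := by
        rw [tubeExtend_add hd4 _ hr hs, phaseSection, flatSection, he1, he2, ← Complex.exp_add,
          ← Complex.exp_add, ← Complex.exp_add, ← Complex.exp_add, ← Complex.exp_nat_mul]
        congr 1
        ring
      have h3 : Q.wave k (D.graphCoords ψ s)
          = Complex.exp (4 * Real.pi * Complex.I * k * Q.Φ (D.graphCoords ψ s)) * a := by
        rw [Quasimode.wave, Quasimode.amp, hχ, Complex.ofReal_one, one_mul]
      have h4 := hC k (D.qCoord s) ⟨hs.1.1.le, hs.1.2.le⟩ (D.pCoord s - ψ (D.qCoord s))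
        ⟨by linarith [hs.2.1], by linarith [hs.2.2]⟩
      rw [tubeLift_proj hd4 hr hs, h2, h1, smul_smul, ← sub_smul, norm_smul]
      have h5 : e1 * (e2 * D.chart ψ k u (D.graphCoords ψ s)) - (A : ℂ) * (e1 * (e2 *
          Complex.exp (4 * Real.pi * Complex.I * k * Q.Φ (D.graphCoords ψ s)))) * a
          = e1 * (e2 * (D.chart ψ k u (D.graphCoords ψ s) - A * Q.wave k (D.graphCoords ψ s))) := by
        rw [h3]
        ring
      rw [h5, norm_mul, norm_mul, he1n, he2n, one_mul, one_mul, mul_right_comm]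
      exact mul_le_mul_of_nonneg_right h4 (norm_nonneg _)

end QuantumTorus

/-! ### The coefficients in the theta basis -/

/-- Passage from powers of `k / 2π` to powers of `k`. -/
theorem hasWKBExpansion_iff {c : ℕ+ → ℤ → ℂ} {φ : ℝ → ℝ} {q₀ q₁ N : ℝ} {f : ℕ → ℝ → ℂ} :
    HasWKBExpansion c φ q₀ q₁ N f ↔ ∀ K ⊆ Ioo q₀ q₁, IsCompact K → HasExpansionOn c φ (-(1 / 2) + N) K
      (fun l q => (((2 * Real.pi) ^ (1 / 2 - N) : ℝ) : ℂ) * f l q) := by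
  have h1 : ∀ (k : ℕ+) (w : ℂ) (L : ℕ) (q : ℝ), (((k : ℝ) ^ (-(1 / 2) + N) : ℝ) : ℂ) * w
        * ∑ l ∈ Finset.range L, ((k : ℂ) ^ l)⁻¹ * ((((2 * Real.pi) ^ (1 / 2 - N) : ℝ) : ℂ) * f l q)
      = ((((k : ℝ) / (2 * Real.pi)) ^ (-(1 / 2) + N) : ℝ) : ℂ) * w
        * ∑ l ∈ Finset.range L, ((k : ℂ) ^ l)⁻¹ * f l q := by
    intro k w L q
    have hπ := Real.pi_pos
    have h2 : ((k : ℝ) / (2 * Real.pi)) ^ (-(1 / 2) + N)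
        = (k : ℝ) ^ (-(1 / 2) + N) * (2 * Real.pi) ^ (1 / 2 - N) := by
      rw [Real.div_rpow (by positivity) (by positivity), div_eq_mul_inv, ← Real.rpow_neg (by positivity)]
      congr 2
      ring
    have h3 : ∑ l ∈ Finset.range L, ((k : ℂ) ^ l)⁻¹ * ((((2 * Real.pi) ^ (1 / 2 - N) : ℝ) : ℂ) * f l q)
        = (((2 * Real.pi) ^ (1 / 2 - N) : ℝ) : ℂ) * ∑ l ∈ Finset.range L, ((k : ℂ) ^ l)⁻¹ * f l q := by
      rw [Finset.mul_sum]
      exact Finset.sum_congr rfl fun l _ => by ring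
    rw [h2, h3, Complex.ofReal_mul]
    ring
  simp only [HasWKBExpansion, HasExpansionOn, h1]

namespace QuantumTorus

variable {E : Type*} [NormedAddCommGroup E] [NormedSpace ℝ E] {D : QuantumTorus E}
  {δ : Type*} [NormedAddCommGroup δ] [InnerProductSpace ℂ δ] {h : HalfFormLine D δ} {Ω : δ}

theorem norm_coeff_le (hΩ : h.sq Ω D.μ = 1)
    {Ψ : (k : ℕ+) → Module.Basis (ZMod (2 * (k : ℕ))) ℂ (D.holSections δ k)}
    (hΨ : ∀ k : ℕ+, D.IsThetaBasis Ω k (Ψ k)) {ξ : (k : ℕ+) → D.holSections δ k} (hξ : D.Admissible ξ) :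
    ∃ B C : ℝ, 0 < C ∧ ∀ (k : ℕ+) (m : ℤ), ‖D.coeff Ψ ξ k m‖ ≤ C * (k : ℝ) ^ B := by
  obtain ⟨B, C, hC0, hC⟩ := hξ
  exact ⟨B, C, hC0, fun k m => (norm_repr_le hΩ k.pos (hΨ k) (ξ k) m).trans (hC k)⟩

theorem exists_norm_thetaCoeff_le (hΩ : h.sq Ω D.μ = 1)
    {Ψ : (k : ℕ+) → Module.Basis (ZMod (2 * (k : ℕ))) ℂ (D.holSections δ k)}
    (hΨ : ∀ k : ℕ+, D.IsThetaBasis Ω k (Ψ k)) {ξ : (k : ℕ+) → D.holSections δ k} (hξ : D.Admissible ξ) :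
    ∃ B C : ℝ, ∀ (k : ℕ+) (m : ℤ),
      ‖D.thetaCoeff k (fun y => HalfFormLine.coordL Ω ((ξ k).1 y)) m‖ ≤ C * (k : ℝ) ^ B := by
  obtain ⟨B, C, hC0, hC⟩ := norm_coeff_le hΩ hΨ hξ
  refine ⟨1 / 4 + B, C, fun k m => ?_⟩
  have hk0 : (0 : ℝ) < k := by have := PNat.one_le_cast_real k; linarith
  rw [thetaCoeff_eq_repr k.pos (hΨ k), norm_mul, norm_thetaCoeff_basis hΩ k.pos (hΨ k), Real.rpow_add hk0]
  have h1 : ((k : ℝ) / (2 * Real.pi)) ^ (1 / 4 : ℝ) ≤ (k : ℝ) ^ (1 / 4 : ℝ) :=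
    Real.rpow_le_rpow (by positivity) (div_le_self hk0.le (by have := Real.pi_gt_three; linarith))
      (by norm_num)
  calc _ ≤ (k : ℝ) ^ (1 / 4 : ℝ) * (C * (k : ℝ) ^ B) :=
        mul_le_mul h1 (hC k m) (norm_nonneg _) (by positivity)
    _ = _ := by ring

/-- The Fourier coefficients and the coefficients in the theta basis are proportional, up to
`O(k^{-∞})`. -/
theorem exists_norm_thetaCoeff_sub_coeff_le (hΩ : h.sq Ω D.μ = 1)
    {Ψ : (k : ℕ+) → Module.Basis (ZMod (2 * (k : ℕ))) ℂ (D.holSections δ k)}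
    (hΨ : ∀ k : ℕ+, D.IsThetaBasis Ω k (Ψ k)) {ξ : (k : ℕ+) → D.holSections δ k} (hξ : D.Admissible ξ)
    (n : ℕ) : ∃ C : ℝ, ∀ (k : ℕ+) (m : ℤ),
      ‖D.thetaCoeff k (fun y => HalfFormLine.coordL Ω ((ξ k).1 y)) m
        - (((2 * Real.pi) ^ (-(1 / 4) : ℝ) : ℝ) : ℂ) * (((k : ℝ) ^ (1 / 4 : ℝ) : ℝ) : ℂ) * D.coeff Ψ ξ k m‖
        ≤ C * (k : ℝ) ^ (-(n : ℝ)) := by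
  have hT := HalfFormLine.modulus_im_pos h hΩ
  have hπ := Real.pi_pos
  obtain ⟨B, C, hC0, hC⟩ := norm_coeff_le hΩ hΨ hξ
  obtain ⟨C₁, hC₁0, hC₁⟩ := exists_exp_neg_le_rpow (a := Real.pi * (h.modulus Ω).im) (by positivity)
    (n + 1 / 4 + B)
  set S := ∑' n : ℤ, Real.exp (-(Real.pi * (h.modulus Ω).im / 2 * |(n : ℝ)|)) with hS
  have hS0 : 0 ≤ S := tsum_nonneg fun _ => (Real.exp_pos _).le
  refine ⟨2 * (C₁ * S) * C, fun k m => ?_⟩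
  have hk1 := PNat.one_le_cast_real k
  have hk0 : (0 : ℝ) < k := by linarith
  have hB : (((2 * Real.pi) ^ (-(1 / 4) : ℝ) : ℝ) : ℂ) * (((k : ℝ) ^ (1 / 4 : ℝ) : ℝ) : ℂ)
      = ((((k : ℝ) / (2 * Real.pi)) ^ (1 / 4 : ℝ) : ℝ) : ℂ) := by
    rw [Real.div_rpow hk0.le (by positivity), Real.rpow_neg (by positivity)]
    push_cast
    ring
  have h1 := norm_thetaCoeff_basis_sub_le hΩ k.pos (hΨ k)
  rw [hB, thetaCoeff_eq_repr k.pos (hΨ k), coeff, ← sub_mul, norm_mul]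
  have h2 : ((k : ℝ) / (2 * Real.pi)) ^ (1 / 4 : ℝ) ≤ (k : ℝ) ^ (1 / 4 : ℝ) :=
    Real.rpow_le_rpow (by positivity) (div_le_self hk0.le (by have := Real.pi_gt_three; linarith))
      (by norm_num)
  have h3 := hC₁ k hk1
  have h4 : (k : ℝ) ^ (-(n : ℝ))
      = (k : ℝ) ^ (1 / 4 : ℝ) * (k : ℝ) ^ (-(n + 1 / 4 + B)) * (k : ℝ) ^ B := by
    rw [← Real.rpow_add hk0, ← Real.rpow_add hk0]
    congr 1
    ring
  calc _ ≤ 2 * ((k : ℝ) ^ (1 / 4 : ℝ) * (C₁ * (k : ℝ) ^ (-(n + 1 / 4 + B)) * S)) * (C * (k : ℝ) ^ B) := by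
        refine mul_le_mul (h1.trans ?_) (hC k m) (norm_nonneg _) (by positivity)
        gcongr
    _ = _ := by
        rw [h4]
        ring

/-- The expansion of the coefficients in the theta basis and the expansion of the Fourier
coefficients are equivalent. -/
theorem hasWKBExpansion_coeff_iff (hΩ : h.sq Ω D.μ = 1)
    {Ψ : (k : ℕ+) → Module.Basis (ZMod (2 * (k : ℕ))) ℂ (D.holSections δ k)}
    (hΨ : ∀ k : ℕ+, D.IsThetaBasis Ω k (Ψ k)) {ξ : (k : ℕ+) → D.holSections δ k} (hξ : D.Admissible ξ)
    {φ : ℝ → ℝ} {q₀ q₁ N : ℝ} {f : ℕ → ℝ → ℂ} :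
    HasWKBExpansion (D.coeff Ψ ξ) φ q₀ q₁ N f ↔ ∀ K ⊆ Ioo q₀ q₁, IsCompact K → HasExpansionOn
      (fun k m => D.thetaCoeff k (fun y => HalfFormLine.coordL Ω ((ξ k).1 y)) m) φ (N - 1 / 4) K
      (fun l q => (((2 * Real.pi) ^ (1 / 4 - N) : ℝ) : ℂ) * f l q) := by
  have hπ := Real.pi_pos
  have h2π : (0 : ℝ) < 2 * Real.pi := by positivity
  have hclose := exists_norm_thetaCoeff_sub_coeff_le hΩ hΨ hξ
  rw [hasWKBExpansion_iff]
  refine forall_congr' fun K => forall_congr' fun _ => forall_congr' fun _ => ⟨fun h1 => ?_, fun h1 => ?_⟩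
  · have h2 := h1.rpow_mul (((2 * Real.pi) ^ (-(1 / 4) : ℝ) : ℝ) : ℂ) (1 / 4)
    have h3 := h2.of_sub_le hclose
    rw [show -(1 / 2) + N + 1 / 4 = N - 1 / 4 by ring] at h3
    refine h3.congr (fun _ _ => rfl) fun l q _ => ?_
    rw [← mul_assoc, ← Complex.ofReal_mul, ← Real.rpow_add h2π]
    congr 3
    ring
  · have h2 := h1.of_sub_le fun n => by
      obtain ⟨C, hC⟩ := hclose n
      exact ⟨C, fun k m => by rw [norm_sub_rev]; exact hC k m⟩
    have h3 := h2.rpow_mul (((2 * Real.pi) ^ (1 / 4 : ℝ) : ℝ) : ℂ) (-(1 / 4))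
    rw [show N - 1 / 4 + -(1 / 4) = -(1 / 2) + N by ring] at h3
    have h4 : (fun (k : ℕ+) (m : ℤ) => (((2 * Real.pi) ^ (1 / 4 : ℝ) : ℝ) : ℂ)
        * (((k : ℝ) ^ (-(1 / 4) : ℝ) : ℝ) : ℂ) * ((((2 * Real.pi) ^ (-(1 / 4) : ℝ) : ℝ) : ℂ)
          * (((k : ℝ) ^ (1 / 4 : ℝ) : ℝ) : ℂ) * D.coeff Ψ ξ k m)) = D.coeff Ψ ξ := by
      funext k m
      have hk0 : (0 : ℝ) < k := by have := PNat.one_le_cast_real k; linarith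
      have e1 : (((2 * Real.pi) ^ (1 / 4 : ℝ) : ℝ) : ℂ) * (((2 * Real.pi) ^ (-(1 / 4) : ℝ) : ℝ) : ℂ) = 1 := by
        rw [← Complex.ofReal_mul, ← Real.rpow_add h2π]
        simp
      have e2 : (((k : ℝ) ^ (-(1 / 4) : ℝ) : ℝ) : ℂ) * (((k : ℝ) ^ (1 / 4 : ℝ) : ℝ) : ℂ) = 1 := by
        rw [← Complex.ofReal_mul, ← Real.rpow_add hk0]
        simp
      calc _ = ((((2 * Real.pi) ^ (1 / 4 : ℝ) : ℝ) : ℂ) * (((2 * Real.pi) ^ (-(1 / 4) : ℝ) : ℝ) : ℂ))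
            * ((((k : ℝ) ^ (-(1 / 4) : ℝ) : ℝ) : ℂ) * (((k : ℝ) ^ (1 / 4 : ℝ) : ℝ) : ℂ))
            * D.coeff Ψ ξ k m := by ring
        _ = _ := by rw [e1, e2, one_mul, one_mul]
    rw [h4] at h3
    refine h3.congr (fun _ _ => rfl) fun l q _ => ?_
    rw [← mul_assoc, ← Complex.ofReal_mul, ← Real.rpow_add h2π]
    congr 3
    ring

/-! ### The square root of `ω(·, μ) / i` along the graph -/

/-- The section `τ` of `δ` over `Γ` which relates the symbol of a Lagrangian state and the leading
term of its coefficients. The factor `(π / κ) ^ (1 / 2)` comes from Laplace's method. -/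
noncomputable def graphRoot (h : HalfFormLine D δ) (Ω : δ) (φ : ℝ → ℝ) (q : ℝ) : δ :=
  ((((2 * Real.pi) ^ (1 / 2 : ℝ) : ℝ) : ℂ) * ((Real.pi / (2 * Real.pi * Complex.I
    / (deriv (deriv φ) q + h.modulus Ω))) ^ (1 / 2 : ℂ))⁻¹) • Ω

theorem contDiffOn_graphRoot (hΩ : h.sq Ω D.μ = 1) {φ : ℝ → ℝ} {q₀ q₁ : ℝ}
    (hφ : ContDiffOn ℝ ∞ φ (Ioo q₀ q₁)) : ContDiffOn ℝ ∞ (graphRoot h Ω φ) (Ioo q₀ q₁) := by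
  have hT := HalfFormLine.modulus_im_pos h hΩ
  intro x hx
  obtain ⟨φ', hφ', -, O₁, hO₁, hxO₁, -, hφφ⟩ :=
    exists_smooth_extension isCompact_singleton isOpen_Ioo (singleton_subset_iff.2 hx) hφ
  rw [singleton_subset_iff] at hxO₁
  have him : ∀ q : ℝ, 0 < (((deriv (deriv φ') q : ℝ) : ℂ) + h.modulus Ω).im := fun q => by simpa using hT
  have hΛ : ContDiff ℝ ∞ fun q : ℝ => ((deriv (deriv φ') q : ℝ) : ℂ) + h.modulus Ω :=
    (Quasimode.contDiff_ofReal.comp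
      (contDiff_infty_iff_deriv.1 (contDiff_infty_iff_deriv.1 hφ').2).2).add contDiff_const
  have h1 : ContDiff ℝ ∞ (graphRoot h Ω φ') :=
    (contDiff_const.mul ((contDiff_sqrt_pi_div hΛ him).inv fun q => sqrt_pi_div_ne_zero (him q))).smul
      contDiff_const
  refine ContDiffAt.contDiffWithinAt (h1.contDiffAt.congr_of_eventuallyEq ?_)
  filter_upwards [hO₁.mem_nhds hxO₁] with q hq
  have hev : φ' =ᶠ[𝓝 q] φ := by filter_upwards [hO₁.mem_nhds hq] with w hw using hφφ hw
  rw [graphRoot, graphRoot, hev.deriv.deriv_eq]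

/-- The square of the factor from Laplace's method is `Λ / 2i` with `Λ = φ'' + T`, and `Ω ^ 2` takes the
value `Λ` on `φ'' μ + lam`. -/
theorem sq_graphRoot (hΩ : h.sq Ω D.μ = 1) (φ : ℝ → ℝ) (q : ℝ) {X : E} (hX : X ∈ D.graphTangent φ q) :
    h.sq (graphRoot h Ω φ q) X = D.om X D.μ / Complex.I := by
  have hT := HalfFormLine.modulus_im_pos h hΩ
  have hπ := Real.pi_pos
  obtain ⟨c, rfl⟩ := Submodule.mem_span_singleton.1 hX
  set Λ : ℂ := ((deriv (deriv φ) q : ℝ) : ℂ) + h.modulus Ω with hΛ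
  have him : 0 < Λ.im := by simpa [hΛ] using hT
  have hΛ0 : Λ ≠ 0 := fun h0 => by rw [h0] at him; simp at him
  have hπ0 : (Real.pi : ℂ) ≠ 0 := Complex.ofReal_ne_zero.2 hπ.ne'
  have hs : ((Real.pi / (2 * Real.pi * Complex.I / Λ)) ^ (1 / 2 : ℂ)) ^ 2 = Λ / (2 * Complex.I) := by
    rw [← Complex.cpow_nat_mul]
    norm_num
    field_simp
  have h2 : ((((2 * Real.pi) ^ (1 / 2 : ℝ) : ℝ) : ℂ)) ^ 2 = 2 * Real.pi := by
    rw [← Complex.ofReal_pow, ← Real.rpow_natCast, ← Real.rpow_mul (by positivity)]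
    norm_num
  have hX2 : h.sq Ω (c • (deriv (deriv φ) q • D.μ + D.lam)) = c * Λ := by
    rw [map_smul, map_add, map_smul, hΩ, hΛ, HalfFormLine.modulus]
    simp
    ring
  have hω : D.om (c • (deriv (deriv φ) q • D.μ + D.lam)) D.μ = -(4 * Real.pi * c) := by
    rw [map_smul, map_add, map_smul, LinearMap.smul_apply, LinearMap.add_apply, LinearMap.smul_apply, D.alt,
      D.om_swap D.lam, D.om_basis]
    simp
    ring
  rw [graphRoot, HalfFormLine.sq_smul, LinearMap.smul_apply, hX2, hω, mul_pow, inv_pow, hs, h2, smul_eq_mul]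
  push_cast
  field_simp
  rw [Complex.I_sq]
  ring

/-- The relation between the symbol and the leading coefficient of the Fourier coefficients. -/
theorem symbol_eq_iff (hΩ : h.sq Ω D.μ = 1) (φ : ℝ → ℝ) (q N : ℝ) (s : δ) (w : ℂ) :
    s = w • graphRoot h Ω φ q ↔ (((2 * Real.pi) ^ (1 / 4 - N) : ℝ) : ℂ) * w
      = (((2 * Real.pi) ^ (-(1 / 4 + N)) : ℝ) : ℂ) * ((Real.pi / (2 * Real.pi * Complex.I
        / (deriv (deriv φ) q + h.modulus Ω))) ^ (1 / 2 : ℂ) * HalfFormLine.coordL Ω s) := by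
  have hT := HalfFormLine.modulus_im_pos h hΩ
  have hπ := Real.pi_pos
  have hs0 := sqrt_pi_div_ne_zero (w := ((deriv (deriv φ) q : ℝ) : ℂ) + h.modulus Ω) (by simpa using hT)
  set r := (Real.pi / (2 * Real.pi * Complex.I
        / (((deriv (deriv φ) q : ℝ) : ℂ) + h.modulus Ω))) ^ (1 / 2 : ℂ) with hr
  set A : ℂ := (((2 * Real.pi) ^ (-(1 / 4 + N)) : ℝ) : ℂ) with hA
  have hA0 : A ≠ 0 := Complex.ofReal_ne_zero.2 (by positivity)
  set b : ℂ := (((2 * Real.pi) ^ (1 / 2 : ℝ) : ℝ) : ℂ) with hb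
  have hAb : (((2 * Real.pi) ^ (1 / 4 - N) : ℝ) : ℂ) = A * b := by
    rw [hA, hb, ← Complex.ofReal_mul, ← Real.rpow_add (by positivity)]
    congr 2
    ring
  have hΩ0 : Ω ≠ 0 := HalfFormLine.ne_zero_of_sq h hΩ
  rw [hAb, mul_assoc, mul_right_inj' hA0, graphRoot, smul_smul, ← hr, ← hb]
  constructor
  · intro h1
    rw [h1, HalfFormLine.coordL_smul hΩ0]
    field_simp
  · intro h1
    rw [← HalfFormLine.coordL_apply_smul h hΩ s]
    congr 1
    field_simp
    rw [mul_comm w, h1, mul_comm]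

end QuantumTorus

theorem mainTheorem5 {E : Type*} [NormedAddCommGroup E] [NormedSpace ℝ E] (D : QuantumTorus E)
    {δ : Type*} [NormedAddCommGroup δ] [InnerProductSpace ℂ δ] (h : HalfFormLine D δ)
    (Ω : δ) (hΩ : h.sq Ω D.μ = 1)
    (Ψ : (k : ℕ+) → Module.Basis (ZMod (2 * (k : ℕ))) ℂ (D.holSections δ k))
    (hΨ : ∀ k : ℕ+, D.IsThetaBasis Ω k (Ψ k))
    (q₀ q₁ : ℝ) (hq : q₀ < q₁) (hq' : q₁ < q₀ + 1)
    (φ : ℝ → ℝ) (hφ : ContDiffOn ℝ ∞ φ (Ioo q₀ q₁)) :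
    ∃ τ : ℝ → δ, ContDiffOn ℝ ∞ τ (Ioo q₀ q₁) ∧
      (∀ q ∈ Ioo q₀ q₁, ∀ X ∈ D.graphTangent φ q, h.sq (τ q) X = D.om X D.μ / Complex.I) ∧
      ∀ (ξ : (k : ℕ+) → D.holSections δ k), D.Admissible ξ → ∀ (σ : D.M → δ) (N : ℝ),
        (D.IsLagrangianState ξ (D.strip q₀ q₁) (D.graph φ q₀ q₁) (D.graphSection φ q₀) σ N ↔
          ∃ f : ℕ → ℝ → ℂ, (∀ l, ContDiffOn ℝ ∞ (f l) (Ioo q₀ q₁)) ∧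
            HasWKBExpansion (D.coeff Ψ ξ) φ q₀ q₁ N f ∧
            (∀ q ∈ Ioo q₀ q₁, ∀ X ∈ D.graphTangent φ q,
              h.sq (σ (D.proj (D.graphPoint φ q))) X = f 0 q ^ 2 * (D.om X D.μ / Complex.I)) ∧
            ∀ q ∈ Ioo q₀ q₁, σ (D.proj (D.graphPoint φ q)) = f 0 q • τ q) := by
  have hπ := Real.pi_pos
  refine ⟨QuantumTorus.graphRoot h Ω φ, QuantumTorus.contDiffOn_graphRoot hΩ hφ,
    fun q _ X hX => QuantumTorus.sq_graphRoot hΩ φ q hX, fun ξ hξ σ N => ⟨fun hL => ?_, ?_⟩⟩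
  · have hloc := fun x (hx : x ∈ Ioo q₀ q₁) =>
      QuantumTorus.exists_local_expansion hΩ hq'.le hφ hL hx
    obtain ⟨g, hg, hgexp⟩ := HasExpansionOn.exists_of_local fun x hx => by
      obtain ⟨O, hO, hxO, hOI, g, hg, -, hexp⟩ := hloc x hx
      exact ⟨O, hO, hxO, hOI, g, fun l => (hg l).contDiffOn, hexp⟩
    have hg0 : ∀ q ∈ Ioo q₀ q₁, g 0 q = (((2 * Real.pi) ^ (-(1 / 4 + N)) : ℝ) : ℂ) *
        ((Real.pi / (2 * Real.pi * Complex.I / (deriv (deriv φ) q + h.modulus Ω))) ^ (1 / 2 : ℂ)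
          * HalfFormLine.coordL Ω (σ (D.proj (D.graphPoint φ q)))) := by
      intro x hx
      obtain ⟨O, hO, hxO, hOI, g', hg', hg'0, hexp'⟩ := hloc x hx
      obtain ⟨O₂, hO₂, hxO₂, hO₂I, hexp⟩ := hgexp x hx
      rw [← hg'0 x hxO]
      exact HasExpansionOn.unique (hO.inter hO₂)
        (fun l => ((hg l).continuousOn).mono (inter_subset_right.trans hO₂I))
        (fun l => (hg' l).continuous.continuousOn) (hexp.mono inter_subset_right)
        (hexp'.mono inter_subset_left) 0 x ⟨hxO, hxO₂⟩
    have hcancel : ∀ w : ℂ, (((2 * Real.pi) ^ (1 / 4 - N) : ℝ) : ℂ)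
        * ((((2 * Real.pi) ^ (N - 1 / 4) : ℝ) : ℂ) * w) = w := by
      intro w
      rw [← mul_assoc, ← Complex.ofReal_mul, ← Real.rpow_add (by positivity)]
      simp
    have hσ : ∀ q ∈ Ioo q₀ q₁, σ (D.proj (D.graphPoint φ q))
        = ((((2 * Real.pi) ^ (N - 1 / 4) : ℝ) : ℂ) * g 0 q) • QuantumTorus.graphRoot h Ω φ q := fun q hqI =>
      (QuantumTorus.symbol_eq_iff hΩ φ q N _ _).2 (by rw [hcancel]; exact hg0 q hqI)
    refine ⟨fun l q => (((2 * Real.pi) ^ (N - 1 / 4) : ℝ) : ℂ) * g l q,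
      fun l => contDiffOn_const.mul (hg l), ?_, fun q hqI X hX => ?_, hσ⟩
    · refine (QuantumTorus.hasWKBExpansion_coeff_iff hΩ hΨ hξ).2 fun K hK hKc => ?_
      simp only [hcancel]
      refine HasExpansionOn.of_isCompact hKc hK fun q hqI => ?_
      obtain ⟨O, hO, hqO, -, hexp⟩ := hgexp q hqI
      exact ⟨O, hO, hqO, hexp⟩
    · rw [hσ q hqI, HalfFormLine.sq_smul, LinearMap.smul_apply, QuantumTorus.sq_graphRoot hΩ φ q hX,
        smul_eq_mul]
  · rintro ⟨f, hf, hexp, -, hσ⟩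
    obtain ⟨B, C, hθ⟩ := QuantumTorus.exists_norm_thetaCoeff_le hΩ hΨ hξ
    exact QuantumTorus.isLagrangianState_of_expansion hΩ hq'.le hφ hθ
      (fun l => contDiffOn_const.mul (hf l))
      ((QuantumTorus.hasWKBExpansion_coeff_iff hΩ hΨ hξ).1 hexp)
      fun q hqI => (QuantumTorus.symbol_eq_iff hΩ φ q N _ _).1 (hσ q hqI)
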